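/- Let $n\ge 1$, $\mathcal D=C_c^\infty(\mathbb R^n)$, $\langle g,f\rangle=\int gf$, and let $T:\mathcal D\to\mathcal D'$ be linear and continuous with a kernel $K$ that is a function locally bounded on $\mathbb R^n\times\mathbb R^n$, i.e. $\langle g,Tf\rangle=\iint g(x)K(x,y)f(y)\,dx\,dy$ for $f,g\in\mathcal D$. Suppose that for some $C\ge0$ and $0<s<1$ one has $|K(x,y)|\le C|x-y|^{-n}$ for $x\ne y$, and $$|K(x,y)-K(x',y)|+|K(y,x)-K(y,x')|\le C\,\frac{|x-x'|^s}{|x-y|^{n+s}}\quad\text{whenever } x\neq y,\ |x-x'|\le\tfrac12|x-y| .$$ For compactly supported integrable $f,g$, write $\langle g,Tf\rangle=\iint g(x)K(x,y)f(y)\,dx\,dy$. Then there is a perfect dyadic singular integral operator $\mathbb T$ such that $T-\mathbb T$ is bounded on $L^p(\mathbb R^n)$ for every $1<p<\infty$. Here a perfect dyadic singular integral operator is a continuous linear map $\mathbb T:\mathcal D\to\mathcal D'$ together with a measurable kernel $\mathbb K$ such that: 1. $|\mathbb K(x,y)|\le C'|x-y|^{-n}$ for $x\neq y$, and $\langle g,\mathbb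 Tf\rangle=\iint g(x)\mathbb K(x,y)f(y)\,dx\,dy$ for $f,g\in\mathcal D$ with disjoint supports; 2. $\langle g,\mathbb Tf\rangle$ extends to all $f\in L^p_c$, $g\in L^{p'}_c$ ($1<p<\infty$, $1/p+1/p'=1$; $L^p_c$ is the space of compactly supported functions in $L^p(\mathbb R^n)$), bilinearly and continuously on functions supported in a fixed compact set; and if $f$, $g$ vanish almost everywhere outside two disjoint (axis-parallel, half-open) cubes, then $\langle g,\mathbb Tf\rangle=\iint g(x)\mathbb K(x,y)f(y)\,dx\,dy$, with absolutely convergent integral; 3. if $f\in L^p_c$ is supported in a dyadic cube $Q$ with $\int f=0$, and $g\in L^{p'}_c$ vanishes almost everywhere on $Q$, then $\langle g,\mathbb Tf\rangle=0$. Moreover, $\mathbb T$ can be taken to be given by the BCR algorithm in the Haar basis, as follows. Let $\phi_{j,k}(x)=2^{nj/2}\phi(2^jx-k)$ with $\phi=1_{[0,1)^n}$, and let $\psi_{j,k}(x)=2^{nj/2}\psi(2^jx-k)$, where $\psi$ runs over the $2^n-1$ Haar functions (sums over the $\psi$'s are implied below). Put $a^j_{k,\ell}=\langle\psi_{j,k},T\psi_{j,\ell}\rangle$,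 $b^j_{k,\ell}=\langle\psi_{j,k},T\phi_{j,\ell}\rangle$, $c^j_{k,\ell}=\langle\phi_{j,k},T\psi_{j,\ell}\rangle$. Let $\alpha,\beta,\gamma$ agree with $a,b,c$ for $k\ne\ell$, and let $\alpha^j_{k,k}=0$, $\beta^j_{k,k}=-\sum_{m\ne k}b^j_{k,m}$, $\gamma^j_{k,k}=-\sum_{m\neq k}c^j_{m,k}$. Then for all $f\in L^p_c$, $g\in L^{p'}_c$, $1<p<\infty$, $$\langle g,Tf\rangle-\langle g,\mathbb Tf\rangle=\sum_{j\in\mathbb Z}\sum_{k,\ell\in\mathbb Z^n}\Big(\langle g,\psi_{j,k}\rangle\alpha^j_{k,\ell}\langle\psi_{j,\ell},f\rangle+\langle g,\psi_{j,k}\rangle\beta^j_{k,\ell}\langle\phi_{j,\ell},f\rangle+\langle g,\phi_{j,k}\rangle\gamma^j_{k,\ell}\langle\psi_{j,\ell},f\rangle\Big).$$ If in addition $\langle P_jg,TP_jf\rangle\to0$ as $j\to-\infty$, where $P_jh=\sum_k\langle\phi_{j,k},h\rangle\phi_{j,k}$, then only the corrected diagonal coefficients remain in $\mathbb T$: $$\langle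 g,\mathbb Tf\rangle=\sum_{j\in\mathbb Z}\sum_{k\in\mathbb Z^n}\Big(\langle g,\psi_{j,k}\rangle(a-\alpha)^j_{k,k}\langle\psi_{j,k},f\rangle+\langle g,\psi_{j,k}\rangle(b-\beta)^j_{k,k}\langle\phi_{j,k},f\rangle+\langle g,\phi_{j,k}\rangle(c-\gamma)^j_{k,k}\langle\psi_{j,k},f\rangle\Big).$$ The sums over $j$ are limits of $\sum_{-N\le j<M}$ as $N,M\to\infty$; for each $j$ the sums over $k,\ell$ are finite. -/

import Mathlib

open MeasureTheory Filter Topology TopologicalSpace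
open scoped ENNReal Distributions

noncomputable section

namespace BCR

/-- Euclidean space `ℝⁿ`, with the Euclidean norm. -/
abbrev Rn (n : ℕ) : Type := EuclideanSpace ℝ (Fin n)

/-- Complex test functions `𝓓(ℝⁿ)`. -/
abbrev TestFn (n : ℕ) : Type := 𝓓((⊤ : Opens (Rn n)), ℂ)

/-- Complex distributions `𝓓'(ℝⁿ)`; in Mathlib these are tested against real test functions. -/
abbrev Distr (n : ℕ) : Type := 𝓓'((⊤ : Opens (Rn n)), ℂ)

/-- Continuous linear operators from `𝓓(ℝⁿ)` to `𝓓'(ℝⁿ)`. -/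
abbrev DistrOp (n : ℕ) : Type := TestFn n →L[ℂ] Distr n

/-- A real test function, as a complex-valued function. -/
def realTest {n : ℕ} (g : 𝓓((⊤ : Opens (Rn n)), ℝ)) : Rn n → ℂ := fun x => (g x : ℂ)

/-- The integrand `(x, y) ↦ g(x) K(x, y) f(y)`. -/
def kernelIntegrand {n : ℕ} (K : Rn n → Rn n → ℂ) (g f : Rn n → ℂ) : Rn n × Rn n → ℂ :=
  fun z => g z.1 * K z.1 z.2 * f z.2

/-- `∬ g(x) K(x, y) f(y) dx dy`. -/
def kernelForm {n : ℕ} (K : Rn n → Rn n → ℂ) (g f : Rn n → ℂ) : ℂ :=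
  ∫ z : Rn n × Rn n, kernelIntegrand K g f z

/-- The bilinear bracket `⟨g, f⟩ = ∫ g f`. -/
def bracket {n : ℕ} (g f : Rn n → ℂ) : ℂ := ∫ x : Rn n, g x * f x

/-- The size condition `|K(x, y)| ≤ C |x - y|^{-n}` off the diagonal. -/
def SizeCondition {n : ℕ} (K : Rn n → Rn n → ℂ) : Prop :=
  ∃ C : ℝ, ∀ x y : Rn n, x ≠ y → ‖K x y‖ ≤ C / ‖x - y‖ ^ n

/-- The Hölder regularity condition, for some exponent `0 < s < 1`. -/
def RegularityCondition {n : ℕ} (K : Rn n → Rn n → ℂ) : Prop :=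
  ∃ s : ℝ, 0 < s ∧ s < 1 ∧ ∃ C : ℝ, ∀ x x' y : Rn n, x ≠ y → ‖x - x'‖ ≤ 1 / 2 * ‖x - y‖ →
    ‖K x y - K x' y‖ + ‖K y x - K y x'‖ ≤ C * (‖x - x'‖ ^ s / ‖x - y‖ ^ ((n : ℝ) + s))

/-- `T : 𝓓 → 𝓓'` is a singular integral operator whose distributional kernel is the function `K`,
locally bounded on `ℝⁿ × ℝⁿ`. -/
structure IsSIOWithLocallyBoundedKernel {n : ℕ} (T : DistrOp n) (K : Rn n → Rn n → ℂ) :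
    Prop where
  measurable : AEStronglyMeasurable (fun z : Rn n × Rn n => K z.1 z.2) volume
  locallyBounded : ∀ A : Set (Rn n × Rn n), IsCompact A → ∃ M : ℝ, ∀ z ∈ A, ‖K z.1 z.2‖ ≤ M
  kernel_eq : ∀ (f : TestFn n) (g : 𝓓((⊤ : Opens (Rn n)), ℝ)),
    T f g = kernelForm K (realTest g) f
  size : SizeCondition K
  regularity : RegularityCondition K

/-- `f` vanishes almost everywhere outside `A`. -/
def SupportedIn {n : ℕ} (f : Rn n → ℂ) (A : Set (Rn n)) : Prop := ∀ᵐ x, x ∉ A → f x = 0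

/-- `f ∈ L^p_c(ℝⁿ)`: `f ∈ L^p` with compact support. -/
def MemLpc {n : ℕ} (f : Rn n → ℂ) (p : ℝ≥0∞) : Prop :=
  MemLp f p volume ∧ ∃ A : Set (Rn n), IsCompact A ∧ SupportedIn f A

/-- `1 < p < ∞` and `q` is the dual exponent of `p`. -/
def DualExponents (p q : ℝ≥0∞) : Prop := 1 < p ∧ p < ∞ ∧ p.HolderConjugate q

/-- The cube with corner `a` and side length `r`. -/
def cube {n : ℕ} (a : Rn n) (r : ℝ) : Set (Rn n) := {x | ∀ i, a i ≤ x i ∧ x i < a i + r}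

/-- The dyadic cube `Q_{j,k} = 2^{-j} k + 2^{-j} [0,1)^n`. -/
def dyadicCube {n : ℕ} (j : ℤ) (k : Fin n → ℤ) : Set (Rn n) :=
  cube (WithLp.toLp 2 fun i => (2 : ℝ) ^ (-j) * k i) ((2 : ℝ) ^ (-j))

/-- `𝕋 : 𝓓 → 𝓓'` is a perfect dyadic singular integral operator with kernel `𝕂`, and `B g f` is
`⟨g, 𝕋 f⟩` for `(f, g) ∈ L^p_c × L^{p'}_c`. The fields `extends_op`, `add_left`, ..., `bound` say
that `⟨g, 𝕋 f⟩` is well defined for such pairs: `B` is the extension of `(f, g) ↦ ⟨g, 𝕋 f⟩` from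
test functions which is bilinear and continuous on functions with support in a fixed compact set. -/
structure IsPerfectDyadicSIO {n : ℕ} (𝕋 : DistrOp n) (𝕂 : Rn n → Rn n → ℂ)
    (B : (Rn n → ℂ) → (Rn n → ℂ) → ℂ) : Prop where
  measurable : AEStronglyMeasurable (fun z : Rn n × Rn n => 𝕂 z.1 z.2) volume
  size : SizeCondition 𝕂
  kernel_eq : ∀ (f : TestFn n) (g : 𝓓((⊤ : Opens (Rn n)), ℝ)),
    Disjoint (tsupport f) (tsupport g) →
      Integrable (kernelIntegrand 𝕂 (realTest g) f) volume ∧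
        𝕋 f g = kernelForm 𝕂 (realTest g) f
  extends_op : ∀ (f : TestFn n) (g : 𝓓((⊤ : Opens (Rn n)), ℝ)), B (realTest g) f = 𝕋 f g
  add_left : ∀ p q, DualExponents p q → ∀ f g₁ g₂, MemLpc f p → MemLpc g₁ q → MemLpc g₂ q →
    B (g₁ + g₂) f = B g₁ f + B g₂ f
  smul_left : ∀ p q, DualExponents p q → ∀ f g (c : ℂ), MemLpc f p → MemLpc g q →
    B (c • g) f = c * B g f
  add_right : ∀ p q, DualExponents p q → ∀ f₁ f₂ g, MemLpc f₁ p → MemLpc f₂ p → MemLpc g q →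
    B g (f₁ + f₂) = B g f₁ + B g f₂
  smul_right : ∀ p q, DualExponents p q → ∀ f g (c : ℂ), MemLpc f p → MemLpc g q →
    B g (c • f) = c * B g f
  bound : ∀ p q, DualExponents p q → ∀ A : Set (Rn n), IsCompact A → ∃ C : ℝ, ∀ f g,
    MemLp f p volume → MemLp g q volume → SupportedIn f A → SupportedIn g A →
      ‖B g f‖ ≤ C * (eLpNorm f p volume).toReal * (eLpNorm g q volume).toReal
  kernel_eq_of_disjoint_cubes : ∀ p q, DualExponents p q → ∀ f g, MemLpc f p → MemLpc g q →
    ∀ (a b : Rn n) (r t : ℝ), 0 < r → 0 < t → Disjoint (cube a r) (cube b t) →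
      SupportedIn f (cube a r) → SupportedIn g (cube b t) →
        Integrable (kernelIntegrand 𝕂 g f) volume ∧ B g f = kernelForm 𝕂 g f
  perfect : ∀ p q, DualExponents p q → ∀ f g, MemLpc f p → MemLpc g q →
    ∀ (j : ℤ) (k : Fin n → ℤ), SupportedIn f (dyadicCube j k) → ∫ x, f x = 0 →
      SupportedIn g (dyadicCube j k)ᶜ → B g f = 0

theorem TestFn.memLp {n : ℕ} (f : TestFn n) (p : ℝ≥0∞) : MemLp f p (volume : Measure (Rn n)) :=
  f.continuous.memLp_of_hasCompactSupport f.hasCompactSupport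

/-- `A : 𝓓 → 𝓓'` is bounded on `L^p`: it coincides on `𝓓` with a bounded operator `L^p → L^p`. -/
def IsBoundedOnLp {n : ℕ} (A : DistrOp n) (p : ℝ≥0∞) [Fact (1 ≤ p)] : Prop :=
  ∃ S : Lp ℂ p (volume : Measure (Rn n)) →L[ℂ] Lp ℂ p (volume : Measure (Rn n)),
    ∀ (f : TestFn n) (g : 𝓓((⊤ : Opens (Rn n)), ℝ)),
      A f g = ∫ x, (g x : ℂ) * S ((TestFn.memLp f p).toLp f) x

/-! ### The Haar basis -/

/-- The tensor products of `1_{[0,1)}` (where `ε i = false`) and `1_{[0,1/2)} - 1_{[1/2,1)}`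
(where `ε i = true`). -/
def haarMother {n : ℕ} (ε : Fin n → Bool) (x : Rn n) : ℂ :=
  ∏ i, if 0 ≤ x i ∧ x i < 1 then (if ε i = true ∧ 1 / 2 ≤ x i then -1 else 1) else 0

/-- `2^{nj/2} h(2^j x - k)`. -/
def dilate {n : ℕ} (h : Rn n → ℂ) (j : ℤ) (k : Fin n → ℤ) (x : Rn n) : ℂ :=
  ((2 : ℝ) ^ ((n : ℝ) * j / 2) : ℝ) * h (WithLp.toLp 2 fun i => (2 : ℝ) ^ j * x i - k i)

/-- The index set of the `2^n - 1` Haar functions. -/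
abbrev HaarIndex (n : ℕ) : Type := {ε : Fin n → Bool // ε ≠ fun _ => false}

/-- The Haar function `ψ_{j,k}`, `ψ ∈ E`. -/
def psi {n : ℕ} (ε : HaarIndex n) (j : ℤ) (k : Fin n → ℤ) : Rn n → ℂ := dilate (haarMother ε.1) j k

/-- `φ_{j,k}`, where `φ = 1_{[0,1)^n}`. -/
def phi {n : ℕ} (j : ℤ) (k : Fin n → ℤ) : Rn n → ℂ := dilate (haarMother fun _ => false) j k

/-- The projection `P_j f = ∑_k ⟨φ_{j,k}, f⟩ φ_{j,k}`. -/
def projV {n : ℕ} (j : ℤ) (f : Rn n → ℂ) (x : Rn n) : ℂ :=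
  ∑' k : Fin n → ℤ, bracket (phi j k) f * phi j k x

/-! ### The coefficients of the BCR algorithm -/

/-- `a^j_{k,ℓ} = ⟨ψ_{j,k}, T ψ_{j,ℓ}⟩`. -/
def coefA {n : ℕ} (K : Rn n → Rn n → ℂ) (j : ℤ) (ε ε' : HaarIndex n) (k l : Fin n → ℤ) : ℂ :=
  kernelForm K (psi ε j k) (psi ε' j l)

/-- `b^j_{k,ℓ} = ⟨ψ_{j,k}, T φ_{j,ℓ}⟩`. -/
def coefB {n : ℕ} (K : Rn n → Rn n → ℂ) (j : ℤ) (ε : HaarIndex n) (k l : Fin n → ℤ) : ℂ :=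
  kernelForm K (psi ε j k) (phi j l)

/-- `c^j_{k,ℓ} = ⟨φ_{j,k}, T ψ_{j,ℓ}⟩`. -/
def coefC {n : ℕ} (K : Rn n → Rn n → ℂ) (j : ℤ) (ε : HaarIndex n) (k l : Fin n → ℤ) : ℂ :=
  kernelForm K (phi j k) (psi ε j l)

/-- `α^j_{k,ℓ}`: the off-diagonal part of `a`. -/
def coefAlpha {n : ℕ} (K : Rn n → Rn n → ℂ) (j : ℤ) (ε ε' : HaarIndex n) (k l : Fin n → ℤ) : ℂ :=
  if k = l then 0 else coefA K j ε ε' k l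

/-- `β^j_{k,ℓ}`: off the diagonal `b^j_{k,ℓ}`, on it `-∑_{m ≠ k} b^j_{k,m}`. -/
def coefBeta {n : ℕ} (K : Rn n → Rn n → ℂ) (j : ℤ) (ε : HaarIndex n) (k l : Fin n → ℤ) : ℂ :=
  if k = l then -∑' m : {m : Fin n → ℤ // m ≠ k}, coefB K j ε k m else coefB K j ε k l

/-- `γ^j_{k,ℓ}`: off the diagonal `c^j_{k,ℓ}`, on it `-∑_{m ≠ k} c^j_{m,k}`. -/
def coefGamma {n : ℕ} (K : Rn n → Rn n → ℂ) (j : ℤ) (ε : HaarIndex n) (k l : Fin n → ℤ) : ℂ :=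
  if k = l then -∑' m : {m : Fin n → ℤ // m ≠ k}, coefC K j ε m k else coefC K j ε k l

/-- The contribution of the scale `j` to `⟨g, 𝒯 f⟩`, where `𝒯 = 𝒰 + 𝒱 + 𝒲` has the coefficients
`α, β, γ`. For compactly supported `f` and `g` the sum has finitely many nonzero terms. -/
def offDiagLevel {n : ℕ} (K : Rn n → Rn n → ℂ) (j : ℤ) (g f : Rn n → ℂ) : ℂ :=
  ∑' kl : (Fin n → ℤ) × (Fin n → ℤ),
    ((∑ ε : HaarIndex n, ∑ ε' : HaarIndex n,
        bracket g (psi ε j kl.1) * coefAlpha K j ε ε' kl.1 kl.2 * bracket (psi ε' j kl.2) f) +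
      (∑ ε : HaarIndex n,
        bracket g (psi ε j kl.1) * coefBeta K j ε kl.1 kl.2 * bracket (phi j kl.2) f) +
      ∑ ε : HaarIndex n,
        bracket g (phi j kl.1) * coefGamma K j ε kl.1 kl.2 * bracket (psi ε j kl.2) f)

/-- The contribution of the scale `j` to `⟨g, (𝕌 + 𝕍 + 𝕎) f⟩`, with the diagonal coefficients
`a - α`, `b - β`, `c - γ`. -/
def diagLevel {n : ℕ} (K : Rn n → Rn n → ℂ) (j : ℤ) (g f : Rn n → ℂ) : ℂ :=
  ∑' k : Fin n → ℤ,
    ((∑ ε : HaarIndex n, ∑ ε' : HaarIndex n,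
        bracket g (psi ε j k) * (coefA K j ε ε' k k - coefAlpha K j ε ε' k k) *
          bracket (psi ε' j k) f) +
      (∑ ε : HaarIndex n,
        bracket g (psi ε j k) * (coefB K j ε k k - coefBeta K j ε k k) * bracket (phi j k) f) +
      ∑ ε : HaarIndex n,
        bracket g (phi j k) * (coefC K j ε k k - coefGamma K j ε k k) * bracket (psi ε j k) f)

/-- `∑_{j ∈ ℤ} u_j = a`, the sum being the limit of `∑_{-N ≤ j < M} u_j` as `N, M → ∞`. -/
def HasBilateralSum (u : ℤ → ℂ) (a : ℂ) : Prop :=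
  Tendsto (fun N : ℕ × ℕ => ∑ j ∈ Finset.Ico (-(N.1 : ℤ)) (N.2 : ℤ), u j) atTop (𝓝 a)

/-- `B g f = ⟨g, 𝕋 f⟩` is the form of the operator `𝕋 = T - 𝒯` that the BCR algorithm in the Haar
basis produces from the operator `T` with kernel `K`; and `𝕋 = 𝕌 + 𝕍 + 𝕎`, with only the diagonal
coefficients, on all pairs for which `⟨P_j g, T P_j f⟩ → 0` as `j → -∞`. -/
def IsBCRDiagonalPart {n : ℕ} (K : Rn n → Rn n → ℂ) (B : (Rn n → ℂ) → (Rn n → ℂ) → ℂ) : Prop :=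
  ∀ p q, DualExponents p q → ∀ f g, MemLpc f p → MemLpc g q →
    HasBilateralSum (fun j => offDiagLevel K j g f) (kernelForm K g f - B g f) ∧
      (Tendsto (fun j : ℤ => kernelForm K (projV j g) (projV j f)) atBot (𝓝 0) →
        HasBilateralSum (fun j => diagLevel K j g f) (B g f))

end BCR

end

open MeasureTheory Filter Topology TopologicalSpace
open scoped ENNReal Distributions

noncomputable section

namespace BCR

/-! ### Discrete multiscale analysis on ℤⁿ: ℓᵖ bounds for dyadic forms with cancellation. -/

section

/-! ### Inequalities for sums in `ℝ≥0∞` -/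

/-! Let P_j be the projection onto functions constant on the dyadic cubes of generation j. Passing
from ⟨P_j g, T P_j f⟩ to ⟨P_{j+1} g, T P_{j+1} f⟩ adds exactly the Haar terms a, b, c of scale j
(`kernelForm_projV_telescope`), and since `K` is locally bounded these forms tend to ⟨g, Tf⟩ as j →
∞ (`IsLocBddKernel.tendsto_kernelForm_projV`). In the basis of the children, the coefficients of one
scale form a matrix, which is split into `tco` (from α, β, γ) and `dco` (from the differences a - α,
b - β, c - γ). The matrix `dco` couples only children of the same cube. The heart of the matter is
that the sum of the `tco` parts over all scales converges to a form `offForm` bounded on L^p ×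
L^{p'}; 𝕋 is then T minus the corresponding operator.

Boundedness. The coefficients with k ≠ l are O((1 + |k - l|)^{-n-s}): for distant cubes by the mean
zero of ψ and the regularity of `K`, for neighbouring cubes by the size condition and a Schur test
across a separating hyperplane. The diagonal entries of β and γ are chosen so that the rows of β and
the columns of γ sum to zero. Hence `tco` is the sum of a matrix and a transposed matrix, each with
two cancellations: it sums to zero over siblings in its first variable, and its rows sum to zero.
After fixing a finest scale, everything happens on the lattice ℤⁿ, with normalized sums over dyadic
boxes in place of the coefficients ⟨φ_{j,k}, f⟩.

For ℓ², the sibling cancellation means that only the martingale differences of g are seen, and these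
are orthogonal. The zero row sums replace the box sums of f by their differences under shifts. These
have a bounded square function, with slow growth in the shift w, because a shift moves only a small
proportion of a large box out of that box (`sum_tsum_lsum_shift_sub_le`, `lform_enorm_sq_le`). For
weak type (1,1), a Calderón–Zygmund decomposition is used: the sum of the bad part over a dyadic box
is zero unless the box lies properly inside a stopping box, so decay of the matrices suffices and no
smoothness is needed (`lT_weak_type`). Interpolation gives 1 < p < 2 and transposition gives p > 2,
with constants independent of the range of scales (`exists_lform_le`).

Structure of 𝕋. If f has mean zero and lives on Q, while g vanishes on Q, then the `dco` terms
vanish at every scale (`diagLevel_eq_zero`) and P_j f = 0 for all coarse j. So ⟨g, Tf⟩ is the sum of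
the off-diagonal terms alone, that is ⟨g, 𝕋f⟩ = 0. The same structure produces the kernel: once x
and y lie in different cubes of generation J, refining the scale changes the kernel of P_j T P_j
only by the `tco` term, which is subtracted. What is left is O(2^{nJ}), and J can be chosen with
2^{nJ} comparable to |x - y|^{-n} (`CZKernel.stageKernel_eq`). Dominated convergence then identifies
the form with the integral against this kernel. -/

theorem ennreal_two_mul_le (a b : ℝ≥0∞) : a * b + a * b ≤ a ^ 2 + b ^ 2 := by
  rcases eq_or_ne a ⊤ with rfl | ha
  · simp
  rcases eq_or_ne b ⊤ with rfl | hb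
  · simp
  lift a to NNReal using ha
  lift b to NNReal using hb
  norm_cast
  have := two_mul_le_add_sq (a : ℝ) b
  rw [← NNReal.coe_le_coe]
  push_cast
  linarith

theorem ennreal_le_of_add_self_le {a b : ℝ≥0∞} (h : a + a ≤ b + b) : a ≤ b := by
  rw [← two_mul, ← two_mul] at h
  exact (ENNReal.mul_le_mul_iff_right (by simp) (by simp)).1 h

/-- Cauchy–Schwarz by symmetrization: both sides are double sums, and for each pair (i, j) twice the
product of a_i b_j and a_j b_i is at most the sum of their squares. No summability is needed in
`ℝ≥0∞`. -/
theorem ennreal_tsum_mul_sq_le {ι : Type*} (a b : ι → ℝ≥0∞) :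
    (∑' i, a i * b i) ^ 2 ≤ (∑' i, a i ^ 2) * ∑' i, b i ^ 2 := by
  apply ennreal_le_of_add_self_le
  have h1 : (∑' i, a i * b i) ^ 2 = ∑' i, ∑' j, (a i * b j) * (a j * b i) := by
    rw [sq, ← ENNReal.tsum_mul_right]
    refine tsum_congr fun i => ?_
    rw [← ENNReal.tsum_mul_left]
    refine tsum_congr fun j => ?_
    ring
  have h2 : (∑' i, a i ^ 2) * ∑' i, b i ^ 2 = ∑' i, ∑' j, (a i * b j) ^ 2 := by
    rw [← ENNReal.tsum_mul_right]
    refine tsum_congr fun i => ?_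
    rw [← ENNReal.tsum_mul_left]
    refine tsum_congr fun j => ?_
    ring
  have h3 : (∑' i, a i ^ 2) * ∑' i, b i ^ 2 = ∑' i, ∑' j, (a j * b i) ^ 2 := by
    rw [h2, ENNReal.tsum_comm]
  rw [h1]
  nth_rewrite 1 [h2]
  rw [h3]
  simp_rw [← ENNReal.tsum_add]
  exact ENNReal.tsum_le_tsum fun i => ENNReal.tsum_le_tsum fun j => ennreal_two_mul_le _ _

/-- Cauchy–Schwarz for the measure with weights `a`, obtained from a = a^{1/2} · a^{1/2}. -/
theorem ennreal_tsum_weight_mul_sq_le {ι : Type*} (a b : ι → ℝ≥0∞) :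
    (∑' i, a i * b i) ^ 2 ≤ (∑' i, a i) * ∑' i, a i * b i ^ 2 := by
  have h := ennreal_tsum_mul_sq_le (fun i => a i ^ (1 / 2 : ℝ)) (fun i => a i ^ (1 / 2 : ℝ) * b i)
  have h1 : ∀ i, (a i ^ (1 / 2 : ℝ)) ^ 2 = a i := fun i => by
    rw [← ENNReal.rpow_natCast, ← ENNReal.rpow_mul]; norm_num
  simpa only [mul_pow, h1, ← mul_assoc, ← sq] using h

/-! ### The dyadic structure of the lattice `ℤⁿ` -/

/-- The lattice `ℤⁿ`. -/
abbrev Lat (n : ℕ) : Type := Fin n → ℤ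

variable {n : ℕ}

/-- The ancestor of a lattice point, `r` dyadic generations up. -/
def anc (r : ℕ) (x : Lat n) : Lat n := fun i => x i / 2 ^ r

/-- The descendants of a lattice point, `r` dyadic generations down. -/
def box (r : ℕ) (k : Lat n) : Finset (Lat n) :=
  Fintype.piFinset fun i => Finset.Ico (2 ^ r * k i) (2 ^ r * k i + 2 ^ r)

theorem int_ediv_eq_iff (r : ℕ) (a b : ℤ) : a / 2 ^ r = b ↔ 2 ^ r * b ≤ a ∧ a < 2 ^ r * b + 2 ^ r := by
  have hp : (0 : ℤ) < 2 ^ r := by positivity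
  constructor
  · rintro rfl
    exact ⟨Int.mul_ediv_self_le hp.ne', Int.lt_mul_ediv_self_add hp⟩
  · rintro ⟨h1, h2⟩
    apply le_antisymm
    · rw [← Int.lt_add_one_iff]
      apply Int.ediv_lt_of_lt_mul hp
      nlinarith
    · rw [Int.le_ediv_iff_mul_le hp]
      nlinarith

@[simp] theorem mem_box {r : ℕ} {k x : Lat n} : x ∈ box r k ↔ anc r x = k := by
  simp only [box, Fintype.mem_piFinset, Finset.mem_Ico, funext_iff, anc]
  exact forall_congr' fun i => (int_ediv_eq_iff r _ _).symm

@[simp] theorem anc_zero (x : Lat n) : anc 0 x = x := by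
  ext i; simp [anc]

theorem anc_anc (a b : ℕ) (x : Lat n) : anc a (anc b x) = anc (a + b) x := by
  ext i
  simp only [anc]
  rw [Int.ediv_ediv_of_nonneg (by positivity), pow_add, mul_comm]

theorem anc_add_mul (r : ℕ) (x w : Lat n) : anc r (fun i => x i + 2 ^ r * w i) = anc r x + w := by
  ext i
  simp only [anc, Pi.add_apply]
  rw [Int.add_mul_ediv_left _ _ (by positivity)]

theorem card_box (r : ℕ) (k : Lat n) : (box r k).card = (2 ^ n) ^ r := by
  simp only [box, Fintype.card_piFinset, Int.card_Ico]
  have : ∀ i, (2 ^ r * k i + 2 ^ r - 2 ^ r * k i).toNat = 2 ^ r := fun i => by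
    rw [add_sub_cancel_left]
    exact Int.toNat_natCast (2 ^ r)
  simp only [this, Finset.prod_const, Finset.card_univ, Fintype.card_fin]
  rw [← pow_mul, ← pow_mul, mul_comm]

theorem sum_box_add {M : Type*} [AddCommMonoid M] (a b : ℕ) (k : Lat n) (f : Lat n → M) :
    ∑ x ∈ box (a + b) k, f x = ∑ u ∈ box a k, ∑ x ∈ box b u, f x := by
  rw [Finset.sum_sigma']
  refine Finset.sum_bij' (fun x _ => ⟨anc b x, x⟩) (fun p _ => p.2) ?_ ?_ ?_ ?_ ?_
  · intro x hx
    simpa [anc_anc] using hx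
  · rintro ⟨u, x⟩ hx
    simp only [Finset.mem_sigma, mem_box] at hx ⊢
    rw [← anc_anc, hx.2, hx.1]
  · intro x hx; rfl
  · rintro ⟨u, x⟩ hx
    simp only [Finset.mem_sigma, mem_box] at hx
    simp [hx.2]
  · intro x hx; rfl

theorem tsum_eq_tsum_sum_box (r : ℕ) (F : Lat n → ℝ≥0∞) :
    ∑' x, F x = ∑' k, ∑ x ∈ box r k, F x := by
  have h1 : ∀ x, F x = ∑' k, if anc r x = k then F x else 0 := fun x => by
    rw [tsum_eq_single (anc r x)]
    · simp
    · intro k hk; simp [hk.symm]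
  have h2 : ∀ k, ∑' x, (if anc r x = k then F x else 0) = ∑ x ∈ box r k, F x := fun k => by
    rw [tsum_eq_sum (s := box r k)]
    · exact Finset.sum_congr rfl fun x hx => by simp [mem_box.1 hx]
    · intro x hx; simp [mem_box.not.1 hx]
  calc ∑' x, F x = ∑' x, ∑' k, if anc r x = k then F x else 0 := tsum_congr h1
    _ = _ := by rw [ENNReal.tsum_comm]; exact tsum_congr h2

theorem tsum_comp_anc (r : ℕ) (F : Lat n → ℝ≥0∞) :
    ∑' x, F (anc r x) = (2 ^ n) ^ r * ∑' k, F k := by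
  rw [tsum_eq_tsum_sum_box r, ← ENNReal.tsum_mul_left]
  refine tsum_congr fun k => ?_
  rw [Finset.sum_congr rfl fun x hx => by rw [mem_box.1 hx], Finset.sum_const, card_box]
  simp

/-- A point leaves the box only if one of its coordinates leaves its interval. In coordinate i this
concerns at most |w_i| values next to the end of the interval, the other coordinates being free; a
union bound over the coordinates finishes the count. -/
theorem card_shift_out (m : ℕ) (k w : Lat n) :
    (((box m k).filter fun u => anc m (u + w) ≠ k).card : ℝ) * 2 ^ m ≤
      n * ‖w‖ * (2 ^ n) ^ m := by
  classical
  let bad : Fin n → Finset ℤ := fun i =>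
    (Finset.Ico (2 ^ m * k i) (2 ^ m * k i + 2 ^ m)).filter fun t => (t + w i) / 2 ^ m ≠ k i
  have hbad : ∀ i, ((bad i).card : ℝ) ≤ ‖w‖ := fun i => by
    have h1 : (bad i) ⊆ if 0 ≤ w i then Finset.Ico (2 ^ m * k i + 2 ^ m - w i) (2 ^ m * k i + 2 ^ m)
        else Finset.Ico (2 ^ m * k i) (2 ^ m * k i - w i) := by
      intro t ht
      simp only [bad, Finset.mem_filter, Finset.mem_Ico, ne_eq, int_ediv_eq_iff] at ht
      split_ifs <;> simp only [Finset.mem_Ico] <;> omega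
    have h2 := Finset.card_le_card h1
    have h3 : (if 0 ≤ w i then Finset.Ico (2 ^ m * k i + 2 ^ m - w i) (2 ^ m * k i + 2 ^ m)
        else Finset.Ico (2 ^ m * k i) (2 ^ m * k i - w i)).card = (w i).natAbs := by
      split_ifs <;> simp only [Int.card_Ico] <;> omega
    rw [h3] at h2
    calc ((bad i).card : ℝ) ≤ ((w i).natAbs : ℝ) := by exact_mod_cast h2
      _ = ‖w i‖ := by rw [Int.norm_eq_abs, Nat.cast_natAbs]; simp
      _ ≤ ‖w‖ := norm_le_pi_norm w i
  let S : Fin n → Finset (Lat n) := fun i => Fintype.piFinset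
    (Function.update (fun i => Finset.Ico (2 ^ m * k i) (2 ^ m * k i + 2 ^ m)) i (bad i))
  have hS : ∀ i, ((S i).card : ℝ) * 2 ^ m ≤ ‖w‖ * (2 ^ n) ^ m := fun i => by
    have h0 : ∀ j, (2 ^ m * k j + 2 ^ m - 2 ^ m * k j).toNat = 2 ^ m := fun j => by
      rw [add_sub_cancel_left]
      exact Int.toNat_natCast (2 ^ m)
    have h1 : (S i).card * 2 ^ m = (bad i).card * (2 ^ n) ^ m := by
      simp only [S, Fintype.card_piFinset]
      rw [← Finset.mul_prod_erase Finset.univ _ (Finset.mem_univ i)]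
      rw [Function.update_self, Finset.prod_congr rfl (g := fun _ => 2 ^ m)]
      · rw [Finset.prod_const, Finset.card_erase_of_mem (Finset.mem_univ i), Finset.card_univ,
          Fintype.card_fin, mul_assoc, ← pow_succ, Nat.sub_add_cancel (Fin.pos i), ← pow_mul,
          ← pow_mul, mul_comm m n]
      · intro j hj
        rw [Function.update_of_ne (Finset.ne_of_mem_erase hj), Int.card_Ico, h0]
    have h2 : ((S i).card : ℝ) * 2 ^ m = (bad i).card * (2 ^ n) ^ m := by exact_mod_cast h1
    rw [h2]
    exact mul_le_mul_of_nonneg_right (hbad i) (by positivity)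
  have hsub : ((box m k).filter fun u => anc m (u + w) ≠ k) ⊆ Finset.univ.biUnion S := by
    intro u hu
    simp only [Finset.mem_filter, box, Fintype.mem_piFinset] at hu
    obtain ⟨hu, hne⟩ := hu
    obtain ⟨i, hi⟩ := Function.ne_iff.1 hne
    simp only [Finset.mem_biUnion, Finset.mem_univ, true_and]
    refine ⟨i, ?_⟩
    simp only [S, Fintype.mem_piFinset]
    intro j
    by_cases hj : j = i
    · subst hj
      rw [Function.update_self]
      exact Finset.mem_filter.2 ⟨hu j, hi⟩
    · rw [Function.update_of_ne hj]
      exact hu j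
  calc (((box m k).filter fun u => anc m (u + w) ≠ k).card : ℝ) * 2 ^ m
      ≤ (∑ i, (S i).card : ℕ) * 2 ^ m := by
        gcongr
        exact (Finset.card_le_card hsub).trans Finset.card_biUnion_le
    _ = ∑ i, ((S i).card : ℝ) * 2 ^ m := by push_cast; rw [Finset.sum_mul]
    _ ≤ ∑ _i : Fin n, ‖w‖ * (2 ^ n) ^ m := Finset.sum_le_sum fun i _ => hS i
    _ = n * ‖w‖ * (2 ^ n) ^ m := by simp [mul_assoc]

/-- The proportion of a box that leaves it under a shift by `w`. -/
theorem card_shift_out_le {σ : ℝ} (h0 : 0 < σ) (h1 : σ ≤ 1) (m : ℕ) (k w : Lat n) :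
    (((box m k).filter fun u => anc m (u + w) ≠ k).card : ℝ) ≤
      n * (1 + ‖w‖) ^ σ * ((2 : ℝ) ^ (-σ)) ^ m * (2 ^ n) ^ m := by
  rcases Nat.eq_zero_or_pos n with rfl | hn
  · have : ((box m k).filter fun u => anc m (u + w) ≠ k) = ∅ := by
      rw [Finset.filter_eq_empty_iff]
      intro u _
      simpa using Subsingleton.elim _ _
    rw [this]; simp
  have hn' : (1 : ℝ) ≤ n := by exact_mod_cast hn
  set c : ℝ := (((box m k).filter fun u => anc m (u + w) ≠ k).card : ℝ) with hc
  have hA := card_shift_out m k w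
  rw [← hc] at hA
  have hB : c ≤ (2 ^ n) ^ m := by
    have := Finset.card_le_card (Finset.filter_subset (fun u => anc m (u + w) ≠ k) (box m k))
    rw [card_box] at this
    rw [hc]
    exact_mod_cast this
  have hpos : (0 : ℝ) < (2 ^ n) ^ m := by positivity
  set z : ℝ := c / (2 ^ n) ^ m with hz
  have hz0 : 0 ≤ z := by positivity
  have hz1 : z ≤ 1 := by rw [hz, div_le_one hpos]; exact hB
  have hz2 : z ≤ n * (1 + ‖w‖) / 2 ^ m := by
    rw [hz, div_le_div_iff₀ hpos (by positivity)]
    refine hA.trans ?_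
    gcongr
    linarith
  -- A proportion z ≤ 1 satisfies z ≤ z^σ, so the linear bound n(1 + |w|)/2^m may be replaced by its
  -- σ-th power. This keeps the growth in w below the available decay of the matrices.
  have hz3 : z ≤ n * (1 + ‖w‖) ^ σ * ((2 : ℝ) ^ (-σ)) ^ m := by
    calc z = z ^ (1 : ℝ) := (Real.rpow_one z).symm
      _ ≤ z ^ σ := by
        rcases eq_or_lt_of_le hz0 with h | h
        · rw [← h, Real.zero_rpow h0.ne', Real.zero_rpow one_ne_zero]
        · exact Real.rpow_le_rpow_of_exponent_ge h hz1 h1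
      _ ≤ (n * (1 + ‖w‖) / 2 ^ m) ^ σ := Real.rpow_le_rpow hz0 hz2 h0.le
      _ = (n : ℝ) ^ σ * (1 + ‖w‖) ^ σ * ((2 : ℝ) ^ (-σ)) ^ m := by
        rw [Real.div_rpow (by positivity) (by positivity), Real.mul_rpow (by positivity)
          (by positivity), div_eq_mul_inv, ← Real.rpow_natCast 2 m, ← Real.rpow_mul (by positivity),
          ← Real.rpow_neg (by positivity), ← Real.rpow_natCast, ← Real.rpow_mul (by positivity)]
        ring_nf
      _ ≤ n * (1 + ‖w‖) ^ σ * ((2 : ℝ) ^ (-σ)) ^ m := by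
        gcongr
        calc (n : ℝ) ^ σ ≤ (n : ℝ) ^ (1 : ℝ) := Real.rpow_le_rpow_of_exponent_le hn' h1
          _ = n := Real.rpow_one _
  calc c = z * (2 ^ n) ^ m := by rw [hz]; field_simp
    _ ≤ _ := by gcongr

end

section

variable {n : ℕ}

/-! ### Normalized box sums and their martingale differences -/

/-- `2^{-n/2}`. -/
def rt (n : ℕ) : ℝ := (Real.sqrt (2 ^ n))⁻¹

theorem rt_pos (n : ℕ) : 0 < rt n := by unfold rt; positivity

theorem rt_sq (n : ℕ) : rt n ^ 2 = (2 ^ n)⁻¹ := by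
  unfold rt; rw [inv_pow, Real.sq_sqrt (by positivity)]

/-- The normalized sum of `f` over a box. -/
def lsum (r : ℕ) (f : Lat n → ℂ) (k : Lat n) : ℂ := (rt n : ℂ) ^ r * ∑ x ∈ box r k, f x

theorem box_zero (k : Lat n) : box 0 k = {k} := by
  ext x; simp

@[simp] theorem lsum_zero (f : Lat n → ℂ) (k : Lat n) : lsum 0 f k = f k := by
  simp [lsum, box_zero]

theorem lsum_succ (r : ℕ) (f : Lat n → ℂ) (k : Lat n) :
    lsum (r + 1) f k = rt n * ∑ u ∈ box 1 k, lsum r f u := by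
  simp only [lsum]
  rw [add_comm r 1, sum_box_add, ← Finset.mul_sum, pow_add, pow_one, mul_assoc]

/-- The difference between the values of consecutive averages. -/
def ldiff (r : ℕ) (f : Lat n → ℂ) (u : Lat n) : ℂ :=
  lsum r f u - rt n * lsum (r + 1) f (anc 1 u)

/-- Pythagoras for the projection onto the constants on s: with c = |s|^{-1/2}, the number c Σ a is
the coefficient along the unit constant vector, and c · c Σ a is the mean. -/
theorem sum_normSq_sub_mean {ι : Type*} (s : Finset ι) (a : ι → ℂ) (c : ℝ)
    (hc : c ^ 2 * s.card = 1) :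
    ∑ i ∈ s, ‖a i - c * (c * ∑ j ∈ s, a j)‖ ^ 2 + ‖c * ∑ j ∈ s, a j‖ ^ 2 = ∑ i ∈ s, ‖a i‖ ^ 2 := by
  simp only [← Complex.normSq_eq_norm_sq, Complex.normSq_apply]
  simp only [Complex.sub_re, Complex.sub_im, Complex.re_ofReal_mul, Complex.im_ofReal_mul,
    Complex.re_sum, Complex.im_sum]
  set A := ∑ j ∈ s, (a j).re
  set B := ∑ j ∈ s, (a j).im
  have h : ∀ i, ((a i).re - c * (c * A)) * ((a i).re - c * (c * A)) +
      ((a i).im - c * (c * B)) * ((a i).im - c * (c * B)) =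
      ((a i).re * (a i).re + (a i).im * (a i).im) - 2 * c ^ 2 * A * (a i).re
        - 2 * c ^ 2 * B * (a i).im + (c ^ 4 * (A ^ 2 + B ^ 2)) := fun i => by ring
  simp only [h, Finset.sum_add_distrib, Finset.sum_sub_distrib, ← Finset.mul_sum, Finset.sum_const,
    nsmul_eq_mul]
  change _ - 2 * c ^ 2 * A * A - 2 * c ^ 2 * B * B + _ + _ = _
  linear_combination (c ^ 2 * (A ^ 2 + B ^ 2)) * hc

theorem enorm_sq_eq_ofReal (z : ℂ) : ‖z‖ₑ ^ 2 = ENNReal.ofReal (‖z‖ ^ 2) := by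
  rw [← ofReal_norm, ENNReal.ofReal_pow (norm_nonneg _)]

/-- Pythagoras inside every box of siblings, with c = `rt n` because such a box has 2^n points. -/
theorem tsum_ldiff_add_tsum_lsum (r : ℕ) (f : Lat n → ℂ) :
    ∑' u, ‖ldiff r f u‖ₑ ^ 2 + ∑' k, ‖lsum (r + 1) f k‖ₑ ^ 2 = ∑' u, ‖lsum r f u‖ₑ ^ 2 := by
  rw [tsum_eq_tsum_sum_box 1, tsum_eq_tsum_sum_box 1 (fun u => ‖lsum r f u‖ₑ ^ 2),
    ← ENNReal.tsum_add]
  refine tsum_congr fun k => ?_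
  simp only [enorm_sq_eq_ofReal]
  rw [← ENNReal.ofReal_sum_of_nonneg (fun _ _ => by positivity),
    ← ENNReal.ofReal_sum_of_nonneg (fun _ _ => by positivity),
    ← ENNReal.ofReal_add (Finset.sum_nonneg fun _ _ => by positivity) (by positivity)]
  congr 1
  rw [← sum_normSq_sub_mean (box 1 k) (lsum r f) (rt n)
    (by rw [rt_sq, card_box]; push_cast; field_simp), lsum_succ]
  congr 1
  refine Finset.sum_congr rfl fun u hu => ?_
  rw [ldiff, mem_box.1 hu, lsum_succ]

theorem sum_tsum_ldiff (R : ℕ) (f : Lat n → ℂ) :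
    ∑ r ∈ Finset.range R, ∑' u, ‖ldiff r f u‖ₑ ^ 2 + ∑' k, ‖lsum R f k‖ₑ ^ 2 =
      ∑' x, ‖f x‖ₑ ^ 2 := by
  induction R with
  | zero => simp
  | succ R ih => rw [Finset.sum_range_succ, add_assoc, tsum_ldiff_add_tsum_lsum, ih]

/-- The pieces of the martingale decomposition with top level `R`. -/
def lpiece (R i : ℕ) (f : Lat n → ℂ) (u : Lat n) : ℂ := if i < R then ldiff i f u else lsum R f u

theorem sum_tsum_lpiece (R : ℕ) (f : Lat n → ℂ) :
    ∑ i ∈ Finset.range (R + 1), ∑' u, ‖lpiece R i f u‖ₑ ^ 2 = ∑' x, ‖f x‖ₑ ^ 2 := by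
  rw [Finset.sum_range_succ, ← sum_tsum_ldiff R f]
  congr 1
  · exact Finset.sum_congr rfl fun i hi => by simp [lpiece, Finset.mem_range.1 hi]
  · simp [lpiece]

/-- Telescoping of the definition of `ldiff` up to the top level r + m. Each generation costs one
factor `rt n`, which reflects the ℓ² normalization of the box sums. -/
theorem lsum_eq_sum_lpiece (r m : ℕ) (f : Lat n → ℂ) (u : Lat n) :
    lsum r f u = ∑ i ∈ Finset.range (m + 1), (rt n : ℂ) ^ i * lpiece (r + m) (r + i) f (anc i u) := by
  have key : ∀ m, lsum r f u = ∑ i ∈ Finset.range m, (rt n : ℂ) ^ i * ldiff (r + i) f (anc i u) +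
      (rt n : ℂ) ^ m * lsum (r + m) f (anc m u) := by
    intro m
    induction m with
    | zero => simp
    | succ m ih =>
      rw [ih, Finset.sum_range_succ, ldiff, anc_anc, add_comm 1 m, pow_succ, ← add_assoc]
      ring
  rw [key m, Finset.sum_range_succ]
  congr 1
  · refine Finset.sum_congr rfl fun i hi => ?_
    simp [lpiece, Finset.mem_range.1 hi]
  · simp [lpiece]

/-! ### Shifts of box-constant functions -/

/-- Only points whose shift lands in another box contribute, and `card_shift_out_le` bounds their
proportion in each box. The term evaluated at u + w becomes, after translation, the same count for
the shift by -w; the constant 4 is 2 + 2 from |a - b|² ≤ 2|a|² + 2|b|². -/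
theorem tsum_shift_sub_sq_le {σ : ℝ} (h0 : 0 < σ) (h1 : σ ≤ 1) (m : ℕ) (w : Lat n)
    (h : Lat n → ℂ) :
    ∑' u, ‖h (anc m (u + w)) - h (anc m u)‖ₑ ^ 2 ≤
      ENNReal.ofReal (4 * n * (1 + ‖w‖) ^ σ * ((2 : ℝ) ^ (-σ)) ^ m * (2 ^ n) ^ m) *
        ∑' k, ‖h k‖ₑ ^ 2 := by
  classical
  set c : ℝ := n * (1 + ‖w‖) ^ σ * ((2 : ℝ) ^ (-σ)) ^ m * (2 ^ n) ^ m with hc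
  have hc0 : 0 ≤ c := by positivity
  have out : ∀ w' : Lat n, ‖w'‖ = ‖w‖ →
      ∑' u, (if anc m (u + w') ≠ anc m u then ‖h (anc m u)‖ₑ ^ 2 else 0) ≤
        ENNReal.ofReal c * ∑' k, ‖h k‖ₑ ^ 2 := by
    intro w' hw'
    rw [tsum_eq_tsum_sum_box m, ← ENNReal.tsum_mul_left]
    refine ENNReal.tsum_le_tsum fun k => ?_
    rw [Finset.sum_congr rfl (g := fun u => if anc m (u + w') ≠ k then ‖h k‖ₑ ^ 2 else 0)
      (fun u hu => by rw [mem_box.1 hu]), ← Finset.sum_filter, Finset.sum_const, nsmul_eq_mul]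
    gcongr
    rw [← ENNReal.ofReal_natCast]
    apply ENNReal.ofReal_le_ofReal
    rw [hc, ← hw']
    exact card_shift_out_le h0 h1 m k w'
  have pt : ∀ u, ‖h (anc m (u + w)) - h (anc m u)‖ₑ ^ 2 ≤
      2 * (if anc m (u + w) ≠ anc m u then ‖h (anc m (u + w))‖ₑ ^ 2 else 0) +
      2 * (if anc m (u + w) ≠ anc m u then ‖h (anc m u)‖ₑ ^ 2 else 0) := by
    intro u
    by_cases hu : anc m (u + w) = anc m u
    · simp [hu]
    · simp only [ne_eq, hu, not_false_eq_true, if_true]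
      calc ‖h (anc m (u + w)) - h (anc m u)‖ₑ ^ 2
          ≤ (‖h (anc m (u + w))‖ₑ + ‖h (anc m u)‖ₑ) ^ 2 := by
            gcongr
            exact enorm_sub_le
        _ = ‖h (anc m (u + w))‖ₑ ^ 2 + ‖h (anc m u)‖ₑ ^ 2 +
            (‖h (anc m (u + w))‖ₑ * ‖h (anc m u)‖ₑ + ‖h (anc m (u + w))‖ₑ * ‖h (anc m u)‖ₑ) := by
            ring
        _ ≤ ‖h (anc m (u + w))‖ₑ ^ 2 + ‖h (anc m u)‖ₑ ^ 2 +
            (‖h (anc m (u + w))‖ₑ ^ 2 + ‖h (anc m u)‖ₑ ^ 2) := by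
            exact add_le_add_right (ennreal_two_mul_le _ _) _
        _ = _ := by ring
  refine (ENNReal.tsum_le_tsum pt).trans ?_
  rw [ENNReal.tsum_add, ENNReal.tsum_mul_left, ENNReal.tsum_mul_left]
  have e1 : ∑' u, (if anc m (u + w) ≠ anc m u then ‖h (anc m (u + w))‖ₑ ^ 2 else 0) =
      ∑' u, (if anc m (u + -w) ≠ anc m u then ‖h (anc m u)‖ₑ ^ 2 else 0) := by
    rw [← (Equiv.addRight w).tsum_eq
      (fun u => if anc m (u + -w) ≠ anc m u then ‖h (anc m u)‖ₑ ^ 2 else 0)]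
    refine tsum_congr fun u => ?_
    simp only [Equiv.coe_addRight, add_neg_cancel_right]
    simp only [ne_comm]
  rw [e1]
  calc _ ≤ 2 * (ENNReal.ofReal c * ∑' k, ‖h k‖ₑ ^ 2) +
        2 * (ENNReal.ofReal c * ∑' k, ‖h k‖ₑ ^ 2) := by
        gcongr
        · exact out (-w) (norm_neg w)
        · exact out w rfl
    _ = ENNReal.ofReal (4 * c) * ∑' k, ‖h k‖ₑ ^ 2 := by
        rw [ENNReal.ofReal_mul (p := 4) (by norm_num), show ENNReal.ofReal 4 = 4 by simp]
        ring
    _ = _ := by rw [hc]; ring_nf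

/-- Cauchy–Schwarz with weights t^i. It allows a sum over generations to be squared term by term at
the price of a factor t^{-i}, to be paid from the geometric decay of the terms. -/
theorem ennreal_sum_sq_le_geometric (t : ℝ≥0∞) (ht0 : t ≠ 0) (ht : t ≠ ⊤) (m : ℕ)
    (x : ℕ → ℝ≥0∞) :
    (∑ i ∈ Finset.range m, x i) ^ 2 ≤
      (1 - t)⁻¹ * ∑ i ∈ Finset.range m, (t ^ i)⁻¹ * x i ^ 2 := by
  have h := ennreal_tsum_weight_mul_sq_le (fun i : Finset.range m => t ^ (i : ℕ))
    (fun i => (t ^ (i : ℕ))⁻¹ * x i)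
  have hi : ∀ i : ℕ, t ^ i * (t ^ i)⁻¹ = 1 := fun i =>
    ENNReal.mul_inv_cancel (pow_ne_zero _ ht0) (ENNReal.pow_ne_top ht)
  rw [tsum_fintype, tsum_fintype, tsum_fintype] at h
  rw [Finset.sum_coe_sort (Finset.range m) (fun i => t ^ i * ((t ^ i)⁻¹ * x i)),
    Finset.sum_coe_sort (Finset.range m) (fun i => t ^ i),
    Finset.sum_coe_sort (Finset.range m) (fun i => t ^ i * ((t ^ i)⁻¹ * x i) ^ 2)] at h
  have e1 : ∀ i, t ^ i * ((t ^ i)⁻¹ * x i) = x i := fun i => by rw [← mul_assoc, hi, one_mul]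
  have e2 : ∀ i, t ^ i * ((t ^ i)⁻¹ * x i) ^ 2 = (t ^ i)⁻¹ * x i ^ 2 := fun i => by
    calc t ^ i * ((t ^ i)⁻¹ * x i) ^ 2 = (t ^ i * (t ^ i)⁻¹) * ((t ^ i)⁻¹ * x i ^ 2) := by ring
      _ = _ := by rw [hi, one_mul]
  simp only [e1, e2] at h
  refine h.trans ?_
  gcongr
  rw [← ENNReal.tsum_geometric]
  exact ENNReal.sum_le_tsum _

/-- The constant of the square function estimate for shifts. -/
def shiftConst (n : ℕ) (σ : ℝ) : ℝ≥0∞ :=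
  ENNReal.ofReal (4 * n) * ((1 - ENNReal.ofReal ((2 : ℝ) ^ (-(σ / 2))))⁻¹ *
    (1 - ENNReal.ofReal ((2 : ℝ) ^ (-(σ / 2))))⁻¹)

theorem shiftConst_ne_top {σ : ℝ} (h0 : 0 < σ) : shiftConst n σ ≠ ⊤ := by
  have : (1 - ENNReal.ofReal ((2 : ℝ) ^ (-(σ / 2))))⁻¹ ≠ ⊤ := by
    rw [ENNReal.inv_ne_top]
    have : ENNReal.ofReal ((2 : ℝ) ^ (-(σ / 2))) < 1 := by
      rw [ENNReal.ofReal_lt_one]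
      exact Real.rpow_lt_one_of_one_lt_of_neg (by norm_num) (by linarith)
    exact (tsub_pos_of_lt this).ne'
  unfold shiftConst
  exact ENNReal.mul_ne_top ENNReal.ofReal_ne_top (ENNReal.mul_ne_top this this)

/-- Square function estimate for the differences of box sums over shifted boxes. -/
theorem sum_tsum_lsum_shift_sub_le {σ : ℝ} (h0 : 0 < σ) (h1 : σ ≤ 1) (R : ℕ) (w : Lat n)
    (f : Lat n → ℂ) :
    ∑ r ∈ Finset.range R, ∑' u, ‖lsum r f (u + w) - lsum r f u‖ₑ ^ 2 ≤
      shiftConst n σ * ENNReal.ofReal ((1 + ‖w‖) ^ σ) * ∑' x, ‖f x‖ₑ ^ 2 := by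
  -- The piece lying i levels above r gains 2^{-σ i} = t^{2i} under a shift. One factor t^i pays for
  -- Cauchy–Schwarz over the pieces; the other makes the sum over all levels r below a given piece
  -- converge.
  set tr : ℝ := (2 : ℝ) ^ (-(σ / 2)) with htr
  have htr0 : 0 < tr := by positivity
  set t : ℝ≥0∞ := ENNReal.ofReal tr with ht
  have ht0 : t ≠ 0 := by rw [ht]; simpa using htr0
  have htop : t ≠ ⊤ := ENNReal.ofReal_ne_top
  have hi : ∀ i : ℕ, (t ^ i)⁻¹ * t ^ i = 1 := fun i =>
    ENNReal.inv_mul_cancel (pow_ne_zero _ ht0) (ENNReal.pow_ne_top htop)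
  set A : ℝ≥0∞ := ENNReal.ofReal (4 * n * (1 + ‖w‖) ^ σ) with hA
  set e : ℕ → ℝ≥0∞ := fun i => ∑' u, ‖lpiece R i f u‖ₑ ^ 2 with he
  have level : ∀ r ∈ Finset.range R, ∑' u, ‖lsum r f (u + w) - lsum r f u‖ₑ ^ 2 ≤
      (1 - t)⁻¹ * A * ∑ j ∈ Finset.range (R + 1), if r ≤ j then t ^ (j - r) * e j else 0 := by
    intro r hr
    obtain ⟨m, hm⟩ := Nat.exists_eq_add_of_le (Finset.mem_range.1 hr).le
    have pt : ∀ u, ‖lsum r f (u + w) - lsum r f u‖ₑ ^ 2 ≤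
        (1 - t)⁻¹ * ∑ i ∈ Finset.range (m + 1), (t ^ i)⁻¹ *
          ‖(rt n : ℂ) ^ i * lpiece R (r + i) f (anc i (u + w)) -
            (rt n : ℂ) ^ i * lpiece R (r + i) f (anc i u)‖ₑ ^ 2 := by
      intro u
      refine le_trans ?_ (ennreal_sum_sq_le_geometric t ht0 htop (m + 1) _)
      rw [lsum_eq_sum_lpiece r m f, lsum_eq_sum_lpiece r m f, ← Finset.sum_sub_distrib, ← hm]
      gcongr
      exact enorm_sum_le _ _
    refine (ENNReal.tsum_le_tsum pt).trans ?_
    rw [ENNReal.tsum_mul_left, mul_assoc]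
    gcongr
    rw [Summable.tsum_finsetSum (fun _ _ => ENNReal.summable)]
    have each : ∀ i ∈ Finset.range (m + 1), ∑' u, (t ^ i)⁻¹ *
          ‖(rt n : ℂ) ^ i * lpiece R (r + i) f (anc i (u + w)) -
            (rt n : ℂ) ^ i * lpiece R (r + i) f (anc i u)‖ₑ ^ 2 ≤ A * (t ^ i * e (r + i)) := by
      intro i _
      rw [ENNReal.tsum_mul_left]
      have hs := tsum_shift_sub_sq_le h0 h1 i w
        (fun k => (rt n : ℂ) ^ i * lpiece R (r + i) f k)
      have hn2 : ∑' k, ‖(rt n : ℂ) ^ i * lpiece R (r + i) f k‖ₑ ^ 2 =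
          ENNReal.ofReal (((2 ^ n)⁻¹) ^ i) * e (r + i) := by
        rw [he, ← ENNReal.tsum_mul_left]
        refine tsum_congr fun k => ?_
        rw [enorm_mul, mul_pow]
        congr 1
        rw [enorm_sq_eq_ofReal, norm_pow, Complex.norm_real, Real.norm_of_nonneg (rt_pos n).le,
          ← pow_mul, mul_comm i 2, pow_mul, rt_sq]
      rw [hn2] at hs
      -- The (2^n)^i points of a box of generation i cancel against the normalization |rt^i|² =
      -- 2^{-ni}, and only the gain t^{2i} is left.
      have hcomb : ENNReal.ofReal (4 * n * (1 + ‖w‖) ^ σ * ((2 : ℝ) ^ (-σ)) ^ i * (2 ^ n) ^ i) *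
          (ENNReal.ofReal (((2 ^ n)⁻¹) ^ i) * e (r + i)) = A * ((t ^ i * t ^ i) * e (r + i)) := by
        rw [← mul_assoc, ← ENNReal.ofReal_mul (by positivity), ← mul_assoc]
        congr 1
        rw [hA, ht, ← ENNReal.ofReal_pow htr0.le, ← ENNReal.ofReal_mul (by positivity),
          ← ENNReal.ofReal_mul (by positivity)]
        congr 1
        have e1 : tr ^ i * tr ^ i = ((2 : ℝ) ^ (-σ)) ^ i := by
          rw [← mul_pow, htr, ← Real.rpow_add (by norm_num)]
          ring_nf
        rw [e1, mul_assoc _ ((2 ^ n) ^ i) _, ← mul_pow, mul_inv_cancel₀ (by positivity), one_pow,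
          mul_one]
      rw [hcomb] at hs
      calc (t ^ i)⁻¹ * _ ≤ (t ^ i)⁻¹ * (A * ((t ^ i * t ^ i) * e (r + i))) := by gcongr
        _ = ((t ^ i)⁻¹ * t ^ i) * (A * (t ^ i * e (r + i))) := by ring
        _ = _ := by rw [hi, one_mul]
    refine (Finset.sum_le_sum each).trans ?_
    rw [← Finset.mul_sum]
    gcongr
    rw [← Finset.sum_filter]
    have : (Finset.range (R + 1)).filter (fun j => r ≤ j) =
        (Finset.range (m + 1)).image (fun i => r + i) := by
      ext j
      simp only [Finset.mem_filter, Finset.mem_range, Finset.mem_image]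
      constructor
      · rintro ⟨ha, hb⟩; exact ⟨j - r, by omega, by omega⟩
      · rintro ⟨i, ha, rfl⟩; omega
    rw [this, Finset.sum_image (fun a _ b _ hab => by simpa using hab)]
    simp
  refine (Finset.sum_le_sum level).trans ?_
  rw [← Finset.mul_sum, Finset.sum_comm]
  have inner : ∀ j ∈ Finset.range (R + 1),
      ∑ r ∈ Finset.range R, (if r ≤ j then t ^ (j - r) * e j else 0) ≤ (1 - t)⁻¹ * e j := by
    intro j _
    calc ∑ r ∈ Finset.range R, (if r ≤ j then t ^ (j - r) * e j else 0)
        ≤ ∑ r ∈ (Finset.range R).filter (fun r => r ≤ j), t ^ (j - r) * e j := by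
          rw [Finset.sum_filter]
      _ = (∑ r ∈ (Finset.range R).filter (fun r => r ≤ j), t ^ (j - r)) * e j := by
          rw [Finset.sum_mul]
      _ = (∑ i ∈ ((Finset.range R).filter (fun r => r ≤ j)).image (fun r => j - r), t ^ i) * e j := by
          rw [Finset.sum_image]
          intro a ha b hb hab
          simp only [Finset.coe_filter, Finset.mem_range, Set.mem_ofPred_eq] at ha hb hab
          omega
      _ ≤ (1 - t)⁻¹ * e j := by
          gcongr
          rw [← ENNReal.tsum_geometric]
          exact ENNReal.sum_le_tsum _
  calc (1 - t)⁻¹ * A * ∑ j ∈ Finset.range (R + 1), ∑ r ∈ Finset.range R,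
        (if r ≤ j then t ^ (j - r) * e j else 0)
      ≤ (1 - t)⁻¹ * A * ∑ j ∈ Finset.range (R + 1), (1 - t)⁻¹ * e j := by
        gcongr with j hj
        exact inner j hj
    _ = shiftConst n σ * ENNReal.ofReal ((1 + ‖w‖) ^ σ) * ∑' x, ‖f x‖ₑ ^ 2 := by
        rw [← Finset.mul_sum, he, sum_tsum_lpiece, hA, ENNReal.ofReal_mul (by positivity),
          shiftConst]
        ring

end

section

variable {n : ℕ}

/-! ### Multiscale forms on the lattice: the `ℓ²` estimate -/

/-- The level `r` part of a multiscale operator, acting on box sums. -/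
def lop (θ : ℕ → Lat n → Lat n → ℂ) (r : ℕ) (f : Lat n → ℂ) (u : Lat n) : ℂ :=
  ∑' v, θ r u v * lsum r f v

/-- A multiscale form with `R` levels. -/
def lform (θ : ℕ → Lat n → Lat n → ℂ) (R : ℕ) (g f : Lat n → ℂ) : ℂ :=
  ∑ r ∈ Finset.range R, ∑' u, lsum r g u * lop θ r f u

/-- The operator of a multiscale form. -/
def lT (θ : ℕ → Lat n → Lat n → ℂ) (R : ℕ) (f : Lat n → ℂ) (x : Lat n) : ℂ :=
  ∑ r ∈ Finset.range R, (rt n : ℂ) ^ r * lop θ r f (anc r x)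

theorem lsum_eq_zero {r : ℕ} {f : Lat n → ℂ} {S : Set (Lat n)} (hS : ∀ x ∉ S, f x = 0) {k : Lat n}
    (hk : k ∉ anc r '' S) : lsum r f k = 0 := by
  rw [lsum, Finset.sum_eq_zero, mul_zero]
  intro x hx
  exact hS x fun h => hk ⟨x, h, mem_box.1 hx⟩

theorem finite_support_lsum {f : Lat n → ℂ} (hf : f.support.Finite) (r : ℕ) :
    (lsum r f).support.Finite := by
  refine (hf.image (anc r)).subset fun k hk => ?_
  by_contra h
  exact hk (lsum_eq_zero (fun x hx => Function.notMem_support.1 hx) h)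

theorem tsum_eq_sum_sum_box {r : ℕ} {F : Lat n → ℂ} {S : Finset (Lat n)}
    (h : ∀ u, anc r u ∉ S → F u = 0) : ∑' u, F u = ∑ k ∈ S, ∑ u ∈ box r k, F u := by
  classical
  rw [tsum_eq_sum (s := S.biUnion (box r)), Finset.sum_biUnion]
  · intro a _ b _ hab
    rw [Function.onFun, Finset.disjoint_left]
    intro x hx hx'
    exact hab ((mem_box.1 hx).symm.trans (mem_box.1 hx'))
  · intro u hu
    apply h
    intro hS
    exact hu (Finset.mem_biUnion.2 ⟨_, hS, mem_box.2 rfl⟩)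

theorem lop_eq_sum {θ : ℕ → Lat n → Lat n → ℂ} {r : ℕ} {f : Lat n → ℂ} {S : Finset (Lat n)}
    (hS : ∀ v ∉ S, lsum r f v = 0) (u : Lat n) : lop θ r f u = ∑ v ∈ S, θ r u v * lsum r f v :=
  tsum_eq_sum fun v hv => by rw [hS v hv, mul_zero]

theorem lform_transpose (θ : ℕ → Lat n → Lat n → ℂ) (R : ℕ) {g f : Lat n → ℂ}
    (hg : g.support.Finite) (hf : f.support.Finite) :
    lform θ R g f = lform (fun r u v => θ r v u) R f g := by
  refine Finset.sum_congr rfl fun r _ => ?_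
  set S := (finite_support_lsum hf r).toFinset
  set S' := (finite_support_lsum hg r).toFinset
  have hS : ∀ v ∉ S, lsum r f v = 0 := fun v hv => by simpa [S] using hv
  have hS' : ∀ v ∉ S', lsum r g v = 0 := fun v hv => by simpa [S'] using hv
  rw [tsum_eq_sum (s := S') (fun u hu => by rw [hS' u hu, zero_mul]),
    tsum_eq_sum (s := S) (fun u hu => by rw [hS u hu, zero_mul])]
  simp only [lop_eq_sum hS, lop_eq_sum hS', Finset.mul_sum]
  rw [Finset.sum_comm]
  refine Finset.sum_congr rfl fun v _ => Finset.sum_congr rfl fun u _ => ?_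
  ring

theorem tsum_mul_lT (θ : ℕ → Lat n → Lat n → ℂ) (R : ℕ) {g : Lat n → ℂ} (f : Lat n → ℂ)
    (hg : g.support.Finite) : ∑' x, g x * lT θ R f x = lform θ R g f := by
  set A := hg.toFinset
  have hA : ∀ x ∉ A, g x = 0 := fun x hx => by simpa [A] using hx
  rw [tsum_eq_sum (s := A) (fun x hx => by rw [hA x hx, zero_mul])]
  simp only [lT, Finset.mul_sum]
  rw [Finset.sum_comm]
  refine Finset.sum_congr rfl fun r _ => ?_
  rw [← tsum_eq_sum (L := SummationFilter.unconditional _) (s := A)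
      (f := fun x => g x * ((rt n : ℂ) ^ r * lop θ r f (anc r x)))
    (fun x hx => by rw [hA x hx, zero_mul])]
  set S := (hg.image (anc r)).toFinset
  have hS : ∀ k ∉ S, lsum r g k = 0 := fun k hk =>
    lsum_eq_zero (S := g.support) (fun x hx => Function.notMem_support.1 hx) (by simpa [S] using hk)
  rw [tsum_eq_sum_sum_box (r := r) (S := S), tsum_eq_sum (s := S)]
  · refine Finset.sum_congr rfl fun k _ => ?_
    rw [lsum, Finset.mul_sum, Finset.sum_mul]
    refine Finset.sum_congr rfl fun x hx => ?_
    rw [mem_box.1 hx]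
    ring
  · intro k hk
    rw [hS k hk, zero_mul]
  · intro u hu
    have : g u = 0 := by
      by_contra h
      exact hu (by simpa [S] using ⟨u, h, rfl⟩)
    rw [this, zero_mul]

section L2

variable {θ : ℕ → Lat n → Lat n → ℂ} {W : Lat n → ℝ≥0∞}

theorem summable_row (hθ : ∀ r u v, ‖θ r u v‖ₑ ≤ W (v - u)) (hW : ∑' z, W z ≠ ⊤) (r : ℕ)
    (u : Lat n) : Summable fun v => θ r u v := by
  apply Summable.of_enorm
  refine ne_top_of_le_ne_top hW ?_
  rw [← (Equiv.subRight u).tsum_eq W]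
  exact ENNReal.tsum_le_tsum fun v => hθ r u v

theorem tsum_weight_ne_top {σ : ℝ} (h0 : 0 < σ)
    (hW : ∑' z, W z * ENNReal.ofReal ((1 + ‖z‖) ^ σ) ≠ ⊤) : ∑' z, W z ≠ ⊤ := by
  refine ne_top_of_le_ne_top hW (ENNReal.tsum_le_tsum fun z => ?_)
  refine le_mul_of_one_le_right' ?_
  rw [ENNReal.one_le_ofReal]
  exact Real.one_le_rpow (by linarith [norm_nonneg z]) h0.le

/-- Since the row u of θ sums to zero, the constant `lsum r f u` can be subtracted inside the sum
over v; Cauchy–Schwarz with weight `W` does the rest. -/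
theorem lop_enorm_sq_le (hθ : ∀ r u v, ‖θ r u v‖ₑ ≤ W (v - u)) (hW : ∑' z, W z ≠ ⊤)
    (hrow : ∀ r u, ∑' v, θ r u v = 0) (r : ℕ) {f : Lat n → ℂ} (hf : f.support.Finite)
    (u : Lat n) :
    ‖lop θ r f u‖ₑ ^ 2 ≤ (∑' z, W z) * ∑' w, W w * ‖lsum r f (u + w) - lsum r f u‖ₑ ^ 2 := by
  refine le_trans ?_ (ennreal_tsum_weight_mul_sq_le _ _)
  gcongr
  have hs := summable_row hθ hW r u
  have e : lop θ r f u = ∑' v, θ r u v * (lsum r f v - lsum r f u) := by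
    have h1 : Summable fun v => θ r u v * lsum r f v :=
      summable_of_hasFiniteSupport ((finite_support_lsum hf r).subset fun v hv => by
        simp only [Function.mem_support, ne_eq, mul_eq_zero, not_or] at hv
        exact hv.2)
    simp only [mul_sub]
    rw [h1.tsum_sub (hs.mul_right _), tsum_mul_right, hrow, zero_mul, sub_zero, lop]
  rw [e]
  refine enorm_tsum_le_tsum_enorm.trans ?_
  rw [← (Equiv.addLeft u).tsum_eq]
  refine ENNReal.tsum_le_tsum fun w => ?_
  rw [enorm_mul]
  gcongr
  · simpa using hθ r u (u + w)
  · rfl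

/-- The pointwise bound reduces the claim to the shift square function for each fixed w, whose
growth (1 + |w|)^σ is absorbed by the moment of `W`. -/
theorem sum_tsum_lop_enorm_sq_le {σ : ℝ} (h0 : 0 < σ) (h1 : σ ≤ 1)
    (hθ : ∀ r u v, ‖θ r u v‖ₑ ≤ W (v - u))
    (hW : ∑' z, W z * ENNReal.ofReal ((1 + ‖z‖) ^ σ) ≠ ⊤)
    (hrow : ∀ r u, ∑' v, θ r u v = 0) (R : ℕ) {f : Lat n → ℂ} (hf : f.support.Finite) :
    ∑ r ∈ Finset.range R, ∑' u, ‖lop θ r f u‖ₑ ^ 2 ≤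
      (∑' z, W z) * (shiftConst n σ * ∑' z, W z * ENNReal.ofReal ((1 + ‖z‖) ^ σ)) *
        ∑' x, ‖f x‖ₑ ^ 2 := by
  have hW' := tsum_weight_ne_top h0 hW
  calc ∑ r ∈ Finset.range R, ∑' u, ‖lop θ r f u‖ₑ ^ 2
      ≤ ∑ r ∈ Finset.range R, ∑' u, (∑' z, W z) * ∑' w, W w *
          ‖lsum r f (u + w) - lsum r f u‖ₑ ^ 2 := by
        gcongr with r _ u
        exact lop_enorm_sq_le hθ hW' hrow r hf u
    _ = (∑' z, W z) * ∑' w, W w * ∑ r ∈ Finset.range R, ∑' u,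
          ‖lsum r f (u + w) - lsum r f u‖ₑ ^ 2 := by
        simp only [ENNReal.tsum_mul_left, ← Finset.mul_sum]
        congr 1
        rw [Finset.sum_congr rfl (fun r _ => ENNReal.tsum_comm),
          ← Summable.tsum_finsetSum (fun _ _ => ENNReal.summable)]
        refine tsum_congr fun w => ?_
        simp only [ENNReal.tsum_mul_left, ← Finset.mul_sum]
    _ ≤ (∑' z, W z) * ∑' w, W w * (shiftConst n σ * ENNReal.ofReal ((1 + ‖w‖) ^ σ) *
          ∑' x, ‖f x‖ₑ ^ 2) := by
        gcongr with w
        exact sum_tsum_lsum_shift_sub_le h0 h1 R w f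
    _ = _ := by
        rw [mul_assoc]
        congr 1
        rw [mul_assoc, ← ENNReal.tsum_mul_right, ← ENNReal.tsum_mul_left]
        refine tsum_congr fun w => ?_
        ring

/-- The part of `lsum r g` which is constant on siblings is orthogonal to D. The box sums of g are
not square summable uniformly over the levels, whereas the martingale differences are. -/
theorem tsum_lsum_mul_eq_tsum_ldiff_mul {r : ℕ} {g : Lat n → ℂ} (hg : g.support.Finite)
    {D : Lat n → ℂ} (hD : ∀ k, ∑ u ∈ box 1 k, D u = 0) :
    ∑' u, lsum r g u * D u = ∑' u, ldiff r g u * D u := by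
  have hfin := (finite_support_lsum hg (r + 1))
  set S := hfin.toFinset
  have hS : ∀ k ∉ S, lsum (r + 1) g k = 0 := fun k hk => by simpa [S] using hk
  have hz : ∑' u, (rt n : ℂ) * lsum (r + 1) g (anc 1 u) * D u = 0 := by
    rw [tsum_eq_sum_sum_box (r := 1) (S := S) (fun u hu => by rw [hS _ hu]; ring)]
    refine Finset.sum_eq_zero fun k _ => ?_
    rw [Finset.sum_congr rfl (fun u hu => by rw [mem_box.1 hu]), ← Finset.mul_sum, hD, mul_zero]
  have hs1 : Summable fun u => lsum r g u * D u :=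
    summable_of_hasFiniteSupport ((finite_support_lsum hg r).subset fun v hv => by
      simp only [Function.mem_support, ne_eq, mul_eq_zero, not_or] at hv
      exact hv.1)
  have hs2 : Summable fun u => (rt n : ℂ) * lsum (r + 1) g (anc 1 u) * D u := by
    refine summable_of_hasFiniteSupport
      ((S.biUnion (box 1)).finite_toSet.subset fun u hu => ?_)
    simp only [Function.mem_support, ne_eq, mul_eq_zero, not_or] at hu
    simp only [Finset.coe_biUnion, Set.mem_iUnion, Finset.mem_coe, mem_box]
    exact ⟨_, by simpa [S] using hu.1.2, rfl⟩
  calc ∑' u, lsum r g u * D u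
      = ∑' u, lsum r g u * D u - ∑' u, (rt n : ℂ) * lsum (r + 1) g (anc 1 u) * D u := by
        rw [hz, sub_zero]
    _ = _ := by
        rw [← hs1.tsum_sub hs2]
        refine tsum_congr fun u => ?_
        rw [ldiff]
        ring

theorem sum_box_lop {r : ℕ} {f : Lat n → ℂ} (hf : f.support.Finite)
    (hsib : ∀ r k v, ∑ u ∈ box 1 k, θ r u v = 0) (k : Lat n) : ∑ u ∈ box 1 k, lop θ r f u = 0 := by
  have hS : ∀ v ∉ (finite_support_lsum hf r).toFinset, lsum r f v = 0 := fun v hv => by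
    simpa using hv
  simp only [lop_eq_sum hS]
  rw [Finset.sum_comm]
  refine Finset.sum_eq_zero fun v _ => ?_
  rw [← Finset.sum_mul, hsib, zero_mul]

/-- The `ℓ²` bound for multiscale forms with cancellation. -/
theorem lform_enorm_sq_le {σ : ℝ} (h0 : 0 < σ) (h1 : σ ≤ 1)
    (hθ : ∀ r u v, ‖θ r u v‖ₑ ≤ W (v - u))
    (hW : ∑' z, W z * ENNReal.ofReal ((1 + ‖z‖) ^ σ) ≠ ⊤)
    (hsib : ∀ r k v, ∑ u ∈ box 1 k, θ r u v = 0)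
    (hrow : ∀ r u, ∑' v, θ r u v = 0) (R : ℕ) {g f : Lat n → ℂ} (hg : g.support.Finite)
    (hf : f.support.Finite) :
    ‖lform θ R g f‖ₑ ^ 2 ≤
      (∑' z, W z) * (shiftConst n σ * ∑' z, W z * ENNReal.ofReal ((1 + ‖z‖) ^ σ)) *
        (∑' x, ‖g x‖ₑ ^ 2) * ∑' x, ‖f x‖ₑ ^ 2 := by
  -- The two cancellations are used on different arguments: summation over siblings turns g into
  -- martingale differences, while the zero row sums enter through the bound for `lop θ r f`.
  have e : lform θ R g f = ∑ r ∈ Finset.range R, ∑' u, ldiff r g u * lop θ r f u :=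
    Finset.sum_congr rfl fun r _ => tsum_lsum_mul_eq_tsum_ldiff_mul hg (sum_box_lop hf hsib)
  have h2 : ‖lform θ R g f‖ₑ ≤
      ∑' p : Finset.range R × Lat n, ‖ldiff p.1 g p.2‖ₑ * ‖lop θ p.1 f p.2‖ₑ := by
    rw [e, ENNReal.tsum_prod', tsum_fintype,
      Finset.sum_coe_sort (Finset.range R) (fun r => ∑' u, ‖ldiff r g u‖ₑ * ‖lop θ r f u‖ₑ)]
    refine (enorm_sum_le _ _).trans (Finset.sum_le_sum fun r _ => ?_)
    refine enorm_tsum_le_tsum_enorm.trans ?_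
    simp only [enorm_mul, le_refl]
  have conv : ∀ F : ℕ → Lat n → ℝ≥0∞, ∑' p : Finset.range R × Lat n, F p.1 p.2 =
      ∑ r ∈ Finset.range R, ∑' u, F r u := fun F => by
    rw [ENNReal.tsum_prod', tsum_fintype,
      Finset.sum_coe_sort (Finset.range R) (fun r => ∑' u, F r u)]
  calc ‖lform θ R g f‖ₑ ^ 2
      ≤ (∑' p : Finset.range R × Lat n, ‖ldiff p.1 g p.2‖ₑ * ‖lop θ p.1 f p.2‖ₑ) ^ 2 := by gcongr
    _ ≤ _ := ennreal_tsum_mul_sq_le _ _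
    _ = (∑ r ∈ Finset.range R, ∑' u, ‖ldiff r g u‖ₑ ^ 2) *
        ∑ r ∈ Finset.range R, ∑' u, ‖lop θ r f u‖ₑ ^ 2 := by
        rw [conv (fun r u => ‖ldiff r g u‖ₑ ^ 2), conv (fun r u => ‖lop θ r f u‖ₑ ^ 2)]
    _ ≤ (∑' x, ‖g x‖ₑ ^ 2) * ((∑' z, W z) *
        (shiftConst n σ * ∑' z, W z * ENNReal.ofReal ((1 + ‖z‖) ^ σ)) * ∑' x, ‖f x‖ₑ ^ 2) := by
        gcongr
        · rw [← sum_tsum_ldiff R g]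
          exact le_self_add
        · exact sum_tsum_lop_enorm_sq_le h0 h1 hθ hW hrow R hf
    _ = _ := by ring

end L2

/-- An `ℓ²` bound for the form gives one for the operator. -/
theorem tsum_lT_enorm_sq_le {θ : ℕ → Lat n → Lat n → ℂ} {R : ℕ} {C : ℝ≥0∞}
    {f : Lat n → ℂ}
    (h : ∀ g : Lat n → ℂ, g.support.Finite →
      ‖lform θ R g f‖ₑ ^ 2 ≤ C * (∑' x, ‖g x‖ₑ ^ 2) * ∑' x, ‖f x‖ₑ ^ 2) :
    ∑' x, ‖lT θ R f x‖ₑ ^ 2 ≤ C * ∑' x, ‖f x‖ₑ ^ 2 := by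
  classical
  rw [ENNReal.tsum_eq_iSup_sum]
  refine iSup_le fun A => ?_
  -- Duality: the form is tested on the conjugate of `lT θ R f`, cut off to a finite set A so that s
  -- is finite and one factor s can be cancelled at the end.
  set g : Lat n → ℂ := fun x => if x ∈ A then (starRingEnd ℂ) (lT θ R f x) else 0 with hg
  have hsupp : g.support.Finite := A.finite_toSet.subset fun x hx => by
    by_contra hxA
    exact hx (by simp only [hg]; rw [if_neg (by simpa using hxA)])
  have hgA : ∀ x ∉ A, g x = 0 := fun x hx => by simp [hg, hx]
  set s : ℝ≥0∞ := ∑ x ∈ A, ‖lT θ R f x‖ₑ ^ 2 with hs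
  have hs_top : s ≠ ⊤ := by
    rw [hs]
    exact ENNReal.sum_ne_top.2 fun x _ => ENNReal.pow_ne_top enorm_ne_top
  have e1 : ∑' x, ‖g x‖ₑ ^ 2 = s := by
    rw [tsum_eq_sum (s := A) (fun x hx => by simp [hgA x hx])]
    refine Finset.sum_congr rfl fun x hx => ?_
    simp [hg, hx]
  have e2 : ‖lform θ R g f‖ₑ = s := by
    rw [← tsum_mul_lT θ R f hsupp, tsum_eq_sum (s := A) (fun x hx => by simp [hgA x hx])]
    have : ∑ x ∈ A, g x * lT θ R f x = ((∑ x ∈ A, ‖lT θ R f x‖ ^ 2 : ℝ) : ℂ) := by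
      push_cast
      refine Finset.sum_congr rfl fun x hx => ?_
      simp only [hg, hx, if_true]
      rw [Complex.conj_mul']
    rw [this, ← ofReal_norm, Complex.norm_real, Real.norm_of_nonneg
      (Finset.sum_nonneg fun _ _ => by positivity),
      ENNReal.ofReal_sum_of_nonneg (fun _ _ => by positivity), hs]
    exact Finset.sum_congr rfl fun x _ => (enorm_sq_eq_ofReal _).symm
  have := h g hsupp
  rw [e1, e2] at this
  by_cases hs0 : s = 0
  · rw [hs0]; exact zero_le
  have h3 : s * s ≤ s * (C * ∑' x, ‖f x‖ₑ ^ 2) := by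
    calc s * s = s ^ 2 := (sq s).symm
      _ ≤ _ := this
      _ = _ := by ring
  exact (ENNReal.mul_le_mul_iff_right hs0 hs_top).1 h3

end

section

variable {n : ℕ}

/-! ### The Calderón–Zygmund decomposition on the lattice -/

theorem anc_eq_of_le {a b : ℕ} (hab : a ≤ b) {x y : Lat n} (h : anc a x = anc a y) :
    anc b x = anc b y := by
  obtain ⟨c, rfl⟩ := Nat.exists_eq_add_of_le' hab
  rw [← anc_anc, ← anc_anc, h]

/-- The average of `‖f‖` over the box of generation `r` containing `x`. -/
def lavg (f : Lat n → ℂ) (r : ℕ) (x : Lat n) : ℝ :=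
  ((2 ^ n) ^ r : ℝ)⁻¹ * ∑ y ∈ box r (anc r x), ‖f y‖

/-- `Ω` is a union of disjoint boxes, the one containing `x` being of generation `lev x`. -/
def IsStopping (Ω : Finset (Lat n)) (lev : Lat n → ℕ) : Prop :=
  ∀ x ∈ Ω, ∀ y, anc (lev x) y = anc (lev x) x → y ∈ Ω ∧ lev y = lev x

/-- After exchanging the sums, the value at y is counted once for each of the (2^n)^{lev y} points
of its stopping box, which cancels the normalization of the average. The field is left general
because the identity is needed both for |f| and for f. -/
theorem IsStopping.sum_average {Ω : Finset (Lat n)} {lev : Lat n → ℕ} (h : IsStopping Ω lev)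
    {𝕜 : Type*} [Field 𝕜] [CharZero 𝕜] (F : Lat n → 𝕜) :
    ∑ x ∈ Ω, ((2 ^ n) ^ lev x : 𝕜)⁻¹ * ∑ y ∈ box (lev x) (anc (lev x) x), F y = ∑ x ∈ Ω, F x := by
  simp only [Finset.mul_sum]
  rw [Finset.sum_comm' (t' := Ω) (s' := fun y => box (lev y) (anc (lev y) y))]
  · refine Finset.sum_congr rfl fun y hy => ?_
    rw [Finset.sum_congr rfl (g := fun _ => ((2 ^ n) ^ lev y : 𝕜)⁻¹ * F y)]
    · rw [Finset.sum_const, card_box, nsmul_eq_mul, ← mul_assoc]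
      push_cast
      rw [mul_inv_cancel₀ (pow_ne_zero _ (pow_ne_zero _ two_ne_zero)), one_mul]
    · intro x hx
      rw [(h y hy x (mem_box.1 hx)).2]
  · intro x y
    simp only [mem_box]
    constructor
    · rintro ⟨hx, hy⟩
      obtain ⟨h1, h2⟩ := h x hx y hy
      exact ⟨by rw [h2, hy], h1⟩
    · rintro ⟨hx, hy⟩
      obtain ⟨h1, h2⟩ := h y hy x hx
      exact ⟨h1, by rw [h2, hx]⟩

theorem lavg_congr {f : Lat n → ℂ} {r : ℕ} {x y : Lat n} (h : anc r x = anc r y) :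
    lavg f r x = lavg f r y := by
  rw [lavg, lavg, h]

theorem lavg_nonneg (f : Lat n → ℂ) (r : ℕ) (x : Lat n) : 0 ≤ lavg f r x := by
  unfold lavg; positivity

theorem lavg_le_succ (f : Lat n → ℂ) (r : ℕ) (x : Lat n) :
    lavg f r x ≤ 2 ^ n * lavg f (r + 1) x := by
  have h : ∑ y ∈ box r (anc r x), ‖f y‖ ≤ ∑ y ∈ box (r + 1) (anc (r + 1) x), ‖f y‖ := by
    refine Finset.sum_le_sum_of_subset_of_nonneg ?_ fun _ _ _ => norm_nonneg _
    intro y hy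
    rw [mem_box] at hy ⊢
    exact anc_eq_of_le (Nat.le_succ r) hy
  unfold lavg
  calc _ ≤ ((2 ^ n) ^ r : ℝ)⁻¹ * ∑ y ∈ box (r + 1) (anc (r + 1) x), ‖f y‖ := by gcongr
    _ = _ := by
      rw [pow_succ, mul_inv]
      field_simp

/-- The averages over boxes of high generation are small because f is finitely supported and n > 0,
so among the boxes around x with average above `lam` there is a largest one. Maximality bounds the
average over its parent by `lam`, hence its own by 2^n `lam`. The maximal generation is the same for
all points of the chosen box, which gives the stopping property. -/
theorem exists_stopping (hn : 0 < n) {f : Lat n → ℂ} (hf : f.support.Finite) {lam : ℝ}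
    (hlam : 0 < lam) :
    ∃ (Ω : Finset (Lat n)) (lev : Lat n → ℕ), IsStopping Ω lev ∧ (∀ x ∉ Ω, ‖f x‖ ≤ lam) ∧
      ∀ x ∈ Ω, lam < lavg f (lev x) x ∧ lavg f (lev x) x ≤ 2 ^ n * lam := by
  classical
  set A := hf.toFinset
  set N1 : ℝ := ∑ y ∈ A, ‖f y‖ with hN1
  have hsum : ∀ (r : ℕ) (x : Lat n), ∑ y ∈ box r (anc r x), ‖f y‖ ≤ N1 := fun r x => by
    rw [hN1, ← Finset.sum_inter_add_sum_sdiff (box r (anc r x)) A]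
    rw [Finset.sum_eq_zero (s := box r (anc r x) \ A), add_zero]
    · exact Finset.sum_le_sum_of_subset_of_nonneg Finset.inter_subset_right
        fun _ _ _ => norm_nonneg _
    · intro y hy
      have := (Finset.mem_sdiff.1 hy).2
      simpa [A] using this
  -- From generation R0 on, even the full ℓ¹ norm N1 divided by (2^n)^r ≥ 2^r is at most `lam`.
  obtain ⟨R0, hR0⟩ : ∃ R0 : ℕ, N1 / lam < 2 ^ R0 := pow_unbounded_of_one_lt _ (by norm_num)
  have hbig : ∀ r, R0 ≤ r → ∀ x, lavg f r x ≤ lam := fun r hr x => by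
    have h1 : (2 : ℝ) ^ R0 ≤ (2 ^ n) ^ r := by
      calc (2 : ℝ) ^ R0 ≤ 2 ^ r := pow_le_pow_right₀ (by norm_num) hr
        _ = (2 ^ 1) ^ r := by rw [pow_one]
        _ ≤ (2 ^ n) ^ r := by exact pow_le_pow_left₀ (by norm_num) (pow_le_pow_right₀ (by norm_num) hn) r
    have h2 : N1 ≤ lam * (2 ^ n) ^ r := by
      rw [div_lt_iff₀ hlam] at hR0
      nlinarith
    unfold lavg
    rw [inv_mul_le_iff₀ (by positivity)]
    linarith [hsum r x]
  set P : Lat n → ℕ → Prop := fun x r => lam < lavg f r x with hP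
  -- The value is 0 when no generation qualifies; Ω is therefore defined by the condition that `lev
  -- x` itself satisfies the predicate.
  set lev : Lat n → ℕ := fun x => Nat.findGreatest (P x) R0 with hlev
  have hle : ∀ x r, P x r → r ≤ lev x := fun x r h => by
    refine Nat.le_findGreatest ?_ h
    by_contra hr
    exact absurd h (not_lt.2 (hbig r (by omega) x))
  have hspec : ∀ x r, P x r → P x (lev x) := fun x r h => by
    refine Nat.findGreatest_spec (P := P x) (m := r) ?_ h
    by_contra hr
    exact absurd h (not_lt.2 (hbig r (by omega) x))
  have hfin : {x | P x (lev x)}.Finite := by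
    refine ((Finset.range (R0 + 1)).biUnion fun r => A.biUnion fun y => box r (anc r y)).finite_toSet.subset
      fun x hx => ?_
    have hx' : P x (lev x) := hx
    have : ∃ y ∈ box (lev x) (anc (lev x) x), f y ≠ 0 := by
      by_contra hcon
      push Not at hcon
      have : lavg f (lev x) x = 0 := by
        unfold lavg
        rw [Finset.sum_eq_zero fun y hy => by rw [hcon y hy, norm_zero], mul_zero]
      rw [hP] at hx'
      simp only [this] at hx'
      linarith
    obtain ⟨y, hy, hfy⟩ := this
    simp only [Finset.coe_biUnion, Set.mem_iUnion, Finset.mem_coe, mem_box, Finset.mem_range]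
    exact ⟨lev x, Nat.lt_succ_of_le (Nat.findGreatest_le R0), y, by simpa [A] using hfy,
      (mem_box.1 hy).symm⟩
  have hmem : ∀ x, x ∈ hfin.toFinset ↔ P x (lev x) := fun x => by simp
  refine ⟨hfin.toFinset, lev, ?_, ?_, ?_⟩
  · intro x hx y hy
    rw [hmem] at hx
    have h1 : P y (lev x) := by
      rw [hP] at hx ⊢
      simp only at hx ⊢
      rwa [lavg_congr hy]
    have h2 := hle y _ h1
    have h3 := hspec y _ h1
    have h4 : P x (lev y) := by
      rw [hP] at h3 ⊢
      simp only at h3 ⊢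
      rwa [lavg_congr (anc_eq_of_le h2 hy.symm)]
    exact ⟨(hmem y).2 h3, le_antisymm (hle x _ h4) h2⟩
  · intro x hx
    rw [hmem] at hx
    have : ¬ P x 0 := fun h => hx (hspec x 0 h)
    rw [hP] at this
    simpa [lavg, box_zero] using this
  · intro x hx
    rw [hmem] at hx
    refine ⟨hx, (lavg_le_succ f (lev x) x).trans ?_⟩
    gcongr
    by_contra hcon
    have := hle x (lev x + 1) (not_le.1 hcon)
    omega

/-- The good part of the Calderón–Zygmund decomposition. -/
def goodPart (Ω : Finset (Lat n)) (lev : Lat n → ℕ) (f : Lat n → ℂ) (x : Lat n) : ℂ :=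
  if x ∈ Ω then ((2 ^ n) ^ lev x : ℂ)⁻¹ * ∑ y ∈ box (lev x) (anc (lev x) x), f y else f x

theorem norm_goodPart_le_lavg {Ω : Finset (Lat n)} {lev : Lat n → ℕ} {f : Lat n → ℂ} {x : Lat n}
    (hx : x ∈ Ω) : ‖goodPart Ω lev f x‖ ≤ lavg f (lev x) x := by
  rw [goodPart, if_pos hx, norm_mul, norm_inv, norm_pow, norm_pow, Complex.norm_ofNat, lavg]
  gcongr
  exact norm_sum_le _ _

theorem finite_support_goodPart {Ω : Finset (Lat n)} {lev : Lat n → ℕ} {f : Lat n → ℂ}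
    (hf : f.support.Finite) : (goodPart Ω lev f).support.Finite := by
  refine (hf.union Ω.finite_toSet).subset fun x hx => ?_
  by_cases h : x ∈ Ω
  · exact Or.inr h
  · left
    rw [Function.mem_support, goodPart, if_neg h] at hx
    exact hx

theorem tsum_goodPart_le {Ω : Finset (Lat n)} {lev : Lat n → ℕ} (h : IsStopping Ω lev)
    (f : Lat n → ℂ) : ∑' x, ‖goodPart Ω lev f x‖ₑ ≤ ∑' x, ‖f x‖ₑ := by
  classical
  have split : ∀ F : Lat n → ℝ≥0∞, ∑' x, F x = ∑ x ∈ Ω, F x + ∑' x, if x ∈ Ω then 0 else F x := by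
    intro F
    have : ∑ x ∈ Ω, F x = ∑' x, if x ∈ Ω then F x else 0 := by
      rw [tsum_eq_sum (s := Ω) (fun x hx => by simp [hx])]
      exact Finset.sum_congr rfl fun x hx => by simp [hx]
    rw [this, ← ENNReal.tsum_add]
    refine tsum_congr fun x => ?_
    split_ifs <;> simp
  rw [split, split fun x => ‖f x‖ₑ]
  refine add_le_add ?_ (ENNReal.tsum_le_tsum fun x => ?_)
  · calc ∑ x ∈ Ω, ‖goodPart Ω lev f x‖ₑ ≤ ∑ x ∈ Ω, ENNReal.ofReal (lavg f (lev x) x) := by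
          refine Finset.sum_le_sum fun x hx => ?_
          rw [← ofReal_norm]
          exact ENNReal.ofReal_le_ofReal (norm_goodPart_le_lavg hx)
      _ = ENNReal.ofReal (∑ x ∈ Ω, lavg f (lev x) x) :=
          (ENNReal.ofReal_sum_of_nonneg fun x _ => lavg_nonneg _ _ _).symm
      _ = ENNReal.ofReal (∑ x ∈ Ω, ‖f x‖) := by
          congr 1
          exact h.sum_average (fun y => ‖f y‖)
      _ = ∑ x ∈ Ω, ‖f x‖ₑ := by
          rw [ENNReal.ofReal_sum_of_nonneg fun x _ => norm_nonneg _]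
          simp only [ofReal_norm]
  · split_ifs with hx
    · exact le_rfl
    · rw [goodPart, if_neg hx]

/-- When no stopping box met by the box is larger than it, the box is a disjoint union of whole
stopping boxes, on each of which f and its good part have the same sum, and of points where they
coincide. -/
theorem IsStopping.sum_box_bad {Ω : Finset (Lat n)} {lev : Lat n → ℕ} (h : IsStopping Ω lev)
    (f : Lat n → ℂ) {r : ℕ} {v : Lat n} (hr : ∀ y ∈ box r v, y ∈ Ω → lev y ≤ r) :
    ∑ y ∈ box r v, (f y - goodPart Ω lev f y) = 0 := by
  classical
  set Ω' := Ω.filter (fun y => anc r y = v) with hΩ'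
  have hst : IsStopping Ω' lev := by
    intro x hx y hy
    rw [hΩ', Finset.mem_filter] at hx
    obtain ⟨h1, h2⟩ := h x hx.1 y hy
    refine ⟨?_, h2⟩
    rw [hΩ', Finset.mem_filter]
    exact ⟨h1, (anc_eq_of_le (hr x (mem_box.2 hx.2) hx.1) hy).trans hx.2⟩
  have h1 := hst.sum_average f
  have h2 : ∑ y ∈ box r v, (f y - goodPart Ω lev f y) = ∑ y ∈ Ω', (f y - goodPart Ω lev f y) := by
    symm
    refine Finset.sum_subset ?_ ?_
    · intro y hy
      exact mem_box.2 (Finset.mem_filter.1 hy).2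
    · intro y hy hy'
      have : y ∉ Ω := fun hΩ => hy' (Finset.mem_filter.2 ⟨hΩ, mem_box.1 hy⟩)
      rw [goodPart, if_neg this, sub_self]
  rw [h2, Finset.sum_sub_distrib, sub_eq_zero, ← h1]
  refine Finset.sum_congr rfl fun y hy => ?_
  rw [goodPart, if_pos (Finset.mem_filter.1 hy).1]

/-- Dyadic dichotomy: a box of generation r either lies inside a stopping box of larger generation,
or all stopping boxes it meets lie inside it, and then the sum of the bad part is zero. So the bad
part is visible only at levels strictly below its stopping generation. -/
theorem IsStopping.enorm_lsum_bad_le {Ω : Finset (Lat n)} {lev : Lat n → ℕ}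
    (h : IsStopping Ω lev) (f : Lat n → ℂ) (r : ℕ) (v : Lat n) :
    ‖lsum r (f - goodPart Ω lev f) v‖ₑ ≤ ENNReal.ofReal (rt n ^ r) * ∑ y ∈ box r v,
      if y ∈ Ω ∧ r < lev y then ‖f y - goodPart Ω lev f y‖ₑ else 0 := by
  have e0 : ‖((rt n : ℂ)) ^ r‖ₑ = ENNReal.ofReal (rt n ^ r) := by
    rw [← ofReal_norm, norm_pow, Complex.norm_real, Real.norm_of_nonneg (rt_pos n).le]
  rw [lsum, enorm_mul, e0]
  gcongr
  simp only [Pi.sub_apply]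
  by_cases hc : ∃ y0 ∈ box r v, y0 ∈ Ω ∧ r < lev y0
  · obtain ⟨y0, hy0, hΩ, hlt⟩ := hc
    refine (enorm_sum_le _ _).trans (Finset.sum_le_sum fun y hy => ?_)
    have h1 : anc r y = anc r y0 := (mem_box.1 hy).trans (mem_box.1 hy0).symm
    obtain ⟨h2, h3⟩ := h y0 hΩ y (anc_eq_of_le hlt.le h1)
    rw [if_pos ⟨h2, by omega⟩]
  · push Not at hc
    rw [h.sum_box_bad f hc]
    simp

/-- The neighbourhood of the stopping set consisting of the threefold boxes. -/
def starSet (Ω : Finset (Lat n)) (lev : Lat n → ℕ) : Finset (Lat n) :=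
  ((Fintype.piFinset fun _ : Fin n => Finset.Icc (-1 : ℤ) 1) ×ˢ Ω).image
    fun p i => p.2 i + 2 ^ lev p.2 * p.1 i

theorem card_starSet_le (Ω : Finset (Lat n)) (lev : Lat n → ℕ) :
    (starSet Ω lev).card ≤ 3 ^ n * Ω.card := by
  refine Finset.card_image_le.trans ?_
  rw [Finset.card_product, Fintype.card_piFinset]
  simp

/-- Outside the threefold boxes, the ancestors of x and y at the stopping level differ by at least 2
in some coordinate, so a full box lies between them. Seen from level r this box has 2^{lev y - r}
cells per side. -/
theorem IsStopping.le_norm_anc_sub {Ω : Finset (Lat n)} {lev : Lat n → ℕ} (h : IsStopping Ω lev)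
    {x y : Lat n} (hx : x ∉ starSet Ω lev) (hy : y ∈ Ω) {r : ℕ} (hr : r < lev y) :
    (2 : ℝ) ^ (lev y - r) ≤ ‖anc r y - anc r x‖ := by
  set l := lev y with hl
  have hex : ∃ i, 2 ≤ |anc l x i - anc l y i| := by
    by_contra hcon
    push Not at hcon
    apply hx
    set w : Lat n := fun i => anc l x i - anc l y i with hw
    -- If all coordinates of w were in {-1, 0, 1}, translating x by -2^l w would lead into the
    -- stopping box of y, and x would belong to the enlarged set.
    set y' : Lat n := fun i => x i + 2 ^ l * (-w) i with hy'
    have h1 : anc l y' = anc l y := by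
      rw [hy', anc_add_mul]
      ext i
      simp [hw]
    obtain ⟨h2, h3⟩ := h y hy y' h1
    rw [starSet, Finset.mem_image]
    refine ⟨(w, y'), ?_, ?_⟩
    · rw [Finset.mem_product, Fintype.mem_piFinset]
      refine ⟨fun i => ?_, h2⟩
      have := abs_lt.1 (hcon i)
      rw [Finset.mem_Icc]
      constructor <;> simp only [hw] <;> omega
    · ext i
      change y' i + 2 ^ lev y' * w i = x i
      rw [h3, ← hl]
      simp only [hy', Pi.neg_apply]
      ring
  obtain ⟨i, hi⟩ := hex
  set m := l - r with hm
  have hlm : l = m + r := by omega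
  have e1 : ∀ z : Lat n, anc l z i = anc r z i / 2 ^ m := fun z => by
    rw [hlm, ← anc_anc]; rfl
  rw [e1, e1] at hi
  refine le_trans ?_ (norm_le_pi_norm (anc r y - anc r x) i)
  rw [Pi.sub_apply, Int.norm_eq_abs]
  set a := anc r x i
  set b := anc r y i
  have ha := (int_ediv_eq_iff m a _).1 rfl
  have hb := (int_ediv_eq_iff m b _).1 rfl
  have hp : (0 : ℤ) < 2 ^ m := by positivity
  have key : (2 : ℤ) ^ m ≤ |b - a| := by
    rcases le_abs.1 hi with h1 | h1
    · rw [abs_sub_comm]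
      refine le_trans ?_ (le_abs_self _)
      nlinarith
    · refine le_trans ?_ (le_abs_self _)
      nlinarith
  exact_mod_cast key

/-- Chebyshev: where |z| ≥ 2^m one has 1 ≤ 2^{-σ m}(1 + |z|)^σ. -/
theorem tsum_weight_tail_le {W : Lat n → ℝ≥0∞} {σ : ℝ} (h0 : 0 < σ) (m : ℕ) :
    ∑' z, (if (2 : ℝ) ^ m ≤ ‖z‖ then W z else 0) ≤
      ENNReal.ofReal ((2 : ℝ) ^ (-σ)) ^ m * ∑' z, W z * ENNReal.ofReal ((1 + ‖z‖) ^ σ) := by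
  rw [← ENNReal.tsum_mul_left]
  refine ENNReal.tsum_le_tsum fun z => ?_
  split_ifs with hz
  · have : (1 : ℝ≥0∞) ≤ ENNReal.ofReal ((2 : ℝ) ^ (-σ)) ^ m * ENNReal.ofReal ((1 + ‖z‖) ^ σ) := by
      rw [← ENNReal.ofReal_pow (by positivity), ← ENNReal.ofReal_mul (by positivity),
        ENNReal.one_le_ofReal]
      calc (1 : ℝ) = ((2 : ℝ) ^ (-σ)) ^ m * ((2 : ℝ) ^ m) ^ σ := by
            rw [← Real.rpow_pow_comm (by norm_num) σ m, ← mul_pow, ← Real.rpow_add (by norm_num)]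
            simp
        _ ≤ ((2 : ℝ) ^ (-σ)) ^ m * (1 + ‖z‖) ^ σ := by
            gcongr
            linarith
    calc W z = W z * 1 := (mul_one _).symm
      _ ≤ W z * (ENNReal.ofReal ((2 : ℝ) ^ (-σ)) ^ m * ENNReal.ofReal ((1 + ‖z‖) ^ σ)) := by gcongr
      _ = _ := by ring
  · exact zero_le

/-! ### The weak type estimate -/

section WeakType

variable {θ : ℕ → Lat n → Lat n → ℂ} {W : Lat n → ℝ≥0∞}

/-- Only the decay of θ is used. A bad point y acts at levels r < lev y, where every x outside the
enlarged set is at distance at least 2^{lev y - r} in units of that level; the tails of `W` then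
form a geometric series in lev y - r. -/
theorem IsStopping.tsum_lT_bad_le {Ω : Finset (Lat n)} {lev : Lat n → ℕ} (h : IsStopping Ω lev)
    {σ : ℝ} (h0 : 0 < σ) (hθ : ∀ r u v, ‖θ r u v‖ₑ ≤ W (v - u)) (R : ℕ) (f : Lat n → ℂ) :
    ∑' x, (if x ∈ starSet Ω lev then 0 else ‖lT θ R (f - goodPart Ω lev f) x‖ₑ) ≤
      (1 - ENNReal.ofReal ((2 : ℝ) ^ (-σ)))⁻¹ * (∑' z, W z * ENNReal.ofReal ((1 + ‖z‖) ^ σ)) *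
        ∑' y, ‖f y - goodPart Ω lev f y‖ₑ := by
  classical
  set b : Lat n → ℂ := f - goodPart Ω lev f with hb
  set E := ∑' z, W z * ENNReal.ofReal ((1 + ‖z‖) ^ σ) with hE
  set t : ℝ≥0∞ := ENNReal.ofReal ((2 : ℝ) ^ (-σ)) with ht
  set c : ℕ → ℝ≥0∞ := fun r => ENNReal.ofReal (rt n ^ r) with hc
  -- One normalizing factor comes from the box sum, the other from spreading the result back to the
  -- points; together they cancel the (2^n)^r points x with a given ancestor.
  have hcc : ∀ r, c r * c r * (2 ^ n) ^ r = 1 := fun r => by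
    have h2 : ((2 : ℝ≥0∞) ^ n) ^ r = ENNReal.ofReal ((2 ^ n) ^ r) := by
      rw [ENNReal.ofReal_pow (by positivity), ENNReal.ofReal_pow (by positivity)]
      simp
    rw [h2, hc, ← ENNReal.ofReal_mul (by positivity [rt_pos n]),
      ← ENNReal.ofReal_mul (by positivity [rt_pos n]), ← mul_pow, ← mul_pow, ← sq, rt_sq,
      inv_mul_cancel₀ (by positivity), one_pow, ENNReal.ofReal_one]
  set bb : ℕ → Lat n → ℝ≥0∞ := fun r y => if y ∈ Ω ∧ r < lev y then ‖b y‖ₑ else 0 with hbb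
  have hlop : ∀ r u, ‖lop θ r b u‖ₑ ≤ ∑' y, c r * (W (anc r y - u) * bb r y) := fun r u => by
    refine enorm_tsum_le_tsum_enorm.trans ?_
    rw [tsum_eq_tsum_sum_box r (fun y => c r * (W (anc r y - u) * bb r y))]
    refine ENNReal.tsum_le_tsum fun v => ?_
    rw [enorm_mul, Finset.sum_congr rfl (g := fun y => W (v - u) * (c r * bb r y)) (fun y hy => by
      rw [mem_box.1 hy]; ring), ← Finset.mul_sum, ← Finset.mul_sum]
    gcongr
    · exact hθ r u v
    · exact h.enorm_lsum_bad_le f r v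
  have hlT : ∀ x, ‖lT θ R b x‖ₑ ≤ ∑ r ∈ Finset.range R, c r * ∑' y, c r *
      (W (anc r y - anc r x) * bb r y) := fun x => by
    refine (enorm_sum_le _ _).trans (Finset.sum_le_sum fun r _ => ?_)
    rw [enorm_mul]
    gcongr
    · rw [← ofReal_norm, norm_pow, Complex.norm_real, Real.norm_of_nonneg (rt_pos n).le]
    · exact hlop r _
  have hpt : ∀ x, (if x ∈ starSet Ω lev then 0 else ‖lT θ R b x‖ₑ) ≤
      ∑ r ∈ Finset.range R, ∑' y, c r * c r * bb r y *
        (if (2 : ℝ) ^ (lev y - r) ≤ ‖anc r y - anc r x‖ then W (anc r y - anc r x) else 0) := by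
    intro x
    split_ifs with hx
    · exact zero_le
    · refine (hlT x).trans (Finset.sum_le_sum fun r _ => ?_)
      rw [← ENNReal.tsum_mul_left]
      refine ENNReal.tsum_le_tsum fun y => ?_
      by_cases hy : y ∈ Ω ∧ r < lev y
      · rw [if_pos (h.le_norm_anc_sub hx hy.1 hy.2)]
        apply le_of_eq
        ring
      · simp [hbb, hy]
  refine (ENNReal.tsum_le_tsum hpt).trans ?_
  rw [Summable.tsum_finsetSum (fun _ _ => ENNReal.summable)]
  have hr : ∀ r, ∑' x, ∑' y, c r * c r * bb r y *
        (if (2 : ℝ) ^ (lev y - r) ≤ ‖anc r y - anc r x‖ then W (anc r y - anc r x) else 0) ≤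
      ∑' y, bb r y * (t ^ (lev y - r) * E) := by
    intro r
    rw [ENNReal.tsum_comm]
    refine ENNReal.tsum_le_tsum fun y => ?_
    rw [ENNReal.tsum_mul_left, tsum_comp_anc r (fun k =>
      if (2 : ℝ) ^ (lev y - r) ≤ ‖anc r y - k‖ then W (anc r y - k) else 0)]
    rw [← (Equiv.subLeft (anc r y)).tsum_eq (fun k =>
      if (2 : ℝ) ^ (lev y - r) ≤ ‖anc r y - k‖ then W (anc r y - k) else 0)]
    simp only [Equiv.subLeft_apply, sub_sub_cancel]
    calc c r * c r * bb r y * ((2 ^ n) ^ r * ∑' z, if (2 : ℝ) ^ (lev y - r) ≤ ‖z‖ then W z else 0)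
        = (c r * c r * (2 ^ n) ^ r) * (bb r y *
          ∑' z, if (2 : ℝ) ^ (lev y - r) ≤ ‖z‖ then W z else 0) := by ring
      _ = bb r y * ∑' z, (if (2 : ℝ) ^ (lev y - r) ≤ ‖z‖ then W z else 0) := by rw [hcc, one_mul]
      _ ≤ bb r y * (t ^ (lev y - r) * E) := by
          gcongr
          exact tsum_weight_tail_le h0 _
  refine (Finset.sum_le_sum fun r _ => hr r).trans ?_
  rw [← Summable.tsum_finsetSum (fun _ _ => ENNReal.summable), ← ENNReal.tsum_mul_left]
  refine ENNReal.tsum_le_tsum fun y => ?_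
  have hb' : ∀ r, bb r y * (t ^ (lev y - r) * E) ≤
      (if r < lev y then t ^ (lev y - r) else 0) * (E * ‖b y‖ₑ) := fun r => by
    simp only [hbb]
    by_cases h1 : r < lev y
    · rw [if_pos h1]
      split_ifs
      · apply le_of_eq
        ring
      · simp
    · simp [h1]
  calc ∑ r ∈ Finset.range R, bb r y * (t ^ (lev y - r) * E)
      ≤ ∑ r ∈ Finset.range R, (if r < lev y then t ^ (lev y - r) else 0) * (E * ‖b y‖ₑ) :=
        Finset.sum_le_sum fun r _ => hb' r
    _ = (∑ r ∈ (Finset.range R).filter (fun r => r < lev y), t ^ (lev y - r)) * (E * ‖b y‖ₑ) := by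
        rw [← Finset.sum_mul, Finset.sum_filter]
    _ = (∑ i ∈ ((Finset.range R).filter (fun r => r < lev y)).image (fun r => lev y - r), t ^ i) *
          (E * ‖b y‖ₑ) := by
        rw [Finset.sum_image]
        intro a ha a' ha' haa
        simp only [Finset.coe_filter, Finset.mem_range, Set.mem_ofPred_eq] at ha ha' haa
        omega
    _ ≤ (1 - t)⁻¹ * (E * ‖b y‖ₑ) := by
        gcongr
        rw [← ENNReal.tsum_geometric]
        exact ENNReal.sum_le_tsum _
    _ = _ := by rw [hb, Pi.sub_apply]; ring

theorem lT_add (θ : ℕ → Lat n → Lat n → ℂ) (R : ℕ) {f₁ f₂ : Lat n → ℂ} (h₁ : f₁.support.Finite)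
    (h₂ : f₂.support.Finite) (x : Lat n) : lT θ R (f₁ + f₂) x = lT θ R f₁ x + lT θ R f₂ x := by
  simp only [lT]
  rw [← Finset.sum_add_distrib]
  refine Finset.sum_congr rfl fun r _ => ?_
  rw [← mul_add]
  congr 1
  have hs : ∀ f : Lat n → ℂ, f.support.Finite →
      Summable fun v => θ r (anc r x) v * lsum r f v := fun f hf =>
    summable_of_hasFiniteSupport ((finite_support_lsum hf r).subset fun v hv => by
      simp only [Function.mem_support, ne_eq, mul_eq_zero, not_or] at hv
      exact hv.2)
  rw [lop, lop, lop, ← (hs f₁ h₁).tsum_add (hs f₂ h₂)]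
  refine tsum_congr fun v => ?_
  simp only [lsum, Pi.add_apply, Finset.sum_add_distrib]
  ring

/-- The constant in the weak type estimate. -/
def weakConst (n : ℕ) (σ : ℝ) (E C₂ : ℝ≥0∞) : ℝ≥0∞ :=
  3 ^ n + 4 * C₂ * 2 ^ n + 4 * ((1 - ENNReal.ofReal ((2 : ℝ) ^ (-σ)))⁻¹ * E)

theorem weakConst_ne_top {σ : ℝ} (h0 : 0 < σ) {E C₂ : ℝ≥0∞} (hE : E ≠ ⊤) (hC : C₂ ≠ ⊤) :
    weakConst n σ E C₂ ≠ ⊤ := by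
  have h1 : (1 - ENNReal.ofReal ((2 : ℝ) ^ (-σ)))⁻¹ ≠ ⊤ := by
    rw [ENNReal.inv_ne_top]
    have : ENNReal.ofReal ((2 : ℝ) ^ (-σ)) < 1 := by
      rw [ENNReal.ofReal_lt_one]
      exact Real.rpow_lt_one_of_one_lt_of_neg (by norm_num) (by linarith)
    exact (tsub_pos_of_lt this).ne'
  unfold weakConst
  refine ENNReal.add_ne_top.2 ⟨ENNReal.add_ne_top.2 ⟨?_, ?_⟩, ?_⟩
  · simp
  · exact ENNReal.mul_ne_top (ENNReal.mul_ne_top (by simp) hC) (by simp)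
  · exact ENNReal.mul_ne_top (by simp) (ENNReal.mul_ne_top h1 hE)

/-- The weak type (1,1) estimate for multiscale operators. -/
theorem lT_weak_type (hn : 0 < n) {σ : ℝ} (h0 : 0 < σ) (hθ : ∀ r u v, ‖θ r u v‖ₑ ≤ W (v - u))
    {R : ℕ} {C₂ : ℝ≥0∞}
    (h2 : ∀ f : Lat n → ℂ, f.support.Finite →
      ∑' x, ‖lT θ R f x‖ₑ ^ 2 ≤ C₂ * ∑' x, ‖f x‖ₑ ^ 2)
    {f : Lat n → ℂ} (hf : f.support.Finite) {lam : ℝ} (hlam : 0 < lam) :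
    ENNReal.ofReal lam * ∑' x, (if lam < ‖lT θ R f x‖ then 1 else 0) ≤
      weakConst n σ (∑' z, W z * ENNReal.ofReal ((1 + ‖z‖) ^ σ)) C₂ * ∑' x, ‖f x‖ₑ := by
  classical
  obtain ⟨Ω, lev, hst, hout, hin⟩ := exists_stopping hn hf hlam
  set E := ∑' z, W z * ENNReal.ofReal ((1 + ‖z‖) ^ σ) with hE
  set N := ∑' x, ‖f x‖ₑ with hN
  set g := goodPart Ω lev f with hg
  have hgf := finite_support_goodPart (Ω := Ω) (lev := lev) hf
  have hbf : (f - g).support.Finite := (hf.union hgf).subset (Function.support_sub f g)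
  have hg_le : ∀ x, ‖g x‖ ≤ 2 ^ n * lam := fun x => by
    by_cases hx : x ∈ Ω
    · exact (norm_goodPart_le_lavg hx).trans (hin x hx).2
    · rw [hg, goodPart, if_neg hx]
      have : (1 : ℝ) ≤ 2 ^ n := one_le_pow₀ (by norm_num)
      nlinarith [hout x hx]
  have hg1 : ∑' x, ‖g x‖ₑ ≤ N := tsum_goodPart_le hst f
  -- The good part is bounded by 2^n `lam` and its ℓ¹ norm does not exceed that of f, which yields
  -- its ℓ² norm.
  have hg2 : ∑' x, ‖g x‖ₑ ^ 2 ≤ ENNReal.ofReal (2 ^ n * lam) * N := by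
    calc ∑' x, ‖g x‖ₑ ^ 2 ≤ ∑' x, ENNReal.ofReal (2 ^ n * lam) * ‖g x‖ₑ := by
          refine ENNReal.tsum_le_tsum fun x => ?_
          rw [sq]
          gcongr
          rw [← ofReal_norm]
          exact ENNReal.ofReal_le_ofReal (hg_le x)
      _ ≤ _ := by rw [ENNReal.tsum_mul_left]; gcongr
  have hb1 : ∑' x, ‖f x - g x‖ₑ ≤ 2 * N := by
    calc ∑' x, ‖f x - g x‖ₑ ≤ ∑' x, (‖f x‖ₑ + ‖g x‖ₑ) :=
          ENNReal.tsum_le_tsum fun x => enorm_sub_le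
      _ ≤ 2 * N := by rw [ENNReal.tsum_add, two_mul]; gcongr
  have hΩ : ENNReal.ofReal lam * Ω.card ≤ N := by
    calc ENNReal.ofReal lam * Ω.card = ∑ _x ∈ Ω, ENNReal.ofReal lam := by
          rw [Finset.sum_const, nsmul_eq_mul, mul_comm]
      _ ≤ ∑ x ∈ Ω, ENNReal.ofReal (lavg f (lev x) x) :=
          Finset.sum_le_sum fun x hx => ENNReal.ofReal_le_ofReal (hin x hx).1.le
      _ = ENNReal.ofReal (∑ x ∈ Ω, lavg f (lev x) x) :=
          (ENNReal.ofReal_sum_of_nonneg fun x _ => lavg_nonneg _ _ _).symm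
      _ = ENNReal.ofReal (∑ x ∈ Ω, ‖f x‖) := by
          congr 1
          exact hst.sum_average (fun y => ‖f y‖)
      _ = ∑ x ∈ Ω, ‖f x‖ₑ := by
          rw [ENNReal.ofReal_sum_of_nonneg fun x _ => norm_nonneg _]
          simp only [ofReal_norm]
      _ ≤ N := ENNReal.sum_le_tsum _
  have hΩs : ENNReal.ofReal lam * ∑' x, (if x ∈ starSet Ω lev then 1 else 0) ≤ 3 ^ n * N := by
    have e : ∑' x, (if x ∈ starSet Ω lev then (1 : ℝ≥0∞) else 0) = (starSet Ω lev).card := by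
      rw [tsum_eq_sum (s := starSet Ω lev) (fun x hx => by simp [hx])]
      simp
    rw [e]
    calc ENNReal.ofReal lam * (starSet Ω lev).card
        ≤ ENNReal.ofReal lam * ((3 ^ n * Ω.card : ℕ) : ℝ≥0∞) := by
          gcongr
          exact card_starSet_le Ω lev
      _ = 3 ^ n * (ENNReal.ofReal lam * Ω.card) := by push_cast; ring
      _ ≤ _ := by gcongr
  have hsplit : ∀ x, ‖lT θ R f x‖ ≤ ‖lT θ R g x‖ + ‖lT θ R (f - g) x‖ := fun x => by
    have : f = g + (f - g) := by abel
    conv_lhs => rw [this]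
    rw [lT_add θ R hgf hbf]
    exact norm_add_le _ _
  -- Off the enlarged set, a value above `lam` forces the bad part above `lam`/2, where lam ≤ 2|lT
  -- b|, or the good part to be at least `lam`/2, where lam ≤ (4/lam)|lT g|². Thus the ℓ¹ estimate
  -- is used for the bad part and the ℓ² estimate for the good part.
  have hpt : ∀ x, ENNReal.ofReal lam * (if lam < ‖lT θ R f x‖ then 1 else 0) ≤
      ENNReal.ofReal lam * (if x ∈ starSet Ω lev then 1 else 0) +
      ENNReal.ofReal (4 / lam) * ‖lT θ R g x‖ₑ ^ 2 +
      2 * (if x ∈ starSet Ω lev then 0 else ‖lT θ R (f - g) x‖ₑ) := by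
    intro x
    by_cases hx : lam < ‖lT θ R f x‖
    swap
    · simp [hx]
    rw [if_pos hx, mul_one]
    by_cases hxs : x ∈ starSet Ω lev
    · rw [if_pos hxs, mul_one, add_assoc]
      exact le_self_add
    rw [if_neg hxs, if_neg hxs, mul_zero, zero_add]
    by_cases hb : lam / 2 < ‖lT θ R (f - g) x‖
    · refine le_trans ?_ le_add_self
      rw [← ofReal_norm, show (2 : ℝ≥0∞) = ENNReal.ofReal 2 by simp,
        ← ENNReal.ofReal_mul (by norm_num)]
      exact ENNReal.ofReal_le_ofReal (by linarith)
    · refine le_trans ?_ le_self_add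
      have hgx : lam / 2 ≤ ‖lT θ R g x‖ := by linarith [hsplit x]
      rw [enorm_sq_eq_ofReal, ← ENNReal.ofReal_mul (by positivity)]
      apply ENNReal.ofReal_le_ofReal
      calc lam = 4 / lam * (lam / 2) ^ 2 := by field_simp; norm_num
        _ ≤ _ := by gcongr
  calc ENNReal.ofReal lam * ∑' x, (if lam < ‖lT θ R f x‖ then 1 else 0)
      = ∑' x, ENNReal.ofReal lam * (if lam < ‖lT θ R f x‖ then 1 else 0) := by
        rw [ENNReal.tsum_mul_left]
    _ ≤ _ := ENNReal.tsum_le_tsum hpt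
    _ = ENNReal.ofReal lam * ∑' x, (if x ∈ starSet Ω lev then 1 else 0) +
        ENNReal.ofReal (4 / lam) * ∑' x, ‖lT θ R g x‖ₑ ^ 2 +
        2 * ∑' x, (if x ∈ starSet Ω lev then 0 else ‖lT θ R (f - g) x‖ₑ) := by
        rw [ENNReal.tsum_add, ENNReal.tsum_add, ENNReal.tsum_mul_left, ENNReal.tsum_mul_left,
          ENNReal.tsum_mul_left]
    _ ≤ 3 ^ n * N + ENNReal.ofReal (4 / lam) * (C₂ * (ENNReal.ofReal (2 ^ n * lam) * N)) +
        2 * ((1 - ENNReal.ofReal ((2 : ℝ) ^ (-σ)))⁻¹ * E * (2 * N)) := by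
        gcongr
        · exact (h2 g hgf).trans (by gcongr)
        · refine (hst.tsum_lT_bad_le h0 hθ R f).trans ?_
          gcongr
    _ = 3 ^ n * N + (ENNReal.ofReal (4 / lam) * ENNReal.ofReal (2 ^ n * lam)) * C₂ * N +
        4 * ((1 - ENNReal.ofReal ((2 : ℝ) ^ (-σ)))⁻¹ * E) * N := by ring
    _ = _ := by
        rw [← ENNReal.ofReal_mul (by positivity)]
        have : 4 / lam * (2 ^ n * lam) = 4 * 2 ^ n := by field_simp
        rw [this, ENNReal.ofReal_mul (by norm_num), ENNReal.ofReal_pow (by norm_num), weakConst]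
        simp only [ENNReal.ofReal_ofNat]
        ring

end WeakType

end

section

variable {n : ℕ}

/-! ### Interpolation -/

theorem lintegral_Ioc_rpow {a s : ℝ} (ha : 0 < a) (hs : -1 < s) :
    ∫⁻ t in Set.Ioc 0 a, ENNReal.ofReal (t ^ s) = ENNReal.ofReal (a ^ (s + 1) / (s + 1)) := by
  have hi : IntegrableOn (fun t : ℝ => t ^ s) (Set.Ioc 0 a) :=
    (intervalIntegrable_iff_integrableOn_Ioc_of_le ha.le).1
      (intervalIntegral.intervalIntegrable_rpow' hs)
  rw [← ofReal_integral_eq_lintegral_ofReal hi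
    ((ae_restrict_iff' measurableSet_Ioc).2 (Eventually.of_forall fun t ht =>
      Real.rpow_nonneg ht.1.le s)), ← intervalIntegral.integral_of_le ha.le,
    integral_rpow (Or.inl hs), Real.zero_rpow (by linarith), sub_zero]

theorem lintegral_Ioi_rpow {a s : ℝ} (ha : 0 < a) (hs : s < -1) :
    ∫⁻ t in Set.Ioi a, ENNReal.ofReal (t ^ s) = ENNReal.ofReal (-a ^ (s + 1) / (s + 1)) := by
  rw [← ofReal_integral_eq_lintegral_ofReal (integrableOn_Ioi_rpow_of_lt hs ha)
    ((ae_restrict_iff' measurableSet_Ioi).2 (Eventually.of_forall fun t ht =>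
      Real.rpow_nonneg (ha.trans ht).le s)), integral_Ioi_rpow_of_lt hs ha]

theorem count_eq_tsum (S : Set (Lat n)) [DecidablePred (· ∈ S)] :
    Measure.count S = ∑' x, if x ∈ S then (1 : ℝ≥0∞) else 0 := by
  rw [← lintegral_indicator_one (Set.to_countable S).measurableSet, lintegral_count]
  refine tsum_congr fun x => ?_
  simp [Set.indicator_apply]

/-- Marcinkiewicz interpolation between a weak (1,1) and a strong (2,2) estimate. -/
theorem tsum_rpow_le_of_weak_strong {T : (Lat n → ℂ) → Lat n → ℂ} {C₁ C₂ : ℝ≥0∞}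
    (hadd : ∀ f₁ f₂ : Lat n → ℂ, f₁.support.Finite → f₂.support.Finite →
      ∀ x, T (f₁ + f₂) x = T f₁ x + T f₂ x)
    (h1 : ∀ f : Lat n → ℂ, f.support.Finite → ∀ lam : ℝ, 0 < lam →
      ENNReal.ofReal lam * ∑' x, (if lam < ‖T f x‖ then 1 else 0) ≤ C₁ * ∑' x, ‖f x‖ₑ)
    (h2 : ∀ f : Lat n → ℂ, f.support.Finite → ∑' x, ‖T f x‖ₑ ^ 2 ≤ C₂ * ∑' x, ‖f x‖ₑ ^ 2)
    {p : ℝ} (hp1 : 1 < p) (hp2 : p < 2) {f : Lat n → ℂ} (hf : f.support.Finite) :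
    ∑' x, ‖T f x‖ₑ ^ p ≤ ENNReal.ofReal (2 ^ p * p) *
      (C₁ * ENNReal.ofReal (1 / (p - 1)) + C₂ * ENNReal.ofReal (1 / (2 - p))) *
        ∑' x, ‖f x‖ₑ ^ p := by
  classical
  set A := hf.toFinset
  have hA : ∀ x ∉ A, f x = 0 := fun x hx => by simpa [A] using hx
  have hA' : ∀ x ∈ A, 0 < ‖f x‖ := fun x hx => by simpa [A] using hx
  -- f is cut at the moving height t. The weak (1,1) bound is applied to the large values and the
  -- (2,2) bound to the small ones; if |T f| > 2t, one of the two images exceeds t, whence the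
  -- factor 2^p at the end.
  set hi : ℝ → Lat n → ℂ := fun t x => if t ≤ ‖f x‖ then f x else 0 with hhi
  set lo : ℝ → Lat n → ℂ := fun t x => if t ≤ ‖f x‖ then 0 else f x with hlo
  have hhi_supp : ∀ t, (hi t).support.Finite := fun t => hf.subset fun x hx => by
    simp only [hhi, Function.mem_support, ne_eq, ite_eq_right_iff, Classical.not_imp] at hx
    exact hx.2
  have hlo_supp : ∀ t, (lo t).support.Finite := fun t => hf.subset fun x hx => by
    simp only [hlo, Function.mem_support, ne_eq, ite_eq_left_iff, Classical.not_imp] at hx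
    exact hx.2
  have hsum : ∀ t, f = hi t + lo t := fun t => by
    ext x
    simp only [hhi, hlo, Pi.add_apply]
    split_ifs <;> simp
  -- The contribution of the single point x at height t. Its integral over t > 0 is finite because p
  -- - 2 > -1 on (0, |f x|] and p - 3 < -1 on (|f x|, ∞).
  set bnd : ℝ → Lat n → ℝ≥0∞ := fun t x =>
    C₁ * ‖f x‖ₑ * (Set.Ioc 0 ‖f x‖).indicator (fun t => ENNReal.ofReal (t ^ (p - 2))) t +
    C₂ * ‖f x‖ₑ ^ 2 * (Set.Ioi ‖f x‖).indicator (fun t => ENNReal.ofReal (t ^ (p - 3))) t with hbnd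
  have key : ∀ t : ℝ, 0 < t → Measure.count {x | t < ‖T f x‖ / 2} * ENNReal.ofReal (t ^ (p - 1)) ≤
      ∑ x ∈ A, bnd t x := by
    intro t ht
    have e1 : ∑' x, ‖hi t x‖ₑ = ∑ x ∈ A, if t ≤ ‖f x‖ then ‖f x‖ₑ else 0 := by
      rw [tsum_eq_sum (s := A) (fun x hx => by simp [hhi, hA x hx])]
      refine Finset.sum_congr rfl fun x _ => ?_
      simp only [hhi]
      split_ifs <;> simp
    have e2 : ∑' x, ‖lo t x‖ₑ ^ 2 = ∑ x ∈ A, if t ≤ ‖f x‖ then 0 else ‖f x‖ₑ ^ 2 := by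
      rw [tsum_eq_sum (s := A) (fun x hx => by simp [hlo, hA x hx])]
      refine Finset.sum_congr rfl fun x _ => ?_
      simp only [hlo]
      split_ifs <;> simp
    have hpt : ∀ x, (if t < ‖T f x‖ / 2 then (1 : ℝ≥0∞) else 0) ≤
        (if t < ‖T (hi t) x‖ then 1 else 0) + ENNReal.ofReal (t ^ (-2 : ℝ)) * ‖T (lo t) x‖ₑ ^ 2 := by
      intro x
      by_cases hx : t < ‖T f x‖ / 2
      swap
      · simp [hx]
      rw [if_pos hx]
      by_cases hxh : t < ‖T (hi t) x‖
      · rw [if_pos hxh]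
        exact le_self_add
      · refine le_trans ?_ le_add_self
        have : ‖T f x‖ ≤ ‖T (hi t) x‖ + ‖T (lo t) x‖ := by
          conv_lhs => rw [hsum t]
          rw [hadd _ _ (hhi_supp t) (hlo_supp t)]
          exact norm_add_le _ _
        have hlt : t ≤ ‖T (lo t) x‖ := by linarith
        rw [enorm_sq_eq_ofReal, ← ENNReal.ofReal_mul (by positivity), ENNReal.one_le_ofReal,
          Real.rpow_neg ht.le, Real.rpow_two, inv_mul_eq_div, one_le_div (by positivity)]
        gcongr
    have hcount : Measure.count {x | t < ‖T f x‖ / 2} ≤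
        ENNReal.ofReal (t ^ (-1 : ℝ)) * (C₁ * ∑ x ∈ A, if t ≤ ‖f x‖ then ‖f x‖ₑ else 0) +
        ENNReal.ofReal (t ^ (-2 : ℝ)) * (C₂ * ∑ x ∈ A, if t ≤ ‖f x‖ then 0 else ‖f x‖ₑ ^ 2) := by
      rw [count_eq_tsum]
      simp only [Set.mem_ofPred_eq]
      refine (ENNReal.tsum_le_tsum hpt).trans ?_
      rw [ENNReal.tsum_add, ENNReal.tsum_mul_left]
      gcongr
      · rw [← e1]
        calc _ = ENNReal.ofReal (t ^ (-1 : ℝ)) * (ENNReal.ofReal t *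
              ∑' x, (if t < ‖T (hi t) x‖ then 1 else 0)) := by
              rw [← mul_assoc, ← ENNReal.ofReal_mul (by positivity), Real.rpow_neg_one,
                inv_mul_cancel₀ ht.ne', ENNReal.ofReal_one, one_mul]
          _ ≤ _ := mul_le_mul' le_rfl (h1 _ (hhi_supp t) t ht)
      · rw [← e2]
        exact h2 _ (hlo_supp t)
    calc _ ≤ (ENNReal.ofReal (t ^ (-1 : ℝ)) * (C₁ * ∑ x ∈ A, if t ≤ ‖f x‖ then ‖f x‖ₑ else 0) +
        ENNReal.ofReal (t ^ (-2 : ℝ)) * (C₂ * ∑ x ∈ A, if t ≤ ‖f x‖ then 0 else ‖f x‖ₑ ^ 2)) *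
          ENNReal.ofReal (t ^ (p - 1)) := by gcongr
      _ = (ENNReal.ofReal (t ^ (-1 : ℝ)) * ENNReal.ofReal (t ^ (p - 1))) *
          (C₁ * ∑ x ∈ A, if t ≤ ‖f x‖ then ‖f x‖ₑ else 0) +
          (ENNReal.ofReal (t ^ (-2 : ℝ)) * ENNReal.ofReal (t ^ (p - 1))) *
          (C₂ * ∑ x ∈ A, if t ≤ ‖f x‖ then 0 else ‖f x‖ₑ ^ 2) := by ring
      _ = ENNReal.ofReal (t ^ (p - 2)) * (C₁ * ∑ x ∈ A, if t ≤ ‖f x‖ then ‖f x‖ₑ else 0) +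
          ENNReal.ofReal (t ^ (p - 3)) * (C₂ * ∑ x ∈ A, if t ≤ ‖f x‖ then 0 else ‖f x‖ₑ ^ 2) := by
          rw [← ENNReal.ofReal_mul (by positivity), ← ENNReal.ofReal_mul (by positivity),
            ← Real.rpow_add ht, ← Real.rpow_add ht]
          ring_nf
      _ = ∑ x ∈ A, bnd t x := by
          simp only [hbnd, Finset.mul_sum, ← Finset.sum_add_distrib]
          refine Finset.sum_congr rfl fun x _ => ?_
          by_cases hx : t ≤ ‖f x‖
          · simp only [hx, if_true, Set.indicator_apply, Set.mem_Ioc, ht, Set.mem_Ioi, not_lt.2 hx,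
              true_and, if_false]
            ring
          · simp only [hx, if_false, Set.indicator_apply, Set.mem_Ioc, ht, Set.mem_Ioi,
              not_le.1 hx, and_false, if_true]
            ring
  have hInt : ∀ x ∈ A, ∫⁻ t in Set.Ioi 0, bnd t x ≤
      (C₁ * ENNReal.ofReal (1 / (p - 1)) + C₂ * ENNReal.ofReal (1 / (2 - p))) * ‖f x‖ₑ ^ p := by
    intro x hx
    set a := ‖f x‖ with ha
    have ha0 : 0 < a := hA' x hx
    have hm : ∀ s : ℝ, Measurable fun t : ℝ => ENNReal.ofReal (t ^ s) := fun s => by fun_prop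
    have i1 : ∫⁻ t in Set.Ioi 0, (Set.Ioc 0 a).indicator (fun t => ENNReal.ofReal (t ^ (p - 2))) t
        = ENNReal.ofReal (a ^ (p - 1) / (p - 1)) := by
      rw [lintegral_indicator measurableSet_Ioc, Measure.restrict_restrict measurableSet_Ioc,
        Set.inter_eq_left.2 Set.Ioc_subset_Ioi_self, lintegral_Ioc_rpow ha0 (by linarith)]
      ring_nf
    have i2 : ∫⁻ t in Set.Ioi 0, (Set.Ioi a).indicator (fun t => ENNReal.ofReal (t ^ (p - 3))) t
        = ENNReal.ofReal (a ^ (p - 2) / (2 - p)) := by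
      rw [lintegral_indicator measurableSet_Ioi, Measure.restrict_restrict measurableSet_Ioi,
        Set.inter_eq_left.2 (Set.Ioi_subset_Ioi ha0.le), lintegral_Ioi_rpow ha0 (by linarith)]
      congr 1
      rw [show p - 3 + 1 = -(2 - p) by ring, neg_div_neg_eq]
      ring_nf
    have hea : ‖f x‖ₑ = ENNReal.ofReal a := (ofReal_norm _).symm
    have m1 : Measurable fun t : ℝ => C₁ * ‖f x‖ₑ *
        (Set.Ioc 0 a).indicator (fun t => ENNReal.ofReal (t ^ (p - 2))) t :=
      ((hm _).indicator measurableSet_Ioc).const_mul _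
    have hea2 : ‖f x‖ₑ ^ p = ENNReal.ofReal (a ^ p) := by
      rw [hea, ENNReal.ofReal_rpow_of_pos ha0]
    simp only [hbnd]
    rw [lintegral_add_left m1, lintegral_const_mul _ ((hm _).indicator measurableSet_Ioc),
      lintegral_const_mul _ ((hm _).indicator measurableSet_Ioi), i1, i2, hea2, hea,
      ← ENNReal.ofReal_pow ha0.le, mul_assoc, mul_assoc, ← ENNReal.ofReal_mul (by positivity),
      ← ENNReal.ofReal_mul (by positivity), add_mul, mul_assoc, mul_assoc,
      ← ENNReal.ofReal_mul (by rw [one_div]; exact inv_nonneg.2 (by linarith)),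
      ← ENNReal.ofReal_mul (by rw [one_div]; exact inv_nonneg.2 (by linarith))]
    apply le_of_eq
    congr 3
    · rw [Real.rpow_sub_one ha0.ne']
      field_simp
    · rw [Real.rpow_sub ha0, Real.rpow_two]
      field_simp
  have hmeas : ∀ x ∈ A, Measurable fun t => bnd t x := fun x _ => by
    have hm : ∀ s : ℝ, Measurable fun t : ℝ => ENNReal.ofReal (t ^ s) := fun s => by fun_prop
    exact (((hm _).indicator measurableSet_Ioc).const_mul _).add
      (((hm _).indicator measurableSet_Ioi).const_mul _)
  have hlc := lintegral_rpow_eq_lintegral_meas_lt_mul (μ := (Measure.count : Measure (Lat n)))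
    (f := fun x => ‖T f x‖ / 2) (Eventually.of_forall fun x => by positivity)
    (measurable_of_countable _).aemeasurable (p := p) (by linarith)
  rw [lintegral_count] at hlc
  have e0 : ∑' x, ‖T f x‖ₑ ^ p = ENNReal.ofReal (2 ^ p) * ∑' x, ENNReal.ofReal ((‖T f x‖ / 2) ^ p) := by
    rw [← ENNReal.tsum_mul_left]
    refine tsum_congr fun x => ?_
    rw [← ENNReal.ofReal_mul (by positivity), ← Real.mul_rpow (by norm_num) (by positivity),
      mul_div_cancel₀ _ (by norm_num), ← ofReal_norm, ENNReal.ofReal_rpow_of_nonneg (norm_nonneg _)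
        (by linarith)]
  rw [e0, hlc, ← mul_assoc, ← ENNReal.ofReal_mul (by positivity), mul_assoc]
  gcongr
  calc ∫⁻ t in Set.Ioi 0, Measure.count {x | t < ‖T f x‖ / 2} * ENNReal.ofReal (t ^ (p - 1))
      ≤ ∫⁻ t in Set.Ioi 0, ∑ x ∈ A, bnd t x :=
        setLIntegral_mono' measurableSet_Ioi fun t ht => key t ht
    _ = ∑ x ∈ A, ∫⁻ t in Set.Ioi 0, bnd t x := lintegral_finsetSum' _ fun x hx =>
        (hmeas x hx).aemeasurable
    _ ≤ ∑ x ∈ A, (C₁ * ENNReal.ofReal (1 / (p - 1)) + C₂ * ENNReal.ofReal (1 / (2 - p))) *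
          ‖f x‖ₑ ^ p := Finset.sum_le_sum hInt
    _ ≤ _ := by
        rw [← Finset.mul_sum]
        gcongr
        exact ENNReal.sum_le_tsum _

/-! ### The `ℓᵖ` bound for multiscale forms -/

theorem lform_le_of_lT {θ : ℕ → Lat n → Lat n → ℂ} {R : ℕ} {g f : Lat n → ℂ}
    (hg : g.support.Finite) {p q : ℝ} (hpq : p.HolderConjugate q) :
    ‖lform θ R g f‖ₑ ≤ (∑' x, ‖lT θ R f x‖ₑ ^ p) ^ (1 / p) * (∑' x, ‖g x‖ₑ ^ q) ^ (1 / q) := by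
  have hA : ∀ x ∉ hg.toFinset, g x = 0 := fun x hx => by simpa using hx
  rw [← tsum_mul_lT θ R f hg, tsum_eq_sum (s := hg.toFinset) (fun x hx => by simp [hA x hx])]
  refine (enorm_sum_le _ _).trans ?_
  simp only [enorm_mul]
  rw [mul_comm]
  refine (ENNReal.inner_le_Lp_mul_Lq _ _ _ hpq.symm).trans ?_
  gcongr
  · exact one_div_nonneg.2 hpq.symm.nonneg
  · exact ENNReal.sum_le_tsum _
  · exact one_div_nonneg.2 hpq.nonneg
  · exact ENNReal.sum_le_tsum _

/-- Cancellation enters only through the assumed ℓ² bound; besides it, just the size of θ matters.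
This makes the statement applicable to transposed forms, and the constant does not depend on θ or on
the number of levels. -/
theorem exists_lform_le_of_lt_two (hn : 0 < n) {W : Lat n → ℝ≥0∞} {σ : ℝ} (h0 : 0 < σ)
    (hW : ∑' z, W z * ENNReal.ofReal ((1 + ‖z‖) ^ σ) ≠ ⊤) {C₂ : ℝ≥0∞} (hC₂ : C₂ ≠ ⊤)
    {p q : ℝ} (hpq : p.HolderConjugate q) (hp2 : p < 2) :
    ∃ C : ℝ≥0∞, C ≠ ⊤ ∧ ∀ θ : ℕ → Lat n → Lat n → ℂ,
      (∀ r u v, ‖θ r u v‖ₑ ≤ W (v - u)) → ∀ R : ℕ,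
      (∀ g f : Lat n → ℂ, g.support.Finite → f.support.Finite →
        ‖lform θ R g f‖ₑ ^ 2 ≤ C₂ * (∑' x, ‖g x‖ₑ ^ 2) * ∑' x, ‖f x‖ₑ ^ 2) →
      ∀ g f : Lat n → ℂ, g.support.Finite → f.support.Finite →
        ‖lform θ R g f‖ₑ ≤ C * (∑' x, ‖f x‖ₑ ^ p) ^ (1 / p) * (∑' x, ‖g x‖ₑ ^ q) ^ (1 / q) := by
  set Cp : ℝ≥0∞ := ENNReal.ofReal (2 ^ p * p) *
    (weakConst n σ (∑' z, W z * ENNReal.ofReal ((1 + ‖z‖) ^ σ)) C₂ * ENNReal.ofReal (1 / (p - 1)) +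
      C₂ * ENNReal.ofReal (1 / (2 - p))) with hCp
  have hp0 : 0 ≤ 1 / p := one_div_nonneg.2 hpq.nonneg
  refine ⟨Cp ^ (1 / p), ?_, ?_⟩
  · apply ENNReal.rpow_ne_top_of_nonneg hp0
    refine ENNReal.mul_ne_top ENNReal.ofReal_ne_top (ENNReal.add_ne_top.2 ⟨?_, ?_⟩)
    · exact ENNReal.mul_ne_top (weakConst_ne_top h0 hW hC₂) ENNReal.ofReal_ne_top
    · exact ENNReal.mul_ne_top hC₂ ENNReal.ofReal_ne_top
  · intro θ hθ R h2 g f hg hf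
    have h2' : ∀ f : Lat n → ℂ, f.support.Finite →
        ∑' x, ‖lT θ R f x‖ₑ ^ 2 ≤ C₂ * ∑' x, ‖f x‖ₑ ^ 2 := fun f hf =>
      tsum_lT_enorm_sq_le fun g hg => h2 g f hg hf
    have hT := tsum_rpow_le_of_weak_strong (T := lT θ R) (fun f₁ f₂ h₁ h₂ x => lT_add θ R h₁ h₂ x)
      (fun f hf lam hlam => lT_weak_type hn h0 hθ h2' hf hlam) h2' hpq.lt hp2 hf
    refine (lform_le_of_lT hg hpq).trans ?_
    gcongr
    rw [← ENNReal.mul_rpow_of_nonneg _ _ hp0]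
    gcongr

/-- Multiscale forms with cancellation are bounded on `ℓᵖ × ℓ^{p'}`. -/
theorem exists_lform_le (hn : 0 < n) {W : Lat n → ℝ≥0∞} (hWneg : ∀ z, W (-z) = W z) {σ : ℝ}
    (h0 : 0 < σ) (h1 : σ ≤ 1)
    (hW : ∑' z, W z * ENNReal.ofReal ((1 + ‖z‖) ^ σ) ≠ ⊤)
    {p q : ℝ} (hpq : p.HolderConjugate q) :
    ∃ C : ℝ≥0∞, C ≠ ⊤ ∧ ∀ θ : ℕ → Lat n → Lat n → ℂ,
      (∀ r u v, ‖θ r u v‖ₑ ≤ W (v - u)) →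
      (∀ r k v, ∑ u ∈ box 1 k, θ r u v = 0) → (∀ r u, ∑' v, θ r u v = 0) → ∀ R : ℕ,
      ∀ g f : Lat n → ℂ, g.support.Finite → f.support.Finite →
        ‖lform θ R g f‖ₑ ≤ C * (∑' x, ‖f x‖ₑ ^ p) ^ (1 / p) * (∑' x, ‖g x‖ₑ ^ q) ^ (1 / q) := by
  set C₂ := (∑' z, W z) * (shiftConst n σ * ∑' z, W z * ENNReal.ofReal ((1 + ‖z‖) ^ σ)) with hC₂
  have hC₂_top : C₂ ≠ ⊤ := ENNReal.mul_ne_top (tsum_weight_ne_top h0 hW)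
    (ENNReal.mul_ne_top (shiftConst_ne_top h0) hW)
  rcases lt_trichotomy p 2 with hp | hp | hp
  · obtain ⟨C, hC, H⟩ := exists_lform_le_of_lt_two hn h0 hW hC₂_top hpq hp
    exact ⟨C, hC, fun θ hθ hsib hrow R g f hg hf => H θ hθ R
      (fun g f hg hf => lform_enorm_sq_le h0 h1 hθ hW hsib hrow R hg hf) g f hg hf⟩
  · have hq : q = 2 := by
      have := hpq.inv_add_inv_eq_one
      rw [hp] at this
      have h3 : q⁻¹ = 2⁻¹ := by linarith
      exact inv_injective h3
    subst hp hq
    refine ⟨C₂ ^ (1 / 2 : ℝ), ENNReal.rpow_ne_top_of_nonneg (by norm_num) hC₂_top, ?_⟩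
    intro θ hθ hsib hrow R g f hg hf
    have h := lform_enorm_sq_le h0 h1 hθ hW hsib hrow R hg hf
    rw [← ENNReal.mul_rpow_of_nonneg _ _ (by norm_num), ← ENNReal.mul_rpow_of_nonneg _ _
      (by norm_num), one_div, ENNReal.le_rpow_inv_iff (by norm_num)]
    simp only [ENNReal.rpow_two]
    refine h.trans (le_of_eq ?_)
    ring
  -- For p > 2 the form is transposed. The transposed matrices need not have the same cancellations,
  -- but the ℓ² bound and the symmetric weight survive, and the case of exponents below 2 asks for
  -- nothing more.
  · have hq : q < 2 := by
      have := hpq.inv_add_inv_eq_one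
      have h3 : p⁻¹ < 2⁻¹ := inv_strictAnti₀ (by norm_num) hp
      have h4 : 2⁻¹ < q⁻¹ := by linarith
      exact (inv_lt_inv₀ (by norm_num) hpq.symm.pos).1 h4
    obtain ⟨C, hC, H⟩ := exists_lform_le_of_lt_two hn h0 hW hC₂_top hpq.symm hq
    refine ⟨C, hC, fun θ hθ hsib hrow R g f hg hf => ?_⟩
    have := H (fun r u v => θ r v u) (fun r u v => by rw [← hWneg, neg_sub]; exact hθ r v u) R
      (fun g f hg hf => by
        rw [← lform_transpose θ R hf hg]
        refine (lform_enorm_sq_le h0 h1 hθ hW hsib hrow R hf hg).trans (le_of_eq ?_)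
        ring) f g hf hg
    rw [lform_transpose θ R hg hf]
    refine this.trans (le_of_eq ?_)
    ring

end

/-! ### Dyadic cubes and Haar functions on ℝⁿ, and the telescoping identity of the BCR algorithm. -/

section

variable {n : ℕ}

/-! ### Dyadic cubes and the Haar functions -/

/-- The index of the dyadic cube of generation `j` that contains `x`. -/
def ix (j : ℤ) (x : Rn n) : Lat n := fun i => ⌊(2 : ℝ) ^ j * x i⌋

/-- The normalization `2^{nj/2}`. -/
def nrm (n : ℕ) (j : ℤ) : ℝ := (2 : ℝ) ^ ((n : ℝ) * j / 2)

theorem nrm_pos (n : ℕ) (j : ℤ) : 0 < nrm n j := by unfold nrm; positivity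

theorem nrm_sq (n : ℕ) (j : ℤ) : nrm n j ^ 2 = ((2 : ℝ) ^ j) ^ n := by
  rw [nrm, ← Real.rpow_natCast, ← Real.rpow_mul (by norm_num), ← Real.rpow_intCast,
    ← Real.rpow_natCast, ← Real.rpow_mul (by norm_num)]
  congr 1
  push_cast
  ring

theorem rt_eq (n : ℕ) : rt n = (2 : ℝ) ^ (-(n : ℝ) / 2) := by
  rw [rt, Real.sqrt_eq_rpow, ← Real.rpow_natCast, ← Real.rpow_mul (by norm_num),
    ← Real.rpow_neg (by norm_num)]
  congr 1
  ring

theorem rt_mul_nrm_succ (n : ℕ) (j : ℤ) : rt n * nrm n (j + 1) = nrm n j := by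
  rw [rt_eq, nrm, nrm, ← Real.rpow_add (by norm_num)]
  congr 1
  push_cast
  ring

theorem anc_ix (j : ℤ) (x : Rn n) : anc 1 (ix (j + 1) x) = ix j x := by
  ext i
  simp only [anc, ix, pow_one]
  rw [zpow_add_one₀ (by norm_num)]
  have := Int.floor_div_natCast ((2 : ℝ) ^ j * 2 * x i) 2
  push_cast at this
  rw [← this]
  congr 1
  ring

theorem mem_dyadicCube {j : ℤ} {k : Lat n} {x : Rn n} : x ∈ dyadicCube j k ↔ ix j x = k := by
  simp only [dyadicCube, cube, Set.mem_ofPred_eq, funext_iff, ix, Int.floor_eq_iff]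
  refine forall_congr' fun i => ?_
  have hp : (0 : ℝ) < 2 ^ j := by positivity
  rw [zpow_neg]
  constructor
  · rintro ⟨h1, h2⟩
    constructor
    · rwa [inv_mul_le_iff₀ hp] at h1
    · rwa [← mul_add_one, lt_inv_mul_iff₀ hp] at h2
  · rintro ⟨h1, h2⟩
    constructor
    · rwa [inv_mul_le_iff₀ hp]
    · rwa [← mul_add_one, lt_inv_mul_iff₀ hp]

/-- The sign of the Haar function `ε` on the cube with index `u`. -/
def hsgn (ε : Fin n → Bool) (u : Lat n) : ℂ := ∏ i, if ε i = true ∧ u i % 2 = 1 then -1 else 1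

/-- The coefficient of `φ_{j+1,u}` in the Haar function `ε` on the parent cube. -/
def hco (ε : Fin n → Bool) (u : Lat n) : ℂ := rt n * hsgn ε u

/-- The Haar function with index `ε`, which is `φ_{j,k}` for `ε = 0`. -/
def haar (ε : Fin n → Bool) (j : ℤ) (k : Lat n) : Rn n → ℂ := dilate (haarMother ε) j k

theorem haar_apply (ε : Fin n → Bool) (j : ℤ) (k : Lat n) (x : Rn n) :
    haar ε j k x = if ix j x = k then (nrm n j : ℂ) * hsgn ε (ix (j + 1) x) else 0 := by
  rw [haar, dilate, haarMother]
  change (nrm n j : ℂ) * _ = _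
  by_cases hx : ix j x = k
  · rw [if_pos hx]
    congr 1
    refine Finset.prod_congr rfl fun i => fun _ => ?_
    have h1 : ⌊(2 : ℝ) ^ j * x i⌋ = k i := congr_fun hx i
    rw [Int.floor_eq_iff] at h1
    have hc : 0 ≤ (2 : ℝ) ^ j * x i - k i ∧ (2 : ℝ) ^ j * x i - k i < 1 :=
      ⟨by linarith, by linarith⟩
    simp only [hc, true_and, if_true]
    have h2 : (1 / 2 ≤ (2 : ℝ) ^ j * x i - k i) ↔ ix (j + 1) x i % 2 = 1 := by
      have e : ix (j + 1) x i = ⌊2 * ((2 : ℝ) ^ j * x i)⌋ := by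
        simp only [ix]
        rw [zpow_add_one₀ (by norm_num)]
        ring_nf
      rw [e]
      constructor
      · intro h
        have : ⌊2 * ((2 : ℝ) ^ j * x i)⌋ = 2 * k i + 1 := by
          rw [Int.floor_eq_iff]
          push_cast
          constructor <;> linarith
        rw [this]
        omega
      · intro h
        by_contra hcon
        have : ⌊2 * ((2 : ℝ) ^ j * x i)⌋ = 2 * k i := by
          rw [Int.floor_eq_iff]
          push_cast
          constructor <;> linarith
        rw [this] at h
        omega
    simp only [h2]
  · rw [if_neg hx]
    obtain ⟨i, hi⟩ := Function.ne_iff.1 hx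
    rw [Finset.prod_eq_zero (Finset.mem_univ i), mul_zero]
    rw [if_neg]
    rintro ⟨h1, h2⟩
    apply hi
    simp only [ix]
    rw [Int.floor_eq_iff]
    constructor <;> linarith

theorem hsgn_false (u : Lat n) : hsgn (fun _ => false) u = 1 := by simp [hsgn]

theorem phi_apply (j : ℤ) (k : Lat n) (x : Rn n) :
    phi j k x = if ix j x = k then (nrm n j : ℂ) else 0 := by
  have := haar_apply (fun _ => false) j k x
  rw [hsgn_false, mul_one] at this
  exact this

theorem phi_eq_haar (j : ℤ) (k : Lat n) : phi j k = haar (fun _ => false) j k := rfl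

theorem psi_eq_haar (ε : HaarIndex n) (j : ℤ) (k : Lat n) : psi ε j k = haar ε.1 j k := rfl

theorem hco_false (u : Lat n) : hco (fun _ => false) u = (rt n : ℂ) := by
  rw [hco, hsgn_false, mul_one]

/-- Haar functions as combinations of characteristic functions of the children. -/
theorem haar_eq_sum (ε : Fin n → Bool) (j : ℤ) (k : Lat n) (x : Rn n) :
    haar ε j k x = ∑ u ∈ box 1 k, hco ε u * phi (j + 1) u x := by
  rw [haar_apply]
  simp only [phi_apply]
  by_cases hx : ix j x = k
  · rw [if_pos hx, Finset.sum_eq_single (ix (j + 1) x)]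
    · rw [if_pos rfl, hco, ← rt_mul_nrm_succ]
      push_cast
      ring
    · intro u _ hu
      rw [if_neg hu.symm, mul_zero]
    · intro h
      rw [mem_box, anc_ix] at h
      exact absurd hx h
  · rw [if_neg hx, Finset.sum_eq_zero]
    intro u hu
    rw [if_neg, mul_zero]
    rintro rfl
    rw [mem_box, anc_ix] at hu
    exact hx hu

/-- Orthogonality of the characters of (ℤ/2)^n: the sum over ε factors over the coordinates, and for
distinct siblings some coordinate has different parities and contributes 1 - 1. -/
theorem sum_hsgn_mul_hsgn (u v : Lat n) (h : anc 1 u = anc 1 v) :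
    ∑ ε : Fin n → Bool, hsgn ε u * hsgn ε v = if u = v then 2 ^ n else 0 := by
  have e : ∀ ε : Fin n → Bool, hsgn ε u * hsgn ε v = ∏ i, ((if ε i = true ∧ u i % 2 = 1 then -1
      else 1) * (if ε i = true ∧ v i % 2 = 1 then -1 else 1)) := fun ε => by
    rw [hsgn, hsgn, Finset.prod_mul_distrib]
  simp only [e]
  have h2 := (Finset.prod_univ_sum (fun _ : Fin n => (Finset.univ : Finset Bool))
    (fun i b => (if b = true ∧ u i % 2 = 1 then (-1 : ℂ) else 1) *
      (if b = true ∧ v i % 2 = 1 then -1 else 1)))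
  rw [Fintype.piFinset_univ] at h2
  rw [← h2]
  have h3 : ∀ i, u i / 2 = v i / 2 := fun i => by simpa [anc] using congr_fun h i
  by_cases huv : u = v
  · subst huv
    rw [if_pos rfl, Finset.prod_congr rfl (g := fun _ => (2 : ℂ))]
    · simp
    · intro i _
      simp only [Fintype.sum_bool]
      by_cases hp : u i % 2 = 1 <;> simp [hp] <;> norm_num
  · rw [if_neg huv]
    obtain ⟨i, hi⟩ := Function.ne_iff.1 huv
    refine Finset.prod_eq_zero (Finset.mem_univ i) ?_
    simp only [Fintype.sum_bool]
    have h4 := h3 i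
    by_cases hp : u i % 2 = 1
    · have hq : ¬ v i % 2 = 1 := by omega
      simp [hp, hq]
    · have hq : v i % 2 = 1 := by omega
      simp [hp, hq]

/-- Inversion of `haar_eq_sum`: the 2^n functions with all ε, including ε = 0, form a basis of the
functions constant on the children of a cube. -/
theorem phi_succ_eq_sum (j : ℤ) (u : Lat n) (x : Rn n) :
    phi (j + 1) u x = ∑ ε : Fin n → Bool, hco ε u * haar ε j (anc 1 u) x := by
  simp only [haar_apply, hco, phi_apply]
  by_cases hx : ix j x = anc 1 u
  · simp only [hx, if_true]
    have h := sum_hsgn_mul_hsgn u (ix (j + 1) x) (by rw [anc_ix, hx])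
    calc _ = (rt n : ℂ) * nrm n j * (if u = ix (j + 1) x then 2 ^ n else 0) := by
          by_cases hu : ix (j + 1) x = u
          · rw [if_pos hu, if_pos hu.symm, ← rt_mul_nrm_succ n j]
            have h3 : rt n * (rt n * nrm n (j + 1)) * 2 ^ n = nrm n (j + 1) := by
              rw [← mul_assoc, ← sq, rt_sq]
              field_simp
            exact_mod_cast h3.symm
          · rw [if_neg hu, if_neg (Ne.symm hu), mul_zero]
      _ = _ := by
          rw [← h, Finset.mul_sum]
          refine Finset.sum_congr rfl fun ε _ => ?_
          ring
  · simp only [hx, if_false, mul_zero, Finset.sum_const_zero]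
    rw [if_neg]
    rintro rfl
    exact hx (anc_ix j x).symm

/-- The sum factors over the coordinates, and a coordinate with ε i = true contributes 1 - 1 from
its two halves. -/
theorem sum_box_hsgn {ε : Fin n → Bool} (hε : ε ≠ fun _ => false) (k : Lat n) :
    ∑ u ∈ box 1 k, hsgn ε u = 0 := by
  obtain ⟨i, hi⟩ := Function.ne_iff.1 hε
  simp only [ne_eq, Bool.not_eq_false] at hi
  simp only [hsgn, box]
  rw [← Finset.prod_univ_sum (fun i => Finset.Ico (2 ^ 1 * k i) (2 ^ 1 * k i + 2 ^ 1))
    (fun i t => if ε i = true ∧ t % 2 = 1 then (-1 : ℂ) else 1)]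
  refine Finset.prod_eq_zero (Finset.mem_univ i) ?_
  have : Finset.Ico (2 ^ 1 * k i) (2 ^ 1 * k i + 2 ^ 1) = {2 * k i, 2 * k i + 1} := by
    ext t
    simp only [Finset.mem_Ico, Finset.mem_insert, Finset.mem_singleton]
    omega
  rw [this, Finset.sum_pair (by omega)]
  have h2 : (2 * k i + 1) % 2 = 1 := by omega
  simp [hi, h2]

theorem sum_box_hco {ε : Fin n → Bool} (hε : ε ≠ fun _ => false) (k : Lat n) :
    ∑ u ∈ box 1 k, hco ε u = 0 := by
  simp only [hco, ← Finset.mul_sum, sum_box_hsgn hε, mul_zero]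

theorem norm_hsgn (ε : Fin n → Bool) (u : Lat n) : ‖hsgn ε u‖ = 1 := by
  rw [hsgn, norm_prod]
  refine Finset.prod_eq_one fun i _ => ?_
  split_ifs <;> simp

theorem norm_hco_le (ε : Fin n → Bool) (u : Lat n) : ‖hco ε u‖ ≤ 1 := by
  rw [hco, norm_mul, norm_hsgn, mul_one, Complex.norm_real, Real.norm_of_nonneg (rt_pos n).le, rt]
  apply inv_le_one_of_one_le₀
  rw [Real.one_le_sqrt]
  exact one_le_pow₀ (by norm_num)

theorem norm_haar_le (ε : Fin n → Bool) (j : ℤ) (k : Lat n) (x : Rn n) :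
    ‖haar ε j k x‖ ≤ if ix j x = k then nrm n j else 0 := by
  rw [haar_apply]
  split_ifs
  · rw [norm_mul, norm_hsgn, mul_one, Complex.norm_real, Real.norm_of_nonneg (nrm_pos n j).le]
  · simp

/-! ### Measurability and compactness -/

theorem measurable_ix (j : ℤ) : Measurable (ix (n := n) j) := by
  refine measurable_pi_lambda _ fun i => ?_
  exact Int.measurable_floor.comp (by fun_prop)

theorem measurable_haar (ε : Fin n → Bool) (j : ℤ) (k : Lat n) : Measurable (haar ε j k) := by
  have : haar ε j k = fun x => (fun p : Lat n × Lat n =>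
      if p.1 = k then (nrm n j : ℂ) * hsgn ε p.2 else 0) (ix j x, ix (j + 1) x) := by
    ext x; rw [haar_apply]
  rw [this]
  have hm : Measurable fun p : Lat n × Lat n =>
      if p.1 = k then (nrm n j : ℂ) * hsgn ε p.2 else 0 := measurable_of_countable _
  exact hm.comp ((measurable_ix j).prodMk (measurable_ix (j + 1)))

theorem measurableSet_dyadicCube (j : ℤ) (k : Lat n) : MeasurableSet (dyadicCube j k) := by
  have : dyadicCube j k = ix (n := n) j ⁻¹' {k} := by ext x; simp [mem_dyadicCube]
  rw [this]
  exact measurable_ix j (measurableSet_singleton k)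

theorem volume_cube (a : Rn n) (r : ℝ) : volume (cube a r) = ENNReal.ofReal r ^ n := by
  have h : cube a r = (@WithLp.ofLp 2 (Fin n → ℝ)) ⁻¹'
      (Set.pi Set.univ fun i => Set.Ico (a i) (a i + r)) := by
    ext x; simp [cube]
  rw [h, (PiLp.volume_preserving_ofLp (Fin n)).measure_preimage
    (MeasurableSet.univ_pi fun i => measurableSet_Ico).nullMeasurableSet, Real.volume_pi_Ico]
  simp

theorem volume_dyadicCube (j : ℤ) (k : Lat n) :
    volume (dyadicCube j k) = ENNReal.ofReal (((2 : ℝ) ^ (-j)) ^ n) := by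
  rw [dyadicCube, volume_cube, ENNReal.ofReal_pow (by positivity)]

theorem euclid_norm_le {x : Rn n} {c : ℝ} (h : ∀ i, |x i| ≤ c) : ‖x‖ ≤ n * c := by
  rcases Nat.eq_zero_or_pos n with rfl | hn
  · simp [EuclideanSpace.norm_eq]
  have hc : 0 ≤ c := (abs_nonneg _).trans (h ⟨0, hn⟩)
  have hn' : (1 : ℝ) ≤ n := by exact_mod_cast hn
  apply abs_le_of_sq_le_sq' _ (by positivity) |>.2
  rw [EuclideanSpace.norm_sq_eq]
  calc ∑ i, ‖x i‖ ^ 2 ≤ ∑ _i : Fin n, c ^ 2 := by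
        refine Finset.sum_le_sum fun i _ => ?_
        rw [Real.norm_eq_abs]
        exact pow_le_pow_left₀ (abs_nonneg _) (h i) 2
    _ = n * c ^ 2 := by simp
    _ ≤ n ^ 2 * c ^ 2 := by
        gcongr
        nlinarith
    _ = _ := by ring

theorem norm_sub_le_of_ix_eq {j : ℤ} {x y : Rn n} (h : ix j x = ix j y) :
    ‖x - y‖ ≤ n * (2 : ℝ) ^ (-j) := by
  refine euclid_norm_le fun i => ?_
  have h1 : ⌊(2 : ℝ) ^ j * x i⌋ = ⌊(2 : ℝ) ^ j * y i⌋ := congr_fun h i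
  have h2 := Int.abs_sub_lt_one_of_floor_eq_floor h1
  rw [← mul_sub, abs_mul, abs_of_pos (by positivity : (0 : ℝ) < 2 ^ j)] at h2
  rw [PiLp.sub_apply, zpow_neg, ← one_div, le_div_iff₀ (by positivity), mul_comm]
  exact h2.le

theorem isBounded_cube (a : Rn n) (r : ℝ) : Bornology.IsBounded (cube a r) := by
  rw [isBounded_iff_forall_norm_le]
  refine ⟨n * (‖a‖ + |r|), fun x hx => euclid_norm_le fun i => ?_⟩
  have h1 := hx i
  have h2 := PiLp.norm_apply_le a i
  rw [Real.norm_eq_abs, abs_le] at h2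
  have h3 := abs_nonneg r
  have h4 := le_abs_self r
  rw [abs_le]
  constructor <;> linarith

end

section

variable {n : ℕ}

/-! ### Compactly supported functions and their dyadic coefficients -/

theorem finite_image_ix {A : Set (Rn n)} (hA : Bornology.IsBounded A) (j : ℤ) :
    (ix j '' A).Finite := by
  obtain ⟨R, hR⟩ := isBounded_iff_forall_norm_le.1 hA
  refine (Set.Finite.pi' (t := fun _ : Fin n => Set.Icc ⌊-((2 : ℝ) ^ j * R)⌋ ⌊(2 : ℝ) ^ j * R⌋)
    fun i => Set.finite_Icc _ _).subset ?_
  rintro _ ⟨x, hx, rfl⟩ i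
  have h1 := (PiLp.norm_apply_le x i).trans (hR x hx)
  rw [Real.norm_eq_abs, abs_le] at h1
  have hp : (0 : ℝ) < 2 ^ j := by positivity
  constructor
  · apply Int.floor_le_floor
    nlinarith
  · apply Int.floor_le_floor
    nlinarith

theorem MemLpc.memLp_of_le {f : Rn n → ℂ} {p q : ℝ≥0∞} (h : MemLpc f p) (hq : q ≤ p) :
    MemLpc f q := by
  obtain ⟨hf, A, hA, hs⟩ := h
  refine ⟨?_, A, hA, hs⟩
  have h1 : f =ᵐ[volume] A.indicator f := by
    filter_upwards [hs] with x hx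
    by_cases hxA : x ∈ A
    · rw [Set.indicator_of_mem hxA]
    · rw [Set.indicator_of_notMem hxA, hx hxA]
  refine MemLp.ae_eq h1.symm ?_
  rw [memLp_indicator_iff_restrict hA.measurableSet]
  have : IsFiniteMeasure (volume.restrict A : Measure (Rn n)) :=
    ⟨by rw [Measure.restrict_apply_univ]; exact hA.measure_lt_top⟩
  exact (hf.restrict A).mono_exponent hq

theorem MemLpc.integrable {f : Rn n → ℂ} (h : MemLpc f 1) : Integrable f :=
  memLp_one_iff_integrable.1 h.1

theorem MemLpc.add {f g : Rn n → ℂ} {p : ℝ≥0∞} (hf : MemLpc f p) (hg : MemLpc g p) :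
    MemLpc (f + g) p := by
  obtain ⟨hf, A, hA, hfA⟩ := hf
  obtain ⟨hg, A', hA', hgA⟩ := hg
  refine ⟨hf.add hg, A ∪ A', hA.union hA', ?_⟩
  filter_upwards [hfA, hgA] with x h1 h2 hx
  rw [Pi.add_apply, h1 fun h => hx (Or.inl h), h2 fun h => hx (Or.inr h), add_zero]

theorem MemLpc.smul {f : Rn n → ℂ} {p : ℝ≥0∞} (c : ℂ) (hf : MemLpc f p) : MemLpc (c • f) p := by
  obtain ⟨hf, A, hA, hfA⟩ := hf
  refine ⟨hf.const_smul c, A, hA, ?_⟩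
  filter_upwards [hfA] with x h1 hx
  rw [Pi.smul_apply, h1 hx, smul_zero]

theorem MemLpc.zero (p : ℝ≥0∞) : MemLpc (0 : Rn n → ℂ) p :=
  ⟨MemLp.zero, ∅, isCompact_empty, Eventually.of_forall fun _ _ => rfl⟩

theorem MemLpc.sub {f g : Rn n → ℂ} {p : ℝ≥0∞} (hf : MemLpc f p) (hg : MemLpc g p) :
    MemLpc (f - g) p := by
  have := hf.add (hg.smul (-1))
  rwa [neg_one_smul, ← sub_eq_add_neg] at this

theorem MemLpc.sum {ι : Type*} (s : Finset ι) {f : ι → Rn n → ℂ} {p : ℝ≥0∞}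
    (hf : ∀ i ∈ s, MemLpc (f i) p) : MemLpc (∑ i ∈ s, f i) p := by
  classical
  induction s using Finset.induction_on with
  | empty => simpa using MemLpc.zero p
  | insert a s ha ih =>
    rw [Finset.sum_insert ha]
    exact (hf a (Finset.mem_insert_self a s)).add
      (ih fun i hi => hf i (Finset.mem_insert_of_mem hi))

theorem SupportedIn.mono {f : Rn n → ℂ} {A A' : Set (Rn n)} (h : SupportedIn f A) (hA : A ⊆ A') :
    SupportedIn f A' := by
  filter_upwards [h] with x hx hxA
  exact hx fun h => hxA (hA h)

theorem isCompact_closure_cube (a : Rn n) (r : ℝ) : IsCompact (closure (cube a r)) :=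
  (isBounded_cube a r).isCompact_closure

theorem memLpc_haar (ε : Fin n → Bool) (j : ℤ) (k : Lat n) (p : ℝ≥0∞) :
    MemLpc (haar ε j k) p := by
  have hs : ∀ x, x ∉ dyadicCube j k → haar ε j k x = 0 := fun x hx => by
    rw [haar_apply, if_neg fun h => hx (mem_dyadicCube.2 h)]
  refine ⟨?_, closure (dyadicCube j k), isCompact_closure_cube _ _,
    Eventually.of_forall fun x hx => hs x fun h => hx (subset_closure h)⟩
  have h1 : haar ε j k = (dyadicCube j k).indicator (haar ε j k) := by
    ext x
    by_cases hx : x ∈ dyadicCube j k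
    · rw [Set.indicator_of_mem hx]
    · rw [Set.indicator_of_notMem hx, hs x hx]
  rw [h1, memLp_indicator_iff_restrict (measurableSet_dyadicCube j k)]
  have : IsFiniteMeasure (volume.restrict (dyadicCube j k) : Measure (Rn n)) :=
    ⟨by rw [Measure.restrict_apply_univ, volume_dyadicCube]; exact ENNReal.ofReal_lt_top⟩
  refine MemLp.of_bound (measurable_haar ε j k).aestronglyMeasurable (nrm n j)
    (Eventually.of_forall fun x => (norm_haar_le ε j k x).trans ?_)
  split_ifs
  · exact le_rfl
  · exact (nrm_pos n j).le

theorem memLpc_phi (j : ℤ) (k : Lat n) (p : ℝ≥0∞) : MemLpc (phi j k) p := memLpc_haar _ j k p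

/-- The coefficient `⟨φ_{j,k}, f⟩`. -/
def scoef (j : ℤ) (f : Rn n → ℂ) (k : Lat n) : ℂ := bracket (phi j k) f

theorem bracket_comm (g f : Rn n → ℂ) : bracket g f = bracket f g := by
  simp only [bracket, mul_comm]

theorem integrable_haar_mul (ε : Fin n → Bool) (j : ℤ) (k : Lat n) {f : Rn n → ℂ}
    (hf : Integrable f) : Integrable fun x => haar ε j k x * f x :=
  hf.bdd_mul (c := nrm n j) (measurable_haar ε j k).aestronglyMeasurable
    (Eventually.of_forall fun x => (norm_haar_le ε j k x).trans (by
      split_ifs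
      · exact le_rfl
      · exact (nrm_pos n j).le))

theorem integrable_phi_mul (j : ℤ) (k : Lat n) {f : Rn n → ℂ}
    (hf : Integrable f) : Integrable fun x => phi j k x * f x := integrable_haar_mul _ j k hf

theorem bracket_haar (ε : Fin n → Bool) (j : ℤ) (k : Lat n) {f : Rn n → ℂ} (hf : Integrable f) :
    bracket (haar ε j k) f = ∑ u ∈ box 1 k, hco ε u * scoef (j + 1) f u := by
  simp only [bracket, scoef, haar_eq_sum ε j k, Finset.sum_mul, mul_assoc]
  rw [integral_finsetSum _ fun u _ => (integrable_phi_mul (j + 1) u hf).const_mul _]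
  exact Finset.sum_congr rfl fun u _ => integral_const_mul _ _

theorem scoef_eq_sum (j : ℤ) (k : Lat n) {f : Rn n → ℂ} (hf : Integrable f) :
    scoef j f k = rt n * ∑ u ∈ box 1 k, scoef (j + 1) f u := by
  have := bracket_haar (fun _ => false) j k hf
  simp only [hco_false] at this
  rw [scoef, phi_eq_haar, this, Finset.mul_sum]

/-- The bridge between ℝⁿ and the lattice: with scale M taken as the finest one, the scaling
coefficients r generations coarser are the normalized box sums of those at scale M. -/
theorem lsum_scoef (M : ℤ) (r : ℕ) {f : Rn n → ℂ} (hf : Integrable f) :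
    lsum r (scoef M f) = scoef (M - r) f := by
  induction r with
  | zero => ext k; simp
  | succ r ih =>
    ext k
    rw [lsum_succ, ih, scoef_eq_sum (M - (r + 1 : ℕ)) k hf]
    have : M - (r + 1 : ℕ) + 1 = M - r := by push_cast; ring
    rw [this]

theorem scoef_eq_zero {j : ℤ} {f : Rn n → ℂ} {A : Set (Rn n)} (hf : SupportedIn f A) {k : Lat n}
    (hk : k ∉ ix j '' A) : scoef j f k = 0 := by
  rw [scoef, bracket]
  apply integral_eq_zero_of_ae
  filter_upwards [hf] with x hx
  by_cases hxA : x ∈ A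
  · rw [phi_apply, if_neg fun h => hk ⟨x, hxA, h⟩, zero_mul, Pi.zero_apply]
  · rw [hx hxA, mul_zero, Pi.zero_apply]

theorem finite_support_scoef {f : Rn n → ℂ} {p : ℝ≥0∞} (hf : MemLpc f p) (j : ℤ) :
    (scoef j f).support.Finite := by
  obtain ⟨_, A, hA, hs⟩ := hf
  refine (finite_image_ix hA.isBounded j).subset fun k hk => ?_
  by_contra h
  exact hk (scoef_eq_zero hs h)

theorem scoef_add (j : ℤ) {f g : Rn n → ℂ} (hf : Integrable f) (hg : Integrable g) :
    scoef j (f + g) = scoef j f + scoef j g := by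
  ext k
  simp only [scoef, bracket, Pi.add_apply, mul_add]
  exact integral_add (integrable_phi_mul j k hf) (integrable_phi_mul j k hg)

theorem scoef_smul (j : ℤ) (c : ℂ) (f : Rn n → ℂ) : scoef j (c • f) = c • scoef j f := by
  ext k
  simp only [scoef, bracket, Pi.smul_apply, smul_eq_mul]
  rw [← integral_const_mul]
  refine integral_congr_ae (Eventually.of_forall fun x => ?_)
  ring

/-- The projection as a function of the index of the cube. -/
theorem projV_apply (j : ℤ) (f : Rn n → ℂ) (x : Rn n) :
    projV j f x = nrm n j * scoef j f (ix j x) := by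
  rw [projV, tsum_eq_single (ix j x)]
  · rw [phi_apply, if_pos rfl, mul_comm, scoef]
  · intro k hk
    rw [phi_apply, if_neg hk.symm, mul_zero]

theorem projV_eq_sum (j : ℤ) (f : Rn n → ℂ) {S : Finset (Lat n)}
    (hS : ∀ k ∉ S, scoef j f k = 0) : projV j f = ∑ k ∈ S, scoef j f k • phi j k := by
  ext x
  rw [projV, tsum_eq_sum (s := S)]
  · simp [Finset.sum_apply, scoef]
  · intro k hk
    change scoef j f k * _ = 0
    rw [hS k hk, zero_mul]

theorem memLpc_projV {f : Rn n → ℂ} {p : ℝ≥0∞} (hf : MemLpc f p) (j : ℤ) (q : ℝ≥0∞) :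
    MemLpc (projV j f) q := by
  rw [projV_eq_sum j f (S := (finite_support_scoef hf j).toFinset) (fun k hk => by simpa using hk)]
  exact MemLpc.sum _ fun k _ => (memLpc_phi j k q).smul _

/-! ### Kernel forms with locally bounded kernels -/

/-- A measurable kernel which is bounded on compact sets. -/
structure IsLocBddKernel (K : Rn n → Rn n → ℂ) : Prop where
  measurable : AEStronglyMeasurable (fun z : Rn n × Rn n => K z.1 z.2) volume
  locallyBounded : ∀ A : Set (Rn n × Rn n), IsCompact A → ∃ M : ℝ, ∀ z ∈ A, ‖K z.1 z.2‖ ≤ M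

theorem ae_fst {P : Rn n → Prop} (h : ∀ᵐ x, P x) : ∀ᵐ z : Rn n × Rn n, P z.1 :=
  Measure.quasiMeasurePreserving_fst.ae h

theorem ae_snd {P : Rn n → Prop} (h : ∀ᵐ x, P x) : ∀ᵐ z : Rn n × Rn n, P z.2 :=
  Measure.quasiMeasurePreserving_snd.ae h

variable {K : Rn n → Rn n → ℂ}

theorem IsLocBddKernel.bound_ae (hK : IsLocBddKernel K) {A : Set (Rn n)} (hA : IsCompact A) :
    ∃ M : ℝ, 0 ≤ M ∧ ∀ g f : Rn n → ℂ, SupportedIn g A → SupportedIn f A →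
      ∀ᵐ z : Rn n × Rn n, ‖kernelIntegrand K g f z‖ ≤ M * (‖g z.1‖ * ‖f z.2‖) := by
  obtain ⟨M, hM⟩ := hK.locallyBounded (A ×ˢ A) (hA.prod hA)
  refine ⟨max M 0, le_max_right _ _, fun g f hg hf => ?_⟩
  filter_upwards [ae_fst hg, ae_snd hf] with z h1 h2
  rw [kernelIntegrand, norm_mul, norm_mul]
  by_cases hz1 : z.1 ∈ A
  · by_cases hz2 : z.2 ∈ A
    · have := (hM z ⟨hz1, hz2⟩).trans (le_max_left M 0)
      calc ‖g z.1‖ * ‖K z.1 z.2‖ * ‖f z.2‖ ≤ ‖g z.1‖ * max M 0 * ‖f z.2‖ := by gcongr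
        _ = _ := by ring
    · rw [h2 hz2]; simp
  · rw [h1 hz1]; simp

theorem IsLocBddKernel.integrable (hK : IsLocBddKernel K) {g f : Rn n → ℂ} (hg : MemLpc g 1)
    (hf : MemLpc f 1) : Integrable (kernelIntegrand K g f) := by
  have hgi := hg.integrable
  have hfi := hf.integrable
  obtain ⟨_, A, hA, hgA⟩ := hg
  obtain ⟨_, A', hA', hfA⟩ := hf
  obtain ⟨M, hM0, hM⟩ := hK.bound_ae (hA.union hA')
  refine Integrable.mono' ((hgi.norm.mul_prod hfi.norm).const_mul M) ?_
    (hM g f (hgA.mono Set.subset_union_left) (hfA.mono Set.subset_union_right))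
  exact (hgi.1.comp_fst.mul hK.measurable).mul hfi.1.comp_snd

theorem IsLocBddKernel.norm_kernelForm_le (hK : IsLocBddKernel K) {A : Set (Rn n)}
    (hA : IsCompact A) : ∃ M : ℝ, 0 ≤ M ∧ ∀ g f : Rn n → ℂ, MemLpc g 1 → MemLpc f 1 →
      SupportedIn g A → SupportedIn f A →
      ‖kernelForm K g f‖ ≤ M * ((∫ x, ‖g x‖) * ∫ x, ‖f x‖) := by
  obtain ⟨M, hM0, hM⟩ := hK.bound_ae hA
  refine ⟨M, hM0, fun g f hg hf hgA hfA => ?_⟩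
  refine (norm_integral_le_of_norm_le ((hg.integrable.norm.mul_prod hf.integrable.norm).const_mul M)
    (hM g f hgA hfA)).trans (le_of_eq ?_)
  rw [integral_const_mul]
  congr 1
  exact integral_prod_mul (fun x => ‖g x‖) (fun x => ‖f x‖)

theorem kernelForm_add_left {g₁ g₂ f : Rn n → ℂ} (h1 : Integrable (kernelIntegrand K g₁ f))
    (h2 : Integrable (kernelIntegrand K g₂ f)) :
    kernelForm K (g₁ + g₂) f = kernelForm K g₁ f + kernelForm K g₂ f := by
  rw [kernelForm, kernelForm, kernelForm, ← integral_add h1 h2]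
  refine integral_congr_ae (Eventually.of_forall fun z => ?_)
  simp only [kernelIntegrand, Pi.add_apply]
  ring

theorem kernelForm_add_right {g f₁ f₂ : Rn n → ℂ} (h1 : Integrable (kernelIntegrand K g f₁))
    (h2 : Integrable (kernelIntegrand K g f₂)) :
    kernelForm K g (f₁ + f₂) = kernelForm K g f₁ + kernelForm K g f₂ := by
  rw [kernelForm, kernelForm, kernelForm, ← integral_add h1 h2]
  refine integral_congr_ae (Eventually.of_forall fun z => ?_)
  simp only [kernelIntegrand, Pi.add_apply]
  ring

theorem kernelForm_smul_left (c : ℂ) (g f : Rn n → ℂ) :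
    kernelForm K (c • g) f = c * kernelForm K g f := by
  rw [kernelForm, kernelForm, ← integral_const_mul]
  refine integral_congr_ae (Eventually.of_forall fun z => ?_)
  simp only [kernelIntegrand, Pi.smul_apply, smul_eq_mul]
  ring

theorem kernelForm_smul_right (c : ℂ) (g f : Rn n → ℂ) :
    kernelForm K g (c • f) = c * kernelForm K g f := by
  rw [kernelForm, kernelForm, ← integral_const_mul]
  refine integral_congr_ae (Eventually.of_forall fun z => ?_)
  simp only [kernelIntegrand, Pi.smul_apply, smul_eq_mul]
  ring

theorem kernelForm_zero_left (f : Rn n → ℂ) : kernelForm K 0 f = 0 := by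
  simp [kernelForm, kernelIntegrand]

theorem kernelForm_zero_right (g : Rn n → ℂ) : kernelForm K g 0 = 0 := by
  simp [kernelForm, kernelIntegrand]

theorem IsLocBddKernel.kernelForm_sum (hK : IsLocBddKernel K) {ι κ : Type*} (s : Finset ι)
    (t : Finset κ) (c : ι → ℂ) (d : κ → ℂ) {g : ι → Rn n → ℂ} {f : κ → Rn n → ℂ}
    (hg : ∀ i ∈ s, MemLpc (g i) 1) (hf : ∀ i ∈ t, MemLpc (f i) 1) :
    kernelForm K (∑ i ∈ s, c i • g i) (∑ i ∈ t, d i • f i) =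
      ∑ i ∈ s, ∑ j ∈ t, c i * d j * kernelForm K (g i) (f j) := by
  classical
  have hF : ∀ (t' : Finset κ), t' ⊆ t → MemLpc (∑ i ∈ t', d i • f i) 1 := fun t' ht' =>
    MemLpc.sum _ fun i hi => (hf i (ht' hi)).smul _
  have right : ∀ g0 : Rn n → ℂ, MemLpc g0 1 → ∀ t' : Finset κ, t' ⊆ t →
      kernelForm K g0 (∑ i ∈ t', d i • f i) = ∑ j ∈ t', d j * kernelForm K g0 (f j) := by
    intro g0 hg0 t'
    induction t' using Finset.induction_on with
    | empty => intro _; simp [kernelForm_zero_right]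
    | insert a t' ha ih =>
      intro hsub
      have hsub' : t' ⊆ t := fun i hi => hsub (Finset.mem_insert_of_mem hi)
      have hat : a ∈ t := hsub (Finset.mem_insert_self a t')
      rw [Finset.sum_insert ha, Finset.sum_insert ha, kernelForm_add_right
        (hK.integrable hg0 ((hf a hat).smul _)) (hK.integrable hg0 (hF t' hsub')),
        kernelForm_smul_right, ih hsub']
  have left : ∀ s' : Finset ι, s' ⊆ s →
      kernelForm K (∑ i ∈ s', c i • g i) (∑ i ∈ t, d i • f i) =
        ∑ i ∈ s', ∑ j ∈ t, c i * d j * kernelForm K (g i) (f j) := by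
    intro s'
    induction s' using Finset.induction_on with
    | empty => intro _; simp [kernelForm_zero_left]
    | insert a s' ha ih =>
      intro hsub
      have hsub' : s' ⊆ s := fun i hi => hsub (Finset.mem_insert_of_mem hi)
      have has : a ∈ s := hsub (Finset.mem_insert_self a s')
      rw [Finset.sum_insert ha, Finset.sum_insert ha, kernelForm_add_left
        (hK.integrable ((hg a has).smul _) (hF t subset_rfl))
        (hK.integrable (MemLpc.sum _ fun i hi => (hg i (hsub' hi)).smul _) (hF t subset_rfl)),
        kernelForm_smul_left, ih hsub', right _ (hg a has) t subset_rfl, Finset.mul_sum]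
      simp only [mul_assoc]
  exact left s subset_rfl

end

section

variable {n : ℕ}

/-! ### The algebra of the BCR algorithm -/

/-- The bilinear form with matrix `t`. -/
def dform (t : Lat n → Lat n → ℂ) (a b : Lat n → ℂ) : ℂ := ∑' u, a u * ∑' v, t u v * b v

theorem dform_eq_sum (t : Lat n → Lat n → ℂ) {a b : Lat n → ℂ} {S S' : Finset (Lat n)}
    (ha : ∀ u ∉ S, a u = 0) (hb : ∀ v ∉ S', b v = 0) :
    dform t a b = ∑ u ∈ S, ∑ v ∈ S', a u * t u v * b v := by
  rw [dform, tsum_eq_sum (s := S) (fun u hu => by rw [ha u hu, zero_mul])]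
  refine Finset.sum_congr rfl fun u _ => ?_
  rw [tsum_eq_sum (s := S') (fun v hv => by rw [hb v hv, mul_zero]), Finset.mul_sum]
  exact Finset.sum_congr rfl fun v _ => by ring

theorem sum_biUnion_box {M : Type*} [AddCommMonoid M] (r : ℕ) (S : Finset (Lat n))
    (F : Lat n → M) : ∑ u ∈ S.biUnion (box r), F u = ∑ k ∈ S, ∑ u ∈ box r k, F u := by
  rw [Finset.sum_biUnion]
  intro a _ b _ hab
  rw [Function.onFun, Finset.disjoint_left]
  intro x hx hx'
  exact hab ((mem_box.1 hx).symm.trans (mem_box.1 hx'))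

theorem exists_finset_anc {a : Lat n → ℂ} (ha : a.support.Finite) :
    ∃ S : Finset (Lat n), ∀ u, anc 1 u ∉ S → a u = 0 := by
  refine ⟨(ha.image (anc 1)).toFinset, fun u hu => ?_⟩
  by_contra h
  exact hu (by simpa using ⟨u, h, rfl⟩)

/-- Pairs of children are grouped by pairs of parents. Sums over (k, l) at scale j thereby become
matrix sums at scale j + 1. -/
theorem tsum_box_box_eq_dform (t : Lat n → Lat n → ℂ) {a b : Lat n → ℂ}
    (ha : a.support.Finite) (hb : b.support.Finite) :
    ∑' kl : Lat n × Lat n, ∑ u ∈ box 1 kl.1, ∑ v ∈ box 1 kl.2, a u * t u v * b v = dform t a b := by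
  obtain ⟨S, hS⟩ := exists_finset_anc ha
  obtain ⟨S', hS'⟩ := exists_finset_anc hb
  rw [dform_eq_sum t (S := S.biUnion (box 1)) (S' := S'.biUnion (box 1)), sum_biUnion_box,
    tsum_eq_sum (s := S ×ˢ S'), Finset.sum_product]
  · refine Finset.sum_congr rfl fun k _ => ?_
    simp only [sum_biUnion_box]
    rw [Finset.sum_comm]
  · intro kl hkl
    refine Finset.sum_eq_zero fun u hu => Finset.sum_eq_zero fun v hv => ?_
    rw [Finset.mem_product, not_and_or] at hkl
    rcases hkl with h | h
    · rw [hS u (by rwa [mem_box.1 hu]), zero_mul, zero_mul]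
    · rw [hS' v (by rwa [mem_box.1 hv]), mul_zero]
  · intro u hu
    exact hS u fun h => hu (Finset.mem_biUnion.2 ⟨_, h, mem_box.2 rfl⟩)
  · intro u hu
    exact hS' u fun h => hu (Finset.mem_biUnion.2 ⟨_, h, mem_box.2 rfl⟩)

theorem tsum_box_eq_dform {t : Lat n → Lat n → ℂ} (ht : ∀ u v, anc 1 u ≠ anc 1 v → t u v = 0)
    {a b : Lat n → ℂ} (ha : a.support.Finite) (hb : b.support.Finite) :
    ∑' k : Lat n, ∑ u ∈ box 1 k, ∑ v ∈ box 1 k, a u * t u v * b v = dform t a b := by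
  rw [← tsum_box_box_eq_dform t ha hb]
  obtain ⟨S, hS⟩ := exists_finset_anc ha
  rw [tsum_eq_sum (s := S), tsum_eq_sum (s := S.image fun k => (k, k)),
    Finset.sum_image (fun _ _ _ _ h => (Prod.ext_iff.1 h).1)]
  · intro kl hkl
    refine Finset.sum_eq_zero fun u hu => Finset.sum_eq_zero fun v hv => ?_
    by_cases h : kl.1 = kl.2
    · rw [hS u, zero_mul, zero_mul]
      intro hmem
      rw [mem_box.1 hu] at hmem
      exact hkl (Finset.mem_image.2 ⟨kl.1, hmem, Prod.ext rfl h⟩)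
    · rw [ht u v (by rw [mem_box.1 hu, mem_box.1 hv]; exact h), mul_zero, zero_mul]
  · intro k hk
    refine Finset.sum_eq_zero fun u hu => Finset.sum_eq_zero fun v hv => ?_
    rw [hS u (by rwa [mem_box.1 hu]), zero_mul, zero_mul]

theorem dform_add (t t' : Lat n → Lat n → ℂ) {a b : Lat n → ℂ} (ha : a.support.Finite)
    (hb : b.support.Finite) :
    dform (fun u v => t u v + t' u v) a b = dform t a b + dform t' a b := by
  have ha' : ∀ u ∉ ha.toFinset, a u = 0 := fun u hu => by simpa using hu
  have hb' : ∀ u ∉ hb.toFinset, b u = 0 := fun u hu => by simpa using hu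
  simp only [dform_eq_sum _ ha' hb', ← Finset.sum_add_distrib]
  refine Finset.sum_congr rfl fun u _ => Finset.sum_congr rfl fun v _ => ?_
  ring

/-- The matrix entry `⟨φ_{j,u}, T φ_{j,v}⟩`. -/
def kap (K : Rn n → Rn n → ℂ) (j : ℤ) (u v : Lat n) : ℂ := kernelForm K (phi j u) (phi j v)

/-- The combination of three coefficient families, in the basis of the children. -/
def haarComb (A : HaarIndex n → HaarIndex n → ℂ) (B C : HaarIndex n → ℂ) (u v : Lat n) : ℂ :=
  (∑ ε : HaarIndex n, ∑ ε' : HaarIndex n, hco ε.1 u * A ε ε' * hco ε'.1 v) +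
    (∑ ε : HaarIndex n, hco ε.1 u * B ε * rt n) + ∑ ε : HaarIndex n, rt n * C ε * hco ε.1 v

theorem sum_box_mul_mul (s s' : Finset (Lat n)) (a b p q : Lat n → ℂ) (c : ℂ) :
    ∑ u ∈ s, ∑ v ∈ s', a u * (p u * c * q v) * b v =
      (∑ u ∈ s, p u * a u) * c * ∑ v ∈ s', q v * b v := by
  rw [Finset.sum_mul, Finset.sum_mul]
  refine Finset.sum_congr rfl fun u _ => ?_
  rw [Finset.mul_sum]
  refine Finset.sum_congr rfl fun v _ => ?_
  ring

/-- Each bracket with a Haar function is expanded in the scaling coefficients of the children. One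
matrix thus carries the three coefficient families, and the estimates need only deal with forms in
`scoef (j + 1)`. -/
theorem sum_box_haarComb (A : HaarIndex n → HaarIndex n → ℂ) (B C : HaarIndex n → ℂ) (j : ℤ)
    (k l : Lat n) {g f : Rn n → ℂ} (hg : Integrable g) (hf : Integrable f) :
    (∑ ε : HaarIndex n, ∑ ε' : HaarIndex n,
        bracket g (psi ε j k) * A ε ε' * bracket (psi ε' j l) f) +
      (∑ ε : HaarIndex n, bracket g (psi ε j k) * B ε * bracket (phi j l) f) +
      (∑ ε : HaarIndex n, bracket g (phi j k) * C ε * bracket (psi ε j l) f) =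
    ∑ u ∈ box 1 k, ∑ v ∈ box 1 l,
      scoef (j + 1) g u * haarComb A B C u v * scoef (j + 1) f v := by
  have h1 : ∀ u v, scoef (j + 1) g u * haarComb A B C u v * scoef (j + 1) f v =
      (∑ ε : HaarIndex n, ∑ ε' : HaarIndex n,
        scoef (j + 1) g u * (hco ε.1 u * A ε ε' * hco ε'.1 v) * scoef (j + 1) f v) +
      (∑ ε : HaarIndex n, scoef (j + 1) g u * (hco ε.1 u * B ε * hco (fun _ => false) v) *
        scoef (j + 1) f v) +
      ∑ ε : HaarIndex n, scoef (j + 1) g u * (hco (fun _ => false) u * C ε * hco ε.1 v) *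
        scoef (j + 1) f v := fun u v => by
    simp only [haarComb, hco_false, mul_add, add_mul, Finset.mul_sum, Finset.sum_mul]
  simp only [h1, Finset.sum_add_distrib]
  congr 1
  · congr 1
    · symm
      calc _ = ∑ ε : HaarIndex n, ∑ ε' : HaarIndex n, ∑ u ∈ box 1 k, ∑ v ∈ box 1 l,
            scoef (j + 1) g u * (hco ε.1 u * A ε ε' * hco ε'.1 v) * scoef (j + 1) f v := by
            rw [Finset.sum_congr rfl fun u _ => Finset.sum_comm, Finset.sum_comm]
            refine Finset.sum_congr rfl fun ε _ => ?_
            rw [Finset.sum_congr rfl fun u _ => Finset.sum_comm, Finset.sum_comm]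
        _ = _ := by
            refine Finset.sum_congr rfl fun ε _ => Finset.sum_congr rfl fun ε' _ => ?_
            rw [sum_box_mul_mul, bracket_comm g, psi_eq_haar, psi_eq_haar, bracket_haar _ _ _ hg,
              bracket_haar _ _ _ hf]
    · symm
      rw [Finset.sum_congr rfl fun u _ => Finset.sum_comm, Finset.sum_comm]
      refine Finset.sum_congr rfl fun ε _ => ?_
      rw [sum_box_mul_mul, bracket_comm g, psi_eq_haar, phi_eq_haar, bracket_haar _ _ _ hg,
        bracket_haar _ _ _ hf]
  · symm
    rw [Finset.sum_congr rfl fun u _ => Finset.sum_comm, Finset.sum_comm]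
    refine Finset.sum_congr rfl fun ε _ => ?_
    rw [sum_box_mul_mul, bracket_comm g, psi_eq_haar, phi_eq_haar, bracket_haar _ _ _ hg,
      bracket_haar _ _ _ hf]

variable (K : Rn n → Rn n → ℂ)

/-- The matrix of the off-diagonal part at scale `j`. -/
def tco (j : ℤ) (u v : Lat n) : ℂ :=
  haarComb (fun ε ε' => coefAlpha K j ε ε' (anc 1 u) (anc 1 v))
    (fun ε => coefBeta K j ε (anc 1 u) (anc 1 v)) (fun ε => coefGamma K j ε (anc 1 u) (anc 1 v)) u v

/-- The matrix of the diagonal part at scale `j`. -/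
def dco (j : ℤ) (u v : Lat n) : ℂ :=
  haarComb (fun ε ε' => coefA K j ε ε' (anc 1 u) (anc 1 v) - coefAlpha K j ε ε' (anc 1 u) (anc 1 v))
    (fun ε => coefB K j ε (anc 1 u) (anc 1 v) - coefBeta K j ε (anc 1 u) (anc 1 v))
    (fun ε => coefC K j ε (anc 1 u) (anc 1 v) - coefGamma K j ε (anc 1 u) (anc 1 v)) u v

/-- α, β, γ agree with a, b, c off the diagonal, so the remainder couples only children of one cube.
This is the source of the perfect dyadic property and of the stabilization of the kernel. -/
theorem dco_eq_zero {j : ℤ} {u v : Lat n} (h : anc 1 u ≠ anc 1 v) : dco K j u v = 0 := by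
  simp [dco, haarComb, coefAlpha, coefBeta, coefGamma, h]

theorem offDiagLevel_eq_dform (j : ℤ) {g f : Rn n → ℂ} (hg : MemLpc g 1) (hf : MemLpc f 1) :
    offDiagLevel K j g f = dform (tco K j) (scoef (j + 1) g) (scoef (j + 1) f) := by
  rw [← tsum_box_box_eq_dform _ (finite_support_scoef hg _) (finite_support_scoef hf _),
    offDiagLevel]
  refine tsum_congr fun kl => ?_
  rw [sum_box_haarComb _ _ _ _ _ _ hg.integrable hf.integrable]
  refine Finset.sum_congr rfl fun u hu => Finset.sum_congr rfl fun v hv => ?_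
  rw [tco, mem_box.1 hu, mem_box.1 hv]

theorem diagLevel_eq_dform (j : ℤ) {g f : Rn n → ℂ} (hg : MemLpc g 1) (hf : MemLpc f 1) :
    diagLevel K j g f = dform (dco K j) (scoef (j + 1) g) (scoef (j + 1) f) := by
  rw [← tsum_box_eq_dform (fun u v h => dco_eq_zero K h) (finite_support_scoef hg _)
    (finite_support_scoef hf _), diagLevel]
  refine tsum_congr fun k => ?_
  rw [sum_box_haarComb _ _ _ _ _ _ hg.integrable hf.integrable]
  refine Finset.sum_congr rfl fun u hu => Finset.sum_congr rfl fun v hv => ?_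
  rw [dco, mem_box.1 hu, mem_box.1 hv]

variable {K}

theorem kernelForm_projV (hK : IsLocBddKernel K) (j : ℤ) {g f : Rn n → ℂ} (hg : MemLpc g 1)
    (hf : MemLpc f 1) :
    kernelForm K (projV j g) (projV j f) = dform (kap K j) (scoef j g) (scoef j f) := by
  have hg' : ∀ k ∉ (finite_support_scoef hg j).toFinset, scoef j g k = 0 := fun k hk => by
    simpa using hk
  have hf' : ∀ k ∉ (finite_support_scoef hf j).toFinset, scoef j f k = 0 := fun k hk => by
    simpa using hk
  rw [projV_eq_sum j g hg', projV_eq_sum j f hf', dform_eq_sum _ hg' hf',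
    hK.kernelForm_sum _ _ _ _ (fun k _ => memLpc_phi j k 1) (fun k _ => memLpc_phi j k 1)]
  refine Finset.sum_congr rfl fun u _ => Finset.sum_congr rfl fun v _ => ?_
  rw [kap]
  ring

theorem sum_bool_eq (F : (Fin n → Bool) → ℂ) :
    ∑ ε, F ε = F (fun _ => false) + ∑ ε : HaarIndex n, F ε.1 := by
  classical
  rw [← Finset.add_sum_erase Finset.univ F (Finset.mem_univ (fun _ => false))]
  congr 1
  refine Finset.sum_subtype _ (fun ε => ?_) F
  simp

/-- The matrix of `T` at scale `j + 1`, in terms of scale `j`. -/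
theorem kap_succ (hK : IsLocBddKernel K) (j : ℤ) (u v : Lat n) :
    kap K (j + 1) u v =
      rt n * kap K j (anc 1 u) (anc 1 v) * rt n + (tco K j u v + dco K j u v) := by
  have hphi : ∀ w : Lat n, phi (j + 1) w = ∑ ε : Fin n → Bool, hco ε w • haar ε j (anc 1 w) := by
    intro w
    ext x
    rw [phi_succ_eq_sum]
    simp [Finset.sum_apply]
  rw [kap, hphi u, hphi v, hK.kernelForm_sum _ _ _ _ (fun ε _ => memLpc_haar ε j _ 1)
    (fun ε _ => memLpc_haar ε j _ 1)]
  -- Separating ε = 0 in both variables gives four types of terms: the pair (0, 0) is the coarse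
  -- matrix, the others are the coefficients a, b, c, and adding `tco` and `dco` restores these.
  rw [sum_bool_eq, sum_bool_eq]
  rw [Finset.sum_congr rfl fun ε _ => sum_bool_eq _]
  simp only [tco, dco, haarComb, coefA, coefB, coefC, kap, psi_eq_haar, phi_eq_haar, hco_false,
    mul_sub, sub_mul, Finset.sum_sub_distrib, Finset.sum_add_distrib]
  have e1 : ∑ x : HaarIndex n, (rt n : ℂ) * hco x.1 v * kernelForm K (haar (fun _ => false) j (anc 1 u))
      (haar x.1 j (anc 1 v)) = ∑ x : HaarIndex n, (rt n : ℂ) * kernelForm K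
        (haar (fun _ => false) j (anc 1 u)) (haar x.1 j (anc 1 v)) * hco x.1 v :=
    Finset.sum_congr rfl fun x _ => by ring
  have e2 : ∑ x : HaarIndex n, hco x.1 u * (rt n : ℂ) * kernelForm K (haar x.1 j (anc 1 u))
      (haar (fun _ => false) j (anc 1 v)) = ∑ x : HaarIndex n, hco x.1 u * kernelForm K
        (haar x.1 j (anc 1 u)) (haar (fun _ => false) j (anc 1 v)) * (rt n : ℂ) :=
    Finset.sum_congr rfl fun x _ => by ring
  have e3 : ∑ x : HaarIndex n, ∑ y : HaarIndex n, hco x.1 u * hco y.1 v *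
      kernelForm K (haar x.1 j (anc 1 u)) (haar y.1 j (anc 1 v)) =
      ∑ x : HaarIndex n, ∑ y : HaarIndex n, hco x.1 u *
      kernelForm K (haar x.1 j (anc 1 u)) (haar y.1 j (anc 1 v)) * hco y.1 v :=
    Finset.sum_congr rfl fun x _ => Finset.sum_congr rfl fun y _ => by ring
  rw [e1, e2, e3]
  ring

/-- One step of the telescoping sum of the BCR algorithm. -/
theorem kernelForm_projV_succ (hK : IsLocBddKernel K) (j : ℤ) {g f : Rn n → ℂ} (hg : MemLpc g 1)
    (hf : MemLpc f 1) :
    kernelForm K (projV (j + 1) g) (projV (j + 1) f) =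
      kernelForm K (projV j g) (projV j f) + (offDiagLevel K j g f + diagLevel K j g f) := by
  have ha := finite_support_scoef hg (j + 1)
  have hb := finite_support_scoef hf (j + 1)
  have ha' := finite_support_scoef hg j
  have hb' := finite_support_scoef hf j
  rw [kernelForm_projV hK _ hg hf, offDiagLevel_eq_dform K j hg hf, diagLevel_eq_dform K j hg hf,
    ← dform_add _ _ ha hb]
  have e : kap K (j + 1) = fun u v => rt n * kap K j (anc 1 u) (anc 1 v) * rt n +
      (tco K j u v + dco K j u v) := by
    ext u v
    exact kap_succ hK j u v
  rw [e, dform_add _ _ ha hb]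
  congr 1
  rw [kernelForm_projV hK _ hg hf, ← tsum_box_box_eq_dform _ ha hb]
  rw [dform_eq_sum (kap K j) (S := ha'.toFinset) (S' := hb'.toFinset) (fun u hu => by simpa using hu)
    (fun u hu => by simpa using hu), ← Finset.sum_product']
  have term : ∀ kl : Lat n × Lat n, ∑ u ∈ box 1 kl.1, ∑ v ∈ box 1 kl.2,
      scoef (j + 1) g u * (rt n * kap K j (anc 1 u) (anc 1 v) * rt n) * scoef (j + 1) f v =
        scoef j g kl.1 * kap K j kl.1 kl.2 * scoef j f kl.2 := fun kl => by
    rw [scoef_eq_sum j kl.1 hg.integrable, scoef_eq_sum j kl.2 hf.integrable, Finset.mul_sum,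
      Finset.mul_sum, ← sum_box_mul_mul]
    refine Finset.sum_congr rfl fun u hu => Finset.sum_congr rfl fun v hv => ?_
    rw [mem_box.1 hu, mem_box.1 hv]
  rw [tsum_congr term, tsum_eq_sum (s := ha'.toFinset ×ˢ hb'.toFinset)]
  intro kl hkl
  rw [Finset.mem_product, not_and_or] at hkl
  rcases hkl with h | h
  · rw [show scoef j g kl.1 = 0 by simpa using h, zero_mul, zero_mul]
  · rw [show scoef j f kl.2 = 0 by simpa using h, mul_zero]

theorem sum_Ico_int_succ_top {M : Type*} [AddCommMonoid M] {a b : ℤ} (hab : a ≤ b) (F : ℤ → M) :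
    ∑ j ∈ Finset.Ico a (b + 1), F j = ∑ j ∈ Finset.Ico a b, F j + F b := by
  have : Finset.Ico a (b + 1) = insert b (Finset.Ico a b) := by
    ext j
    simp only [Finset.mem_Ico, Finset.mem_insert]
    omega
  rw [this, Finset.sum_insert (by simp), add_comm]

/-- The telescoping sum of the BCR algorithm. -/
theorem kernelForm_projV_telescope (hK : IsLocBddKernel K) {g f : Rn n → ℂ} (hg : MemLpc g 1)
    (hf : MemLpc f 1) (a : ℤ) (m : ℕ) :
    kernelForm K (projV (a + m) g) (projV (a + m) f) =
      kernelForm K (projV a g) (projV a f) + (∑ j ∈ Finset.Ico a (a + m), offDiagLevel K j g f +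
        ∑ j ∈ Finset.Ico a (a + m), diagLevel K j g f) := by
  induction m with
  | zero => simp
  | succ m ih =>
    push_cast
    rw [← add_assoc, kernelForm_projV_succ hK _ hg hf, ih, sum_Ico_int_succ_top (by omega),
      sum_Ico_int_succ_top (by omega)]
    ring

end

/-! ### Estimates for kernels with size and regularity conditions, and for the matrices they
produce. -/

section

variable {n : ℕ}

/-! ### The kernel `|x - y|^{-n}` across a hyperplane -/

/-- Translation removes w₀ and the substitution w ↦ a w extracts a^{m - (m+1)} = a^{-1}; the
integral for a = 1 converges because the exponent m + 1 exceeds the dimension. -/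
theorem exists_lintegral_add_norm_le (m : ℕ) : ∃ C : ℝ≥0∞, C ≠ ⊤ ∧ ∀ a : ℝ, 0 < a →
    ∀ w₀ : Fin m → ℝ, ∫⁻ w : Fin m → ℝ, ENNReal.ofReal (((a + ‖w₀ - w‖) ^ (m + 1))⁻¹) ≤
      C * ENNReal.ofReal a⁻¹ := by
  refine ⟨∫⁻ w : Fin m → ℝ, ENNReal.ofReal (((1 + ‖w‖) ^ (m + 1))⁻¹), ?_, fun a ha w₀ => ?_⟩
  · have h := finite_integral_one_add_norm (E := Fin m → ℝ) (μ := volume) (r := ((m + 1 : ℕ) : ℝ))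
      (by simp)
    refine ne_of_lt (lt_of_eq_of_lt (lintegral_congr fun w => ?_) h)
    rw [Real.rpow_neg (by positivity), Real.rpow_natCast]
  · have hF : Measurable fun w : Fin m → ℝ => ENNReal.ofReal (((1 + ‖w‖) ^ (m + 1))⁻¹) := by
      fun_prop
    rw [lintegral_sub_left_eq_self (fun w : Fin m → ℝ =>
      ENNReal.ofReal (((a + ‖w‖) ^ (m + 1))⁻¹)) w₀]
    have h1 : ∀ w : Fin m → ℝ, ENNReal.ofReal (((a + ‖w‖) ^ (m + 1))⁻¹) =
        ENNReal.ofReal ((a ^ (m + 1))⁻¹) * ENNReal.ofReal (((1 + ‖a⁻¹ • w‖) ^ (m + 1))⁻¹) := by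
      intro w
      rw [← ENNReal.ofReal_mul (by positivity), ← mul_inv, ← mul_pow, norm_smul, Real.norm_eq_abs,
        abs_of_pos (inv_pos.2 ha)]
      congr 4
      field_simp
    simp_rw [h1]
    rw [lintegral_const_mul _ (by fun_prop)]
    have h2 := lintegral_map (μ := (volume : Measure (Fin m → ℝ))) hF
      (measurable_const_smul (a⁻¹ : ℝ))
    rw [Measure.map_addHaar_smul _ (inv_ne_zero ha.ne'), lintegral_smul_measure] at h2
    rw [← h2, smul_eq_mul, ← mul_assoc, ← ENNReal.ofReal_mul (by positivity), mul_comm]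
    refine mul_le_mul' le_rfl (ENNReal.ofReal_le_ofReal (le_of_eq ?_))
    rw [abs_of_pos (by positivity)]
    simp only [Module.finrank_fintype_fun_eq_card, Fintype.card_fin, inv_pow, inv_inv]
    field_simp
    ring

theorem lintegral_comp_abs {F : ℝ → ℝ≥0∞} (hF : Measurable F) :
    ∫⁻ t, F |t| = 2 * ∫⁻ t in Set.Ioi 0, F t := by
  have h0 : ∫⁻ t, F |t| = (∫⁻ t in Set.Iic 0, F |t|) + ∫⁻ t in Set.Ioi 0, F |t| := by
    rw [← lintegral_add_compl _ measurableSet_Iic (A := Set.Iic (0 : ℝ)), Set.compl_Iic]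
  have h1 : ∫⁻ t in Set.Ioi 0, F |t| = ∫⁻ t in Set.Ioi 0, F t :=
    setLIntegral_congr_fun measurableSet_Ioi fun t ht => by rw [abs_of_pos ht]
  have h2 : ∫⁻ t in Set.Iic 0, F |t| = ∫⁻ t in Set.Ioi 0, F |t| := by
    rw [setLIntegral_congr (Iio_ae_eq_Iic (a := (0 : ℝ))).symm]
    rw [← (Measure.measurePreserving_neg (volume : Measure ℝ)).setLIntegral_comp_preimage
      measurableSet_Iio (f := fun t => F |t|) (hF.comp measurable_abs)]
    simp
  rw [h0, h2, h1, two_mul]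

/-- The one-dimensional Schur estimate for the Hilbert-type kernel 1/(d + |t|) with weight |t|^{-θ}.
The integral is split at |t| = d; the inner part needs θ < 1 and the outer part θ > 0. -/
theorem lintegral_abs_rpow_div_le {θ : ℝ} (h0 : 0 < θ) (h1 : θ < 1) {d : ℝ} (hd : 0 < d) (c : ℝ) :
    ∫⁻ t, ENNReal.ofReal (|t - c| ^ (-θ)) * ENNReal.ofReal (d + |t - c|)⁻¹ ≤
      ENNReal.ofReal (2 * (1 / (1 - θ) + 1 / θ)) * ENNReal.ofReal (d ^ (-θ)) := by
  rw [lintegral_sub_right_eq_self (fun t : ℝ =>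
    ENNReal.ofReal (|t| ^ (-θ)) * ENNReal.ofReal (d + |t|)⁻¹) c]
  rw [lintegral_comp_abs (F := fun t => ENNReal.ofReal (t ^ (-θ)) * ENNReal.ofReal (d + t)⁻¹)
    (by fun_prop)]
  rw [ENNReal.ofReal_mul (by norm_num), mul_assoc, ENNReal.ofReal_ofNat]
  refine mul_le_mul' le_rfl ?_
  have hsplit : Set.Ioi (0 : ℝ) = Set.Ioc 0 d ∪ Set.Ioi d := (Set.Ioc_union_Ioi_eq_Ioi hd.le).symm
  rw [hsplit]
  refine (lintegral_union_le _ _ _).trans ?_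
  have hθ' : 0 < 1 - θ := by linarith
  rw [ENNReal.ofReal_add (by positivity) (by positivity), add_mul]
  refine add_le_add ?_ ?_
  · calc ∫⁻ t in Set.Ioc 0 d, ENNReal.ofReal (t ^ (-θ)) * ENNReal.ofReal (d + t)⁻¹
        ≤ ∫⁻ t in Set.Ioc 0 d, ENNReal.ofReal (t ^ (-θ)) * ENNReal.ofReal d⁻¹ := by
          refine setLIntegral_mono' measurableSet_Ioc fun t ht => mul_le_mul' le_rfl ?_
          refine ENNReal.ofReal_le_ofReal (inv_anti₀ hd ?_)
          linarith [ht.1]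
      _ = ENNReal.ofReal (d ^ (-θ + 1) / (-θ + 1)) * ENNReal.ofReal d⁻¹ := by
          rw [lintegral_mul_const _ (by fun_prop), lintegral_Ioc_rpow hd (by linarith)]
      _ ≤ _ := by
          rw [← ENNReal.ofReal_mul (by
            have : 0 < -θ + 1 := by linarith
            positivity), ← ENNReal.ofReal_mul (by positivity), Real.rpow_add_one hd.ne']
          refine ENNReal.ofReal_le_ofReal (le_of_eq ?_)
          rw [show -θ + 1 = 1 - θ by ring]
          field_simp
  · calc ∫⁻ t in Set.Ioi d, ENNReal.ofReal (t ^ (-θ)) * ENNReal.ofReal (d + t)⁻¹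
        ≤ ∫⁻ t in Set.Ioi d, ENNReal.ofReal (t ^ (-θ - 1)) := by
          refine setLIntegral_mono' measurableSet_Ioi fun t ht => ?_
          have ht0 : 0 < t := hd.trans ht
          rw [← ENNReal.ofReal_mul (by positivity), Real.rpow_sub_one ht0.ne', div_eq_mul_inv]
          refine ENNReal.ofReal_le_ofReal (mul_le_mul_of_nonneg_left (inv_anti₀ ht0 ?_)
            (by positivity))
          linarith
      _ = ENNReal.ofReal (-d ^ (-θ - 1 + 1) / (-θ - 1 + 1)) := lintegral_Ioi_rpow hd (by linarith)
      _ ≤ _ := by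
          rw [← ENNReal.ofReal_mul (by positivity)]
          refine ENNReal.ofReal_le_ofReal (le_of_eq ?_)
          rw [sub_add_cancel]
          field_simp

/-- The kernel `|x - y|^{-n}`, restricted to pairs separated by the hyperplane `x_i = c`. -/
def sepKernel (i : Fin n) (c : ℝ) (x y : Rn n) : ℝ≥0∞ :=
  if (x i - c) * (y i - c) < 0 then ENNReal.ofReal ((‖x - y‖ ^ n)⁻¹) else 0

theorem sepKernel_comm (i : Fin n) (c : ℝ) (x y : Rn n) :
    sepKernel i c x y = sepKernel i c y x := by
  rw [sepKernel, sepKernel, mul_comm, norm_sub_rev]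

theorem measurable_apply (i : Fin n) : Measurable fun x : Rn n => x i :=
  (EuclideanSpace.proj (𝕜 := ℝ) i).continuous.measurable

theorem measurable_sepKernel (i : Fin n) (c : ℝ) :
    Measurable fun z : Rn n × Rn n => sepKernel i c z.1 z.2 := by
  unfold sepKernel
  have h1 : Measurable fun z : Rn n × Rn n => z.1 i := (measurable_apply i).comp measurable_fst
  have h2 : Measurable fun z : Rn n × Rn n => z.2 i := (measurable_apply i).comp measurable_snd
  refine Measurable.ite (measurableSet_lt ((h1.sub_const c).mul (h2.sub_const c)) measurable_const)
    ?_ measurable_const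
  fun_prop

theorem abs_sub_eq_of_mul_neg {a b : ℝ} (h : a * b < 0) : |a - b| = |a| + |b| := by
  rcases mul_neg_iff.1 h with ⟨ha, hb⟩ | ⟨ha, hb⟩
  · rw [abs_of_pos ha, abs_of_neg hb, abs_of_pos (by linarith)]; ring
  · rw [abs_of_neg ha, abs_of_pos hb, abs_of_neg (by linarith)]; ring

/-- For points on opposite sides of the hyperplane, |x - y| dominates both |x_i - c| + |y_i - c| and
the distance of the remaining coordinates. Integrating out the n - 1 tangential coordinates leaves
the one-dimensional Hilbert-type kernel. -/
theorem exists_lintegral_sepKernel_le (hn : 0 < n) {θ : ℝ} (h0 : 0 < θ) (h1 : θ < 1) :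
    ∃ C : ℝ≥0∞, C ≠ ⊤ ∧ ∀ (i : Fin n) (c : ℝ) (x : Rn n),
      ∫⁻ y, sepKernel i c x y * ENNReal.ofReal (|y i - c| ^ (-θ)) ≤
        C * ENNReal.ofReal (|x i - c| ^ (-θ)) := by
  obtain ⟨m, rfl⟩ : ∃ m, n = m + 1 := ⟨n - 1, by omega⟩
  obtain ⟨C₁, hC₁, H⟩ := exists_lintegral_add_norm_le m
  refine ⟨ENNReal.ofReal (2 ^ (m + 1)) * (C₁ * ENNReal.ofReal (2 * (1 / (1 - θ) + 1 / θ))),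
    ENNReal.mul_ne_top ENNReal.ofReal_ne_top (ENNReal.mul_ne_top hC₁ ENNReal.ofReal_ne_top),
    fun i c x => ?_⟩
  rcases eq_or_ne (x i) c with hx | hx
  · simp [sepKernel, hx]
  have hd : 0 < |x i - c| := abs_pos.2 (sub_ne_zero.2 hx)
  set d := |x i - c|
  set w₀ : Fin m → ℝ := fun k => x (i.succAbove k)
  set h : ℝ × (Fin m → ℝ) → ℝ≥0∞ := fun z => ENNReal.ofReal (2 ^ (m + 1)) *
    (ENNReal.ofReal (|z.1 - c| ^ (-θ)) *
      ENNReal.ofReal (((d + |z.1 - c| + ‖w₀ - z.2‖) ^ (m + 1))⁻¹)) with hh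
  have hhm : Measurable h := by fun_prop
  have hpt : ∀ y : Rn (m + 1), sepKernel i c x y * ENNReal.ofReal (|y i - c| ^ (-θ)) ≤
      h (MeasurableEquiv.piFinSuccAbove (fun _ => ℝ) i (WithLp.ofLp y)) := by
    intro y
    rw [sepKernel]
    split_ifs with hneg
    swap
    · rw [zero_mul]; exact zero_le
    have e : MeasurableEquiv.piFinSuccAbove (fun _ => ℝ) i (WithLp.ofLp y) =
      (y i, fun k => y (i.succAbove k)) := rfl
    rw [e, hh]
    simp only
    rw [mul_left_comm, mul_comm, ← ENNReal.ofReal_mul (p := 2 ^ (m + 1)) (by positivity)]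
    refine mul_le_mul' le_rfl (ENNReal.ofReal_le_ofReal ?_)
    have hle1 : d + |y i - c| ≤ ‖x - y‖ := by
      have := abs_sub_eq_of_mul_neg hneg
      rw [← this]
      have := PiLp.norm_apply_le (x - y) i
      simpa using this
    have hle2 : ‖w₀ - fun k => y (i.succAbove k)‖ ≤ ‖x - y‖ := by
      refine (pi_norm_le_iff_of_nonneg (norm_nonneg _)).2 fun k => ?_
      have := PiLp.norm_apply_le (x - y) (i.succAbove k)
      simpa using this
    have hpos : 0 < d + |y i - c| + ‖w₀ - fun k => y (i.succAbove k)‖ := by positivity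
    -- The two lower bounds for |x - y| are averaged, which accounts for the factor 2^{m+1}.
    have hle : (d + |y i - c| + ‖w₀ - fun k => y (i.succAbove k)‖) / 2 ≤ ‖x - y‖ := by linarith
    calc (‖x - y‖ ^ (m + 1))⁻¹
        ≤ (((d + |y i - c| + ‖w₀ - fun k => y (i.succAbove k)‖) / 2) ^ (m + 1))⁻¹ := by gcongr
      _ = _ := by rw [div_pow, inv_div, div_eq_mul_inv]
  calc ∫⁻ y, sepKernel i c x y * ENNReal.ofReal (|y i - c| ^ (-θ))
      ≤ ∫⁻ y : Rn (m + 1), h (MeasurableEquiv.piFinSuccAbove (fun _ => ℝ) i (WithLp.ofLp y)) :=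
        lintegral_mono hpt
    _ = ∫⁻ z, h z := by
        rw [(PiLp.volume_preserving_ofLp (Fin (m + 1))).lintegral_comp (f := fun y =>
          h (MeasurableEquiv.piFinSuccAbove (fun _ => ℝ) i y))
          (hhm.comp (MeasurableEquiv.measurable _))]
        exact (volume_preserving_piFinSuccAbove (fun _ => ℝ) i).lintegral_comp hhm
    _ = ∫⁻ t, ∫⁻ w, h (t, w) := by
        rw [Measure.volume_eq_prod, lintegral_prod _ hhm.aemeasurable]
    _ ≤ ∫⁻ t, ENNReal.ofReal (2 ^ (m + 1)) * (C₁ * (ENNReal.ofReal (|t - c| ^ (-θ)) *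
          ENNReal.ofReal (d + |t - c|)⁻¹)) := by
        refine lintegral_mono fun t => ?_
        simp only [hh]
        rw [lintegral_const_mul _ (by fun_prop), lintegral_const_mul _ (by fun_prop),
          mul_left_comm C₁]
        exact mul_le_mul' le_rfl (mul_le_mul' le_rfl (H _ (by positivity) _))
    _ ≤ _ := by
        rw [lintegral_const_mul _ (by fun_prop), lintegral_const_mul _ (by fun_prop), mul_assoc,
          mul_assoc]
        exact mul_le_mul' le_rfl (mul_le_mul' le_rfl (lintegral_abs_rpow_div_le h0 h1 hd c))

/-- The Schur test for `sepKernel`. -/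
theorem exists_lintegral_mul_sepKernel_mul_le (hn : 0 < n) {p q : ℝ} (hpq : p.HolderConjugate q) :
    ∃ C : ℝ≥0∞, C ≠ ⊤ ∧ ∀ (i : Fin n) (c : ℝ) (G F : Rn n → ℝ≥0∞), AEMeasurable G → AEMeasurable F →
      ∫⁻ z : Rn n × Rn n, G z.1 * sepKernel i c z.1 z.2 * F z.2 ≤
        C * ((∫⁻ x, G x ^ q) + ∫⁻ y, F y ^ p) := by
  have hp := hpq.pos
  have hq := hpq.symm.pos
  have hp1 : 1 < p := hpq.lt
  have hq1 : 1 < q := hpq.symm.lt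
  obtain ⟨C₁, hC₁, H₁⟩ := exists_lintegral_sepKernel_le hn (θ := 1 / p) (by positivity)
    (by rw [div_lt_one hp]; exact hp1)
  obtain ⟨C₂, hC₂, H₂⟩ := exists_lintegral_sepKernel_le hn (θ := 1 / q) (by positivity)
    (by rw [div_lt_one hq]; exact hq1)
  refine ⟨C₁ + C₂, ENNReal.add_ne_top.2 ⟨hC₁, hC₂⟩, fun i c G F hG hF => ?_⟩
  have hpt : ∀ z : Rn n × Rn n, G z.1 * sepKernel i c z.1 z.2 * F z.2 ≤
      G z.1 ^ q * ENNReal.ofReal (|z.1 i - c| ^ (1 / p)) *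
        (sepKernel i c z.1 z.2 * ENNReal.ofReal (|z.2 i - c| ^ (-(1 / p)))) +
      F z.2 ^ p * ENNReal.ofReal (|z.2 i - c| ^ (1 / q)) *
        (sepKernel i c z.2 z.1 * ENNReal.ofReal (|z.1 i - c| ^ (-(1 / q)))) := by
    rintro ⟨x, y⟩
    simp only
    rw [sepKernel_comm i c y x]
    by_cases hneg : (x i - c) * (y i - c) < 0
    swap
    · simp [sepKernel, hneg]
    have hx : 0 < |x i - c| := abs_pos.2 fun h => by rw [h, zero_mul] at hneg; exact hneg.false
    have hy : 0 < |y i - c| := abs_pos.2 fun h => by rw [h, mul_zero] at hneg; exact hneg.false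
    set a := |x i - c|
    set b := |y i - c|
    set k := sepKernel i c x y
    -- Young's inequality is applied to (G l)(F l⁻¹). The exponent is chosen so that l^q =
    -- (a/b)^{1/p} and l^{-p} = (b/a)^{1/q} are quotients of the Schur weights. The resulting bound
    -- is a sum instead of a product of norms, which is enough for absolute integrability and for
    -- normalized functions.
    set l := (a / b) ^ (1 / (p * q))
    have hl : 0 < l := by positivity
    have hlq : l ^ q = a ^ (1 / p) * b ^ (-(1 / p)) := by
      rw [← Real.rpow_mul (by positivity), show 1 / (p * q) * q = 1 / p by field_simp,
        Real.div_rpow hx.le hy.le, Real.rpow_neg hy.le, div_eq_mul_inv]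
    have hlp : l⁻¹ ^ p = b ^ (1 / q) * a ^ (-(1 / q)) := by
      rw [Real.inv_rpow hl.le, ← Real.rpow_mul (by positivity),
        show 1 / (p * q) * p = 1 / q by field_simp, Real.div_rpow hx.le hy.le,
        Real.rpow_neg hx.le, inv_div, div_eq_mul_inv]
    have hone : ENNReal.ofReal l * ENNReal.ofReal l⁻¹ = 1 := by
      rw [← ENNReal.ofReal_mul hl.le, mul_inv_cancel₀ hl.ne', ENNReal.ofReal_one]
    have key : G x * F y ≤ G x ^ q * ENNReal.ofReal (l ^ q) + F y ^ p * ENNReal.ofReal (l⁻¹ ^ p) := by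
      calc G x * F y = (G x * ENNReal.ofReal l) * (F y * ENNReal.ofReal l⁻¹) := by
            rw [mul_mul_mul_comm, hone, mul_one]
        _ ≤ (G x * ENNReal.ofReal l) ^ q / ENNReal.ofReal q +
            (F y * ENNReal.ofReal l⁻¹) ^ p / ENNReal.ofReal p :=
            ENNReal.young_inequality _ _ hpq.symm
        _ ≤ (G x * ENNReal.ofReal l) ^ q + (F y * ENNReal.ofReal l⁻¹) ^ p := by
            refine add_le_add ?_ ?_
            · exact ENNReal.div_le_of_le_mul (le_mul_of_one_le_right zero_le
                (ENNReal.one_le_ofReal.2 hq1.le))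
            · exact ENNReal.div_le_of_le_mul (le_mul_of_one_le_right zero_le
                (ENNReal.one_le_ofReal.2 hp1.le))
        _ = _ := by
            rw [ENNReal.mul_rpow_of_nonneg _ _ hq.le, ENNReal.mul_rpow_of_nonneg _ _ hp.le,
              ENNReal.ofReal_rpow_of_pos hl, ENNReal.ofReal_rpow_of_pos (inv_pos.2 hl)]
    calc G x * k * F y = (G x * F y) * k := by ring
      _ ≤ (G x ^ q * ENNReal.ofReal (l ^ q) + F y ^ p * ENNReal.ofReal (l⁻¹ ^ p)) * k :=
          mul_le_mul' key le_rfl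
      _ = _ := by
          rw [hlq, hlp, ENNReal.ofReal_mul (by positivity), ENNReal.ofReal_mul (by positivity)]
          ring
  have hmi := measurable_apply i
  have hk := measurable_sepKernel (n := n) i c
  have hk' : Measurable fun z : Rn n × Rn n => sepKernel i c z.2 z.1 := hk.comp measurable_swap
  have m1 : Measurable fun z : Rn n × Rn n => z.1 i := hmi.comp measurable_fst
  have m2 : Measurable fun z : Rn n × Rn n => z.2 i := hmi.comp measurable_snd
  have hG1 : AEMeasurable fun z : Rn n × Rn n => G z.1 :=
    hG.comp_quasiMeasurePreserving Measure.quasiMeasurePreserving_fst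
  have hF2 : AEMeasurable fun z : Rn n × Rn n => F z.2 :=
    hF.comp_quasiMeasurePreserving Measure.quasiMeasurePreserving_snd
  have M1 : AEMeasurable fun z : Rn n × Rn n =>
      G z.1 ^ q * ENNReal.ofReal (|z.1 i - c| ^ (1 / p)) *
        (sepKernel i c z.1 z.2 * ENNReal.ofReal (|z.2 i - c| ^ (-(1 / p)))) := by fun_prop
  have M2 : AEMeasurable fun z : Rn n × Rn n =>
      F z.2 ^ p * ENNReal.ofReal (|z.2 i - c| ^ (1 / q)) *
        (sepKernel i c z.2 z.1 * ENNReal.ofReal (|z.1 i - c| ^ (-(1 / q)))) := by fun_prop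
  have aux : ∀ {a t : ℝ}, 0 ≤ a → ENNReal.ofReal (a ^ t) * ENNReal.ofReal (a ^ (-t)) ≤ 1 := by
    intro a t ha
    rw [← ENNReal.ofReal_mul (by positivity), Real.rpow_neg ha]
    exact ENNReal.ofReal_le_one.2 (mul_inv_le_one)
  refine (lintegral_mono hpt).trans ?_
  rw [lintegral_add_left' M1, add_mul, mul_add, mul_add, Measure.volume_eq_prod, lintegral_prod _ M1,
    lintegral_prod_symm _ M2]
  refine add_le_add (le_add_right ?_) (le_add_left ?_)
  · rw [← lintegral_const_mul' _ _ hC₁]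
    refine lintegral_mono fun x => ?_
    simp only
    rw [lintegral_const_mul]
    · calc G x ^ q * ENNReal.ofReal (|x i - c| ^ (1 / p)) * _
          ≤ G x ^ q * ENNReal.ofReal (|x i - c| ^ (1 / p)) *
            (C₁ * ENNReal.ofReal (|x i - c| ^ (-(1 / p)))) := mul_le_mul' le_rfl (H₁ i c x)
        _ = C₁ * G x ^ q * (ENNReal.ofReal (|x i - c| ^ (1 / p)) *
            ENNReal.ofReal (|x i - c| ^ (-(1 / p)))) := by ring
        _ ≤ C₁ * G x ^ q * 1 := mul_le_mul' le_rfl (aux (abs_nonneg _))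
        _ = _ := mul_one _
    · exact ((hk.comp measurable_prodMk_left)).mul (by fun_prop)
  · rw [← lintegral_const_mul' _ _ hC₂]
    refine lintegral_mono fun x => ?_
    simp only
    rw [lintegral_const_mul]
    · calc F x ^ p * ENNReal.ofReal (|x i - c| ^ (1 / q)) * _
          ≤ F x ^ p * ENNReal.ofReal (|x i - c| ^ (1 / q)) *
            (C₂ * ENNReal.ofReal (|x i - c| ^ (-(1 / q)))) := mul_le_mul' le_rfl (H₂ i c x)
        _ = C₂ * F x ^ p * (ENNReal.ofReal (|x i - c| ^ (1 / q)) *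
            ENNReal.ofReal (|x i - c| ^ (-(1 / q)))) := by ring
        _ ≤ C₂ * F x ^ p * 1 := mul_le_mul' le_rfl (aux (abs_nonneg _))
        _ = _ := mul_one _
    · exact ((hk.comp measurable_prodMk_left)).mul (by fun_prop)

end

section

variable {n : ℕ} {K : Rn n → Rn n → ℂ}

/-! ### Matrix coefficients of Calderón–Zygmund kernels -/

theorem ae_apply_ne (i : Fin n) (c : ℝ) : ∀ᵐ x : Rn n, x i ≠ c :=
  (PiLp.volume_preserving_ofLp (Fin n)).quasiMeasurePreserving.ae
    (Measure.ae_eval_ne (μ := fun _ : Fin n => (volume : Measure ℝ)) i c)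

/-- If no coordinate hyperplane separates the cubes, the coordinate intervals meet in every
direction, and the point formed by the larger left endpoints lies in both cubes. The inequality is
strict off the null set where a point lies on the hyperplane. -/
theorem exists_separating_of_disjoint_cube {a b : Rn n} {r t : ℝ} (hr : 0 < r) (ht : 0 < t)
    (h : Disjoint (cube a r) (cube b t)) :
    ∃ (i : Fin n) (c : ℝ), ∀ x ∈ cube a r, ∀ y ∈ cube b t, (x i - c) * (y i - c) ≤ 0 := by
  by_contra hcon
  push Not at hcon
  have h1 : ∀ i, a i < b i + t := fun i => by
    obtain ⟨x, hx, y, hy, hxy⟩ := hcon i (b i + t)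
    by_contra h2
    push Not at h2
    have := hx i
    have := hy i
    nlinarith
  have h2 : ∀ i, b i < a i + r := fun i => by
    obtain ⟨x, hx, y, hy, hxy⟩ := hcon i (a i + r)
    by_contra h2
    push Not at h2
    have := hx i
    have := hy i
    nlinarith
  refine Set.disjoint_left.1 h (show WithLp.toLp 2 (fun i => max (a i) (b i)) ∈ cube a r from
    fun i => ?_) (fun i => ?_)
  · exact ⟨le_max_left _ _, max_lt (by linarith) (h2 i)⟩
  · exact ⟨le_max_right _ _, max_lt (h1 i) (by linarith)⟩

/-- A kernel bounded by `A |x - y|^{-n}` is absolutely integrable against functions on disjoint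
cubes. -/
theorem exists_lintegral_kernelIntegrand_le (hn : 0 < n) {p q : ℝ} (hpq : p.HolderConjugate q)
    (A : ℝ) : ∃ C : ℝ≥0∞, C ≠ ⊤ ∧ ∀ K : Rn n → Rn n → ℂ,
      (∀ x y, x ≠ y → ‖K x y‖ ≤ A / ‖x - y‖ ^ n) → ∀ (a b : Rn n) (r t : ℝ), 0 < r → 0 < t →
      Disjoint (cube a r) (cube b t) → ∀ g f : Rn n → ℂ, AEStronglyMeasurable g →
      AEStronglyMeasurable f → SupportedIn f (cube a r) → SupportedIn g (cube b t) →
      ∫⁻ z, ‖kernelIntegrand K g f z‖ₑ ≤ C * ((∫⁻ x, ‖g x‖ₑ ^ q) + ∫⁻ x, ‖f x‖ₑ ^ p) := by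
  obtain ⟨C, hC, H⟩ := exists_lintegral_mul_sepKernel_mul_le hn hpq
  refine ⟨ENNReal.ofReal A * C, ENNReal.mul_ne_top ENNReal.ofReal_ne_top hC, ?_⟩
  intro K hK a b r t hr ht hdisj g f hg hf hfs hgs
  obtain ⟨i, c, hsep⟩ := exists_separating_of_disjoint_cube hr ht hdisj
  rw [mul_assoc]
  refine le_trans ?_ (mul_le_mul' le_rfl (H i c _ _ hg.enorm hf.enorm))
  rw [← lintegral_const_mul' _ _ ENNReal.ofReal_ne_top]
  refine lintegral_mono_ae ?_
  filter_upwards [ae_fst hgs, ae_snd hfs, ae_fst (ae_apply_ne i c), ae_snd (ae_apply_ne i c)]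
    with z h1 h2 h3 h4
  by_cases hz1 : z.1 ∈ cube b t
  swap
  · simp [kernelIntegrand, h1 hz1]
  by_cases hz2 : z.2 ∈ cube a r
  swap
  · simp [kernelIntegrand, h2 hz2]
  have hneg : (z.1 i - c) * (z.2 i - c) < 0 := by
    refine lt_of_le_of_ne ?_ (mul_ne_zero (sub_ne_zero.2 h3) (sub_ne_zero.2 h4))
    rw [mul_comm]
    exact hsep _ hz2 _ hz1
  have hne : z.1 ≠ z.2 := fun h => by
    rw [h] at hneg
    nlinarith
  have hb : ‖K z.1 z.2‖ₑ ≤ ENNReal.ofReal A * sepKernel i c z.1 z.2 := by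
    rw [sepKernel, if_pos hneg, ← ENNReal.ofReal_mul' (by positivity), ← div_eq_mul_inv,
      ← ofReal_norm]
    exact ENNReal.ofReal_le_ofReal (hK _ _ hne)
  rw [kernelIntegrand, enorm_mul, enorm_mul]
  calc ‖g z.1‖ₑ * ‖K z.1 z.2‖ₑ * ‖f z.2‖ₑ
      ≤ ‖g z.1‖ₑ * (ENNReal.ofReal A * sepKernel i c z.1 z.2) * ‖f z.2‖ₑ := by gcongr
    _ = _ := by ring

/-- A locally bounded kernel with the size and regularity estimates of exponent `s` and
constant `A`. -/
structure CZKernel (K : Rn n → Rn n → ℂ) (s A : ℝ) : Prop extends IsLocBddKernel K where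
  s_pos : 0 < s
  s_lt : s < 1
  nonneg : 0 ≤ A
  size : ∀ x y, x ≠ y → ‖K x y‖ ≤ A / ‖x - y‖ ^ n
  reg_fst : ∀ x x' y, x ≠ y → ‖x - x'‖ ≤ 1 / 2 * ‖x - y‖ →
    ‖K x y - K x' y‖ ≤ A * (‖x - x'‖ ^ s / ‖x - y‖ ^ ((n : ℝ) + s))
  reg_snd : ∀ x x' y, x ≠ y → ‖x - x'‖ ≤ 1 / 2 * ‖x - y‖ →
    ‖K y x - K y x'‖ ≤ A * (‖x - x'‖ ^ s / ‖x - y‖ ^ ((n : ℝ) + s))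

theorem IsSIOWithLocallyBoundedKernel.exists_czKernel {T : DistrOp n}
    (hT : IsSIOWithLocallyBoundedKernel T K) : ∃ s A, CZKernel K s A := by
  obtain ⟨C, hC⟩ := hT.size
  obtain ⟨s, hs0, hs1, C', hC'⟩ := hT.regularity
  have key : ∀ {c d X Y : ℝ}, X ≤ c * Y → 0 ≤ Y → c ≤ d → X ≤ d * Y := fun h1 h2 h3 =>
    h1.trans (mul_le_mul_of_nonneg_right h3 h2)
  refine ⟨s, max (max C C') 0, ⟨⟨hT.measurable, hT.locallyBounded⟩, hs0, hs1, le_max_right _ _,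
    fun x y h => ?_, fun x x' y h h' => ?_, fun x x' y h h' => ?_⟩⟩
  · have := hC x y h
    rw [div_eq_mul_inv] at this ⊢
    exact key this (by positivity) ((le_max_left C C').trans (le_max_left _ _))
  · exact key ((le_add_of_nonneg_right (norm_nonneg _)).trans (hC' x x' y h h')) (by positivity)
      ((le_max_right C C').trans (le_max_left _ _))
  · exact key ((le_add_of_nonneg_left (norm_nonneg _)).trans (hC' x x' y h h')) (by positivity)
      ((le_max_right C C').trans (le_max_left _ _))

theorem CZKernel.transpose {s A : ℝ} (hK : CZKernel K s A) : CZKernel (fun x y => K y x) s A where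
  measurable := hK.measurable.prod_swap
  locallyBounded B hB := by
    obtain ⟨M, hM⟩ := hK.locallyBounded (Prod.swap '' B) (hB.image continuous_swap)
    exact ⟨M, fun z hz => hM z.swap ⟨z, hz, rfl⟩⟩
  s_pos := hK.s_pos
  s_lt := hK.s_lt
  nonneg := hK.nonneg
  size x y h := by rw [norm_sub_rev]; exact hK.size y x h.symm
  reg_fst := hK.reg_snd
  reg_snd := hK.reg_fst

theorem kernelForm_transpose (K : Rn n → Rn n → ℂ) (g f : Rn n → ℂ) :
    kernelForm (fun x y => K y x) f g = kernelForm K g f := by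
  rw [kernelForm, kernelForm, Measure.volume_eq_prod, ← integral_prod_swap]
  refine integral_congr_ae (Eventually.of_forall fun z => ?_)
  simp only [kernelIntegrand, Prod.fst_swap, Prod.snd_swap]
  ring

/-- A measurable function on the cube `Q_{j,k}` bounded by `|Q_{j,k}|^{-1/2}`. -/
structure IsAtom (j : ℤ) (k : Lat n) (g : Rn n → ℂ) : Prop where
  measurable : Measurable g
  bound : ∀ x, ‖g x‖ ≤ if ix j x = k then nrm n j else 0

theorem isAtom_haar (ε : Fin n → Bool) (j : ℤ) (k : Lat n) : IsAtom j k (haar ε j k) :=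
  ⟨measurable_haar ε j k, norm_haar_le ε j k⟩

theorem IsAtom.supportedIn {j : ℤ} {k : Lat n} {g : Rn n → ℂ} (hg : IsAtom j k g) :
    SupportedIn g (dyadicCube j k) := by
  refine Eventually.of_forall fun x hx => ?_
  have := hg.bound x
  rw [if_neg (fun h => hx (mem_dyadicCube.2 h))] at this
  exact norm_le_zero_iff.1 this

theorem nrm_sq_mul_volume (j : ℤ) (k : Lat n) :
    ENNReal.ofReal (nrm n j) ^ 2 * volume (dyadicCube (n := n) j k) = 1 := by
  rw [volume_dyadicCube, ← ENNReal.ofReal_pow (nrm_pos n j).le, nrm_sq,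
    ← ENNReal.ofReal_mul (by positivity), ← mul_pow, ← zpow_add₀ two_ne_zero]
  simp

theorem IsAtom.lintegral_rpow_le {j : ℤ} {k : Lat n} {g : Rn n → ℂ} (hg : IsAtom j k g) {p : ℝ}
    (hp : 0 < p) : ∫⁻ x, ‖g x‖ₑ ^ p ≤
      ENNReal.ofReal (nrm n j) ^ p * volume (dyadicCube (n := n) j k) := by
  classical
  rw [← setLIntegral_const, ← lintegral_indicator (measurableSet_dyadicCube j k)]
  refine lintegral_mono fun x => ?_
  have := hg.bound x
  rw [Set.indicator_apply]
  simp only [mem_dyadicCube]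
  split_ifs with h
  · rw [if_pos h] at this
    rw [← ofReal_norm]
    gcongr
  · rw [if_neg h] at this
    rw [norm_le_zero_iff.1 this, enorm_zero, ENNReal.zero_rpow_of_pos hp]

theorem IsAtom.memLpc {j : ℤ} {k : Lat n} {g : Rn n → ℂ} (hg : IsAtom j k g) (p : ℝ≥0∞) :
    MemLpc g p := by
  refine ⟨?_, _, isCompact_closure_cube _ _, hg.supportedIn.mono subset_closure⟩
  refine (memLpc_phi j k p).1.mono hg.measurable.aestronglyMeasurable
    (Eventually.of_forall fun x => ?_)
  refine (hg.bound x).trans ?_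
  rw [phi_apply]
  split_ifs
  · rw [Complex.norm_real, Real.norm_of_nonneg (nrm_pos n j).le]
  · simp

theorem IsAtom.integral_norm_le {j : ℤ} {k : Lat n} {g : Rn n → ℂ} (hg : IsAtom j k g) :
    ∫ x, ‖g x‖ ≤ (nrm n j)⁻¹ := by
  have h := hg.lintegral_rpow_le one_pos
  simp only [ENNReal.rpow_one] at h
  rw [integral_norm_eq_lintegral_enorm hg.measurable.aestronglyMeasurable]
  refine ENNReal.toReal_le_of_le_ofReal (inv_nonneg.2 (nrm_pos n j).le) (h.trans (le_of_eq ?_))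
  have h2 := nrm_sq_mul_volume (n := n) j k
  have h0 : ENNReal.ofReal (nrm n j) ≠ 0 := by simpa using nrm_pos n j
  rw [ENNReal.ofReal_inv_of_pos (nrm_pos n j)]
  refine ENNReal.eq_inv_of_mul_eq_one_left ?_
  rw [← h2]; ring

theorem disjoint_dyadicCube {j : ℤ} {k l : Lat n} (h : k ≠ l) :
    Disjoint (dyadicCube (n := n) j k) (dyadicCube j l) := by
  rw [Set.disjoint_left]
  intro x hx hx'
  exact h ((mem_dyadicCube.1 hx).symm.trans (mem_dyadicCube.1 hx'))

/-- Distinct cubes of one generation may touch, so the size condition has no pointwise use; the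
Schur bound with p = q = 2 still gives a uniform constant since atoms have L² norm at most 1. -/
theorem exists_norm_kernelForm_atom_le (hn : 0 < n) (A : ℝ) : ∃ C : ℝ, 0 ≤ C ∧
    ∀ K : Rn n → Rn n → ℂ, (∀ x y, x ≠ y → ‖K x y‖ ≤ A / ‖x - y‖ ^ n) →
    ∀ (j : ℤ) (k l : Lat n), k ≠ l → ∀ g f : Rn n → ℂ, IsAtom j k g → IsAtom j l f →
      ‖kernelForm K g f‖ ≤ C := by
  obtain ⟨C, hC, H⟩ := exists_lintegral_kernelIntegrand_le hn
    (p := 2) (q := 2) (Real.holderConjugate_iff.2 ⟨by norm_num, by norm_num⟩) A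
  refine ⟨(C * 2).toReal, ENNReal.toReal_nonneg, fun K hK j k l hkl g f hg hf => ?_⟩
  have h1 : ∀ {k : Lat n} {g : Rn n → ℂ}, IsAtom j k g → ∫⁻ x, ‖g x‖ₑ ^ (2 : ℝ) ≤ 1 :=
    fun {k g} hg => (hg.lintegral_rpow_le two_pos).trans (le_of_eq (by
      rw [ENNReal.rpow_two]; exact nrm_sq_mul_volume j k))
  have h2 := H K hK _ _ _ _ (by positivity) (by positivity) (disjoint_dyadicCube (j := j) hkl.symm)
    g f hg.measurable.aestronglyMeasurable hf.measurable.aestronglyMeasurable hf.supportedIn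
    hg.supportedIn
  have h3 : ‖kernelForm K g f‖ₑ ≤ C * 2 :=
    (enorm_integral_le_lintegral_enorm _).trans (h2.trans (mul_le_mul' le_rfl
      ((add_le_add (h1 hg) (h1 hf)).trans (le_of_eq one_add_one_eq_two))))
  rw [← toReal_enorm]
  exact ENNReal.toReal_mono (ENNReal.mul_ne_top hC (by simp)) h3

theorem norm_sub_ix_le {j : ℤ} (x y : Rn n) : ‖ix j x - ix j y‖ ≤ (2 : ℝ) ^ j * ‖x - y‖ + 1 := by
  refine (pi_norm_le_iff_of_nonneg (by positivity)).2 fun i => ?_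
  rw [Pi.sub_apply, Int.norm_eq_abs, Int.cast_sub]
  have h1 : |(2 : ℝ) ^ j * x i - (2 : ℝ) ^ j * y i| ≤ (2 : ℝ) ^ j * ‖x - y‖ := by
    rw [← mul_sub, abs_mul, abs_of_pos (by positivity)]
    have := PiLp.norm_apply_le (x - y) i
    rw [PiLp.sub_apply, Real.norm_eq_abs] at this
    gcongr
  have h2 := Int.floor_le ((2 : ℝ) ^ j * x i)
  have h3 := Int.lt_floor_add_one ((2 : ℝ) ^ j * x i)
  have h4 := Int.floor_le ((2 : ℝ) ^ j * y i)
  have h5 := Int.lt_floor_add_one ((2 : ℝ) ^ j * y i)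
  rw [abs_le] at h1 ⊢
  simp only [ix]
  constructor <;> linarith [h1.1, h1.2]

/-- The mean zero of g allows K(x₀, y), with x₀ in the cube of g, to be subtracted from K(x, y), and
regularity gains the s-th power of diameter over distance. The threshold 2n + 1 guarantees |x - x₀|
≤ nδ ≤ |x - y|/2, as regularity requires. The L¹ norms of the atoms contribute δ^n, which cancels
the remaining powers of the side length δ. -/
theorem exists_norm_kernelForm_le_of_far (hn : 0 < n) {s A : ℝ} (hK : CZKernel K s A)
    {j : ℤ} {k l : Lat n} (hkl : 2 * n + 1 ≤ ‖k - l‖) {g f : Rn n → ℂ} (hg : IsAtom j k g)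
    (hf : IsAtom j l f) (hg0 : ∫ x, g x = 0) :
    ‖kernelForm K g f‖ ≤ A * n ^ s * 3 ^ ((n : ℝ) + s) * (1 + ‖k - l‖) ^ (-((n : ℝ) + s)) := by
  have hs := hK.s_pos
  have hA := hK.nonneg
  have hn1 : (1 : ℝ) ≤ n := by exact_mod_cast hn
  set δ : ℝ := (2 : ℝ) ^ (-j)
  have hδ : 0 < δ := by positivity
  have hfar : ∀ x y : Rn n, ix j x = k → ix j y = l → δ * (‖k - l‖ - 1) ≤ ‖x - y‖ := by
    intro x y hx hy
    have := norm_sub_ix_le (j := j) x y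
    rw [hx, hy] at this
    have h2 : (2 : ℝ) ^ j = δ⁻¹ := by simp [δ]
    rw [h2] at this
    have h3 : ‖k - l‖ - 1 ≤ δ⁻¹ * ‖x - y‖ := by linarith
    calc δ * (‖k - l‖ - 1) ≤ δ * (δ⁻¹ * ‖x - y‖) := by gcongr
      _ = _ := by field_simp
  set D := A * ((n * δ) ^ s / (δ * (‖k - l‖ - 1)) ^ ((n : ℝ) + s)) with hD
  have hpos : 0 < ‖k - l‖ - 1 := by linarith
  have hdiff : ∀ x x' y : Rn n, ix j x = k → ix j x' = k → ix j y = l →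
      ‖K x y - K x' y‖ ≤ D := by
    intro x x' y hx hx' hy
    have h1 := norm_sub_le_of_ix_eq (hx.trans hx'.symm)
    have h2 := hfar x y hx hy
    have h3 : 0 < ‖x - y‖ := lt_of_lt_of_le (by positivity) h2
    refine (hK.reg_fst x x' y (sub_ne_zero.1 (norm_pos_iff.1 h3)) ?_).trans ?_
    · have : 2 * n * δ ≤ δ * (‖k - l‖ - 1) := by nlinarith
      linarith
    · rw [hD]
      gcongr
  -- a point of `Q_{j,k}` at which the kernel has a measurable section
  obtain ⟨x₀, hx₀, hmeas⟩ : ∃ x₀ : Rn n, ix j x₀ = k ∧ AEStronglyMeasurable (fun y => K x₀ y) := by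
    have h1 : ∀ᵐ x : Rn n, AEStronglyMeasurable (fun y => K x y) := hK.measurable.prodMk_left
    by_contra hcon
    push Not at hcon
    have h2 : volume (dyadicCube (n := n) j k) = 0 :=
      measure_mono_null (fun x hx => hcon x (mem_dyadicCube.1 hx)) (ae_iff.1 h1)
    rw [volume_dyadicCube] at h2
    have : (0 : ℝ) < ((2 : ℝ) ^ (-j)) ^ n := by positivity
    exact absurd h2 (by simpa using this)
  have hgi := (hg.memLpc 1).integrable
  have hfi := (hf.memLpc 1).integrable
  have hsec : Integrable fun y => K x₀ y * f y := by
    obtain ⟨M, hM⟩ := hK.locallyBounded ({x₀} ×ˢ closure (dyadicCube j l))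
      (isCompact_singleton.prod (isCompact_closure_cube _ _))
    refine Integrable.mono' (hfi.norm.const_mul M) (hmeas.mul hfi.1) ?_
    filter_upwards [hf.supportedIn] with y hy
    rw [norm_mul]
    by_cases hyQ : y ∈ dyadicCube j l
    · exact mul_le_mul_of_nonneg_right (hM (x₀, y) ⟨rfl, subset_closure hyQ⟩) (norm_nonneg _)
    · rw [hy hyQ]; simp
  have hzero : ∫ z : Rn n × Rn n, g z.1 * (K x₀ z.2 * f z.2) = 0 := by
    rw [Measure.volume_eq_prod, integral_prod_mul g (fun y => K x₀ y * f y), hg0, zero_mul]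
  have hsub : kernelForm K g f =
      ∫ z : Rn n × Rn n, (kernelIntegrand K g f z - g z.1 * (K x₀ z.2 * f z.2)) := by
    rw [integral_sub (hK.integrable (hg.memLpc 1) (hf.memLpc 1)) (hgi.mul_prod hsec), hzero,
      sub_zero, kernelForm]
  have hb : ‖kernelForm K g f‖ ≤ D * ((∫ x, ‖g x‖) * ∫ x, ‖f x‖) := by
    rw [hsub, ← integral_prod_mul (fun x => ‖g x‖) (fun x => ‖f x‖), ← integral_const_mul]
    refine norm_integral_le_of_norm_le ((hgi.norm.mul_prod hfi.norm).const_mul D)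
      (Eventually.of_forall fun z => ?_)
    have e : kernelIntegrand K g f z - g z.1 * (K x₀ z.2 * f z.2) =
      g z.1 * (K z.1 z.2 - K x₀ z.2) * f z.2 := by rw [kernelIntegrand]; ring
    rw [e, norm_mul, norm_mul]
    by_cases h1 : ix j z.1 = k
    · by_cases h2 : ix j z.2 = l
      · calc _ ≤ ‖g z.1‖ * D * ‖f z.2‖ := by gcongr; exact hdiff _ _ _ h1 hx₀ h2
          _ = _ := by ring
      · have := hf.bound z.2
        rw [if_neg h2] at this
        rw [norm_le_zero_iff.1 this]; simp
    · have := hg.bound z.1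
      rw [if_neg h1] at this
      rw [norm_le_zero_iff.1 this]; simp
  have hD0 : 0 ≤ D := by positivity
  have hN := nrm_pos n j
  calc ‖kernelForm K g f‖ ≤ D * ((∫ x, ‖g x‖) * ∫ x, ‖f x‖) := hb
    _ ≤ D * ((nrm n j)⁻¹ * (nrm n j)⁻¹) := by
        refine mul_le_mul_of_nonneg_left (mul_le_mul hg.integral_norm_le hf.integral_norm_le
          (integral_nonneg fun x => norm_nonneg _) (by positivity)) hD0
    _ = A * n ^ s * (‖k - l‖ - 1) ^ (-((n : ℝ) + s)) := by
        have h1 : (nrm n j)⁻¹ * (nrm n j)⁻¹ = δ ^ (n : ℝ) := by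
          rw [← mul_inv, ← sq, nrm_sq, Real.rpow_natCast]
          simp [δ]
        rw [h1, hD, Real.mul_rpow (by positivity) hδ.le, Real.mul_rpow hδ.le hpos.le,
          Real.rpow_neg hpos.le, Real.rpow_add hδ]
        have := (Real.rpow_pos_of_pos hδ s).ne'
        have := (Real.rpow_pos_of_pos hδ (n : ℝ)).ne'
        field_simp
    -- Since |k - l| ≥ 2, one has |k - l| - 1 ≥ (1 + |k - l|)/3.
    _ ≤ A * n ^ s * (3 ^ ((n : ℝ) + s) * (1 + ‖k - l‖) ^ (-((n : ℝ) + s))) := by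
        gcongr
        have h3 : (3 : ℝ) ^ ((n : ℝ) + s) = (3⁻¹ : ℝ) ^ (-((n : ℝ) + s)) := by
          rw [Real.inv_rpow (by norm_num), Real.rpow_neg (by norm_num), inv_inv]
        rw [h3, ← Real.mul_rpow (by norm_num) (by positivity)]
        refine Real.rpow_le_rpow_of_nonpos (by positivity) ?_ (by linarith)
        linarith
    _ = _ := by ring

/-- Distant cubes are covered by regularity. For |k - l| < 2n + 1 the decay factor is at least (2n +
2)^{-(n+s)}, so the uniform bound for atoms on disjoint cubes is enough. -/
theorem CZKernel.exists_norm_kernelForm_le_fst (hn : 0 < n) {s A : ℝ} (hK : CZKernel K s A) :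
    ∃ C : ℝ, 0 ≤ C ∧ ∀ (j : ℤ) (k l : Lat n), k ≠ l → ∀ g f : Rn n → ℂ, IsAtom j k g →
      IsAtom j l f → ∫ x, g x = 0 →
      ‖kernelForm K g f‖ ≤ C * (1 + ‖k - l‖) ^ (-((n : ℝ) + s)) := by
  obtain ⟨C, hC0, hC⟩ := exists_norm_kernelForm_atom_le hn A
  have hs := hK.s_pos
  have hA := hK.nonneg
  refine ⟨A * n ^ s * 3 ^ ((n : ℝ) + s) + C * (2 * n + 2) ^ ((n : ℝ) + s), by positivity,
    fun j k l hkl g f hg hf hg0 => ?_⟩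
  have hpos : 0 ≤ (1 + ‖k - l‖) ^ (-((n : ℝ) + s)) := by positivity
  rcases le_or_gt (2 * n + 1 : ℝ) ‖k - l‖ with h | h
  · refine (exists_norm_kernelForm_le_of_far hn hK h hg hf hg0).trans ?_
    gcongr
    exact le_add_of_nonneg_right (by positivity)
  · refine (hC K hK.size j k l hkl g f hg hf).trans ?_
    have h1 : 1 ≤ (2 * n + 2 : ℝ) ^ ((n : ℝ) + s) * (1 + ‖k - l‖) ^ (-((n : ℝ) + s)) := by
      rw [Real.rpow_neg (by positivity), ← div_eq_mul_inv, one_le_div (by positivity)]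
      exact Real.rpow_le_rpow (by positivity) (by linarith) (by positivity)
    calc C = C * 1 := (mul_one _).symm
      _ ≤ C * ((2 * n + 2 : ℝ) ^ ((n : ℝ) + s) * (1 + ‖k - l‖) ^ (-((n : ℝ) + s))) := by gcongr
      _ ≤ _ := by
        rw [← mul_assoc]
        gcongr
        exact le_add_of_nonneg_left (by positivity)

theorem integral_phi (j : ℤ) (k : Lat n) : ∫ x, phi j k x = ((nrm n j)⁻¹ : ℝ) := by
  classical
  have h : phi (n := n) j k = (dyadicCube j k).indicator fun _ => (nrm n j : ℂ) := by
    ext x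
    rw [phi_apply, Set.indicator_apply]
    simp only [mem_dyadicCube]
  rw [h, integral_indicator (measurableSet_dyadicCube j k), setIntegral_const, measureReal_def,
    volume_dyadicCube, ENNReal.toReal_ofReal (by positivity)]
  have h2 := nrm_sq n j
  have h3 := (nrm_pos n j).ne'
  rw [Complex.real_smul, ← Complex.ofReal_mul]
  congr 1
  rw [zpow_neg, inv_pow, ← h2]
  field_simp

theorem integral_haar {ε : Fin n → Bool} (hε : ε ≠ fun _ => false) (j : ℤ) (k : Lat n) :
    ∫ x, haar ε j k x = 0 := by
  simp_rw [haar_eq_sum]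
  rw [integral_finsetSum]
  · simp_rw [integral_const_mul, integral_phi]
    rw [← Finset.sum_mul, sum_box_hco hε, zero_mul]
  · exact fun u _ => ((memLpc_phi _ u 1).integrable).const_mul _

theorem lintegral_comp_ix (j : ℤ) (F : Lat n → ℝ≥0∞) :
    ∫⁻ x : Rn n, F (ix j x) = (∑' k, F k) * ENNReal.ofReal (((2 : ℝ) ^ (-j)) ^ n) := by
  rw [← lintegral_map (f := F) (measurable_of_countable F) (measurable_ix j), lintegral_countable',
    ← ENNReal.tsum_mul_right]
  refine tsum_congr fun k => ?_
  rw [Measure.map_apply (measurable_ix j) (measurableSet_singleton k)]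
  congr 1
  rw [← volume_dyadicCube j k]
  congr 1
  ext x
  simp [mem_dyadicCube]

/-- The lattice sum is an integral over unit cubes of a function constant on each of them, and is
compared with the integral of (1 + |x|)^{-r}. -/
theorem tsum_one_add_norm_ne_top {r : ℝ} (hr : (n : ℝ) < r) :
    ∑' z : Lat n, ENNReal.ofReal ((1 + ‖z‖) ^ (-r)) ≠ ⊤ := by
  have hr0 : 0 < r := lt_of_le_of_lt (Nat.cast_nonneg n) hr
  have h1 := lintegral_comp_ix 0 fun z : Lat n => ENNReal.ofReal ((1 + ‖z‖) ^ (-r))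
  simp only [neg_zero, zpow_zero, one_pow, ENNReal.ofReal_one, mul_one] at h1
  rw [← h1]
  have h2 := finite_integral_one_add_norm (E := Rn n) (μ := volume) (r := r) (by simpa using hr)
  have h3 : ∫⁻ x : Rn n, ENNReal.ofReal ((1 + ‖ix 0 x‖) ^ (-r)) ≤
      ENNReal.ofReal (((n + 1 : ℝ)⁻¹) ^ (-r)) * ∫⁻ x : Rn n, ENNReal.ofReal ((1 + ‖x‖) ^ (-r)) := by
    rw [← lintegral_const_mul' _ _ ENNReal.ofReal_ne_top]
    refine lintegral_mono fun x => ?_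
    rw [← ENNReal.ofReal_mul (by positivity), ← Real.mul_rpow (by positivity) (by positivity)]
    refine ENNReal.ofReal_le_ofReal (Real.rpow_le_rpow_of_nonpos (by positivity) ?_ (by linarith))
    have h4 : ‖x‖ ≤ n * (‖ix 0 x‖ + 1) := by
      refine euclid_norm_le fun i => ?_
      have h5 := norm_le_pi_norm (ix 0 x) i
      rw [Int.norm_eq_abs, abs_le] at h5
      simp only [ix, zpow_zero, one_mul] at h5 ⊢
      have h6 := Int.floor_le (x i)
      have h7 := Int.lt_floor_add_one (x i)
      rw [abs_le]
      constructor <;> linarith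
    rw [inv_mul_le_iff₀ (by positivity)]
    nlinarith [norm_nonneg (ix 0 x)]
  exact ne_of_lt (lt_of_le_of_lt h3 (ENNReal.mul_lt_top ENNReal.ofReal_lt_top h2))

end

section

variable {n : ℕ} {K : Rn n → Rn n → ℂ}

/-! ### The off-diagonal part of the BCR algorithm -/

theorem tsum_eq_tsum_box_of_summable {F : Lat n → ℂ} (hF : Summable F) :
    ∑' u, F u = ∑' k, ∑ u ∈ box 1 k, F u := by
  have h := (hF.hasSum.tsum_fiberwise (anc 1)).tsum_eq
  rw [← h]
  refine tsum_congr fun k => ?_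
  have e : anc 1 ⁻¹' {k} = (box 1 k : Set (Lat n)) := by
    ext u
    simp [mem_box]
  rw [e, Finset.tsum_subtype']

theorem one_add_norm_sub_le (u v : Lat n) : 1 + ‖u - v‖ ≤ 2 * (1 + ‖anc 1 u - anc 1 v‖) := by
  have h : ‖u - v‖ ≤ 2 * ‖anc 1 u - anc 1 v‖ + 1 := by
    refine (pi_norm_le_iff_of_nonneg (by positivity)).2 fun i => ?_
    have h1 := norm_le_pi_norm (anc 1 u - anc 1 v) i
    rw [Int.norm_eq_abs, ← Int.cast_abs] at h1 ⊢
    have h2 : |(u - v) i| ≤ 2 * |(anc 1 u - anc 1 v) i| + 1 := by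
      simp only [Pi.sub_apply, anc, pow_one]
      have h3 := Int.emod_add_mul_ediv (u i) 2
      have h4 := Int.emod_add_mul_ediv (v i) 2
      have h5 := Int.emod_two_eq_zero_or_one (u i)
      have h6 := Int.emod_two_eq_zero_or_one (v i)
      rw [abs_le]
      have h7 := le_abs_self (u i / 2 - v i / 2)
      have h8 := neg_abs_le (u i / 2 - v i / 2)
      constructor <;> omega
    calc ((|(u - v) i| : ℤ) : ℝ) ≤ ((2 * |(anc 1 u - anc 1 v) i| + 1 : ℤ) : ℝ) := by
          exact_mod_cast h2
      _ = 2 * ((|(anc 1 u - anc 1 v) i| : ℤ) : ℝ) + 1 := by push_cast; ring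
      _ ≤ _ := by linarith
  linarith

/-- A matrix with cancellation in the first variable. -/
def haarMat (a : HaarIndex n → HaarIndex n → Lat n → Lat n → ℂ) (b : HaarIndex n → Lat n → Lat n → ℂ)
    (u v : Lat n) : ℂ :=
  haarComb (fun ε ε' => a ε ε' (anc 1 u) (anc 1 v)) (fun ε => b ε (anc 1 u) (anc 1 v))
    (fun _ => 0) u v

section haarMat

variable {a : HaarIndex n → HaarIndex n → Lat n → Lat n → ℂ} {b : HaarIndex n → Lat n → Lat n → ℂ}

theorem haarMat_eq (u v : Lat n) : haarMat a b u v =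
    (∑ ε : HaarIndex n, ∑ ε' : HaarIndex n, hco ε.1 u * a ε ε' (anc 1 u) (anc 1 v) * hco ε'.1 v) +
      ∑ ε : HaarIndex n, hco ε.1 u * b ε (anc 1 u) (anc 1 v) * rt n := by
  simp [haarMat, haarComb]

theorem rt_le_one (n : ℕ) : rt n ≤ 1 := by
  have h := rt_sq n
  have h2 : ((2 : ℝ) ^ n)⁻¹ ≤ 1 := inv_le_one_of_one_le₀ (one_le_pow₀ (by norm_num))
  have h3 := rt_pos n
  nlinarith

theorem norm_haarMat_le {M r : ℝ} (hM : 0 ≤ M) (hr : 0 ≤ r)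
    (ha : ∀ ε ε' k l, ‖a ε ε' k l‖ ≤ M * (1 + ‖k - l‖) ^ (-r))
    (hb : ∀ ε k l, ‖b ε k l‖ ≤ M * (1 + ‖k - l‖) ^ (-r)) (u v : Lat n) :
    ‖haarMat a b u v‖ ≤ (Fintype.card (HaarIndex n) ^ 2 + Fintype.card (HaarIndex n)) *
      (M * 2 ^ r) * (1 + ‖u - v‖) ^ (-r) := by
  set X := M * (1 + ‖anc 1 u - anc 1 v‖) ^ (-r)
  have hX : X ≤ M * 2 ^ r * (1 + ‖u - v‖) ^ (-r) := by
    rw [mul_assoc]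
    refine mul_le_mul_of_nonneg_left ?_ hM
    have h2 : (2 : ℝ) ^ r = (2⁻¹ : ℝ) ^ (-r) := by
      rw [Real.inv_rpow (by norm_num), Real.rpow_neg (by norm_num), inv_inv]
    rw [h2, ← Real.mul_rpow (by norm_num) (by positivity)]
    refine Real.rpow_le_rpow_of_nonpos (by positivity) ?_ (by linarith)
    linarith [one_add_norm_sub_le u v]
  have hX0 : 0 ≤ X := by positivity
  have hrt : ‖(rt n : ℂ)‖ ≤ 1 := by
    rw [Complex.norm_real, Real.norm_of_nonneg (rt_pos n).le]; exact rt_le_one n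
  have mulb : ∀ {x y z : ℂ}, ‖x‖ ≤ 1 → ‖y‖ ≤ X → ‖z‖ ≤ 1 → ‖x * y * z‖ ≤ X := by
    intro x y z hx hy hz
    rw [norm_mul, norm_mul]
    calc ‖x‖ * ‖y‖ * ‖z‖ ≤ 1 * X * 1 := by gcongr
      _ = X := by ring
  rw [haarMat_eq]
  calc _ ≤ (∑ _ε : HaarIndex n, ∑ _ε' : HaarIndex n, X) + ∑ _ε : HaarIndex n, X := by
        refine (norm_add_le _ _).trans (add_le_add ?_ ?_)
        · refine (norm_sum_le _ _).trans (Finset.sum_le_sum fun ε _ => ?_)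
          refine (norm_sum_le _ _).trans (Finset.sum_le_sum fun ε' _ => ?_)
          exact mulb (norm_hco_le _ _) (ha _ _ _ _) (norm_hco_le _ _)
        · refine (norm_sum_le _ _).trans (Finset.sum_le_sum fun ε _ => ?_)
          exact mulb (norm_hco_le _ _) (hb _ _ _) hrt
    _ = (Fintype.card (HaarIndex n) ^ 2 + Fintype.card (HaarIndex n)) * X := by
        simp only [Finset.sum_const, Finset.card_univ, nsmul_eq_mul]
        ring
    _ ≤ _ := by
        rw [mul_assoc]
        exact mul_le_mul_of_nonneg_left hX (by positivity)

/-- Every term carries a factor `hco ε u` with ε ≠ 0, and everything else depends on u only through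
its parent. -/
theorem sum_box_haarMat (k v : Lat n) : ∑ u ∈ box 1 k, haarMat a b u v = 0 := by
  have h : ∀ u ∈ box 1 k, haarMat a b u v =
      ∑ ε : HaarIndex n, hco ε.1 u * ((∑ ε' : HaarIndex n, a ε ε' k (anc 1 v) * hco ε'.1 v) +
        b ε k (anc 1 v) * rt n) := fun u hu => by
    rw [haarMat_eq, mem_box.1 hu, ← Finset.sum_add_distrib]
    refine Finset.sum_congr rfl fun ε _ => ?_
    rw [mul_add, Finset.mul_sum]
    congr 1
    · exact Finset.sum_congr rfl fun ε' _ => by ring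
    · ring
  rw [Finset.sum_congr rfl h, Finset.sum_comm]
  refine Finset.sum_eq_zero fun ε _ => ?_
  rw [← Finset.sum_mul, sum_box_hco ε.2, zero_mul]

/-- The sum over v is taken over siblings before parents: the a-terms disappear because of the Haar
factor in v, and the b-terms become a multiple of Σ_l b(k, l) = 0. The correction of the diagonal of
β serves precisely this purpose. -/
theorem tsum_haarMat {u : Lat n} (hs : Summable (haarMat a b u)) (hb : ∀ ε k, Summable (b ε k))
    (hb0 : ∀ ε k, ∑' l, b ε k l = 0) : ∑' v, haarMat a b u v = 0 := by
  rw [tsum_eq_tsum_box_of_summable hs]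
  have h : ∀ l, ∑ v ∈ box 1 l, haarMat a b u v =
      ∑ ε : HaarIndex n, hco ε.1 u * (2 ^ n * rt n) * b ε (anc 1 u) l := fun l => by
    simp only [haarMat_eq, Finset.sum_add_distrib]
    rw [Finset.sum_comm, Finset.sum_eq_zero, zero_add, Finset.sum_comm]
    · refine Finset.sum_congr rfl fun ε _ => ?_
      rw [Finset.sum_congr rfl fun v hv => by rw [mem_box.1 hv], Finset.sum_const, card_box]
      simp
      ring
    · intro ε _
      rw [Finset.sum_comm]
      refine Finset.sum_eq_zero fun ε' _ => ?_
      rw [Finset.sum_congr rfl fun v hv => by rw [mem_box.1 hv], ← Finset.mul_sum,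
        sum_box_hco ε'.2, mul_zero]
  simp_rw [h]
  rw [Summable.tsum_finsetSum (fun ε _ => (hb ε _).mul_left _)]
  refine Finset.sum_eq_zero fun ε _ => ?_
  rw [tsum_mul_left, hb0, mul_zero]

end haarMat

theorem summable_one_add_norm {r : ℝ} (hr : (n : ℝ) < r) :
    Summable fun z : Lat n => (1 + ‖z‖) ^ (-r) := by
  refine Summable.of_enorm ?_
  refine ne_of_eq_of_ne (tsum_congr fun z => ?_) (tsum_one_add_norm_ne_top hr)
  rw [Real.enorm_eq_ofReal (by positivity)]

/-- The coefficients of the off-diagonal part decay like `(1 + |k - l|)^{-n-s}`, and the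
coefficients `β` sum to zero. -/
theorem CZKernel.exists_coef_le (hn : 0 < n) {s A : ℝ} (hK : CZKernel K s A) :
    ∃ M : ℝ, 0 ≤ M ∧
      (∀ j ε ε' k l, ‖coefAlpha K j ε ε' k l‖ ≤ M * (1 + ‖k - l‖) ^ (-((n : ℝ) + s))) ∧
      (∀ j ε k l, ‖coefBeta K j ε k l‖ ≤ M * (1 + ‖k - l‖) ^ (-((n : ℝ) + s))) ∧
      (∀ j ε k, Summable (coefBeta K j ε k)) ∧ ∀ j ε k, ∑' l, coefBeta K j ε k l = 0 := by
  obtain ⟨C, hC0, hC⟩ := hK.exists_norm_kernelForm_le_fst hn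
  have hs := hK.s_pos
  have hsum := summable_one_add_norm (n := n) (r := (n : ℝ) + s) (by linarith)
  set S := ∑' z : Lat n, (1 + ‖z‖) ^ (-((n : ℝ) + s))
  have hS0 : 0 ≤ S := tsum_nonneg fun z => by positivity
  have hA : ∀ j ε ε' k l, ‖coefAlpha K j ε ε' k l‖ ≤ C * (1 + ‖k - l‖) ^ (-((n : ℝ) + s)) := by
    intro j ε ε' k l
    rw [coefAlpha]
    split_ifs with h
    · rw [norm_zero]; positivity
    · exact hC j k l h _ _ (isAtom_haar _ _ _) (isAtom_haar _ _ _) (integral_haar ε.2 _ _)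
  have hB : ∀ j ε k l, k ≠ l → ‖coefB K j ε k l‖ ≤ C * (1 + ‖k - l‖) ^ (-((n : ℝ) + s)) :=
    fun j ε k l h => hC j k l h _ _ (isAtom_haar _ _ _) (isAtom_haar _ _ _) (integral_haar ε.2 _ _)
  have hshift : ∀ k : Lat n, Summable fun l => C * (1 + ‖k - l‖) ^ (-((n : ℝ) + s)) := fun k =>
    ((Equiv.subLeft k).summable_iff.2 hsum).mul_left C
  have hshiftS : ∀ k : Lat n, ∑' l, C * (1 + ‖k - l‖) ^ (-((n : ℝ) + s)) = C * S := fun k => by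
    rw [tsum_mul_left]
    congr 1
    exact (Equiv.subLeft k).tsum_eq fun z : Lat n => (1 + ‖z‖) ^ (-((n : ℝ) + s))
  have hind : ∀ j ε (k : Lat n), ∀ l, ‖(if l = k then (0 : ℂ) else coefB K j ε k l)‖ ≤
      C * (1 + ‖k - l‖) ^ (-((n : ℝ) + s)) := fun j ε k l => by
    split_ifs with h
    · rw [norm_zero]; positivity
    · exact hB j ε k l (Ne.symm h)
  have hdiag : ∀ j ε k, coefBeta K j ε k k = -∑' l, if l = k then 0 else coefB K j ε k l := by
    intro j ε k
    rw [coefBeta, if_pos rfl]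
    congr 1
    refine (tsum_subtype {m : Lat n | m ≠ k} (fun m => coefB K j ε k m)).trans ?_
    refine tsum_congr fun l => ?_
    by_cases h : l = k <;> simp [Set.indicator, h]
  have hBsum : ∀ j ε k, Summable (coefBeta K j ε k) := by
    intro j ε k
    have h1 : Summable fun l => if l = k then (0 : ℂ) else coefB K j ε k l :=
      Summable.of_norm_bounded (hshift k) (hind j ε k)
    have h2 : Summable fun l : Lat n => if l = k then coefBeta K j ε k k else 0 :=
      summable_of_hasFiniteSupport ((Set.finite_singleton k).subset fun l hl => by
        by_contra h
        simp [show ¬ l = k from h] at hl)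
    refine (h1.add h2).congr fun l => ?_
    by_cases h : l = k
    · simp [h]
    · simp [h, coefBeta, Ne.symm h]
  -- C bounds the decay constant off the diagonal; on the diagonal β is minus the sum of its row,
  -- which is at most C S.
  refine ⟨C + C * S, by positivity, fun j ε ε' k l => ?_, fun j ε k l => ?_, hBsum,
    fun j ε k => ?_⟩
  · refine (hA j ε ε' k l).trans ?_
    gcongr
    exact le_add_of_nonneg_right (by positivity)
  · by_cases h : k = l
    · subst h
      rw [hdiag, norm_neg, sub_self, norm_zero, add_zero, Real.one_rpow, mul_one]
      refine (tsum_of_norm_bounded (hshift k).hasSum (hind j ε k)).trans ?_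
      rw [hshiftS]
      exact le_add_of_nonneg_left hC0
    · rw [coefBeta, if_neg h]
      refine (hB j ε k l h).trans ?_
      gcongr
      exact le_add_of_nonneg_right (by positivity)
  · rw [(hBsum j ε k).tsum_eq_add_tsum_ite k, hdiag]
    have : ∀ l, (if l = k then (0 : ℂ) else coefBeta K j ε k l) =
        if l = k then 0 else coefB K j ε k l := fun l => by
      by_cases h : l = k
      · simp [h]
      · simp [h, coefBeta, Ne.symm h]
    rw [tsum_congr this, neg_add_cancel]

/-- Transposing the kernel exchanges β and γ, so the zero column sums and the decay of γ follow from
those of β. -/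
theorem coefGamma_eq (K : Rn n → Rn n → ℂ) (j : ℤ) (ε : HaarIndex n) (k l : Lat n) :
    coefGamma K j ε k l = coefBeta (fun x y => K y x) j ε l k := by
  have h : ∀ k l, coefC K j ε k l = coefB (fun x y => K y x) j ε l k := fun k l => by
    rw [coefC, coefB, kernelForm_transpose]
  rw [coefGamma, coefBeta]
  by_cases hkl : k = l
  · subst hkl
    simp [h]
  · rw [if_neg hkl, if_neg (Ne.symm hkl), h]

/-- The part of `tco` with cancellation in the first variable. -/
def tcoV (K : Rn n → Rn n → ℂ) (j : ℤ) : Lat n → Lat n → ℂ :=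
  haarMat (coefAlpha K j) (coefBeta K j)

/-- The transpose of the part of `tco` with cancellation only in the second variable. -/
def tcoW (K : Rn n → Rn n → ℂ) (j : ℤ) : Lat n → Lat n → ℂ :=
  haarMat (fun _ _ _ _ => 0) (coefBeta (fun x y => K y x) j)

theorem sum_box_tcoV (K : Rn n → Rn n → ℂ) (j : ℤ) (k v : Lat n) :
    ∑ u ∈ box 1 k, tcoV K j u v = 0 := sum_box_haarMat k v

theorem sum_box_tcoW (K : Rn n → Rn n → ℂ) (j : ℤ) (k v : Lat n) :
    ∑ u ∈ box 1 k, tcoW K j u v = 0 := sum_box_haarMat k v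

/-- The terms with γ cancel only over siblings in the second variable, hence the transposition. The
terms with α have Haar factors on both sides and could be put in either part. -/
theorem tco_eq (K : Rn n → Rn n → ℂ) (j : ℤ) (u v : Lat n) :
    tco K j u v = tcoV K j u v + tcoW K j v u := by
  rw [tcoV, tcoW, haarMat_eq, haarMat_eq, tco, haarComb]
  simp only [mul_zero, zero_mul, Finset.sum_const_zero, zero_add]
  congr 1
  refine Finset.sum_congr rfl fun ε _ => ?_
  rw [coefGamma_eq]
  ring

/-- The weight dominating the off-diagonal matrices. -/
def wgt (n : ℕ) (s D : ℝ) (z : Lat n) : ℝ≥0∞ := ENNReal.ofReal (D * (1 + ‖z‖) ^ (-((n : ℝ) + s)))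

theorem CZKernel.exists_tco_bounds (hn : 0 < n) {s A : ℝ} (hK : CZKernel K s A) :
    ∃ D : ℝ, 0 ≤ D ∧
      (∀ j u v, ‖tcoV K j u v‖ ≤ D * (1 + ‖v - u‖) ^ (-((n : ℝ) + s))) ∧
      (∀ j u v, ‖tcoW K j u v‖ ≤ D * (1 + ‖v - u‖) ^ (-((n : ℝ) + s))) ∧
      (∀ j u, ∑' v, tcoV K j u v = 0) ∧ ∀ j u, ∑' v, tcoW K j u v = 0 := by
  obtain ⟨M, hM, ha, hb, hbs, hb0⟩ := hK.exists_coef_le hn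
  obtain ⟨M', hM', -, hb', hbs', hb0'⟩ := hK.transpose.exists_coef_le hn
  have hs := hK.s_pos
  have hr : (0 : ℝ) ≤ n + s := by positivity
  set N : ℝ := (Fintype.card (HaarIndex n) : ℝ) ^ 2 + Fintype.card (HaarIndex n)
  have hN : 0 ≤ N := by positivity
  have h1 : ∀ j u v, ‖tcoV K j u v‖ ≤ N * (M * 2 ^ ((n : ℝ) + s)) *
      (1 + ‖v - u‖) ^ (-((n : ℝ) + s)) := fun j u v => by
    rw [norm_sub_rev v u]
    exact norm_haarMat_le hM hr (ha j) (hb j) u v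
  have h2 : ∀ j u v, ‖tcoW K j u v‖ ≤ N * (M' * 2 ^ ((n : ℝ) + s)) *
      (1 + ‖v - u‖) ^ (-((n : ℝ) + s)) := fun j u v => by
    rw [norm_sub_rev v u]
    refine norm_haarMat_le hM' hr (fun _ _ _ _ => ?_) (hb' j) u v
    rw [norm_zero]; positivity
  have hsum : ∀ (c : ℝ) (u : Lat n), Summable fun v => c * (1 + ‖v - u‖) ^ (-((n : ℝ) + s)) :=
    fun c u => ((Equiv.subRight u).summable_iff.2
      (summable_one_add_norm (n := n) (r := (n : ℝ) + s) (by linarith))).mul_left c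
  refine ⟨N * (M * 2 ^ ((n : ℝ) + s)) + N * (M' * 2 ^ ((n : ℝ) + s)), by positivity,
    fun j u v => (h1 j u v).trans ?_, fun j u v => (h2 j u v).trans ?_, fun j u => ?_,
    fun j u => ?_⟩
  · gcongr
    exact le_add_of_nonneg_right (by positivity)
  · gcongr
    exact le_add_of_nonneg_left (by positivity)
  · exact tsum_haarMat (Summable.of_norm_bounded (hsum _ u) (h1 j u)) (hbs j) (hb0 j)
  · exact tsum_haarMat (Summable.of_norm_bounded (hsum _ u) (h2 j u)) (hbs' j) (hb0' j)

/-- With σ = s/2, half of the excess decay is spent on the weight (1 + |z|)^σ, and the other half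
keeps the exponent n + s/2 summable. -/
theorem tsum_wgt_ne_top {s : ℝ} (hs : 0 < s) {D : ℝ} (hD : 0 ≤ D) :
    ∑' z : Lat n, wgt n s D z * ENNReal.ofReal ((1 + ‖z‖) ^ (s / 2)) ≠ ⊤ := by
  have h : ∀ z : Lat n, wgt n s D z * ENNReal.ofReal ((1 + ‖z‖) ^ (s / 2)) =
      ENNReal.ofReal D * ENNReal.ofReal ((1 + ‖z‖) ^ (-((n : ℝ) + s / 2))) := fun z => by
    rw [wgt, ← ENNReal.ofReal_mul (by positivity), ← ENNReal.ofReal_mul hD, mul_assoc,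
      ← Real.rpow_add (by positivity)]
    congr 3
    ring
  rw [tsum_congr h, ENNReal.tsum_mul_left]
  exact ENNReal.mul_ne_top ENNReal.ofReal_ne_top (tsum_one_add_norm_ne_top (by linarith))

/-- Scale j acts on the coefficients of scale j + 1, so the scale j = M - 1 - r is level r of a
lattice form whose finest scale is M. -/
theorem sum_offDiagLevel_eq_lform (K : Rn n → Rn n → ℂ) {g f : Rn n → ℂ} (hg : MemLpc g 1)
    (hf : MemLpc f 1) (M : ℤ) (R : ℕ) :
    ∑ j ∈ Finset.Ico (M - R) M, offDiagLevel K j g f =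
      lform (fun r => tcoV K (M - 1 - r)) R (scoef M g) (scoef M f) +
        lform (fun r => tcoW K (M - 1 - r)) R (scoef M f) (scoef M g) := by
  have hg' := finite_support_scoef hg M
  have hf' := finite_support_scoef hf M
  rw [lform_transpose (fun r => tcoW K (M - 1 - r)) R hf' hg', lform, lform,
    ← Finset.sum_add_distrib]
  have h1 : ∑ j ∈ Finset.Ico (M - R) M, offDiagLevel K j g f =
      ∑ r ∈ Finset.range R, offDiagLevel K (M - 1 - r) g f := by
    refine (Finset.sum_bij (fun (r : ℕ) _ => M - 1 - (r : ℤ)) ?_ ?_ ?_ ?_).symm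
    · intro r hr
      have := Finset.mem_range.1 hr
      rw [Finset.mem_Ico]
      omega
    · intro r _ r' _ h
      omega
    · intro j hj
      rw [Finset.mem_Ico] at hj
      exact ⟨(M - 1 - j).toNat, Finset.mem_range.2 (by omega), by omega⟩
    · intro r _; rfl
  rw [h1]
  refine Finset.sum_congr rfl fun r _ => ?_
  have hl : ∀ {h : Rn n → ℂ}, MemLpc h 1 → scoef (M - 1 - r + 1) h = lsum r (scoef M h) :=
    fun {h} hh => by
      rw [lsum_scoef M r hh.integrable]
      congr 1
      ring
  have hfin : ∀ {h : Rn n → ℂ}, MemLpc h 1 → (lsum r (scoef M h)).support.Finite := fun {h} hh => by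
    rw [← hl hh]; exact finite_support_scoef hh _
  rw [offDiagLevel_eq_dform K _ hg hf, hl hg, hl hf]
  have e : tco K (M - 1 - r) = fun u v => tcoV K (M - 1 - r) u v + tcoW K (M - 1 - r) v u := by
    ext u v; exact tco_eq K _ u v
  rw [e, dform_add _ _ (hfin hg) (hfin hf)]
  rfl

/-- The off-diagonal sums are uniformly bounded, in terms of the scaling coefficients. -/
theorem CZKernel.exists_sum_offDiagLevel_le (hn : 0 < n) {s A : ℝ} (hK : CZKernel K s A)
    {p q : ℝ} (hpq : p.HolderConjugate q) :
    ∃ C : ℝ≥0∞, C ≠ ⊤ ∧ ∀ (M : ℤ) (R : ℕ) (g f : Rn n → ℂ), MemLpc g 1 → MemLpc f 1 →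
      ‖∑ j ∈ Finset.Ico (M - R) M, offDiagLevel K j g f‖ₑ ≤
        C * (∑' k, ‖scoef M f k‖ₑ ^ p) ^ (1 / p) * (∑' k, ‖scoef M g k‖ₑ ^ q) ^ (1 / q) := by
  have hs := hK.s_pos
  have hs1 := hK.s_lt
  obtain ⟨D, hD, hV, hW, hV0, hW0⟩ := hK.exists_tco_bounds hn
  have hneg : ∀ z, wgt n s D (-z) = wgt n s D z := fun z => by rw [wgt, wgt, norm_neg]
  obtain ⟨C₁, hC₁, H₁⟩ := exists_lform_le hn hneg (half_pos hs) (by linarith)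
    (tsum_wgt_ne_top hs hD) hpq
  obtain ⟨C₂, hC₂, H₂⟩ := exists_lform_le hn hneg (half_pos hs) (by linarith)
    (tsum_wgt_ne_top hs hD) hpq.symm
  refine ⟨C₁ + C₂, ENNReal.add_ne_top.2 ⟨hC₁, hC₂⟩, fun M R g f hg hf => ?_⟩
  have hg' := finite_support_scoef hg M
  have hf' := finite_support_scoef hf M
  have hconv : ∀ {x : ℂ} {z : Lat n}, ‖x‖ ≤ D * (1 + ‖z‖) ^ (-((n : ℝ) + s)) →
      ‖x‖ₑ ≤ wgt n s D z := fun h => by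
    rw [wgt, ← ofReal_norm]; exact ENNReal.ofReal_le_ofReal h
  rw [sum_offDiagLevel_eq_lform K hg hf]
  refine (enorm_add_le _ _).trans ?_
  rw [add_mul, add_mul]
  refine add_le_add ?_ ?_
  · exact H₁ (fun r => tcoV K (M - 1 - r)) (fun r u v => hconv (hV _ u v))
      (fun r k v => sum_box_tcoV K _ k v)
      (fun r u => hV0 _ u) R _ _ hg' hf'
  · refine (H₂ (fun r => tcoW K (M - 1 - r)) (fun r u v => hconv (hW _ u v))
      (fun r k v => sum_box_tcoW K _ k v)
      (fun r u => hW0 _ u) R _ _ hf' hg').trans (le_of_eq ?_)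
    ring

end

/-! ### Passage from lattice forms to L^p, and convergence of the sums over the scales. -/

section

variable {n : ℕ} {K : Rn n → Rn n → ℂ}

/-! ### Lebesgue norms and the projections `P_j` -/

theorem DualExponents.real {p q : ℝ≥0∞} (h : DualExponents p q) :
    p.toReal.HolderConjugate q.toReal :=
  (ENNReal.HolderConjugate.toReal_iff (by
    rw [← ENNReal.toReal_one]
    exact (ENNReal.toReal_lt_toReal ENNReal.one_ne_top h.2.1.ne).2 h.1)).2 h.2.2

theorem DualExponents.snd_ne_top {p q : ℝ≥0∞} (h : DualExponents p q) : q ≠ ⊤ := fun hq => by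
  have := h.real.symm.pos
  simp [hq] at this

theorem DualExponents.symm {p q : ℝ≥0∞} (h : DualExponents p q) : DualExponents q p := by
  refine ⟨?_, h.snd_ne_top.lt_top, ?_⟩
  · have := h.real.symm.lt
    rw [← ENNReal.toReal_one] at this
    exact (ENNReal.toReal_lt_toReal ENNReal.one_ne_top h.snd_ne_top).1 this
  · have := h.2.2
    exact ENNReal.HolderConjugate.symm

theorem enorm_scoef_le (j : ℤ) (f : Rn n → ℂ) (k : Lat n) :
    ‖scoef j f k‖ₑ ≤ ENNReal.ofReal (nrm n j) * ∫⁻ x in dyadicCube j k, ‖f x‖ₑ := by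
  classical
  refine (enorm_integral_le_lintegral_enorm _).trans ?_
  rw [← lintegral_const_mul' _ _ ENNReal.ofReal_ne_top,
    ← lintegral_indicator (measurableSet_dyadicCube j k)]
  refine lintegral_mono fun x => ?_
  rw [phi_apply, Set.indicator_apply]
  simp only [mem_dyadicCube]
  split_ifs
  · rw [enorm_mul, ← ofReal_norm (nrm n j : ℂ), Complex.norm_real,
      Real.norm_of_nonneg (nrm_pos n j).le]
  · simp

theorem tsum_lintegral_dyadicCube (j : ℤ) (F : Rn n → ℝ≥0∞) :
    ∑' k : Lat n, ∫⁻ x in dyadicCube j k, F x = ∫⁻ x, F x := by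
  rw [← lintegral_iUnion (measurableSet_dyadicCube j) fun k l h => disjoint_dyadicCube h]
  have : (⋃ k : Lat n, dyadicCube j k) = (Set.univ : Set (Rn n)) := by
    ext x
    simp [mem_dyadicCube]
  rw [this, setLIntegral_univ]

/-- The volume of the dyadic cubes of generation `j`. -/
def dvol (n : ℕ) (j : ℤ) : ℝ≥0∞ := ENNReal.ofReal (((2 : ℝ) ^ (-j)) ^ n)

theorem nrm_sq_mul_dvol (n : ℕ) (j : ℤ) : ENNReal.ofReal (nrm n j) ^ 2 * dvol n j = 1 := by
  have := nrm_sq_mul_volume (n := n) j 0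
  rwa [volume_dyadicCube] at this

/-- Hölder on each cube separately; the cubes of a generation partition the space, so the p-th
powers of the local norms add up to the global one. -/
theorem tsum_enorm_scoef_rpow_le {p q : ℝ} (hpq : p.HolderConjugate q) (j : ℤ) {f : Rn n → ℂ}
    (hf : AEStronglyMeasurable f) :
    (∑' k, ‖scoef j f k‖ₑ ^ p) ^ (1 / p) ≤
      ENNReal.ofReal (nrm n j) * dvol n j ^ (1 / q) * (∫⁻ x, ‖f x‖ₑ ^ p) ^ (1 / p) := by
  have hp := hpq.pos
  have h1 : ∀ k, ‖scoef j f k‖ₑ ^ p ≤ (ENNReal.ofReal (nrm n j) * dvol n j ^ (1 / q)) ^ p *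
      ∫⁻ x in dyadicCube j k, ‖f x‖ₑ ^ p := by
    intro k
    have h2 := ENNReal.lintegral_mul_le_Lp_mul_Lq (volume.restrict (dyadicCube j k)) hpq
      (f := fun x => ‖f x‖ₑ) (g := fun _ => 1) hf.enorm.restrict aemeasurable_const
    simp only [Pi.mul_apply, mul_one, ENNReal.one_rpow, lintegral_const,
      Measure.restrict_apply_univ, one_mul, volume_dyadicCube] at h2
    calc ‖scoef j f k‖ₑ ^ p ≤ (ENNReal.ofReal (nrm n j) * ((∫⁻ x in dyadicCube j k, ‖f x‖ₑ ^ p) ^ (1 / p)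
          * dvol n j ^ (1 / q))) ^ p :=
          ENNReal.rpow_le_rpow ((enorm_scoef_le j f k).trans (mul_le_mul' le_rfl h2)) hp.le
      _ = _ := by
          rw [mul_comm (_ ^ (1 / p)), ← mul_assoc, ENNReal.mul_rpow_of_nonneg _ _ hp.le,
            ← ENNReal.rpow_mul, one_div_mul_cancel hp.ne', ENNReal.rpow_one]
  calc (∑' k, ‖scoef j f k‖ₑ ^ p) ^ (1 / p)
      ≤ ((ENNReal.ofReal (nrm n j) * dvol n j ^ (1 / q)) ^ p * ∫⁻ x, ‖f x‖ₑ ^ p) ^ (1 / p) := by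
        refine ENNReal.rpow_le_rpow ?_ (by positivity)
        rw [← tsum_lintegral_dyadicCube j, ← ENNReal.tsum_mul_left]
        exact ENNReal.tsum_le_tsum h1
    _ = _ := by
        rw [ENNReal.mul_rpow_of_nonneg _ _ (by positivity), ← ENNReal.rpow_mul,
          mul_one_div_cancel hp.ne', ENNReal.rpow_one]

/-- Scale invariance: |Q|^{-1/2}|Q|^{1/q} and |Q|^{-1/2}|Q|^{1/p} are reciprocal. For this reason
the lattice bounds pass to L^p × L^{p'} with a constant independent of the finest scale. -/
theorem nrm_mul_dvol_rpow {p q : ℝ} (hpq : p.HolderConjugate q) (j : ℤ) :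
    (ENNReal.ofReal (nrm n j) * dvol n j ^ (1 / q)) *
      (ENNReal.ofReal (nrm n j) * dvol n j ^ (1 / p)) = 1 := by
  rw [mul_mul_mul_comm, ← ENNReal.rpow_add_of_nonneg _ _ (one_div_nonneg.2 hpq.symm.nonneg)
    (one_div_nonneg.2 hpq.nonneg), one_div, one_div, add_comm, hpq.inv_add_inv_eq_one,
    ENNReal.rpow_one, ← sq, nrm_sq_mul_dvol]

/-- The off-diagonal sums are bounded uniformly on `L^p × L^q`. -/
theorem CZKernel.exists_sum_offDiagLevel_le_eLpNorm (hn : 0 < n) {s A : ℝ} (hK : CZKernel K s A)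
    {p q : ℝ≥0∞} (hpq : DualExponents p q) :
    ∃ C : ℝ≥0∞, C ≠ ⊤ ∧ ∀ (M : ℤ) (R : ℕ) (g f : Rn n → ℂ), MemLpc g q → MemLpc f p →
      ‖∑ j ∈ Finset.Ico (M - R) M, offDiagLevel K j g f‖ₑ ≤
        C * eLpNorm f p volume * eLpNorm g q volume := by
  obtain ⟨C, hC, H⟩ := hK.exists_sum_offDiagLevel_le hn hpq.real
  refine ⟨C, hC, fun M R g f hg hf => ?_⟩
  refine (H M R g f (hg.memLp_of_le hpq.symm.1.le) (hf.memLp_of_le hpq.1.le)).trans ?_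
  rw [eLpNorm_eq_lintegral_rpow_enorm_toReal (zero_lt_one.trans hpq.1).ne' hpq.2.1.ne,
    eLpNorm_eq_lintegral_rpow_enorm_toReal (zero_lt_one.trans hpq.symm.1).ne' hpq.symm.2.1.ne]
  set F := (∫⁻ x, ‖f x‖ₑ ^ p.toReal) ^ (1 / p.toReal)
  set G := (∫⁻ x, ‖g x‖ₑ ^ q.toReal) ^ (1 / q.toReal)
  calc _ ≤ C * (ENNReal.ofReal (nrm n M) * dvol n M ^ (1 / q.toReal) * F) *
        (ENNReal.ofReal (nrm n M) * dvol n M ^ (1 / p.toReal) * G) := by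
        refine mul_le_mul' (mul_le_mul' le_rfl ?_) ?_
        · exact tsum_enorm_scoef_rpow_le hpq.real M hf.1.1
        · exact tsum_enorm_scoef_rpow_le hpq.real.symm M hg.1.1
    _ = (ENNReal.ofReal (nrm n M) * dvol n M ^ (1 / q.toReal)) *
          (ENNReal.ofReal (nrm n M) * dvol n M ^ (1 / p.toReal)) * (C * F * G) := by ring
    _ = _ := by rw [nrm_mul_dvol_rpow hpq.real, one_mul]

/-- `P_j` is a contraction on `L^p`. -/
theorem eLpNorm_projV_le {p q : ℝ≥0∞} (hpq : DualExponents p q) (j : ℤ) {f : Rn n → ℂ}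
    (hf : AEStronglyMeasurable f) : eLpNorm (projV j f) p volume ≤ eLpNorm f p volume := by
  have hp := hpq.real.pos
  rw [eLpNorm_eq_lintegral_rpow_enorm_toReal (zero_lt_one.trans hpq.1).ne' hpq.2.1.ne,
    eLpNorm_eq_lintegral_rpow_enorm_toReal (zero_lt_one.trans hpq.1).ne' hpq.2.1.ne]
  have h1 : ∀ x, ‖projV j f x‖ₑ ^ p.toReal =
      ENNReal.ofReal (nrm n j) ^ p.toReal * ‖scoef j f (ix j x)‖ₑ ^ p.toReal := fun x => by
    rw [projV_apply, enorm_mul, ← ofReal_norm (nrm n j : ℂ), Complex.norm_real,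
      Real.norm_of_nonneg (nrm_pos n j).le, ENNReal.mul_rpow_of_nonneg _ _ hp.le]
  simp_rw [h1]
  rw [lintegral_const_mul' _ _ (ENNReal.rpow_ne_top_of_nonneg hp.le ENNReal.ofReal_ne_top),
    lintegral_comp_ix j fun k => ‖scoef j f k‖ₑ ^ p.toReal,
    ENNReal.mul_rpow_of_nonneg _ _ (by positivity), ENNReal.mul_rpow_of_nonneg _ _ (by positivity),
    ← ENNReal.rpow_mul, mul_one_div_cancel hp.ne', ENNReal.rpow_one]
  set F := (∫⁻ x, ‖f x‖ₑ ^ p.toReal) ^ (1 / p.toReal)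
  calc _ ≤ ENNReal.ofReal (nrm n j) * (ENNReal.ofReal (nrm n j) * dvol n j ^ (1 / q.toReal) * F *
        dvol n j ^ (1 / p.toReal)) :=
        mul_le_mul' le_rfl (mul_le_mul' (tsum_enorm_scoef_rpow_le hpq.real j hf) le_rfl)
    _ = (ENNReal.ofReal (nrm n j) * dvol n j ^ (1 / q.toReal)) *
          (ENNReal.ofReal (nrm n j) * dvol n j ^ (1 / p.toReal)) * F := by ring
    _ = F := by rw [nrm_mul_dvol_rpow hpq.real, one_mul]

theorem projV_sub (j : ℤ) {f g : Rn n → ℂ} (hf : Integrable f) (hg : Integrable g) :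
    projV j (f - g) = projV j f - projV j g := by
  ext x
  have h : scoef j (f - g) = scoef j f - scoef j g := by
    have e : f - g = f + (-1 : ℂ) • g := by rw [neg_one_smul]; exact sub_eq_add_neg f g
    rw [e, scoef_add j hf (hg.smul _), scoef_smul, neg_one_smul]
    exact (sub_eq_add_neg _ _).symm
  rw [Pi.sub_apply, projV_apply, projV_apply, projV_apply, h, Pi.sub_apply, mul_sub]

theorem supportedIn_projV {f : Rn n → ℂ} {A : Set (Rn n)} (hf : SupportedIn f A) {j : ℤ}
    (hj : 0 ≤ j) : ∀ x ∉ Metric.cthickening n A, projV j f x = 0 := by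
  intro x hx
  rw [projV_apply, scoef_eq_zero hf, mul_zero]
  rintro ⟨y, hy, hxy⟩
  refine hx (Metric.mem_cthickening_of_dist_le x y _ A hy ?_)
  rw [dist_eq_norm]
  refine (norm_sub_le_of_ix_eq hxy.symm).trans ?_
  have : (2 : ℝ) ^ (-j) ≤ 1 := zpow_le_one_of_nonpos₀ (by norm_num) (by omega)
  exact mul_le_of_le_one_right (Nat.cast_nonneg n) this

theorem norm_projV_sub_le {f : Rn n → ℂ} (hf : Integrable f) {j : ℤ} {x : Rn n} {η : ℝ}
    (h : ∀ y, ix j y = ix j x → ‖f y - f x‖ ≤ η) : ‖projV j f x - f x‖ ≤ η := by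
  have hN := nrm_pos n j
  have hphi := (memLpc_phi j (ix j x) 1).integrable
  have e : projV j f x - f x = nrm n j * ∫ y, phi j (ix j x) y * (f y - f x) := by
    have h1 : ∫ y, phi j (ix j x) y * (f y - f x) =
        scoef j f (ix j x) - ((nrm n j)⁻¹ : ℝ) * f x := by
      simp_rw [mul_sub]
      rw [integral_sub (integrable_phi_mul j _ hf) (hphi.mul_const _), integral_mul_const,
        integral_phi, scoef, bracket]
    rw [h1, projV_apply, mul_sub, ← mul_assoc, ← Complex.ofReal_mul, mul_inv_cancel₀ hN.ne',
      Complex.ofReal_one, one_mul]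
  have hη : 0 ≤ η := (norm_nonneg _).trans (h x rfl)
  have h2 : ‖∫ y, phi j (ix j x) y * (f y - f x)‖ ≤ (nrm n j)⁻¹ * η := by
    calc _ ≤ ∫ y, ‖phi j (ix j x) y‖ * η := by
          refine norm_integral_le_of_norm_le (hphi.norm.mul_const η) (Eventually.of_forall fun y => ?_)
          rw [norm_mul]
          by_cases hy : ix j y = ix j x
          · exact mul_le_mul_of_nonneg_left (h y hy) (norm_nonneg _)
          · rw [phi_apply, if_neg hy]; simp
      _ ≤ _ := by
          rw [integral_mul_const]
          exact mul_le_mul_of_nonneg_right (isAtom_haar _ _ _).integral_norm_le hη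
  rw [e, norm_mul, Complex.norm_real, Real.norm_of_nonneg hN.le]
  calc nrm n j * _ ≤ nrm n j * ((nrm n j)⁻¹ * η) := by gcongr
    _ = η := by field_simp

theorem tendsto_two_zpow_neg : Tendsto (fun j : ℤ => (2 : ℝ) ^ (-j)) atTop (𝓝 0) := by
  have h : Tendsto (fun m : ℕ => (2 : ℝ) ^ (-(m : ℤ))) atTop (𝓝 0) := by
    have := tendsto_pow_atTop_nhds_zero_of_lt_one (r := (2⁻¹ : ℝ)) (by norm_num) (by norm_num)
    refine this.congr fun m => ?_
    rw [zpow_neg, zpow_natCast, inv_pow]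
  rw [Metric.tendsto_atTop] at h ⊢
  intro ε hε
  obtain ⟨N, hN⟩ := h ε hε
  refine ⟨N, fun j hj => ?_⟩
  lift j to ℕ using by omega
  exact hN j (by omega)

theorem memLpc_of_continuous {f : Rn n → ℂ} (hf : Continuous f) (hc : HasCompactSupport f)
    (p : ℝ≥0∞) : MemLpc f p :=
  ⟨hf.memLp_of_hasCompactSupport hc, tsupport f, hc,
    Eventually.of_forall fun _ hx => image_eq_zero_of_notMem_tsupport hx⟩

theorem tendsto_eLpNorm_projV_sub_of_continuous {f : Rn n → ℂ} (hf : Continuous f)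
    (hc : HasCompactSupport f) (p : ℝ≥0∞) :
    Tendsto (fun j : ℤ => eLpNorm (projV j f - f) p volume) atTop (𝓝 0) := by
  have hfi : Integrable f := (memLpc_of_continuous hf hc 1).integrable
  set A := Metric.cthickening (n : ℝ) (tsupport f)
  have hA : IsCompact A := hc.isCompact.cthickening
  have hsupp : SupportedIn f (tsupport f) :=
    Eventually.of_forall fun _ hx => image_eq_zero_of_notMem_tsupport hx
  rw [ENNReal.tendsto_nhds_zero]
  intro ε hε
  set V := volume A ^ (1 / p.toReal)
  have hV : V ≠ ⊤ := ENNReal.rpow_ne_top_of_nonneg (by positivity) hA.measure_lt_top.ne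
  obtain ⟨η, hη0, hη⟩ : ∃ η : ℝ, 0 < η ∧ ENNReal.ofReal η * V ≤ ε := by
    have : Tendsto (fun η : ℝ => ENNReal.ofReal η * V) (𝓝[>] 0) (𝓝 0) := by
      have h1 : Tendsto (fun η : ℝ => ENNReal.ofReal η * V) (𝓝 0) (𝓝 (ENNReal.ofReal 0 * V)) :=
        ENNReal.Tendsto.mul_const (ENNReal.tendsto_ofReal tendsto_id) (Or.inr hV)
      rw [ENNReal.ofReal_zero, zero_mul] at h1
      exact h1.mono_left nhdsWithin_le_nhds
    obtain ⟨η, h1, h2⟩ := ((ENNReal.tendsto_nhds_zero.1 this ε hε).and self_mem_nhdsWithin).exists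
    exact ⟨η, h2, h1⟩
  have huc : UniformContinuous f := hc.uniformContinuous_of_continuous hf
  obtain ⟨δ, hδ, hfδ⟩ := Metric.uniformContinuous_iff.1 huc η hη0
  have hlim : Tendsto (fun j : ℤ => (n : ℝ) * (2 : ℝ) ^ (-j)) atTop (𝓝 0) := by
    simpa using tendsto_two_zpow_neg.const_mul (n : ℝ)
  filter_upwards [hlim.eventually_lt_const hδ, eventually_ge_atTop 0] with j hj hj0
  have hb : ∀ x, ‖(projV j f - f) x‖ ≤ ‖A.indicator (fun _ => η) x‖ := by
    intro x
    classical
    rw [Set.indicator_apply]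
    split_ifs with hx
    · rw [Real.norm_of_nonneg hη0.le]
      refine norm_projV_sub_le hfi fun y hy => ?_
      have := hfδ (a := y) (b := x) (by
        rw [dist_eq_norm]; exact (norm_sub_le_of_ix_eq hy).trans_lt hj)
      rw [dist_eq_norm] at this
      exact this.le
    · rw [Pi.sub_apply, supportedIn_projV hsupp hj0 x hx, image_eq_zero_of_notMem_tsupport
        fun h => hx (Metric.self_subset_cthickening _ h)]
      simp
  refine (eLpNorm_mono hb).trans ((eLpNorm_indicator_const_le η p).trans (le_trans (le_of_eq ?_) hη))
  rw [Real.enorm_eq_ofReal hη0.le]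

/-- `P_j f → f` in `L^p`. -/
theorem tendsto_eLpNorm_projV_sub {p q : ℝ≥0∞} (hpq : DualExponents p q) {f : Rn n → ℂ}
    (hf : MemLpc f p) :
    Tendsto (fun j : ℤ => eLpNorm (projV j f - f) p volume) atTop (𝓝 0) := by
  rw [ENNReal.tendsto_nhds_zero]
  intro ε hε
  have hε3 : ε / 3 ≠ 0 := (ENNReal.div_pos hε.ne' (by norm_num)).ne'
  obtain ⟨h, hc, hle, hcont, hmem⟩ := hf.1.exists_hasCompactSupport_eLpNorm_sub_le hpq.2.1.ne hε3
  have hh := memLpc_of_continuous hcont hc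
  have h1 := tendsto_eLpNorm_projV_sub_of_continuous hcont hc p
  filter_upwards [ENNReal.tendsto_nhds_zero.1 h1 (ε / 3) (pos_iff_ne_zero.2 hε3)] with j hj
  have hd : MemLpc (f - h) p := hf.sub (hh p)
  have e : projV j f - f = projV j (f - h) + ((projV j h - h) - (f - h)) := by
    rw [projV_sub j (hf.memLp_of_le hpq.1.le).integrable (hh 1).integrable]
    abel
  have m1 := (memLpc_projV hd j p).1.1
  have m2 := ((memLpc_projV (hh p) j p).sub (hh p)).1.1
  rw [e]
  calc _ ≤ eLpNorm (projV j (f - h)) p volume + (eLpNorm (projV j h - h) p volume +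
        eLpNorm (f - h) p volume) :=
        (eLpNorm_add_le m1 (m2.sub hd.1.1) hpq.1.le).trans
          (add_le_add le_rfl (eLpNorm_sub_le m2 hd.1.1 hpq.1.le))
    _ ≤ ε / 3 + (ε / 3 + ε / 3) :=
        add_le_add ((eLpNorm_projV_le hpq j hd.1.1).trans hle) (add_le_add hj hle)
    _ = ε := by rw [← add_assoc, ENNReal.add_thirds]

end

section

variable {n : ℕ} {K : Rn n → Rn n → ℂ}

/-! ### Convergence of the BCR algorithm -/

theorem dform_add_left (t : Lat n → Lat n → ℂ) {a a' b : Lat n → ℂ} (ha : a.support.Finite)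
    (ha' : a'.support.Finite) : dform t (a + a') b = dform t a b + dform t a' b := by
  have h : ∀ {c : Lat n → ℂ}, c.support.Finite → Summable fun u => c u * ∑' v, t u v * b v :=
    fun {c} hc => summable_of_hasFiniteSupport (hc.subset fun u hu => left_ne_zero_of_mul hu)
  rw [dform, dform, dform, ← (h ha).tsum_add (h ha')]
  exact tsum_congr fun u => by rw [Pi.add_apply, add_mul]

theorem dform_smul_left (t : Lat n → Lat n → ℂ) (c : ℂ) (a b : Lat n → ℂ) :
    dform t (c • a) b = c * dform t a b := by
  rw [dform, dform, ← tsum_mul_left]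
  exact tsum_congr fun u => by rw [Pi.smul_apply, smul_eq_mul, mul_assoc]

theorem dform_add_right (t : Lat n → Lat n → ℂ) {a b b' : Lat n → ℂ} (hb : b.support.Finite)
    (hb' : b'.support.Finite) (ha : a.support.Finite) :
    dform t a (b + b') = dform t a b + dform t a b' := by
  have h : ∀ {c : Lat n → ℂ}, c.support.Finite → ∀ u, Summable fun v => t u v * c v :=
    fun {c} hc u => summable_of_hasFiniteSupport (hc.subset fun v hv => right_ne_zero_of_mul hv)
  have h' : ∀ F : Lat n → ℂ, Summable fun u => a u * F u :=
    fun F => summable_of_hasFiniteSupport (ha.subset fun u hu => left_ne_zero_of_mul hu)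
  rw [dform, dform, dform, ← (h' _).tsum_add (h' _)]
  refine tsum_congr fun u => ?_
  rw [← mul_add, ← (h hb u).tsum_add (h hb' u)]
  congr 1
  exact tsum_congr fun v => by rw [Pi.add_apply, mul_add]

theorem dform_smul_right (t : Lat n → Lat n → ℂ) (c : ℂ) (a b : Lat n → ℂ) :
    dform t a (c • b) = c * dform t a b := by
  rw [dform, dform, ← tsum_mul_left]
  refine tsum_congr fun u => ?_
  rw [mul_left_comm c, ← tsum_mul_left (a := c)]
  congr 1
  exact tsum_congr fun v => by rw [Pi.smul_apply, smul_eq_mul, mul_left_comm]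

theorem offDiagLevel_add_left (K : Rn n → Rn n → ℂ) (j : ℤ) {g g' f : Rn n → ℂ} (hg : MemLpc g 1)
    (hg' : MemLpc g' 1) (hf : MemLpc f 1) :
    offDiagLevel K j (g + g') f = offDiagLevel K j g f + offDiagLevel K j g' f := by
  rw [offDiagLevel_eq_dform K j (hg.add hg') hf, offDiagLevel_eq_dform K j hg hf,
    offDiagLevel_eq_dform K j hg' hf, scoef_add _ hg.integrable hg'.integrable,
    dform_add_left _ (finite_support_scoef hg _) (finite_support_scoef hg' _)]

theorem offDiagLevel_smul_left (K : Rn n → Rn n → ℂ) (j : ℤ) (c : ℂ) {g f : Rn n → ℂ}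
    (hg : MemLpc g 1) (hf : MemLpc f 1) :
    offDiagLevel K j (c • g) f = c * offDiagLevel K j g f := by
  rw [offDiagLevel_eq_dform K j (hg.smul c) hf, offDiagLevel_eq_dform K j hg hf, scoef_smul,
    dform_smul_left]

theorem offDiagLevel_add_right (K : Rn n → Rn n → ℂ) (j : ℤ) {g f f' : Rn n → ℂ} (hg : MemLpc g 1)
    (hf : MemLpc f 1) (hf' : MemLpc f' 1) :
    offDiagLevel K j g (f + f') = offDiagLevel K j g f + offDiagLevel K j g f' := by
  rw [offDiagLevel_eq_dform K j hg (hf.add hf'), offDiagLevel_eq_dform K j hg hf,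
    offDiagLevel_eq_dform K j hg hf', scoef_add _ hf.integrable hf'.integrable,
    dform_add_right _ (finite_support_scoef hf _) (finite_support_scoef hf' _)
      (finite_support_scoef hg _)]

theorem offDiagLevel_smul_right (K : Rn n → Rn n → ℂ) (j : ℤ) (c : ℂ) {g f : Rn n → ℂ}
    (hg : MemLpc g 1) (hf : MemLpc f 1) :
    offDiagLevel K j g (c • f) = c * offDiagLevel K j g f := by
  rw [offDiagLevel_eq_dform K j hg (hf.smul c), offDiagLevel_eq_dform K j hg hf, scoef_smul,
    dform_smul_right]

theorem ix_eq_of_le {i j : ℤ} (hij : i ≤ j) {x y : Rn n} (h : ix j x = ix j y) :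
    ix i x = ix i y := by
  obtain ⟨m, rfl⟩ : ∃ m : ℕ, j = i + m := ⟨(j - i).toNat, by omega⟩
  induction m with
  | zero => simpa using h
  | succ m ih =>
    refine ih (by omega) ?_
    rw [← anc_ix (i + m) x, ← anc_ix (i + m) y]
    push_cast at h
    rw [add_assoc, h]

/-- P_i f is constant on the cubes of generation j ≥ i, and ψ has mean zero. -/
theorem bracket_psi_projV (ε : HaarIndex n) {i j : ℤ} (hij : i ≤ j) (k : Lat n) (f : Rn n → ℂ) :
    bracket (psi ε j k) (projV i f) = 0 := by
  by_cases hk : ∃ y : Rn n, ix j y = k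
  · obtain ⟨y, hy⟩ := hk
    have h : ∀ x, psi ε j k x * projV i f x = psi ε j k x * projV i f y := by
      intro x
      by_cases hx : ix j x = k
      · rw [projV_apply, projV_apply, ix_eq_of_le hij (hx.trans hy.symm)]
      · rw [psi_eq_haar, haar_apply, if_neg hx, zero_mul, zero_mul]
    rw [bracket]
    simp_rw [h]
    rw [integral_mul_const, psi_eq_haar, integral_haar ε.2, zero_mul]
  · push Not at hk
    rw [bracket]
    have h : ∀ x, psi ε j k x * projV i f x = 0 := fun x => by
      rw [psi_eq_haar, haar_apply, if_neg (hk x), zero_mul]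
    simp [h]

/-- Each of the three families has a Haar function ψ on at least one side. Thus, for projected
functions, the sum over the scales stops at the scale of the projection. -/
theorem offDiagLevel_projV (K : Rn n → Rn n → ℂ) {i j : ℤ} (hij : i ≤ j) (g f : Rn n → ℂ) :
    offDiagLevel K j (projV i g) (projV i f) = 0 := by
  simp [offDiagLevel, bracket_comm (projV i g), bracket_psi_projV _ hij]

theorem enorm_dform_le {t : Lat n → Lat n → ℂ} {D : ℝ≥0∞} (ht : ∀ u v, ‖t u v‖ₑ ≤ D)
    (a b : Lat n → ℂ) : ‖dform t a b‖ₑ ≤ D * (∑' u, ‖a u‖ₑ) * ∑' v, ‖b v‖ₑ := by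
  calc ‖dform t a b‖ₑ ≤ ∑' u, ‖a u * ∑' v, t u v * b v‖ₑ := enorm_tsum_le_tsum_enorm
    _ ≤ ∑' u, ‖a u‖ₑ * (D * ∑' v, ‖b v‖ₑ) := by
        refine ENNReal.tsum_le_tsum fun u => ?_
        rw [enorm_mul, ← ENNReal.tsum_mul_left]
        refine mul_le_mul' le_rfl (enorm_tsum_le_tsum_enorm.trans (ENNReal.tsum_le_tsum fun v => ?_))
        rw [enorm_mul]
        exact mul_le_mul' (ht u v) le_rfl
    _ = _ := by rw [ENNReal.tsum_mul_right]; ring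

theorem tsum_enorm_scoef_le (j : ℤ) (f : Rn n → ℂ) :
    ∑' k, ‖scoef j f k‖ₑ ≤ ENNReal.ofReal (nrm n j) * ∫⁻ x, ‖f x‖ₑ := by
  rw [← tsum_lintegral_dyadicCube j, ← ENNReal.tsum_mul_left]
  exact ENNReal.tsum_le_tsum fun k => enorm_scoef_le j f k

theorem CZKernel.exists_norm_tco_le (hn : 0 < n) {s A : ℝ} (hK : CZKernel K s A) :
    ∃ D : ℝ, 0 ≤ D ∧ ∀ j u v, ‖tco K j u v‖ ≤ D := by
  obtain ⟨D, hD, hV, hW, -, -⟩ := hK.exists_tco_bounds hn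
  have hs := hK.s_pos
  have h1 : ∀ u v : Lat n, D * (1 + ‖v - u‖) ^ (-((n : ℝ) + s)) ≤ D := fun u v =>
    mul_le_of_le_one_right hD (Real.rpow_le_one_of_one_le_of_nonpos
      (by linarith [norm_nonneg (v - u)]) (by have := Nat.cast_nonneg (α := ℝ) n; linarith))
  refine ⟨D + D, by positivity, fun j u v => ?_⟩
  rw [tco_eq]
  exact (norm_add_le _ _).trans (add_le_add ((hV j u v).trans (h1 u v)) ((hW j v u).trans (h1 v u)))

/-- A crude bound from the boundedness of the matrix entries: the two coefficient sequences of scale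
j + 1 have ℓ¹ norms at most 2^{n(j+1)/2} times the L¹ norms. It makes the sum over coarse scales
converge absolutely. -/
theorem CZKernel.exists_norm_offDiagLevel_le (hn : 0 < n) {s A : ℝ} (hK : CZKernel K s A) :
    ∃ C : ℝ, 0 ≤ C ∧ ∀ (j : ℤ) (g f : Rn n → ℂ), MemLpc g 1 → MemLpc f 1 →
      ‖offDiagLevel K j g f‖ ≤ C * ((2 : ℝ) ^ j) ^ n * ((∫ x, ‖g x‖) * ∫ x, ‖f x‖) := by
  obtain ⟨D, hD, ht⟩ := hK.exists_norm_tco_le hn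
  refine ⟨D * 2 ^ n, by positivity, fun j g f hg hf => ?_⟩
  have h1 := enorm_dform_le (t := tco K j) (D := ENNReal.ofReal D) (fun u v => by
    rw [← ofReal_norm]; exact ENNReal.ofReal_le_ofReal (ht j u v)) (scoef (j + 1) g)
      (scoef (j + 1) f)
  have h2 : ∀ {h : Rn n → ℂ}, MemLpc h 1 → ∑' k, ‖scoef (j + 1) h k‖ₑ ≤
      ENNReal.ofReal (nrm n (j + 1) * ∫ x, ‖h x‖) := fun {h} hh => by
    refine (tsum_enorm_scoef_le _ _).trans (le_of_eq ?_)
    rw [ENNReal.ofReal_mul (nrm_pos _ _).le, ofReal_integral_norm_eq_lintegral_enorm hh.integrable]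
  have h0 : ∀ h : Rn n → ℂ, 0 ≤ ∫ x, ‖h x‖ := fun h => integral_nonneg fun x => norm_nonneg _
  have hN := nrm_pos n (j + 1)
  have h3 := h1.trans (mul_le_mul' (mul_le_mul' le_rfl (h2 hg)) (h2 hf))
  rw [← ENNReal.ofReal_mul hD, ← ENNReal.ofReal_mul
    (mul_nonneg hD (mul_nonneg hN.le (h0 g))), ← offDiagLevel_eq_dform K j hg hf,
    ← ofReal_norm] at h3
  have h4 := (ENNReal.ofReal_le_ofReal_iff (mul_nonneg (mul_nonneg hD (mul_nonneg hN.le (h0 g)))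
    (mul_nonneg hN.le (h0 f)))).1 h3
  refine h4.trans (le_of_eq ?_)
  have h5 := nrm_sq n (j + 1)
  rw [zpow_add_one₀ two_ne_zero, mul_pow] at h5
  calc _ = D * nrm n (j + 1) ^ 2 * ((∫ x, ‖g x‖) * ∫ x, ‖f x‖) := by ring
    _ = _ := by rw [h5]; ring

/-- The partial sums of the off-diagonal part. -/
def offSum (K : Rn n → Rn n → ℂ) (g f : Rn n → ℂ) (N : ℕ × ℕ) : ℂ :=
  ∑ j ∈ Finset.Ico (-(N.1 : ℤ)) (N.2 : ℤ), offDiagLevel K j g f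

/-- A uniform limit of convergent nets is Cauchy. -/
theorem exists_tendsto_of_approx {S : ℕ × ℕ → ℂ}
    (h : ∀ η > 0, ∃ S' : ℕ × ℕ → ℂ, (∃ a, Tendsto S' atTop (𝓝 a)) ∧ ∀ i, ‖S i - S' i‖ ≤ η) :
    ∃ a, Tendsto S atTop (𝓝 a) := by
  refine cauchySeq_tendsto_of_complete (Metric.cauchySeq_iff'.2 fun η hη => ?_)
  obtain ⟨S', ⟨a, ha⟩, hS⟩ := h (η / 4) (by positivity)
  obtain ⟨N, hN⟩ := Metric.cauchySeq_iff'.1 ha.cauchySeq (η / 4) (by positivity)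
  refine ⟨N, fun m hm => ?_⟩
  have h1 := hN m hm
  rw [dist_eq_norm] at h1 ⊢
  calc ‖S m - S N‖ = ‖(S m - S' m) + (S' m - S' N) - (S N - S' N)‖ := by congr 1; ring
    _ ≤ ‖S m - S' m‖ + ‖S' m - S' N‖ + ‖S N - S' N‖ :=
        (norm_sub_le _ _).trans (add_le_add_left (norm_add_le _ _) _)
    _ < η := by linarith [hS m, hS N]

theorem sum_Ico_neg_eq_sum_range (u : ℤ → ℂ) (N J : ℕ) :
    ∑ j ∈ Finset.Ico (-(N : ℤ)) (J : ℤ), u j = ∑ i ∈ Finset.range (N + J), u (J - 1 - i) := by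
  refine (Finset.sum_bij (fun (r : ℕ) _ => (J : ℤ) - 1 - (r : ℤ)) ?_ ?_ ?_ ?_).symm
  · intro r hr
    have := Finset.mem_range.1 hr
    rw [Finset.mem_Ico]
    omega
  · intro r _ r' _ h
    omega
  · intro j hj
    rw [Finset.mem_Ico] at hj
    exact ⟨((J : ℤ) - 1 - j).toNat, Finset.mem_range.2 (by omega), by omega⟩
  · intro r _; rfl

/-- The sums over the scales below a fixed one converge absolutely. -/
theorem CZKernel.exists_tendsto_offSum_fst (hn : 0 < n) {s A : ℝ} (hK : CZKernel K s A)
    {g f : Rn n → ℂ} (hg : MemLpc g 1) (hf : MemLpc f 1) (J : ℕ) :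
    ∃ a, Tendsto (fun N : ℕ => offSum K g f (N, J)) atTop (𝓝 a) := by
  obtain ⟨C, hC0, hC⟩ := hK.exists_norm_offDiagLevel_le hn
  set I := (∫ x, ‖g x‖) * ∫ x, ‖f x‖
  have hI : 0 ≤ I := mul_nonneg (integral_nonneg fun x => norm_nonneg _)
    (integral_nonneg fun x => norm_nonneg _)
  have hs : Summable fun i : ℕ => offDiagLevel K ((J : ℤ) - 1 - i) g f := by
    refine Summable.of_norm_bounded (g := fun i : ℕ => C * ((2 : ℝ) ^ J) ^ n * I * (2⁻¹ : ℝ) ^ i)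
      ((summable_geometric_of_lt_one (by norm_num) (by norm_num)).mul_left _) fun i => ?_
    refine (hC _ g f hg hf).trans ?_
    have h1 : ((2 : ℝ) ^ ((J : ℤ) - 1 - i)) ^ n ≤ ((2 : ℝ) ^ J) ^ n * (2⁻¹ : ℝ) ^ i := by
      calc ((2 : ℝ) ^ ((J : ℤ) - 1 - i)) ^ n ≤ ((2 : ℝ) ^ J * (2⁻¹ : ℝ) ^ i) ^ n := by
            refine pow_le_pow_left₀ (by positivity) ?_ n
            rw [show ((2 : ℝ) ^ J * (2⁻¹ : ℝ) ^ i) = (2 : ℝ) ^ ((J : ℤ) - i) by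
              rw [zpow_sub₀ two_ne_zero, zpow_natCast, zpow_natCast, inv_pow, div_eq_mul_inv]]
            exact zpow_le_zpow_right₀ (by norm_num) (by omega)
        _ = ((2 : ℝ) ^ J) ^ n * ((2⁻¹ : ℝ) ^ i) ^ n := mul_pow _ _ _
        _ ≤ _ := by
            refine mul_le_mul_of_nonneg_left ?_ (by positivity)
            exact pow_le_of_le_one (by positivity) (pow_le_one₀ (by norm_num) (by norm_num)) hn.ne'
    calc _ ≤ C * (((2 : ℝ) ^ J) ^ n * (2⁻¹ : ℝ) ^ i) * I := by gcongr
      _ = _ := by ring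
  refine ⟨_, ((hs.hasSum.tendsto_sum_nat).comp (tendsto_add_atTop_nat J)).congr fun N => ?_⟩
  rw [offSum, sum_Ico_neg_eq_sum_range]
  rfl

theorem offSum_sub_right (K : Rn n → Rn n → ℂ) {g f f' : Rn n → ℂ} (hg : MemLpc g 1)
    (hf : MemLpc f 1) (hf' : MemLpc f' 1) (N : ℕ × ℕ) :
    offSum K g (f - f') N = offSum K g f N - offSum K g f' N := by
  rw [offSum, offSum, offSum, ← Finset.sum_sub_distrib]
  refine Finset.sum_congr rfl fun j _ => ?_
  have h := offDiagLevel_add_right K j hg (hf.sub hf') hf'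
  rw [sub_add_cancel] at h
  rw [h, add_sub_cancel_right]

theorem offSum_sub_left (K : Rn n → Rn n → ℂ) {g g' f : Rn n → ℂ} (hg : MemLpc g 1)
    (hg' : MemLpc g' 1) (hf : MemLpc f 1) (N : ℕ × ℕ) :
    offSum K (g - g') f N = offSum K g f N - offSum K g' f N := by
  rw [offSum, offSum, offSum, ← Finset.sum_sub_distrib]
  refine Finset.sum_congr rfl fun j _ => ?_
  have h := offDiagLevel_add_left K j (hg.sub hg') hg' hf
  rw [sub_add_cancel] at h
  rw [h, add_sub_cancel_right]

theorem CZKernel.exists_offSum_le (hn : 0 < n) {s A : ℝ} (hK : CZKernel K s A)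
    {p q : ℝ≥0∞} (hpq : DualExponents p q) :
    ∃ C : ℝ≥0∞, C ≠ ⊤ ∧ ∀ (N : ℕ × ℕ) (g f : Rn n → ℂ), MemLpc g q → MemLpc f p →
      ‖offSum K g f N‖ₑ ≤ C * eLpNorm f p volume * eLpNorm g q volume := by
  obtain ⟨C, hC, H⟩ := hK.exists_sum_offDiagLevel_le_eLpNorm hn hpq
  refine ⟨C, hC, fun N g f hg hf => ?_⟩
  have := H N.2 (N.1 + N.2) g f hg hf
  rwa [show ((N.2 : ℤ) - (N.1 + N.2 : ℕ)) = -(N.1 : ℤ) by push_cast; ring] at this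

/-- The off-diagonal part of the BCR algorithm converges. -/
theorem CZKernel.exists_tendsto_offSum (hn : 0 < n) {s A : ℝ} (hK : CZKernel K s A)
    {p q : ℝ≥0∞} (hpq : DualExponents p q) {g f : Rn n → ℂ} (hg : MemLpc g q) (hf : MemLpc f p) :
    ∃ a, Tendsto (offSum K g f) atTop (𝓝 a) := by
  obtain ⟨C, hC, H⟩ := hK.exists_offSum_le hn hpq
  have hg1 := hg.memLp_of_le hpq.symm.1.le
  have hf1 := hf.memLp_of_le hpq.1.le
  have hgp := fun J : ℤ => memLpc_projV hg J
  have hfp := fun J : ℤ => memLpc_projV hf J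
  -- (g, f) is replaced by (P_J g, P_J f) with J large. The bound for the partial sums is uniform in
  -- N, so the error is uniformly small; for the projected pair the scales j ≥ J contribute nothing
  -- and the coarse ones converge absolutely.
  refine exists_tendsto_of_approx fun η hη => ?_
  have hlim : Tendsto (fun J : ℤ => C * eLpNorm (projV J f - f) p volume * eLpNorm g q volume +
      C * eLpNorm f p volume * eLpNorm (projV J g - g) q volume) atTop (𝓝 0) := by
    have h1 := tendsto_eLpNorm_projV_sub hpq hf
    have h2 := tendsto_eLpNorm_projV_sub hpq.symm hg
    have h3 := (ENNReal.Tendsto.mul_const (b := eLpNorm g q volume)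
      (ENNReal.Tendsto.const_mul h1 (Or.inr hC)) (Or.inr hg.1.2.ne)).add
        (ENNReal.Tendsto.const_mul (a := C * eLpNorm f p volume) h2
          (Or.inr (ENNReal.mul_ne_top hC hf.1.2.ne)))
    simpa using h3
  obtain ⟨J, hJ, hJ0⟩ := ((ENNReal.tendsto_nhds_zero.1 hlim (ENNReal.ofReal η) (by simpa using hη)).and
    (eventually_ge_atTop 0)).exists
  lift J to ℕ using hJ0
  refine ⟨offSum K (projV J g) (projV J f), ?_, fun N => ?_⟩
  · obtain ⟨a, ha⟩ := hK.exists_tendsto_offSum_fst hn (hgp J 1) (hfp J 1) J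
    refine ⟨a, ?_⟩
    have h1 : Tendsto (fun N : ℕ × ℕ => offSum K (projV J g) (projV J f) (N.1, J)) atTop (𝓝 a) := by
      rw [← prod_atTop_atTop_eq]
      exact ha.comp tendsto_fst
    refine h1.congr' ?_
    filter_upwards [eventually_ge_atTop ((0 : ℕ), J)] with N hN
    have hN2 : J ≤ N.2 := hN.2
    rw [offSum, offSum]
    refine Finset.sum_subset (fun j hj => ?_) fun j hj hj' => ?_
    · simp only [Finset.mem_Ico] at hj ⊢
      omega
    · simp only [Finset.mem_Ico, not_and, not_lt] at hj hj'
      exact offDiagLevel_projV K (hj' hj.1) g f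
  · have e : offSum K g f N - offSum K (projV J g) (projV J f) N =
        -offSum K g (projV J f - f) N - offSum K (projV J g - g) (projV J f) N := by
      rw [offSum_sub_right K hg1 (hfp J 1) hf1, offSum_sub_left K (hgp J 1) hg1 (hfp J 1)]
      ring
    have h2 : ‖offSum K g f N - offSum K (projV J g) (projV J f) N‖ₑ ≤ ENNReal.ofReal η := by
      rw [e]
      refine (enorm_sub_le).trans (le_trans ?_ hJ)
      rw [enorm_neg]
      refine add_le_add (H N _ _ hg ((hfp J p).sub hf)) ?_
      refine (H N _ _ ((hgp J q).sub hg) (hfp J p)).trans ?_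
      exact mul_le_mul' (mul_le_mul' le_rfl (eLpNorm_projV_le hpq J hf.1.1)) le_rfl
    rw [← ofReal_norm] at h2
    exact (ENNReal.ofReal_le_ofReal_iff hη.le).1 h2

/-- The off-diagonal form `⟨g, 𝒯 f⟩`. -/
def offForm (K : Rn n → Rn n → ℂ) (g f : Rn n → ℂ) : ℂ := limUnder atTop (offSum K g f)

theorem CZKernel.tendsto_offSum (hn : 0 < n) {s A : ℝ} (hK : CZKernel K s A)
    {p q : ℝ≥0∞} (hpq : DualExponents p q) {g f : Rn n → ℂ} (hg : MemLpc g q) (hf : MemLpc f p) :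
    Tendsto (offSum K g f) atTop (𝓝 (offForm K g f)) :=
  tendsto_nhds_limUnder (hK.exists_tendsto_offSum hn hpq hg hf)

theorem CZKernel.exists_offForm_le (hn : 0 < n) {s A : ℝ} (hK : CZKernel K s A)
    {p q : ℝ≥0∞} (hpq : DualExponents p q) :
    ∃ C : ℝ, 0 ≤ C ∧ ∀ g f : Rn n → ℂ, MemLpc g q → MemLpc f p →
      ‖offForm K g f‖ ≤ C * (eLpNorm f p volume).toReal * (eLpNorm g q volume).toReal := by
  obtain ⟨C, hC, H⟩ := hK.exists_offSum_le hn hpq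
  refine ⟨C.toReal, ENNReal.toReal_nonneg, fun g f hg hf => ?_⟩
  refine le_of_tendsto (hK.tendsto_offSum hn hpq hg hf).norm (Eventually.of_forall fun N => ?_)
  rw [← toReal_enorm, ← ENNReal.toReal_mul, ← ENNReal.toReal_mul]
  exact ENNReal.toReal_mono (ENNReal.mul_ne_top (ENNReal.mul_ne_top hC hf.1.2.ne) hg.1.2.ne)
    (H N g f hg hf)

section bilinear

variable {s A : ℝ} {p q : ℝ≥0∞}

theorem CZKernel.offForm_add_left (hn : 0 < n) (hK : CZKernel K s A) (hpq : DualExponents p q)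
    {g g' f : Rn n → ℂ} (hg : MemLpc g q) (hg' : MemLpc g' q) (hf : MemLpc f p) :
    offForm K (g + g') f = offForm K g f + offForm K g' f := by
  refine tendsto_nhds_unique (hK.tendsto_offSum hn hpq (hg.add hg') hf)
    (((hK.tendsto_offSum hn hpq hg hf).add (hK.tendsto_offSum hn hpq hg' hf)).congr fun N => ?_)
  rw [offSum, offSum, offSum, ← Finset.sum_add_distrib]
  exact Finset.sum_congr rfl fun j _ => (offDiagLevel_add_left K j (hg.memLp_of_le hpq.symm.1.le)
    (hg'.memLp_of_le hpq.symm.1.le) (hf.memLp_of_le hpq.1.le)).symm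

theorem CZKernel.offForm_add_right (hn : 0 < n) (hK : CZKernel K s A) (hpq : DualExponents p q)
    {g f f' : Rn n → ℂ} (hg : MemLpc g q) (hf : MemLpc f p) (hf' : MemLpc f' p) :
    offForm K g (f + f') = offForm K g f + offForm K g f' := by
  refine tendsto_nhds_unique (hK.tendsto_offSum hn hpq hg (hf.add hf'))
    (((hK.tendsto_offSum hn hpq hg hf).add (hK.tendsto_offSum hn hpq hg hf')).congr fun N => ?_)
  rw [offSum, offSum, offSum, ← Finset.sum_add_distrib]
  exact Finset.sum_congr rfl fun j _ => (offDiagLevel_add_right K j (hg.memLp_of_le hpq.symm.1.le)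
    (hf.memLp_of_le hpq.1.le) (hf'.memLp_of_le hpq.1.le)).symm

theorem CZKernel.offForm_smul_left (hn : 0 < n) (hK : CZKernel K s A) (hpq : DualExponents p q)
    {g f : Rn n → ℂ} (c : ℂ) (hg : MemLpc g q) (hf : MemLpc f p) :
    offForm K (c • g) f = c * offForm K g f := by
  refine tendsto_nhds_unique (hK.tendsto_offSum hn hpq (hg.smul c) hf)
    (((hK.tendsto_offSum hn hpq hg hf).const_mul c).congr fun N => ?_)
  rw [offSum, offSum, Finset.mul_sum]
  exact Finset.sum_congr rfl fun j _ => (offDiagLevel_smul_left K j c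
    (hg.memLp_of_le hpq.symm.1.le) (hf.memLp_of_le hpq.1.le)).symm

theorem CZKernel.offForm_smul_right (hn : 0 < n) (hK : CZKernel K s A) (hpq : DualExponents p q)
    {g f : Rn n → ℂ} (c : ℂ) (hg : MemLpc g q) (hf : MemLpc f p) :
    offForm K g (c • f) = c * offForm K g f := by
  refine tendsto_nhds_unique (hK.tendsto_offSum hn hpq hg (hf.smul c))
    (((hK.tendsto_offSum hn hpq hg hf).const_mul c).congr fun N => ?_)
  rw [offSum, offSum, Finset.mul_sum]
  exact Finset.sum_congr rfl fun j _ => (offDiagLevel_smul_right K j c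
    (hg.memLp_of_le hpq.symm.1.le) (hf.memLp_of_le hpq.1.le)).symm

end bilinear

end

section

variable {n : ℕ} {K : Rn n → Rn n → ℂ}

/-! ### The diagonal form -/

theorem exists_integral_norm_le {A : Set (Rn n)} (hA : IsCompact A) {p : ℝ≥0∞} (hp : 1 ≤ p) :
    ∃ C : ℝ, 0 ≤ C ∧ ∀ f : Rn n → ℂ, MemLp f p volume → SupportedIn f A →
      ∫ x, ‖f x‖ ≤ C * (eLpNorm f p volume).toReal := by
  have hV : volume A ^ (1 / (1 : ℝ≥0∞).toReal - 1 / p.toReal) ≠ ⊤ := by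
    refine ENNReal.rpow_ne_top_of_nonneg ?_ hA.measure_lt_top.ne
    rw [sub_nonneg, ENNReal.toReal_one, div_one]
    rcases eq_or_ne p ⊤ with h | h
    · simp [h]
    · exact div_le_one_of_le₀ (by
        rw [← ENNReal.toReal_one]
        exact (ENNReal.toReal_le_toReal ENNReal.one_ne_top h).2 hp) ENNReal.toReal_nonneg
  refine ⟨(volume A ^ (1 / (1 : ℝ≥0∞).toReal - 1 / p.toReal)).toReal, ENNReal.toReal_nonneg,
    fun f hf hs => ?_⟩
  rw [integral_norm_eq_lintegral_enorm hf.1, ← ENNReal.toReal_mul]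
  refine ENNReal.toReal_mono (ENNReal.mul_ne_top hV hf.2.ne) ?_
  have h1 : f =ᵐ[volume] A.indicator f := by
    filter_upwards [hs] with x hx
    by_cases h : x ∈ A
    · simp [h]
    · simp [h, hx h]
  rw [← eLpNorm_one_eq_lintegral_enorm, eLpNorm_congr_ae h1,
    eLpNorm_indicator_eq_eLpNorm_restrict hA.measurableSet, mul_comm]
  refine (eLpNorm_le_eLpNorm_mul_rpow_measure_univ hp hf.1.restrict).trans ?_
  rw [Measure.restrict_apply_univ]
  exact mul_le_mul' (eLpNorm_mono_measure f Measure.restrict_le_self) le_rfl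

theorem IsLocBddKernel.exists_kernelForm_le (hK : IsLocBddKernel K) {p q : ℝ≥0∞}
    (hpq : DualExponents p q) {A : Set (Rn n)} (hA : IsCompact A) :
    ∃ C : ℝ, 0 ≤ C ∧ ∀ g f : Rn n → ℂ, MemLp f p volume → MemLp g q volume → SupportedIn f A →
      SupportedIn g A →
      ‖kernelForm K g f‖ ≤ C * (eLpNorm f p volume).toReal * (eLpNorm g q volume).toReal := by
  obtain ⟨M, hM, H⟩ := hK.norm_kernelForm_le hA
  obtain ⟨C₁, hC₁, H₁⟩ := exists_integral_norm_le hA hpq.1.le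
  obtain ⟨C₂, hC₂, H₂⟩ := exists_integral_norm_le hA hpq.symm.1.le
  refine ⟨M * (C₁ * C₂), by positivity, fun g f hf hg hfs hgs => ?_⟩
  have hf' : MemLpc f p := ⟨hf, A, hA, hfs⟩
  have hg' : MemLpc g q := ⟨hg, A, hA, hgs⟩
  refine (H g f (hg'.memLp_of_le hpq.symm.1.le) (hf'.memLp_of_le hpq.1.le) hgs hfs).trans ?_
  calc M * ((∫ x, ‖g x‖) * ∫ x, ‖f x‖)
      ≤ M * ((C₂ * (eLpNorm g q volume).toReal) * (C₁ * (eLpNorm f p volume).toReal)) := by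
        refine mul_le_mul_of_nonneg_left (mul_le_mul (H₂ g hg hgs) (H₁ f hf hfs)
          (integral_nonneg fun x => norm_nonneg _) (by positivity)) hM
    _ = _ := by ring

theorem kernelForm_sub_left (hK : IsLocBddKernel K) {g g' f : Rn n → ℂ} (hg : MemLpc g 1)
    (hg' : MemLpc g' 1) (hf : MemLpc f 1) :
    kernelForm K (g - g') f = kernelForm K g f - kernelForm K g' f := by
  have h := kernelForm_add_left (hK.integrable (hg.sub hg') hf) (hK.integrable hg' hf)
  rw [sub_add_cancel] at h
  rw [h, add_sub_cancel_right]

theorem kernelForm_sub_right (hK : IsLocBddKernel K) {g f f' : Rn n → ℂ} (hg : MemLpc g 1)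
    (hf : MemLpc f 1) (hf' : MemLpc f' 1) :
    kernelForm K g (f - f') = kernelForm K g f - kernelForm K g f' := by
  have h := kernelForm_add_right (hK.integrable hg (hf.sub hf')) (hK.integrable hg hf')
  rw [sub_add_cancel] at h
  rw [h, add_sub_cancel_right]

theorem SupportedIn.sub {f g : Rn n → ℂ} {A : Set (Rn n)} (hf : SupportedIn f A)
    (hg : SupportedIn g A) : SupportedIn (f - g) A := by
  filter_upwards [hf, hg] with x h1 h2 hx
  rw [Pi.sub_apply, h1 hx, h2 hx, sub_zero]

/-- A locally bounded kernel gives a form continuous on L^p × L^{p'} over a fixed compact set, and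
for j ≥ 0 all projections live in the n-neighbourhood of the original supports. Convergence of P_j
in L^p and L^{p'} then suffices. -/
theorem IsLocBddKernel.tendsto_kernelForm_projV (hK : IsLocBddKernel K) {p q : ℝ≥0∞}
    (hpq : DualExponents p q) {g f : Rn n → ℂ} (hg : MemLpc g q) (hf : MemLpc f p) :
    Tendsto (fun j : ℤ => kernelForm K (projV j g) (projV j f)) atTop (𝓝 (kernelForm K g f)) := by
  obtain ⟨A, hA, hgA⟩ := hg.2
  obtain ⟨A', hA', hfA'⟩ := hf.2
  set S := Metric.cthickening (n : ℝ) (A ∪ A')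
  have hS : IsCompact S := (hA.union hA').cthickening
  have hgS : SupportedIn g S :=
    hgA.mono (Set.subset_union_left.trans (Metric.self_subset_cthickening _))
  have hfS : SupportedIn f S :=
    hfA'.mono (Set.subset_union_right.trans (Metric.self_subset_cthickening _))
  have hgp : ∀ j : ℤ, 0 ≤ j → SupportedIn (projV j g) S := fun j hj =>
    Eventually.of_forall (supportedIn_projV (hgA.mono Set.subset_union_left) hj)
  have hfp : ∀ j : ℤ, 0 ≤ j → SupportedIn (projV j f) S := fun j hj =>
    Eventually.of_forall (supportedIn_projV (hfA'.mono Set.subset_union_right) hj)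
  obtain ⟨C, hC, H⟩ := hK.exists_kernelForm_le hpq hS
  rw [tendsto_iff_norm_sub_tendsto_zero]
  have h1 := (ENNReal.tendsto_toReal ENNReal.zero_ne_top).comp (tendsto_eLpNorm_projV_sub hpq hf)
  have h2 := (ENNReal.tendsto_toReal ENNReal.zero_ne_top).comp
    (tendsto_eLpNorm_projV_sub hpq.symm hg)
  have h3 : Tendsto (fun j : ℤ => C * (eLpNorm f p volume).toReal *
      (eLpNorm (projV j g - g) q volume).toReal +
      C * (eLpNorm (projV j f - f) p volume).toReal * (eLpNorm g q volume).toReal) atTop (𝓝 0) := by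
    have := (h2.const_mul (C * (eLpNorm f p volume).toReal)).add
      ((h1.const_mul C).mul_const (eLpNorm g q volume).toReal)
    simpa using this
  refine squeeze_zero' (Eventually.of_forall fun j => norm_nonneg _) ?_ h3
  filter_upwards [eventually_ge_atTop 0] with j hj
  have hg1 := hg.memLp_of_le hpq.symm.1.le
  have hf1 := hf.memLp_of_le hpq.1.le
  have e : kernelForm K (projV j g) (projV j f) - kernelForm K g f =
      kernelForm K (projV j g - g) (projV j f) + kernelForm K g (projV j f - f) := by
    rw [kernelForm_sub_left hK (memLpc_projV hg j 1) hg1 (memLpc_projV hf j 1),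
      kernelForm_sub_right hK hg1 (memLpc_projV hf j 1) hf1]
    ring
  rw [e]
  refine (norm_add_le _ _).trans (add_le_add ?_ ?_)
  · refine (H _ _ (memLpc_projV hf j p).1 ((memLpc_projV hg j q).sub hg).1 (hfp j hj)
      ((hgp j hj).sub hgS)).trans ?_
    gcongr
    · exact hf.1.2.ne
    · exact eLpNorm_projV_le hpq j hf.1.1
  · exact H _ _ ((memLpc_projV hf j p).sub hf).1 hg.1 ((hfp j hj).sub hfS) hgS

/-- The form `⟨g, 𝕋 f⟩` of the perfect dyadic part. -/
def diagForm (K : Rn n → Rn n → ℂ) (g f : Rn n → ℂ) : ℂ := kernelForm K g f - offForm K g f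

theorem kernelForm_projV_eq (hK : IsLocBddKernel K) {g f : Rn n → ℂ} (hg : MemLpc g 1)
    (hf : MemLpc f 1) (N : ℕ × ℕ) :
    kernelForm K (projV N.2 g) (projV N.2 f) =
      kernelForm K (projV (-(N.1 : ℤ)) g) (projV (-(N.1 : ℤ)) f) + (offSum K g f N +
        ∑ j ∈ Finset.Ico (-(N.1 : ℤ)) (N.2 : ℤ), diagLevel K j g f) := by
  have h := kernelForm_projV_telescope hK hg hf (-(N.1 : ℤ)) (N.1 + N.2)
  rwa [show -(N.1 : ℤ) + (N.1 + N.2 : ℕ) = N.2 by push_cast; ring] at h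

theorem tendsto_snd_atTop : Tendsto (fun N : ℕ × ℕ => (N.2 : ℤ)) atTop atTop := by
  rw [← prod_atTop_atTop_eq]
  exact tendsto_natCast_atTop_atTop.comp tendsto_snd

theorem tendsto_neg_fst_atBot : Tendsto (fun N : ℕ × ℕ => -(N.1 : ℤ)) atTop atBot := by
  rw [← prod_atTop_atTop_eq]
  exact tendsto_neg_atTop_atBot.comp (tendsto_natCast_atTop_atTop.comp tendsto_fst)

/-- The first identity is the definition of `diagForm`. The second is the telescoping identity with
both ends sent to their limits, the coarse end vanishing by assumption. -/
theorem CZKernel.isBCRDiagonalPart (hn : 0 < n) {s A : ℝ} (hK : CZKernel K s A) :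
    IsBCRDiagonalPart K (diagForm K) := by
  intro p q hpq f g hf hg
  have h1 := hK.tendsto_offSum hn hpq hg hf
  refine ⟨?_, fun h0 => ?_⟩
  · rw [diagForm, sub_sub_cancel]
    exact h1
  · have h2 := ((hK.tendsto_kernelForm_projV hpq hg hf).comp tendsto_snd_atTop).sub
      ((h0.comp tendsto_neg_fst_atBot).add h1)
    rw [zero_add] at h2
    refine h2.congr fun N => ?_
    simp only [Function.comp_apply]
    rw [kernelForm_projV_eq hK.toIsLocBddKernel (hg.memLp_of_le hpq.symm.1.le)
      (hf.memLp_of_le hpq.1.le) N]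
    ring

theorem CZKernel.exists_diagForm_le (hn : 0 < n) {s A : ℝ} (hK : CZKernel K s A) {p q : ℝ≥0∞}
    (hpq : DualExponents p q) {S : Set (Rn n)} (hS : IsCompact S) :
    ∃ C : ℝ, ∀ f g : Rn n → ℂ, MemLp f p volume → MemLp g q volume → SupportedIn f S →
      SupportedIn g S →
      ‖diagForm K g f‖ ≤ C * (eLpNorm f p volume).toReal * (eLpNorm g q volume).toReal := by
  obtain ⟨C₁, -, H₁⟩ := hK.exists_kernelForm_le hpq hS
  obtain ⟨C₂, -, H₂⟩ := hK.exists_offForm_le hn hpq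
  refine ⟨C₁ + C₂, fun f g hf hg hfS hgS => ?_⟩
  rw [diagForm, add_mul, add_mul]
  exact (norm_sub_le _ _).trans (add_le_add (H₁ g f hf hg hfS hgS)
    (H₂ g f ⟨hg, S, hS, hgS⟩ ⟨hf, S, hS, hfS⟩))

/-- For i ≤ j the function φ_{i,l} is constant on the cube that supports f. -/
theorem scoef_eq_zero_of_integral {f : Rn n → ℂ} {i j : ℤ} (hij : i ≤ j) {k : Lat n}
    (hf : SupportedIn f (dyadicCube j k)) (h0 : ∫ x, f x = 0) (l : Lat n) : scoef i f l = 0 := by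
  by_cases hk : ∃ y : Rn n, ix j y = k
  · obtain ⟨y, hy⟩ := hk
    have h : ∫ x, phi i l x * f x = ∫ x, phi i l y * f x := by
      refine integral_congr_ae ?_
      filter_upwards [hf] with x hx
      by_cases hxQ : ix j x = k
      · rw [phi_apply, phi_apply, ix_eq_of_le hij (hxQ.trans hy.symm)]
      · rw [hx (fun h => hxQ (mem_dyadicCube.1 h)), mul_zero, mul_zero]
    rw [scoef, bracket, h, integral_const_mul, h0, mul_zero]
  · push Not at hk
    rw [scoef, bracket]
    refine integral_eq_zero_of_ae ?_
    filter_upwards [hf] with x hx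
    rw [hx (fun h => hk x (mem_dyadicCube.1 h)), mul_zero, Pi.zero_apply]

theorem projV_eq_zero_of_integral {f : Rn n → ℂ} {i j : ℤ} (hij : i ≤ j) {k : Lat n}
    (hf : SupportedIn f (dyadicCube j k)) (h0 : ∫ x, f x = 0) : projV i f = 0 := by
  ext x
  rw [projV_apply, scoef_eq_zero_of_integral hij hf h0, mul_zero, Pi.zero_apply]

/-- At scales i < j the coefficients of f vanish by mean zero. At scales i ≥ j a nonzero term would
need children of a common cube of generation i, one meeting Q and the other meeting its complement,
although such a cube lies entirely in Q or entirely outside it. -/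
theorem diagLevel_eq_zero {g f : Rn n → ℂ} (hg : MemLpc g 1) (hf : MemLpc f 1) {j : ℤ} {k : Lat n}
    (hfQ : SupportedIn f (dyadicCube j k)) (h0 : ∫ x, f x = 0)
    (hgQ : SupportedIn g (dyadicCube j k)ᶜ) (i : ℤ) : diagLevel K i g f = 0 := by
  rw [diagLevel_eq_dform K i hg hf, dform]
  refine (tsum_congr fun u => ?_).trans tsum_zero
  by_cases hu : scoef (i + 1) g u = 0
  · rw [hu, zero_mul]
  refine mul_eq_zero_of_right _ ((tsum_congr fun v => ?_).trans tsum_zero)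
  by_cases hv : scoef (i + 1) f v = 0
  · rw [hv, mul_zero]
  have hij : j ≤ i := by
    by_contra h
    exact hv (scoef_eq_zero_of_integral (by omega) hfQ h0 v)
  refine mul_eq_zero_of_left (dco_eq_zero K fun huv => ?_) _
  have hu' := not_imp_comm.1 (scoef_eq_zero hgQ) hu
  have hv' := not_imp_comm.1 (scoef_eq_zero hfQ) hv
  obtain ⟨y, hy, rfl⟩ := hu'
  obtain ⟨x, hx, rfl⟩ := hv'
  rw [anc_ix, anc_ix] at huv
  refine hy (mem_dyadicCube.2 ?_)
  rw [← mem_dyadicCube.1 hx]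
  exact ix_eq_of_le hij huv

/-- As soon as -N ≤ j the coarse term is zero because P_{-N} f = 0, and so are all diagonal terms.
The finite stages of ⟨g, Tf⟩ are then exactly the off-diagonal partial sums. -/
theorem CZKernel.diagForm_perfect (hn : 0 < n) {s A : ℝ} (hK : CZKernel K s A) {p q : ℝ≥0∞}
    (hpq : DualExponents p q) {g f : Rn n → ℂ} (hf : MemLpc f p) (hg : MemLpc g q) {j : ℤ}
    {k : Lat n} (hfQ : SupportedIn f (dyadicCube j k)) (h0 : ∫ x, f x = 0)
    (hgQ : SupportedIn g (dyadicCube j k)ᶜ) : diagForm K g f = 0 := by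
  have hg1 := hg.memLp_of_le hpq.symm.1.le
  have hf1 := hf.memLp_of_le hpq.1.le
  have h1 := ((hK.tendsto_kernelForm_projV hpq hg hf).comp tendsto_snd_atTop).sub
    (hK.tendsto_offSum hn hpq hg hf)
  refine tendsto_nhds_unique h1 (tendsto_const_nhds.congr' ?_)
  filter_upwards [tendsto_neg_fst_atBot.eventually (eventually_le_atBot j)] with N hN
  simp only [Function.comp_apply]
  rw [kernelForm_projV_eq hK.toIsLocBddKernel hg1 hf1 N, projV_eq_zero_of_integral hN hfQ h0,
    kernelForm_zero_right, Finset.sum_eq_zero fun i _ => diagLevel_eq_zero hg1 hf1 hfQ h0 hgQ i]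
  ring

end

/-! ### The kernel of 𝕋 as a limit of step kernels. -/

section

variable {n : ℕ} {K : Rn n → Rn n → ℂ}

/-! ### The kernel of the perfect dyadic part -/

/-- The kernel which is `2^{nm} t(u, v)` on `Q_{m,u} × Q_{m,v}`. -/
def stepKernel (m : ℤ) (t : Lat n → Lat n → ℂ) (x y : Rn n) : ℂ :=
  ((((2 : ℝ) ^ m) ^ n : ℝ) : ℂ) * t (ix m x) (ix m y)

theorem measurable_stepKernel (m : ℤ) (t : Lat n → Lat n → ℂ) :
    Measurable fun z : Rn n × Rn n => stepKernel m t z.1 z.2 := by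
  have h : Measurable fun w : Lat n × Lat n => ((((2 : ℝ) ^ m) ^ n : ℝ) : ℂ) * t w.1 w.2 :=
    measurable_of_countable _
  exact h.comp (((measurable_ix m).comp measurable_fst).prodMk
    ((measurable_ix m).comp measurable_snd))

theorem norm_stepKernel (m : ℤ) (t : Lat n → Lat n → ℂ) (x y : Rn n) :
    ‖stepKernel m t x y‖ = ((2 : ℝ) ^ m) ^ n * ‖t (ix m x) (ix m y)‖ := by
  rw [stepKernel, norm_mul, Complex.norm_real, Real.norm_of_nonneg (by positivity)]

/-- The factor 2^{nm} is the product of the normalizations of φ_{m,u} and φ_{m,v}; matrices at scale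
m thereby act as integral operators, and forms can be compared through their kernels. -/
theorem kernelForm_stepKernel (m : ℤ) (t : Lat n → Lat n → ℂ) {g f : Rn n → ℂ} (hg : MemLpc g 1)
    (hf : MemLpc f 1) :
    Integrable (kernelIntegrand (stepKernel m t) g f) ∧
      kernelForm (stepKernel m t) g f = dform t (scoef m g) (scoef m f) := by
  have hgi := hg.integrable
  have hfi := hf.integrable
  obtain ⟨-, A, hA, hgA⟩ := hg
  obtain ⟨-, A', hA', hfA'⟩ := hf
  set S := (finite_image_ix hA.isBounded m).toFinset
  set S' := (finite_image_ix hA'.isBounded m).toFinset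
  have hS : ∀ u ∉ S, scoef m g u = 0 := fun u hu => scoef_eq_zero hgA (by simpa [S] using hu)
  have hS' : ∀ u ∉ S', scoef m f u = 0 := fun u hu => scoef_eq_zero hfA' (by simpa [S'] using hu)
  have hN : ((((2 : ℝ) ^ m) ^ n : ℝ) : ℂ) = (nrm n m : ℂ) * nrm n m := by
    rw [← nrm_sq, sq, Complex.ofReal_mul]
  have hae : (fun z : Rn n × Rn n => ∑ u ∈ S, ∑ v ∈ S',
      t u v * ((phi m u z.1 * g z.1) * (phi m v z.2 * f z.2))) =ᵐ[volume]
      kernelIntegrand (stepKernel m t) g f := by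
    filter_upwards [ae_fst hgA, ae_snd hfA'] with z h1 h2
    by_cases hz1 : z.1 ∈ A
    swap
    · simp [kernelIntegrand, h1 hz1]
    by_cases hz2 : z.2 ∈ A'
    swap
    · simp [kernelIntegrand, h2 hz2]
    have m1 : ix m z.1 ∈ S := by simpa [S] using ⟨z.1, hz1, rfl⟩
    have m2 : ix m z.2 ∈ S' := by simpa [S'] using ⟨z.2, hz2, rfl⟩
    rw [Finset.sum_eq_single_of_mem _ m1, Finset.sum_eq_single_of_mem _ m2]
    · rw [phi_apply, phi_apply, if_pos rfl, if_pos rfl, kernelIntegrand, stepKernel, hN]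
      ring
    · intro v _ hv
      rw [phi_apply m v, if_neg (Ne.symm hv)]
      ring
    · intro u _ hu
      refine Finset.sum_eq_zero fun v _ => ?_
      rw [phi_apply m u, if_neg (Ne.symm hu)]
      ring
  have hInt : ∀ u v, Integrable fun z : Rn n × Rn n =>
      t u v * ((phi m u z.1 * g z.1) * (phi m v z.2 * f z.2)) := fun u v =>
    ((integrable_phi_mul m u hgi).mul_prod (integrable_phi_mul m v hfi)).const_mul _
  refine ⟨(integrable_finsetSum _ fun u _ => integrable_finsetSum _ fun v _ =>
    hInt u v).congr hae, ?_⟩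
  rw [kernelForm, ← integral_congr_ae hae, integral_finsetSum _ fun u _ =>
    integrable_finsetSum _ fun v _ => hInt u v, dform_eq_sum t hS hS']
  refine Finset.sum_congr rfl fun u _ => ?_
  rw [integral_finsetSum _ fun v _ => hInt u v]
  refine Finset.sum_congr rfl fun v _ => ?_
  rw [integral_const_mul]
  have := integral_prod_mul (μ := (volume : Measure (Rn n))) (ν := (volume : Measure (Rn n)))
    (fun x => phi m u x * g x) (fun x => phi m v x * f x)
  rw [Measure.volume_eq_prod, this, scoef, scoef, bracket, bracket]
  ring

/-- The finite stages of the kernel. -/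
def stageKernel (K : Rn n → Rn n → ℂ) (N : ℕ) (x y : Rn n) : ℂ :=
  stepKernel N (kap K N) x y -
    ∑ j ∈ Finset.Ico (-(N : ℤ)) (N : ℤ), stepKernel (j + 1) (tco K j) x y

theorem measurable_stageKernel (K : Rn n → Rn n → ℂ) (N : ℕ) :
    Measurable fun z : Rn n × Rn n => stageKernel K N z.1 z.2 :=
  (measurable_stepKernel _ _).sub (Finset.measurable_sum _ fun _ _ => measurable_stepKernel _ _)

theorem kernelForm_stageKernel (hK : IsLocBddKernel K) (N : ℕ) {g f : Rn n → ℂ} (hg : MemLpc g 1)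
    (hf : MemLpc f 1) :
    kernelForm (stageKernel K N) g f =
      kernelForm K (projV N g) (projV N f) - offSum K g f (N, N) := by
  have e : kernelIntegrand (stageKernel K N) g f = fun z =>
      kernelIntegrand (stepKernel N (kap K N)) g f z - ∑ j ∈ Finset.Ico (-(N : ℤ)) (N : ℤ),
        kernelIntegrand (stepKernel (j + 1) (tco K j)) g f z := by
    ext z
    simp only [kernelIntegrand, stageKernel, mul_sub, sub_mul, Finset.mul_sum, Finset.sum_mul]
  have h := fun (m : ℤ) (t : Lat n → Lat n → ℂ) => kernelForm_stepKernel m t hg hf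
  rw [kernelForm, e, integral_sub (h _ _).1 (integrable_finsetSum _ fun j _ => (h _ _).1),
    integral_finsetSum _ fun j _ => (h _ _).1]
  rw [kernelForm_projV hK _ hg hf, ← (h _ _).2, kernelForm, offSum]
  congr 1
  refine Finset.sum_congr rfl fun j _ => ?_
  rw [offDiagLevel_eq_dform K j hg hf, ← (h _ _).2, kernelForm]

/-- For points in different cubes of generation j the diagonal matrix vanishes, so refining the
scale adds the `tco` term only, and this is the term subtracted in 𝕋. -/
theorem stepKernel_kap_succ (hK : IsLocBddKernel K) {j : ℤ} {x y : Rn n} (h : ix j x ≠ ix j y) :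
    stepKernel (j + 1) (kap K (j + 1)) x y =
      stepKernel j (kap K j) x y + stepKernel (j + 1) (tco K j) x y := by
  have hd : dco K j (ix (j + 1) x) (ix (j + 1) y) = 0 :=
    dco_eq_zero K (by rwa [anc_ix, anc_ix])
  have hrt : ((((2 : ℝ) ^ (j + 1)) ^ n : ℝ) : ℂ) * (rt n * rt n) = ((((2 : ℝ) ^ j) ^ n : ℝ) : ℂ) := by
    rw [← Complex.ofReal_mul, ← Complex.ofReal_mul]
    congr 1
    rw [← sq, rt_sq, zpow_add_one₀ two_ne_zero, mul_pow]
    field_simp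
  simp only [stepKernel]
  rw [kap_succ hK, hd, anc_ix, anc_ix, add_zero, mul_add, ← hrt]
  ring

theorem stepKernel_kap_eq (hK : IsLocBddKernel K) {i j : ℤ} (hij : i ≤ j) {x y : Rn n}
    (h : ix i x ≠ ix i y) :
    stepKernel j (kap K j) x y = stepKernel i (kap K i) x y +
      ∑ m ∈ Finset.Ico i j, stepKernel (m + 1) (tco K m) x y := by
  obtain ⟨r, rfl⟩ : ∃ r : ℕ, j = i + r := ⟨(j - i).toNat, by omega⟩
  induction r with
  | zero => simp
  | succ r ih =>
    push_cast
    rw [← add_assoc, stepKernel_kap_succ hK (fun h' => h (ix_eq_of_le (by omega) h')),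
      ih (by omega), sum_Ico_int_succ_top (by omega)]
    ring

theorem sum_Ico_two_zpow_le (hn : 0 < n) (i j : ℤ) :
    ∑ m ∈ Finset.Ico i j, ((2 : ℝ) ^ (m + 1)) ^ n ≤ 2 * ((2 : ℝ) ^ j) ^ n := by
  rcases le_or_gt j i with h | h
  · rw [Finset.Ico_eq_empty_of_le h, Finset.sum_empty]
    positivity
  obtain ⟨r, rfl⟩ : ∃ r : ℕ, j = i + r := ⟨(j - i).toNat, by omega⟩
  clear h
  induction r with
  | zero =>
    rw [Nat.cast_zero, add_zero, Finset.Ico_self, Finset.sum_empty]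
    positivity
  | succ r ih =>
    push_cast
    rw [← add_assoc, sum_Ico_int_succ_top (by omega)]
    have h1 : ((2 : ℝ) ^ (i + r + 1)) ^ n = 2 ^ n * ((2 : ℝ) ^ (i + (r : ℤ))) ^ n := by
      rw [zpow_add_one₀ two_ne_zero, mul_pow, mul_comm]
    have h2 : (2 : ℝ) ≤ 2 ^ n := le_self_pow₀ (by norm_num) hn.ne'
    have h3 : (0 : ℝ) < ((2 : ℝ) ^ (i + (r : ℤ))) ^ n := by positivity
    rw [h1]
    nlinarith

theorem norm_sum_stepKernel_le (hn : 0 < n) {D : ℝ} (hD : ∀ j u v, ‖tco K j u v‖ ≤ D) (i j : ℤ)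
    (x y : Rn n) : ‖∑ m ∈ Finset.Ico i j, stepKernel (m + 1) (tco K m) x y‖ ≤
      2 * D * ((2 : ℝ) ^ j) ^ n := by
  have hD0 : 0 ≤ D := (norm_nonneg _).trans (hD 0 0 0)
  calc _ ≤ ∑ m ∈ Finset.Ico i j, ((2 : ℝ) ^ (m + 1)) ^ n * D := by
        refine (norm_sum_le _ _).trans (Finset.sum_le_sum fun m _ => ?_)
        rw [norm_stepKernel]
        exact mul_le_mul_of_nonneg_left (hD _ _ _) (by positivity)
    _ ≤ 2 * ((2 : ℝ) ^ j) ^ n * D := by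
        rw [← Finset.sum_mul]
        exact mul_le_mul_of_nonneg_right (sum_Ico_two_zpow_le hn i j) hD0
    _ = _ := by ring

/-- A scale which separates two points. -/
theorem exists_ix_ne (hn : 0 < n) {x y : Rn n} (h : x ≠ y) :
    ∃ J : ℤ, ix J x ≠ ix J y ∧ ((2 : ℝ) ^ J) ^ n ≤ (2 * n) ^ n / ‖x - y‖ ^ n := by
  have hd : 0 < ‖x - y‖ := norm_pos_iff.2 (sub_ne_zero.2 h)
  have hn' : (0 : ℝ) < n := by exact_mod_cast hn
  -- m is chosen with 2^m ≤ n/|x - y| < 2^{m+1}. A common cube of generation m + 1 would force |x -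
  -- y| ≤ n 2^{-(m+1)}, which is false.
  obtain ⟨m, h1, h2⟩ := exists_mem_Ico_zpow (x := (n : ℝ) / ‖x - y‖) (y := 2) (by positivity)
    (by norm_num)
  refine ⟨m + 1, fun h3 => ?_, ?_⟩
  · have h4 := norm_sub_le_of_ix_eq h3
    rw [zpow_neg, ← div_eq_mul_inv, le_div_iff₀ (by positivity), mul_comm,
      ← le_div_iff₀ hd] at h4
    exact absurd h2 (not_lt.2 h4)
  · rw [← div_pow]
    refine pow_le_pow_left₀ (by positivity) ?_ n
    rw [zpow_add_one₀ two_ne_zero, mul_div_assoc, mul_comm]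
    gcongr

theorem CZKernel.exists_norm_kap_le (hn : 0 < n) {s A : ℝ} (hK : CZKernel K s A) :
    ∃ C : ℝ, 0 ≤ C ∧ ∀ j u v, u ≠ v → ‖kap K j u v‖ ≤ C := by
  obtain ⟨C, hC0, hC⟩ := exists_norm_kernelForm_atom_le hn A
  exact ⟨C, hC0, fun j u v h => hC K hK.size j u v h _ _ (isAtom_haar _ _ _) (isAtom_haar _ _ _)⟩

/-- The kernel of the perfect dyadic part. -/
def perfKernel (K : Rn n → Rn n → ℂ) (x y : Rn n) : ℂ :=
  if x = y then 0 else limUnder atTop fun N => stageKernel K N x y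

/-- Beyond a separating scale J the growth of the kernel of P_j T P_j is cancelled exactly by the
subtracted terms. The stage depends on N only through the coarse tail, which is geometrically small.
-/
theorem CZKernel.stageKernel_eq {s A : ℝ} (hK : CZKernel K s A) {x y : Rn n} {J : ℤ}
    (hJ : ix J x ≠ ix J y) {N : ℕ} (h1 : -(N : ℤ) ≤ J) (h2 : J ≤ N) :
    stageKernel K N x y = stepKernel J (kap K J) x y -
      ∑ j ∈ Finset.Ico (-(N : ℤ)) J, stepKernel (j + 1) (tco K j) x y := by
  rw [stageKernel, stepKernel_kap_eq hK.toIsLocBddKernel h2 hJ,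
    ← Finset.Ico_union_Ico_eq_Ico h1 h2, Finset.sum_union (Finset.Ico_disjoint_Ico_consecutive _ _ _)]
  ring

theorem CZKernel.tendsto_stageKernel (hn : 0 < n) {s A : ℝ} (hK : CZKernel K s A) {x y : Rn n}
    (h : x ≠ y) : Tendsto (fun N => stageKernel K N x y) atTop (𝓝 (perfKernel K x y)) := by
  rw [perfKernel, if_neg h]
  refine tendsto_nhds_limUnder ?_
  obtain ⟨J, hJ, -⟩ := exists_ix_ne hn h
  obtain ⟨D, hD0, hD⟩ := hK.exists_norm_tco_le hn
  have hs : Summable fun i : ℕ => stepKernel (J - 1 - i + 1) (tco K (J - 1 - i)) x y := by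
    refine Summable.of_norm_bounded (g := fun i : ℕ => ((2 : ℝ) ^ J) ^ n * D * (2⁻¹ : ℝ) ^ i)
      ((summable_geometric_of_lt_one (by norm_num) (by norm_num)).mul_left _) fun i => ?_
    rw [norm_stepKernel]
    have h1 : ((2 : ℝ) ^ (J - 1 - i + 1)) ^ n ≤ ((2 : ℝ) ^ J) ^ n * (2⁻¹ : ℝ) ^ i := by
      rw [show ((2 : ℝ) ^ (J - 1 - i + 1)) = (2 : ℝ) ^ J * (2⁻¹ : ℝ) ^ i by
        rw [show J - 1 - (i : ℤ) + 1 = J - i by ring, zpow_sub₀ two_ne_zero, zpow_natCast, inv_pow,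
          div_eq_mul_inv], mul_pow]
      refine mul_le_mul_of_nonneg_left ?_ (by positivity)
      exact pow_le_of_le_one (by positivity) (pow_le_one₀ (by norm_num) (by norm_num)) hn.ne'
    calc _ ≤ (((2 : ℝ) ^ J) ^ n * (2⁻¹ : ℝ) ^ i) * D := by
          gcongr
          exact hD _ _ _
      _ = _ := by ring
  have htend : Tendsto (fun N : ℕ => (N + J).toNat) atTop atTop := by
    refine tendsto_atTop_mono (f := fun N : ℕ => N - J.natAbs) (fun N => by omega) ?_
    exact tendsto_sub_atTop_nat _
  refine ⟨_, ((tendsto_const_nhds (x := stepKernel J (kap K J) x y)).sub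
    (hs.hasSum.tendsto_sum_nat.comp htend)).congr' ?_⟩
  filter_upwards [eventually_ge_atTop J.natAbs] with N hN
  rw [hK.stageKernel_eq hJ (by omega) (by omega)]
  congr 1
  simp only [Function.comp_apply]
  refine Finset.sum_bij (fun (r : ℕ) _ => J - 1 - (r : ℤ)) ?_ ?_ ?_ ?_
  · intro r hr
    have := Finset.mem_range.1 hr
    rw [Finset.mem_Ico]
    omega
  · intro r _ r' _ h
    omega
  · intro j hj
    rw [Finset.mem_Ico] at hj
    exact ⟨(J - 1 - j).toNat, Finset.mem_range.2 (by omega), by omega⟩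
  · intro r _; rfl

theorem CZKernel.measurable_perfKernel (hn : 0 < n) {s A : ℝ} (hK : CZKernel K s A) :
    Measurable fun z : Rn n × Rn n => perfKernel K z.1 z.2 := by
  have hdiag : MeasurableSet {z : Rn n × Rn n | z.1 = z.2} :=
    measurableSet_eq_fun measurable_fst measurable_snd
  classical
  refine measurable_of_tendsto_metrizable (f := fun (N : ℕ) (z : Rn n × Rn n) =>
    if z.1 = z.2 then 0 else stageKernel K N z.1 z.2)
    (fun N => Measurable.ite hdiag measurable_const (measurable_stageKernel K N)) ?_
  rw [tendsto_pi_nhds]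
  intro z
  by_cases hz : z.1 = z.2
  · simp [hz, perfKernel]
  · simp only [hz, if_false]
    exact hK.tendsto_stageKernel hn hz

/-- At the separating scale J the entry of `kap` is bounded because the two cubes are distinct, and
the tail of `tco` terms is a geometric series; both contribute O(2^{nJ}) with 2^{nJ} ≤ (2n)^n |x -
y|^{-n}. -/
theorem CZKernel.exists_norm_perfKernel_le (hn : 0 < n) {s A : ℝ} (hK : CZKernel K s A) :
    ∃ C : ℝ, ∀ x y, x ≠ y → ‖perfKernel K x y‖ ≤ C / ‖x - y‖ ^ n := by
  obtain ⟨C, hC0, hC⟩ := hK.exists_norm_kap_le hn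
  obtain ⟨D, hD0, hD⟩ := hK.exists_norm_tco_le hn
  refine ⟨(C + 2 * D) * (2 * n) ^ n, fun x y h => ?_⟩
  obtain ⟨J, hJ, hJ'⟩ := exists_ix_ne hn h
  refine le_of_tendsto (hK.tendsto_stageKernel hn h).norm ?_
  filter_upwards [eventually_ge_atTop J.natAbs] with N hN
  rw [hK.stageKernel_eq hJ (by omega) (by omega)]
  calc _ ≤ ((2 : ℝ) ^ J) ^ n * C + 2 * D * ((2 : ℝ) ^ J) ^ n := by
        refine (norm_sub_le _ _).trans (add_le_add ?_ (norm_sum_stepKernel_le hn hD _ _ _ _))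
        rw [norm_stepKernel]
        exact mul_le_mul_of_nonneg_left (hC _ _ _ hJ) (by positivity)
    _ = (C + 2 * D) * ((2 : ℝ) ^ J) ^ n := by ring
    _ ≤ (C + 2 * D) * ((2 * n) ^ n / ‖x - y‖ ^ n) := by gcongr
    _ = _ := by ring

/-- The finite stages of the kernel are dominated on compact sets. -/
theorem CZKernel.exists_norm_stageKernel_le (hn : 0 < n) {s A : ℝ} (hK : CZKernel K s A)
    {S : Set (Rn n)} (hS : IsCompact S) : ∃ C M : ℝ, 0 ≤ C ∧ 0 ≤ M ∧
      ∀ (N : ℕ) (x y : Rn n), x ∈ S → y ∈ S → x ≠ y →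
        ‖stageKernel K N x y‖ ≤ C * (‖x - y‖ ^ n)⁻¹ + M := by
  obtain ⟨C, hC0, hC⟩ := hK.exists_norm_kap_le hn
  obtain ⟨D, hD0, hD⟩ := hK.exists_norm_tco_le hn
  obtain ⟨M, hM0, hM⟩ := hK.norm_kernelForm_le (hS.cthickening (r := (n : ℝ)))
  refine ⟨(C + 2 * D) * (2 * n) ^ n, C + M, by positivity, by positivity,
    fun N x y hx hy h => ?_⟩
  obtain ⟨J, hJ, hJ'⟩ := exists_ix_ne hn h
  rw [div_eq_mul_inv] at hJ'
  have hJ'' : (C + 2 * D) * ((2 : ℝ) ^ J) ^ n ≤ (C + 2 * D) * (2 * n) ^ n * (‖x - y‖ ^ n)⁻¹ := by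
    rw [mul_assoc]
    exact mul_le_mul_of_nonneg_left hJ' (by positivity)
  have hpow : (0 : ℝ) < ((2 : ℝ) ^ J) ^ n := by positivity
  have hpos : 0 ≤ (C + 2 * D) * (2 * n) ^ n * (‖x - y‖ ^ n)⁻¹ := by positivity
  -- Three cases. If x and y are already separated at the coarsest scale -N, only the matrix entry
  -- at that scale is left and 2^{-nN} ≤ 1. If J lies between -N and N, the bound is that of the
  -- limit kernel.
  rcases le_or_gt J (-(N : ℤ)) with h1 | h1
  · have hN : ix (-(N : ℤ)) x ≠ ix (-(N : ℤ)) y := fun h' => hJ (ix_eq_of_le h1 h')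
    rw [hK.stageKernel_eq hN le_rfl (by omega), Finset.Ico_self, Finset.sum_empty, sub_zero,
      norm_stepKernel]
    have h2 : ((2 : ℝ) ^ (-(N : ℤ))) ^ n ≤ 1 :=
      pow_le_one₀ (by positivity) (zpow_le_one_of_nonpos₀ (by norm_num) (by omega))
    calc _ ≤ 1 * C := by
          gcongr
          exact hC _ _ _ hN
      _ ≤ _ := by linarith
  rcases le_or_gt J N with h2 | h2
  · rw [hK.stageKernel_eq hJ h1.le h2]
    calc _ ≤ ((2 : ℝ) ^ J) ^ n * C + 2 * D * ((2 : ℝ) ^ J) ^ n := by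
          refine (norm_sub_le _ _).trans (add_le_add ?_ (norm_sum_stepKernel_le hn hD _ _ _ _))
          rw [norm_stepKernel]
          exact mul_le_mul_of_nonneg_left (hC _ _ _ hJ) (by positivity)
      _ = (C + 2 * D) * ((2 : ℝ) ^ J) ^ n := by ring
      _ ≤ _ := by linarith
  -- When J > N, the points may still share a cube of generation N and the size condition says
  -- nothing about the `kap` entry. Local boundedness of `K` bounds that step kernel instead, as an
  -- average of `K` near (x, y).
  · rw [stageKernel]
    have h3 : ‖stepKernel N (kap K N) x y‖ ≤ M := by
      have hsupp : ∀ w ∈ S, SupportedIn (phi (N : ℤ) (ix N w)) (Metric.cthickening (n : ℝ) S) := by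
        intro w hw
        refine Eventually.of_forall fun v hv => ?_
        rw [phi_apply, if_neg]
        intro hvw
        refine hv (Metric.mem_cthickening_of_dist_le v w _ S hw ?_)
        rw [dist_eq_norm]
        refine (norm_sub_le_of_ix_eq hvw).trans ?_
        exact mul_le_of_le_one_right (Nat.cast_nonneg n)
          (zpow_le_one_of_nonpos₀ (by norm_num) (by omega))
      have h4 := hM _ _ (memLpc_phi (N : ℤ) (ix N x) 1) (memLpc_phi (N : ℤ) (ix N y) 1)
        (hsupp x hx) (hsupp y hy)
      have h5 : ∀ u : Lat n, ∫ w, ‖phi (N : ℤ) u w‖ ≤ (nrm n N)⁻¹ := fun u =>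
        (isAtom_haar _ _ _).integral_norm_le
      have hnp := nrm_pos n N
      rw [norm_stepKernel, ← nrm_sq]
      calc nrm n N ^ 2 * ‖kap K N (ix N x) (ix N y)‖
          ≤ nrm n N ^ 2 * (M * ((nrm n N)⁻¹ * (nrm n N)⁻¹)) := by
            refine mul_le_mul_of_nonneg_left (h4.trans ?_) (by positivity)
            exact mul_le_mul_of_nonneg_left (mul_le_mul (h5 _) (h5 _)
              (integral_nonneg fun w => norm_nonneg _) (by positivity)) hM0
        _ = M := by field_simp
    have h6 := norm_sum_stepKernel_le hn hD (-(N : ℤ)) N x y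
    have h7 : ((2 : ℝ) ^ (N : ℤ)) ^ n ≤ ((2 : ℝ) ^ J) ^ n :=
      pow_le_pow_left₀ (by positivity) (zpow_le_zpow_right₀ (by norm_num) h2.le) n
    have h8 : 2 * D * ((2 : ℝ) ^ (N : ℤ)) ^ n ≤ (C + 2 * D) * ((2 : ℝ) ^ J) ^ n := by
      calc _ ≤ 2 * D * ((2 : ℝ) ^ J) ^ n := by gcongr
        _ ≤ _ := by
          gcongr
          linarith
    calc _ ≤ M + 2 * D * ((2 : ℝ) ^ (N : ℤ)) ^ n :=
          (norm_sub_le _ _).trans (add_le_add h3 h6)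
      _ ≤ _ := by linarith

/-- The diagonal form is given by its kernel on separated functions. -/
theorem CZKernel.diagForm_eq_kernelForm (hn : 0 < n) {s A : ℝ} (hK : CZKernel K s A)
    {p q : ℝ≥0∞} (hpq : DualExponents p q) {g f : Rn n → ℂ} (hf : MemLpc f p) (hg : MemLpc g q)
    (hne : ∀ᵐ z : Rn n × Rn n, g z.1 ≠ 0 → f z.2 ≠ 0 → z.1 ≠ z.2)
    (hInt : Integrable (kernelIntegrand (fun x y => (((‖x - y‖ ^ n)⁻¹ : ℝ) : ℂ)) g f)) :
    Integrable (kernelIntegrand (perfKernel K) g f) ∧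
      diagForm K g f = kernelForm (perfKernel K) g f := by
  have hg1 := hg.memLp_of_le hpq.symm.1.le
  have hf1 := hf.memLp_of_le hpq.1.le
  obtain ⟨S₁, hS₁, hgS⟩ := hg.2
  obtain ⟨S₂, hS₂, hfS⟩ := hf.2
  obtain ⟨C, M, hC, hM, H⟩ := hK.exists_norm_stageKernel_le hn (hS₁.union hS₂)
  -- A majorant for all stages at once: the first part is integrable by the hypothesis on |x -
  -- y|^{-n}, the second because g and f are integrable.
  set bd : Rn n × Rn n → ℝ := fun z =>
    C * ‖kernelIntegrand (fun x y => (((‖x - y‖ ^ n)⁻¹ : ℝ) : ℂ)) g f z‖ +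
      M * (‖g z.1‖ * ‖f z.2‖) with hbd
  have hbdi : Integrable bd :=
    (hInt.norm.const_mul C).add ((hg1.integrable.norm.mul_prod hf1.integrable.norm).const_mul M)
  have hmeas : ∀ L : Rn n → Rn n → ℂ, Measurable (fun z : Rn n × Rn n => L z.1 z.2) →
      AEStronglyMeasurable (kernelIntegrand L g f) := fun L hL =>
    (hg1.integrable.1.comp_fst.mul hL.aestronglyMeasurable).mul hf1.integrable.1.comp_snd
  have hb : ∀ N, ∀ᵐ z, ‖kernelIntegrand (stageKernel K N) g f z‖ ≤ bd z := by
    intro N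
    filter_upwards [hne, ae_fst hgS, ae_snd hfS] with z hz h1 h2
    by_cases hgz : g z.1 = 0
    · simp [kernelIntegrand, hbd, hgz]
    by_cases hfz : f z.2 = 0
    · simp [kernelIntegrand, hbd, hfz]
    have m1 : z.1 ∈ S₁ ∪ S₂ := Or.inl (by by_contra h; exact hgz (h1 h))
    have m2 : z.2 ∈ S₁ ∪ S₂ := Or.inr (by by_contra h; exact hfz (h2 h))
    have h3 := H N z.1 z.2 m1 m2 (hz hgz hfz)
    simp only [kernelIntegrand, hbd, norm_mul, Complex.norm_real]
    rw [Real.norm_of_nonneg (by positivity : 0 ≤ (‖z.1 - z.2‖ ^ n)⁻¹)]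
    calc _ ≤ ‖g z.1‖ * (C * (‖z.1 - z.2‖ ^ n)⁻¹ + M) * ‖f z.2‖ := by gcongr
      _ = _ := by ring
  have hlim : ∀ᵐ z, Tendsto (fun N => kernelIntegrand (stageKernel K N) g f z) atTop
      (𝓝 (kernelIntegrand (perfKernel K) g f z)) := by
    filter_upwards [hne] with z hz
    by_cases hgz : g z.1 = 0
    · simp [kernelIntegrand, hgz]
    by_cases hfz : f z.2 = 0
    · simp [kernelIntegrand, hfz]
    exact ((hK.tendsto_stageKernel hn (hz hgz hfz)).const_mul _).mul_const _
  refine ⟨?_, ?_⟩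
  · refine hbdi.mono' (hmeas _ (hK.measurable_perfKernel hn)) ?_
    filter_upwards [hlim, ae_all_iff.2 hb] with z h1 h2
    exact le_of_tendsto h1.norm (Eventually.of_forall h2)
  · have h1 := tendsto_integral_of_dominated_convergence bd
      (fun N => hmeas _ (measurable_stageKernel K N)) hbdi hb hlim
    have h2 : Tendsto (fun N : ℕ => kernelForm (stageKernel K N) g f) atTop
        (𝓝 (diagForm K g f)) := by
      have h3 := ((hK.tendsto_kernelForm_projV hpq hg hf).comp
        (tendsto_natCast_atTop_atTop (R := ℤ))).sub
        ((hK.tendsto_offSum hn hpq hg hf).comp (tendsto_atTop_diagonal (α := ℕ)))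
      refine h3.congr fun N => ?_
      rw [kernelForm_stageKernel hK.toIsLocBddKernel N hg1 hf1]
      rfl
    exact tendsto_nhds_unique h2 h1

end

/-! ### Realization of the forms by operators, and the boundedness of T - 𝕋 on L^p. -/

section

variable {n : ℕ} {K : Rn n → Rn n → ℂ}

/-! ### Duality -/

theorem dualExponents_two : DualExponents 2 2 :=
  ⟨by norm_num, by norm_num, inferInstance⟩

theorem memLpc_of_bounded {g : Rn n → ℂ} (hg : Measurable g) {C R : ℝ} (hC : ∀ x, ‖g x‖ ≤ C)
    (hR : ∀ x, g x ≠ 0 → ‖x‖ ≤ R) (r : ℝ≥0∞) : MemLpc g r := by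
  have hs : ∀ x, x ∉ Metric.closedBall (0 : Rn n) R → g x = 0 := by
    intro x hx
    by_contra h
    exact hx (mem_closedBall_zero_iff.2 (hR x h))
  refine ⟨?_, Metric.closedBall 0 R, isCompact_closedBall 0 R, ae_of_all _ hs⟩
  have hfin : volume (Metric.closedBall (0 : Rn n) R) ≠ ⊤ := measure_closedBall_lt_top.ne
  have : IsFiniteMeasure ((volume : Measure (Rn n)).restrict (Metric.closedBall 0 R)) :=
    ⟨by rw [Measure.restrict_apply_univ]; exact hfin.lt_top⟩
  have h1 : MemLp g r (volume.restrict (Metric.closedBall (0 : Rn n) R)) :=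
    MemLp.of_bound hg.aestronglyMeasurable C (ae_of_all _ hC)
  have h2 := (memLp_indicator_iff_restrict Metric.isClosed_closedBall.measurableSet).2 h1
  refine (memLp_congr_ae (ae_of_all _ fun x => ?_)).1 h2
  classical
  rw [Set.indicator_apply]
  split_ifs with hx
  · rfl
  · exact (hs x hx).symm

theorem le_of_le_mul_rpow {p q : ℝ} (hpq : p.HolderConjugate q) {I c : ℝ≥0∞} (hI : I ≠ ⊤)
    (h : I ≤ c * I ^ (1 / q)) : I ≤ c ^ p := by
  rcases eq_or_ne I 0 with h0 | h0
  · rw [h0]; exact zero_le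
  have h1 : I ^ (1 / p) ≤ c := by
    have h2 : I = I ^ (1 / p) * I ^ (1 / q) := by
      rw [← ENNReal.rpow_add _ _ h0 hI]
      have := hpq.inv_add_inv_eq_one
      rw [one_div, one_div, this, ENNReal.rpow_one]
    have h3 : I ^ (1 / q) ≠ 0 := by simp [ENNReal.rpow_eq_zero_iff, h0, hI]
    have h4 : I ^ (1 / q) ≠ ⊤ := ENNReal.rpow_ne_top_of_nonneg (by
      have := hpq.symm.pos; positivity) hI
    rw [h2] at h
    nth_rewrite 2 [← h2] at h
    exact (ENNReal.mul_le_mul_iff_left h3 h4).1 h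
  calc I = (I ^ (1 / p)) ^ p := by
        rw [← ENNReal.rpow_mul, one_div, inv_mul_cancel₀ hpq.pos.ne', ENNReal.rpow_one]
    _ ≤ c ^ p := ENNReal.rpow_le_rpow h1 hpq.pos.le

/-- The part of `ℝⁿ` on which `x` and `h x` are at most `R`. -/
def sublevel (h : Rn n → ℂ) (R : ℝ) : Set (Rn n) := {x | ‖x‖ ≤ R ∧ ‖h x‖ ≤ R}

theorem measurableSet_sublevel {h : Rn n → ℂ} (hm : Measurable h) (R : ℝ) :
    MeasurableSet (sublevel h R) :=
  (measurableSet_le measurable_norm measurable_const).inter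
    (measurableSet_le hm.norm measurable_const)

/-- The extremal function of Hölder's inequality, conj(h)|h|^{p-2}, is cut off to a set where x and
h are bounded. It is then an admissible test function, and the integral I is finite without knowing
that h lies in L^p; I ≤ C I^{1/q} gives the bound. -/
theorem setLIntegral_sublevel_le {p q : ℝ≥0∞} (hpq : DualExponents p q) {h : Rn n → ℂ}
    (hm : Measurable h) {C : ℝ} (hC : 0 ≤ C)
    (H : ∀ g, (∀ r, MemLpc g r) → ‖∫ x, g x * h x‖ ≤ C * (eLpNorm g q volume).toReal) (R : ℝ) :
    ∫⁻ x in sublevel h R, ‖h x‖ₑ ^ p.toReal ≤ ENNReal.ofReal C ^ p.toReal := by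
  have hreal := hpq.real
  have hp1 : 0 < p.toReal - 1 := by linarith [hreal.lt]
  have hA := measurableSet_sublevel hm R
  -- The exponent p - 2 may be negative; where h x = 0 the conjugate factor makes the product zero.
  set w : Rn n → ℂ := fun x => starRingEnd ℂ (h x) * ((‖h x‖ ^ (p.toReal - 2) : ℝ) : ℂ) with hw
  have hwn : ∀ x, ‖w x‖ = ‖h x‖ ^ (p.toReal - 1) := by
    intro x
    rw [hw]
    simp only [norm_mul, RCLike.norm_conj, Complex.norm_real]
    rw [Real.norm_of_nonneg (by positivity)]
    rcases eq_or_ne (h x) 0 with h0 | h0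
    · rw [h0, norm_zero, zero_mul, Real.zero_rpow hp1.ne']
    · have : 0 < ‖h x‖ := norm_pos_iff.2 h0
      rw [show p.toReal - 1 = 1 + (p.toReal - 2) by ring, Real.rpow_add this, Real.rpow_one]
  have hwh : ∀ x, w x * h x = ((‖h x‖ ^ p.toReal : ℝ) : ℂ) := by
    intro x
    rcases eq_or_ne (h x) 0 with h0 | h0
    · rw [h0, norm_zero, mul_zero, Real.zero_rpow hreal.pos.ne', Complex.ofReal_zero]
    · have : 0 < ‖h x‖ := norm_pos_iff.2 h0
      have h1 : starRingEnd ℂ (h x) * h x = ((‖h x‖ ^ (2 : ℝ) : ℝ) : ℂ) := by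
        rw [mul_comm, Complex.mul_conj, Complex.normSq_eq_norm_sq]
        norm_cast
      rw [hw]
      simp only
      rw [mul_right_comm, h1, ← Complex.ofReal_mul, ← Real.rpow_add this]
      congr 2
      ring
  have hwm : Measurable w := by
    have h1 : Measurable fun x => starRingEnd ℂ (h x) :=
      Complex.continuous_conj.measurable.comp hm
    exact h1.mul (Complex.measurable_ofReal.comp (hm.norm.pow_const _))
  set g : Rn n → ℂ := (sublevel h R).indicator w with hg
  have hgLp : ∀ r, MemLpc g r := by
    classical
    refine memLpc_of_bounded (hwm.indicator hA) (C := |R| ^ (p.toReal - 1)) (R := R) ?_ ?_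
    · intro x
      rw [hg, Set.indicator_apply]
      split_ifs with hx
      · rw [hwn]
        exact Real.rpow_le_rpow (norm_nonneg _) (hx.2.trans (le_abs_self R)) hp1.le
      · rw [norm_zero]; positivity
    · intro x hx
      exact (Set.mem_of_indicator_ne_zero hx).1
  set I := ∫⁻ x in sublevel h R, ‖h x‖ₑ ^ p.toReal with hI
  have henorm : ∀ x, ENNReal.ofReal (‖h x‖ ^ p.toReal) = ‖h x‖ₑ ^ p.toReal := by
    intro x
    rw [← ENNReal.ofReal_rpow_of_nonneg (norm_nonneg _) hreal.pos.le, ofReal_norm]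
  have hgq : eLpNorm g q volume = I ^ (1 / q.toReal) := by
    rw [eLpNorm_eq_lintegral_rpow_enorm_toReal (zero_lt_one.trans hpq.symm.1).ne'
      hpq.snd_ne_top, hI, ← lintegral_indicator hA]
    congr 1
    refine lintegral_congr fun x => ?_
    classical
    rw [hg, Set.indicator_apply, Set.indicator_apply]
    split_ifs with hx
    · rw [← ofReal_norm, hwn, ENNReal.ofReal_rpow_of_nonneg (by positivity) hreal.symm.pos.le,
        ← Real.rpow_mul (norm_nonneg _), hreal.sub_one_mul_conj, henorm]
    · rw [enorm_zero, ENNReal.zero_rpow_of_pos hreal.symm.pos]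
  have hIt : I ≠ ⊤ := by
    have h1 : I ^ (1 / q.toReal) < ⊤ := hgq ▸ (hgLp q).1.2
    intro h2
    rw [h2, ENNReal.top_rpow_of_pos (by have := hreal.symm.pos; positivity)] at h1
    exact lt_irrefl _ h1
  have hInt : ‖∫ x, g x * h x‖ = I.toReal := by
    have h1 : ∀ x, g x * h x = ((sublevel h R).indicator (fun x => ‖h x‖ ^ p.toReal) x : ℝ) := by
      intro x
      classical
      rw [hg, Set.indicator_apply, Set.indicator_apply]
      split_ifs with hx
      · exact hwh x
      · simp
    rw [integral_congr_ae (ae_of_all _ h1), integral_complex_ofReal, integral_indicator hA,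
      Complex.norm_real, integral_eq_lintegral_of_nonneg_ae
        (ae_of_all _ fun x => by positivity)
        (hm.norm.pow_const _).aestronglyMeasurable, Real.norm_of_nonneg ENNReal.toReal_nonneg]
    simp only [henorm]
    rfl
  have h1 := H g hgLp
  rw [hInt, hgq] at h1
  refine le_of_le_mul_rpow hreal hIt ?_
  rw [← ENNReal.toReal_le_toReal hIt (ENNReal.mul_ne_top ENNReal.ofReal_ne_top (hgq ▸ (hgLp q).1.2.ne)),
    ENNReal.toReal_mul, ENNReal.toReal_ofReal hC]
  exact h1

/-- The converse of Hölder's inequality. -/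
theorem eLpNorm_le_of_forall_integral {p q : ℝ≥0∞} (hpq : DualExponents p q) {h : Rn n → ℂ}
    (hm : Measurable h) {C : ℝ} (hC : 0 ≤ C)
    (H : ∀ g, (∀ r, MemLpc g r) → ‖∫ x, g x * h x‖ ≤ C * (eLpNorm g q volume).toReal) :
    eLpNorm h p volume ≤ ENNReal.ofReal C := by
  have hp := hpq.real.pos
  have hU : ⋃ N : ℕ, sublevel h N = Set.univ := by
    refine Set.eq_univ_of_forall fun x => ?_
    obtain ⟨N, hN⟩ := exists_nat_ge (max ‖x‖ ‖h x‖)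
    exact Set.mem_iUnion.2 ⟨N, (le_max_left _ _).trans hN, (le_max_right _ _).trans hN⟩
  have hd : Directed (· ⊆ ·) fun N : ℕ => sublevel h N := by
    refine Monotone.directed_le (f := fun N : ℕ => sublevel h N) fun M N hMN x hx => ?_
    have : (M : ℝ) ≤ N := by exact_mod_cast hMN
    exact ⟨hx.1.trans this, hx.2.trans this⟩
  have h1 : ∫⁻ x, ‖h x‖ₑ ^ p.toReal ≤ ENNReal.ofReal C ^ p.toReal := by
    rw [← setLIntegral_univ, ← hU, setLIntegral_iUnion_of_directed _ hd]
    exact iSup_le fun N => setLIntegral_sublevel_le hpq hm hC H N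
  rw [eLpNorm_eq_lintegral_rpow_enorm_toReal (zero_lt_one.trans hpq.1).ne' hpq.2.1.ne]
  calc (∫⁻ x, ‖h x‖ₑ ^ p.toReal) ^ (1 / p.toReal)
      ≤ (ENNReal.ofReal C ^ p.toReal) ^ (1 / p.toReal) :=
        ENNReal.rpow_le_rpow h1 (by positivity)
    _ = ENNReal.ofReal C := by
        rw [← ENNReal.rpow_mul, mul_one_div_cancel hp.ne', ENNReal.rpow_one]

theorem ae_eq_of_forall_integral {h h' : Rn n → ℂ} (hm : Measurable h) (hm' : Measurable h')
    (h2 : MemLp h 2) (h2' : MemLp h' 2)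
    (H : ∀ g, MemLpc g 2 → ∫ x, g x * h x = ∫ x, g x * h' x) : h =ᵐ[volume] h' := by
  have h1 : eLpNorm (h - h') 2 volume ≤ ENNReal.ofReal 0 := by
    refine eLpNorm_le_of_forall_integral dualExponents_two (hm.sub hm') le_rfl fun g hg => ?_
    have hi : Integrable fun x => g x * h x := (hg 2).1.integrable_mul h2
    have hi' : Integrable fun x => g x * h' x := (hg 2).1.integrable_mul h2'
    have : ∫ x, g x * (h - h') x = 0 := by
      simp only [Pi.sub_apply, mul_sub]
      rw [integral_sub hi hi', H g (hg 2), sub_self]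
    rw [this, norm_zero, zero_mul]
  rw [ENNReal.ofReal_zero, nonpos_iff_eq_zero,
    eLpNorm_eq_zero_iff (hm.sub hm').aestronglyMeasurable (by norm_num)] at h1
  filter_upwards [h1] with x hx
  exact sub_eq_zero.1 hx

/-- Test functions, as elements of `L^p`. -/
def testToLp (p : ℝ≥0∞) : TestFn n →ₗ[ℂ] Lp ℂ p (volume : Measure (Rn n)) where
  toFun f := (TestFn.memLp f p).toLp f
  map_add' f g := MemLp.toLp_add (TestFn.memLp f p) (TestFn.memLp g p)
  map_smul' c f := MemLp.toLp_const_smul c (TestFn.memLp f p)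

theorem denseRange_testToLp {p : ℝ≥0∞} [Fact (1 ≤ p)] (hp : p ≠ ⊤) :
    DenseRange (testToLp (n := n) p) := by
  refine (Lp.dense_hasCompactSupport_contDiff (F := ℂ) (μ := (volume : Measure (Rn n))) hp).mono ?_
  rintro f ⟨g, hfg, hc, hs⟩
  let φ : TestFn n := ⟨g, hs, hc, Set.subset_univ _⟩
  exact ⟨φ, Lp.ext ((MemLp.coeFn_toLp (TestFn.memLp φ p)).trans hfg.symm)⟩

/-- The space `L^p_c`. -/
def lpcSubmodule (n : ℕ) (p : ℝ≥0∞) : Submodule ℂ (Rn n → ℂ) where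
  carrier := {f | MemLpc f p}
  add_mem' hf hg := MemLpc.add hf hg
  zero_mem' := MemLpc.zero p
  smul_mem' c _ hf := MemLpc.smul c hf

/-- The map from `L^p_c` to `L^p`. -/
def lpcToLp (p : ℝ≥0∞) : lpcSubmodule n p →ₗ[ℂ] Lp ℂ p (volume : Measure (Rn n)) where
  toFun f := f.2.1.toLp f.1
  map_add' f g := MemLp.toLp_add f.2.1 g.2.1
  map_smul' c f := MemLp.toLp_const_smul c f.2.1

theorem TestFn.memLpc (f : TestFn n) (p : ℝ≥0∞) : MemLpc f p :=
  memLpc_of_continuous f.continuous f.hasCompactSupport p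

theorem denseRange_lpcToLp {p : ℝ≥0∞} [Fact (1 ≤ p)] (hp : p ≠ ⊤) :
    DenseRange (lpcToLp (n := n) p) := by
  refine (denseRange_testToLp hp).mono ?_
  rintro _ ⟨f, rfl⟩
  exact ⟨⟨f, TestFn.memLpc f p⟩, rfl⟩

theorem norm_lpcToLp {p : ℝ≥0∞} (f : lpcSubmodule n p) :
    ‖lpcToLp p f‖ = (eLpNorm f.1 p volume).toReal :=
  Lp.norm_toLp f.1 f.2.1

/-- By the L² bound, g ↦ ⟨g, 𝒯f⟩ extends from the dense space L²_c to L², where the Riesz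
representation applies. The conjugate appears because the bracket is bilinear and the inner product
is not. -/
theorem CZKernel.exists_offForm_eq_integral (hn : 0 < n) {s A : ℝ} (hK : CZKernel K s A)
    {f : Rn n → ℂ} (hf : MemLpc f 2) :
    ∃ h : Rn n → ℂ, Measurable h ∧ MemLp h 2 ∧
      ∀ g, MemLpc g 2 → offForm K g f = ∫ x, g x * h x := by
  obtain ⟨C, -, hC⟩ := hK.exists_offForm_le hn dualExponents_two
  let φ : lpcSubmodule n 2 →ₗ[ℂ] ℂ :=
    { toFun := fun g => offForm K g.1 f
      map_add' := fun g g' => hK.offForm_add_left hn dualExponents_two g.2 g'.2 hf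
      map_smul' := fun c g => hK.offForm_smul_left hn dualExponents_two c g.2 hf }
  have hdense : DenseRange (lpcToLp (n := n) 2) := denseRange_lpcToLp (by norm_num)
  have hbd : ∃ C, ∀ g, ‖φ g‖ ≤ C * ‖lpcToLp 2 g‖ :=
    ⟨C * (eLpNorm f 2 volume).toReal, fun g => by
      rw [norm_lpcToLp]
      exact hC g.1 f g.2 hf⟩
  set L := φ.extendOfNorm (lpcToLp (n := n) 2) with hL
  set u := (InnerProductSpace.toDual ℂ (Lp ℂ 2 (volume : Measure (Rn n)))).symm L with hu
  refine ⟨fun x => starRingEnd ℂ (u x),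
    Complex.continuous_conj.measurable.comp (Lp.stronglyMeasurable u).measurable,
    (Lp.memLp u).star, fun g hg => ?_⟩
  have h1 : L (lpcToLp 2 ⟨g, hg⟩) = offForm K g f := LinearMap.extendOfNorm_eq hdense hbd ⟨g, hg⟩
  rw [← h1, ← InnerProductSpace.toDual_symm_apply (y := L), L2.inner_def]
  refine integral_congr_ae ?_
  filter_upwards [MemLp.coeFn_toLp (hg.1)] with x hx
  rw [RCLike.inner_apply]
  congr 1

/-- A map to functions which is linear modulo null sets, as a linear map to `L^p`. -/
def linearMapOfAE {p : ℝ≥0∞} (h : TestFn n → Rn n → ℂ)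
    (hp : ∀ f, MemLp (h f) p) (hadd : ∀ f f', h (f + f') =ᵐ[volume] h f + h f')
    (hsmul : ∀ (c : ℂ) f, h (c • f) =ᵐ[volume] c • h f) :
    TestFn n →ₗ[ℂ] Lp ℂ p (volume : Measure (Rn n)) where
  toFun f := (hp f).toLp (h f)
  map_add' f f' := (MemLp.toLp_congr (hp (f + f')) ((hp f).add (hp f')) (hadd f f')).trans
    (MemLp.toLp_add (hp f) (hp f'))
  map_smul' c f := (MemLp.toLp_congr (hp (c • f)) ((hp f).const_smul c) (hsmul c f)).trans
    (MemLp.toLp_const_smul c (hp f))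

theorem exists_continuousLinearMap_of_norm_le {p : ℝ≥0∞} [Fact (1 ≤ p)] (hpt : p ≠ ⊤)
    (Φ : TestFn n →ₗ[ℂ] Lp ℂ p (volume : Measure (Rn n))) {C : ℝ}
    (hC : ∀ f, ‖Φ f‖ ≤ C * ‖testToLp p f‖) :
    ∃ S : Lp ℂ p (volume : Measure (Rn n)) →L[ℂ] Lp ℂ p (volume : Measure (Rn n)),
      ∀ f : TestFn n, S (testToLp p f) = Φ f :=
  ⟨Φ.extendOfNorm (testToLp p), LinearMap.extendOfNorm_eq (denseRange_testToLp hpt) ⟨C, hC⟩⟩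

/-- A single function h f, found in L², serves all exponents: the L^p × L^{p'} bound for the form
and the converse of Hölder's inequality show that it lies in L^p with norm controlled by that of f.
It depends linearly on f only almost everywhere, since it is determined only up to null sets. -/
theorem CZKernel.exists_boundedExtension (hn : 0 < n) {s A : ℝ} (hK : CZKernel K s A) :
    ∃ h : TestFn n → Rn n → ℂ,
      (∀ (f : TestFn n) (g : Rn n → ℂ), MemLpc g 2 → offForm K g f = ∫ x, g x * h f x) ∧
      ∀ p q, DualExponents p q → ∀ [Fact (1 ≤ p)],
        ∃ S : Lp ℂ p (volume : Measure (Rn n)) →L[ℂ] Lp ℂ p (volume : Measure (Rn n)),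
          ∀ f : TestFn n, S (testToLp p f) =ᵐ[volume] h f := by
  have hex : ∀ f : TestFn n, ∃ h : Rn n → ℂ, Measurable h ∧ MemLp h 2 ∧
      ∀ g, MemLpc g 2 → offForm K g f = ∫ x, g x * h x := fun f =>
    hK.exists_offForm_eq_integral hn (TestFn.memLpc f 2)
  choose h hm h2 hh using hex
  refine ⟨h, hh, fun p q hpq _ => ?_⟩
  obtain ⟨C, hC0, hC⟩ := hK.exists_offForm_le hn hpq
  have hle : ∀ f : TestFn n, eLpNorm (h f) p volume
      ≤ ENNReal.ofReal (C * (eLpNorm f p volume).toReal) := by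
    intro f
    refine eLpNorm_le_of_forall_integral hpq (hm f) (by positivity) fun g hg => ?_
    rw [← hh f g (hg 2)]
    exact hC g f (hg q) (TestFn.memLpc f p)
  have hp : ∀ f : TestFn n, MemLp (h f) p := fun f =>
    ⟨(hm f).aestronglyMeasurable, (hle f).trans_lt ENNReal.ofReal_lt_top⟩
  have hadd : ∀ f f' : TestFn n, h (f + f') =ᵐ[volume] h f + h f' := by
    intro f f'
    refine ae_eq_of_forall_integral (hm _) ((hm f).add (hm f')) (h2 _) ((h2 f).add (h2 f'))
      fun g hg => ?_
    have hi : Integrable fun x => g x * h f x := hg.1.integrable_mul (h2 f)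
    have hi' : Integrable fun x => g x * h f' x := hg.1.integrable_mul (h2 f')
    simp only [Pi.add_apply, mul_add]
    rw [integral_add hi hi', ← hh _ g hg, ← hh _ g hg, ← hh _ g hg]
    exact hK.offForm_add_right hn dualExponents_two hg (TestFn.memLpc f 2) (TestFn.memLpc f' 2)
  have hsmul : ∀ (c : ℂ) (f : TestFn n), h (c • f) =ᵐ[volume] c • h f := by
    intro c f
    refine ae_eq_of_forall_integral (hm _) ((hm f).const_smul c) (h2 _) ((h2 f).const_smul c)
      fun g hg => ?_
    simp only [Pi.smul_apply, smul_eq_mul, mul_left_comm _ c]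
    rw [integral_const_mul, ← hh _ g hg, ← hh _ g hg]
    exact hK.offForm_smul_right hn dualExponents_two c hg (TestFn.memLpc f 2)
  have hΦ : ∀ f, ‖linearMapOfAE h hp hadd hsmul f‖ ≤ C * ‖testToLp p f‖ := by
    intro f
    have h1 : ‖testToLp p f‖ = (eLpNorm f p volume).toReal := Lp.norm_toLp f (TestFn.memLp f p)
    have h2 : ‖linearMapOfAE h hp hadd hsmul f‖ = (eLpNorm (h f) p volume).toReal :=
      Lp.norm_toLp (h f) (hp f)
    rw [h1, h2]
    exact ENNReal.toReal_le_of_le_ofReal (by positivity) (hle f)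
  obtain ⟨S, hS⟩ := exists_continuousLinearMap_of_norm_le hpq.2.1.ne _ hΦ
  exact ⟨S, fun f => (hS f).symm ▸ MemLp.coeFn_toLp (hp f)⟩

end

section

variable {n : ℕ} {K : Rn n → Rn n → ℂ}

/-! ### The operator with the off-diagonal coefficients -/

theorem exists_norm_testToLp_le (S : Compacts (Rn n)) {p : ℝ≥0∞} :
    ∃ C : ℝ, ∀ f : TestFn n, (∀ x ∉ S, f x = 0) → ∀ M : ℝ, 0 ≤ M → (∀ x, ‖f x‖ ≤ M) →
      ‖testToLp p f‖ ≤ C * M := by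
  have hS : MeasurableSet (S : Set (Rn n)) := S.isCompact.measurableSet
  refine ⟨((volume (S : Set (Rn n))) ^ p.toReal⁻¹).toReal, fun f hf M hM hfM => ?_⟩
  have h1 : ‖testToLp p f‖ = (eLpNorm f p volume).toReal := Lp.norm_toLp f (TestFn.memLp f p)
  have h2 : eLpNorm f p volume ≤ volume (S : Set (Rn n)) ^ p.toReal⁻¹ * ENNReal.ofReal M := by
    have h3 : (f : Rn n → ℂ) = (S : Set (Rn n)).indicator f := by
      refine (Set.indicator_eq_self.2 fun x hx => ?_).symm
      by_contra h
      exact hx (hf x h)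
    rw [h3, eLpNorm_indicator_eq_eLpNorm_restrict hS]
    refine (eLpNorm_le_of_ae_bound (ae_of_all _ hfM)).trans ?_
    rw [Measure.restrict_apply_univ]
  rw [h1, ← ENNReal.toReal_ofReal hM, ← ENNReal.toReal_mul]
  refine ENNReal.toReal_mono (ENNReal.mul_ne_top ?_ ENNReal.ofReal_ne_top) h2
  exact ENNReal.rpow_ne_top_of_nonneg (by positivity) S.isCompact.measure_lt_top.ne

/-- The inclusion of the test functions in `L²`. -/
def testToL2 (n : ℕ) : TestFn n →L[ℂ] Lp ℂ 2 (volume : Measure (Rn n)) :=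
  TestFunction.mkCLM ℂ (testToLp 2) (map_add _) (map_smul _) fun S hS => by
    obtain ⟨C, hC⟩ := exists_norm_testToLp_le S (p := 2)
    let Λ := (testToLp (n := n) 2).toAddMonoidHom.comp
      (TestFunction.ofSupportedInCLM (F := ℂ) (n := ⊤) ℂ hS).toLinearMap.toAddMonoidHom
    change Continuous Λ
    refine continuous_of_tendsto_nhds_zero Λ ?_
    have he : Tendsto (fun f : ContDiffMapSupportedIn (Rn n) ℂ ⊤ S =>
        C * ‖ContDiffMapSupportedIn.toBoundedContinuousFunctionCLM ℂ f‖) (𝓝 0) (𝓝 0) := by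
      have h1 : Continuous fun f : ContDiffMapSupportedIn (Rn n) ℂ ⊤ S =>
          C * ‖ContDiffMapSupportedIn.toBoundedContinuousFunctionCLM ℂ f‖ := by fun_prop
      exact h1.tendsto' 0 0 (by rw [map_zero, norm_zero, mul_zero])
    refine squeeze_zero_norm (fun f => ?_) he
    refine hC (TestFunction.ofSupportedIn hS f) (fun x hx => ?_) _ (norm_nonneg _) fun x => ?_
    · exact image_eq_zero_of_notMem_tsupport fun h => hx (f.tsupport_subset h)
    · exact (ContDiffMapSupportedIn.toBoundedContinuousFunctionCLM ℂ f).norm_coe_le_norm x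

/-- The inclusion of the real test functions in the complex `L²`. -/
def realTestToL2 (n : ℕ) : 𝓓((⊤ : Opens (Rn n)), ℝ) →L[ℝ] Lp ℂ 2 (volume : Measure (Rn n)) :=
  (testToL2 n).restrictScalars ℝ ∘L TestFunction.postcompCLM Complex.ofRealCLM

theorem coeFn_realTestToL2 (g : 𝓓((⊤ : Opens (Rn n)), ℝ)) :
    realTestToL2 n g =ᵐ[volume] realTest g :=
  MemLp.coeFn_toLp (TestFn.memLp (TestFunction.postcompCLM Complex.ofRealCLM g) 2)

theorem inner_realTestToL2 (g : 𝓓((⊤ : Opens (Rn n)), ℝ))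
    (u : Lp ℂ 2 (volume : Measure (Rn n))) :
    inner ℂ (realTestToL2 n g) u = ∫ x, (g x : ℂ) * u x := by
  rw [L2.inner_def]
  refine integral_congr_ae ?_
  filter_upwards [coeFn_realTestToL2 g] with x hx
  rw [RCLike.inner_apply, hx, realTest, Complex.conj_ofReal, mul_comm]

/-- The distribution `g ↦ ∫ g u` for `u ∈ L²`. -/
def distrOfL2 (u : Lp ℂ 2 (volume : Measure (Rn n))) : Distr n :=
  ContinuousLinearMap.toUniformConvergenceCLM (RingHom.id ℝ) ℂ _
    { toFun := fun g => inner ℂ (realTestToL2 n g) u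
      map_add' := fun g g' => by rw [map_add, inner_add_left]
      map_smul' := fun c g => by
        rw [map_smul, RingHom.id_apply, inner_smul_left_eq_smul]
      cont := (realTestToL2 n).continuous.inner continuous_const }

/-- The inclusion of `L²` in the distributions, as a linear map. -/
def l2ToDistrLinear (n : ℕ) : Lp ℂ 2 (volume : Measure (Rn n)) →ₗ[ℂ] Distr n where
  toFun := distrOfL2
  map_add' u v := DFunLike.ext _ _ fun g => inner_add_right (realTestToL2 n g) u v
  map_smul' c u := DFunLike.ext _ _ fun g => inner_smul_right (realTestToL2 n g) u c

/-- The inclusion of `L²` in the distributions. -/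
def l2ToDistr (n : ℕ) : Lp ℂ 2 (volume : Measure (Rn n)) →L[ℂ] Distr n where
  toLinearMap := l2ToDistrLinear n
  -- Distributions carry a topology of uniform convergence over bounded families of test functions,
  -- for which joint continuity of (u, g) ↦ ∫ g u is enough.
  cont := UniformConvergenceCLM.continuous_of_continuous_uncurry
    (fun _ hs => IsCompact.isVonNBounded ℝ hs) ((l2ToDistrLinear n).restrictScalars ℝ)
    (((realTestToL2 n).continuous.comp continuous_snd).inner continuous_fst)

theorem l2ToDistr_apply (u : Lp ℂ 2 (volume : Measure (Rn n))) (g : 𝓓((⊤ : Opens (Rn n)), ℝ)) :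
    l2ToDistr n u g = ∫ x, (g x : ℂ) * u x := inner_realTestToL2 g u

theorem exists_dualExponents {p : ℝ≥0∞} (h1 : 1 < p) (ht : p < ⊤) : ∃ q, DualExponents p q :=
  ⟨(1 - p⁻¹)⁻¹, h1, ht, ENNReal.holderConjugate_iff.2 (by
    rw [inv_inv]
    exact add_tsub_cancel_of_le (ENNReal.inv_le_one.2 h1.le))⟩

theorem memLpc_realTest (g : 𝓓((⊤ : Opens (Rn n)), ℝ)) (p : ℝ≥0∞) : MemLpc (realTest g) p :=
  TestFn.memLpc (TestFunction.postcompCLM Complex.ofRealCLM g) p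

/-- The operator is factored as test functions → L² → L² → distributions, so its continuity is
automatic. For other p its values are represented by the same functions h f, hence by the bounded
extension to L^p. -/
theorem CZKernel.exists_distrOp (hn : 0 < n) {s A : ℝ} (hK : CZKernel K s A) :
    ∃ U : DistrOp n,
      (∀ (f : TestFn n) (g : 𝓓((⊤ : Opens (Rn n)), ℝ)), U f g = offForm K (realTest g) f) ∧
      ∀ (p : ℝ≥0∞) [Fact (1 ≤ p)], 1 < p → p < ⊤ → IsBoundedOnLp U p := by
  obtain ⟨h, hh, H⟩ := hK.exists_boundedExtension hn
  obtain ⟨S, hS⟩ := H 2 2 dualExponents_two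
  have hU : ∀ (f : TestFn n) (g : 𝓓((⊤ : Opens (Rn n)), ℝ)),
      (l2ToDistr n ∘L S ∘L testToL2 n) f g = ∫ x, realTest g x * h f x := by
    intro f g
    refine (l2ToDistr_apply (S (testToLp 2 f)) g).trans (integral_congr_ae ?_)
    filter_upwards [hS f] with x hx
    rw [hx, realTest]
  refine ⟨l2ToDistr n ∘L S ∘L testToL2 n, fun f g => ?_, fun p _ h1 ht => ?_⟩
  · rw [hU, hh f _ (memLpc_realTest g 2)]
  · obtain ⟨q, hpq⟩ := exists_dualExponents h1 ht
    obtain ⟨S', hS'⟩ := H p q hpq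
    refine ⟨S', fun f g => (hU f g).trans (integral_congr_ae ?_)⟩
    filter_upwards [hS' f] with x hx
    rw [realTest, ← hx]
    rfl

/-! ### The perfect dyadic operator -/

theorem measurable_invNorm : Measurable fun z : Rn n × Rn n => (((‖z.1 - z.2‖ ^ n)⁻¹ : ℝ) : ℂ) := by
  fun_prop

theorem aestronglyMeasurable_kernelIntegrand_invNorm {g f : Rn n → ℂ}
    (hg : AEStronglyMeasurable g) (hf : AEStronglyMeasurable f) :
    AEStronglyMeasurable
      (kernelIntegrand (fun x y : Rn n => (((‖x - y‖ ^ n)⁻¹ : ℝ) : ℂ)) g f) :=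
  (hg.comp_fst.mul measurable_invNorm.aestronglyMeasurable).mul hf.comp_snd

/-- Disjoint compact supports are at positive distance, so |x - y|^{-n} is bounded on the relevant
pairs. -/
theorem CZKernel.diagForm_eq_kernelForm_of_disjoint_tsupport (hn : 0 < n) {s A : ℝ}
    (hK : CZKernel K s A) {g f : Rn n → ℂ} (hg : Continuous g) (hgc : HasCompactSupport g)
    (hf : Continuous f) (hfc : HasCompactSupport f) (hd : Disjoint (tsupport f) (tsupport g)) :
    Integrable (kernelIntegrand (perfKernel K) g f) ∧
      diagForm K g f = kernelForm (perfKernel K) g f := by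
  obtain ⟨r, hr, hrd⟩ := Metric.exists_pos_forall_lt_edist hgc.isCompact hfc.isCompact.isClosed
    hd.symm
  have hsep : ∀ x y, g x ≠ 0 → f y ≠ 0 → (r : ℝ) ≤ ‖x - y‖ := by
    intro x y hx hy
    have := hrd x (subset_tsupport g hx) y (subset_tsupport f hy)
    rw [edist_nndist, ENNReal.coe_lt_coe] at this
    rw [← dist_eq_norm, ← coe_nndist]
    exact_mod_cast this.le
  have hgL := memLpc_of_continuous hg hgc
  have hfL := memLpc_of_continuous hf hfc
  refine hK.diagForm_eq_kernelForm hn dualExponents_two (hfL 2) (hgL 2)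
    (ae_of_all _ fun z hx hy h => ?_) ?_
  · have h1 := hsep _ _ hx hy
    rw [h, sub_self, norm_zero] at h1
    exact absurd hr (not_lt.2 (by exact_mod_cast h1))
  · have hi := ((hgL 1).integrable.norm.mul_prod (hfL 1).integrable.norm).const_mul
      (((r : ℝ) ^ n)⁻¹)
    refine hi.mono' (aestronglyMeasurable_kernelIntegrand_invNorm hg.aestronglyMeasurable
      hf.aestronglyMeasurable) (ae_of_all _ fun z => ?_)
    rw [kernelIntegrand, norm_mul, norm_mul, Complex.norm_real, Real.norm_of_nonneg (by positivity)]
    by_cases hx : g z.1 = 0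
    · simp [hx]
    by_cases hy : f z.2 = 0
    · simp [hy]
    have h1 := hsep _ _ hx hy
    have hr' : (0 : ℝ) < r := by exact_mod_cast hr
    have h2 : (‖z.1 - z.2‖ ^ n)⁻¹ ≤ ((r : ℝ) ^ n)⁻¹ := by gcongr
    have h3 : 0 ≤ ‖g z.1‖ * ‖f z.2‖ := by positivity
    nlinarith [mul_le_mul_of_nonneg_right h2 h3]

theorem MemLpc.lintegral_rpow_ne_top {f : Rn n → ℂ} {p q : ℝ≥0∞} (hpq : DualExponents p q)
    (hf : MemLpc f p) : ∫⁻ x, ‖f x‖ₑ ^ p.toReal ≠ ⊤ :=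
  (lintegral_rpow_enorm_lt_top_of_eLpNorm_lt_top (zero_lt_one.trans hpq.1).ne' hpq.2.1.ne
    hf.1.2).ne

theorem ae_ne_of_disjoint {g f : Rn n → ℂ} {A B : Set (Rn n)} (hd : Disjoint A B)
    (hf : SupportedIn f A) (hg : SupportedIn g B) :
    ∀ᵐ z : Rn n × Rn n, g z.1 ≠ 0 → f z.2 ≠ 0 → z.1 ≠ z.2 := by
  have h1 := Measure.quasiMeasurePreserving_fst
    (μ := (volume : Measure (Rn n))) (ν := (volume : Measure (Rn n))) |>.ae hg
  have h2 := Measure.quasiMeasurePreserving_snd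
    (μ := (volume : Measure (Rn n))) (ν := (volume : Measure (Rn n))) |>.ae hf
  rw [Measure.volume_eq_prod]
  filter_upwards [h1, h2] with z hz1 hz2 hx hy hxy
  have hB : z.1 ∈ B := by
    by_contra h
    exact hx (hz1 h)
  have hA : z.2 ∈ A := by
    by_contra h
    exact hy (hz2 h)
  exact Set.disjoint_left.1 hd hA (hxy ▸ hB)

/-- Disjoint half-open cubes may touch; integrability of |x - y|^{-n} against g and f then comes
from the Schur test across the separating hyperplane. -/
theorem CZKernel.diagForm_eq_kernelForm_of_disjoint_cube (hn : 0 < n) {s A : ℝ}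
    (hK : CZKernel K s A) {p q : ℝ≥0∞} (hpq : DualExponents p q) {f g : Rn n → ℂ}
    (hf : MemLpc f p) (hg : MemLpc g q) {a b : Rn n} {r t : ℝ} (hr : 0 < r) (ht : 0 < t)
    (hd : Disjoint (cube a r) (cube b t)) (hfa : SupportedIn f (cube a r))
    (hgb : SupportedIn g (cube b t)) :
    Integrable (kernelIntegrand (perfKernel K) g f) ∧
      diagForm K g f = kernelForm (perfKernel K) g f := by
  refine hK.diagForm_eq_kernelForm hn hpq hf hg (ae_ne_of_disjoint hd hfa hgb) ?_
  obtain ⟨C, hC, H⟩ := exists_lintegral_kernelIntegrand_le hn hpq.real 1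
  refine ⟨aestronglyMeasurable_kernelIntegrand_invNorm hg.1.1 hf.1.1, ?_⟩
  refine (H _ (fun x y _ => ?_) a b r t hr ht hd g f hg.1.1 hf.1.1 hfa hgb).trans_lt
    (ENNReal.mul_lt_top hC.lt_top (ENNReal.add_lt_top.2
      ⟨(hg.lintegral_rpow_ne_top hpq.symm).lt_top, (hf.lintegral_rpow_ne_top hpq).lt_top⟩))
  rw [Complex.norm_real, Real.norm_of_nonneg (by positivity), one_div]

theorem isPerfectDyadicSIO_sub (hn : 0 < n) {T U : DistrOp n}
    (hT : IsSIOWithLocallyBoundedKernel T K) {s A : ℝ} (hK : CZKernel K s A)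
    (hU : ∀ (f : TestFn n) (g : 𝓓((⊤ : Opens (Rn n)), ℝ)), U f g = offForm K (realTest g) f) :
    IsPerfectDyadicSIO (T - U) (perfKernel K) (diagForm K) := by
  have hop : ∀ (f : TestFn n) (g : 𝓓((⊤ : Opens (Rn n)), ℝ)),
      (T - U) f g = diagForm K (realTest g) f := by
    intro f g
    rw [diagForm, ← hT.kernel_eq, ← hU]
    rfl
  have hone : ∀ {p q : ℝ≥0∞}, DualExponents p q → ∀ {f g : Rn n → ℂ}, MemLpc f p → MemLpc g q →
      Integrable (kernelIntegrand K g f) := fun hpq _ _ hf hg =>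
    hK.integrable (hg.memLp_of_le hpq.symm.1.le) (hf.memLp_of_le hpq.1.le)
  exact
    { measurable := (hK.measurable_perfKernel hn).aestronglyMeasurable
      size := hK.exists_norm_perfKernel_le hn
      kernel_eq := fun f g hd => by
        rw [hop]
        have hgt : tsupport (realTest g) ⊆ tsupport g := tsupport_comp_subset Complex.ofReal_zero g
        exact hK.diagForm_eq_kernelForm_of_disjoint_tsupport hn
          (Complex.continuous_ofReal.comp g.continuous)
          (g.hasCompactSupport.comp_left Complex.ofReal_zero) f.continuous f.hasCompactSupport
          (hd.mono_right hgt)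
      extends_op := fun f g => (hop f g).symm
      add_left := fun p q hpq f g₁ g₂ hf hg₁ hg₂ => by
        rw [diagForm, diagForm, diagForm, kernelForm_add_left (hone hpq hf hg₁) (hone hpq hf hg₂),
          hK.offForm_add_left hn hpq hg₁ hg₂ hf]
        ring
      smul_left := fun p q hpq f g c hf hg => by
        rw [diagForm, diagForm, kernelForm_smul_left, hK.offForm_smul_left hn hpq c hg hf]
        ring
      add_right := fun p q hpq f₁ f₂ g hf₁ hf₂ hg => by
        rw [diagForm, diagForm, diagForm, kernelForm_add_right (hone hpq hf₁ hg) (hone hpq hf₂ hg),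
          hK.offForm_add_right hn hpq hg hf₁ hf₂]
        ring
      smul_right := fun p q hpq f g c hf hg => by
        rw [diagForm, diagForm, kernelForm_smul_right, hK.offForm_smul_right hn hpq c hg hf]
        ring
      bound := fun p q hpq S hS => hK.exists_diagForm_le hn hpq hS
      kernel_eq_of_disjoint_cubes := fun p q hpq f g hf hg a b r t hr ht hd hfa hgb =>
        hK.diagForm_eq_kernelForm_of_disjoint_cube hn hpq hf hg hr ht hd hfa hgb
      perfect := fun p q hpq f g hf hg j k hfQ h0 hgQ =>
        hK.diagForm_perfect hn hpq hf hg hfQ h0 hgQ }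

end

end BCR

end

theorem theorem3p2 (n : ℕ) (hn : 0 < n) (T : BCR.DistrOp n) (K : BCR.Rn n → BCR.Rn n → ℂ)
    (hT : BCR.IsSIOWithLocallyBoundedKernel T K) :
    ∃ (𝕋 : BCR.DistrOp n) (𝕂 : BCR.Rn n → BCR.Rn n → ℂ)
      (B : (BCR.Rn n → ℂ) → (BCR.Rn n → ℂ) → ℂ),
      BCR.IsPerfectDyadicSIO 𝕋 𝕂 B ∧ BCR.IsBCRDiagonalPart K B ∧
        ∀ (p : ENNReal) [Fact (1 ≤ p)], 1 < p → p < ⊤ → BCR.IsBoundedOnLp (T - 𝕋) p := by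
  obtain ⟨s, A, hK⟩ := hT.exists_czKernel
  obtain ⟨U, hU, hb⟩ := hK.exists_distrOp hn
  refine ⟨T - U, BCR.perfKernel K, BCR.diagForm K, BCR.isPerfectDyadicSIO_sub hn hT hK hU,
    hK.isBCRDiagonalPart hn, ?_⟩
  rwa [sub_sub_cancel]
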